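/- Model: a unit-cost word RAM with word length $w$, whose memory addresses are words, and whose instructions are copying, small constants, load, store, $+,-,\times$ modulo $2^w$, bitwise and, or, exclusive-or and not, left and right shifts, and branching on comparisons ($<$, $=$). A program is a fixed finite text that does not depend on $w$ or on the input. For bit strings $x_1,\dots,x_r$ of length $f\ge 1$, the $f$-packed sequence $\langle x_1,\dots,x_r\rangle$ of length $r$ is the bit string $0\cdot x_r\cdots 0\cdot x_2\cdot 0\cdot x_1$. It is stored in consecutive words with $\lfloor w/(f+1)\rfloor$ fields of $f+1$ bits per word (the first field rightmost, unused bits $0$). An $f$-packed function of length $u$ is a $2f$-packed sequence $G=\langle (z_1,g(z_1)),\dots,(z_u,g(z_u))\rangle$ with $z_1<\dots<z_u$, where $g$ maps $\{0,1\}^f$ to $\{0,1\}^f$ and $(z,g(z))$ denotes concatenation; its domain is $z_1,\dots,z_u$. Assume $2f+1\le w$ (a field of $G$ fits in a word) and $r\le 2^f$. Then there are a single program and an absolute constant $C$ such that for all $w,f,r,u$ as above, every $f$-packed sequence $X=\langle x_1,\dots,x_r\rangle$ and every $f$-packed function $G$ of length $u$ whose domain contains every $x_i$, the program, started with $w$,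 $f$, $r$, $u$ and the addresses of $G$ and of the output in registers and with $X$ (from address $0$), $G$ stored consecutively in memory (all other cells and registers arbitrary), halts with the packed sequence $\mathrm{Map}(G,X)=\langle g(x_1),\dots,g(x_r)\rangle$ stored directly after the input, and with the input cells unchanged at the end, within $$C\left(\left(\frac{rf}{w}+1\right)\log r\,\log w+\left(\frac{(r+u)f}{w}+1\right)\log w\right)$$ steps (logarithms to base $2$, with $\log 0$ read as $0$). Whenever $X$ fills at least one word, that is, $r\ge\lfloor w/(f+1)\rfloor$, the number of steps is at most $$C\left(\frac{rf}{w}\log r\,\log w+\frac{(r+u)f}{w}\log w\right).$$ -/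

import Mathlib

/-! ## The unit-cost word RAM

Words are elements of `BitVec w`.  A machine has registers and a random access memory whose
addresses are words.  A program is a finite text that does not depend on the word length `w`.
Every instruction and every evaluation of a branching condition costs one step. -/

namespace WordRAM

/-- The standard binary word operations: arithmetic modulo `2 ^ w`, bitwise operations, shifts. -/
inductive BinOp where
  | add | sub | mul | and | or | xor | shl | shr

/-- The effect of a binary operation; shifting by at least `w` positions gives `0`. -/
def BinOp.eval {w : ℕ} : BinOp → BitVec w → BitVec w → BitVec w
  | .add, x, y => x + y
  | .sub, x, y => x - y
  | .mul, x, y => x * y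
  | .and, x, y => x &&& y
  | .or, x, y => x ||| y
  | .xor, x, y => x ^^^ y
  | .shl, x, y => x <<< y
  | .shr, x, y => x >>> y

/-- Instructions; the arguments `d a b` are register names. -/
inductive Instr where
  /-- write the numeral `n` (modulo `2 ^ w`) into register `d` -/
  | const (d n : ℕ)
  /-- copy register `a` into register `d` -/
  | move (d a : ℕ)
  /-- write the bitwise complement of register `a` into register `d` -/
  | not (d a : ℕ)
  /-- write the result of `op` on registers `a` and `b` into register `d` -/
  | bin (op : BinOp) (d a b : ℕ)
  /-- write the memory cell whose address is in register `a` into register `d` -/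
  | load (d a : ℕ)
  /-- write register `b` into the memory cell whose address is in register `a` -/
  | store (a b : ℕ)

/-- Branching conditions: (unsigned) comparisons of two registers. -/
inductive Cond where
  | lt (a b : ℕ)
  | eq (a b : ℕ)

/-- Programs: instructions combined by sequencing, branching and loops. -/
inductive Program where
  | instr (i : Instr)
  | seq (p q : Program)
  | ite (c : Cond) (p q : Program)
  | loop (c : Cond) (p : Program)

/-- A machine state for word length `w`. -/
structure State (w : ℕ) where
  reg : ℕ → BitVec w
  mem : BitVec w → BitVec w

/-- The state after one instruction. -/
def Instr.exec {w : ℕ} (s : State w) : Instr → State w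
  | .const d n => { s with reg := Function.update s.reg d (BitVec.ofNat w n) }
  | .move d a => { s with reg := Function.update s.reg d (s.reg a) }
  | .not d a => { s with reg := Function.update s.reg d (~~~(s.reg a)) }
  | .bin op d a b => { s with reg := Function.update s.reg d (op.eval (s.reg a) (s.reg b)) }
  | .load d a => { s with reg := Function.update s.reg d (s.mem (s.reg a)) }
  | .store a b => { s with mem := Function.update s.mem (s.reg a) (s.reg b) }

/-- The condition `c` is true in the state `s`. -/
def Cond.Holds {w : ℕ} (s : State w) : Cond → Prop
  | .lt a b => s.reg a < s.reg b
  | .eq a b => s.reg a = s.reg b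

/-- `Runs P s t s'`: started in the state `s`, the program `P` halts after exactly `t` steps, in
the state `s'`. -/
inductive Runs {w : ℕ} : Program → State w → ℕ → State w → Prop where
  | instr (i : Instr) (s : State w) : Runs (.instr i) s 1 (i.exec s)
  | seq {p q : Program} {s s' s'' : State w} {t t' : ℕ} :
      Runs p s t s' → Runs q s' t' s'' → Runs (.seq p q) s (t + t') s''
  | ite_true {c : Cond} {p q : Program} {s s' : State w} {t : ℕ} :
      c.Holds s → Runs p s t s' → Runs (.ite c p q) s (1 + t) s'
  | ite_false {c : Cond} {p q : Program} {s s' : State w} {t : ℕ} :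
      ¬ c.Holds s → Runs q s t s' → Runs (.ite c p q) s (1 + t) s'
  | loop_false {c : Cond} {p : Program} {s : State w} :
      ¬ c.Holds s → Runs (.loop c p) s 1 s
  | loop_true {c : Cond} {p : Program} {s s' s'' : State w} {t t' : ℕ} :
      c.Holds s → Runs p s t s' → Runs (.loop c p) s' t' s'' →
        Runs (.loop c p) s (1 + t + t') s''

end WordRAM

/-! ## Packed sequences -/

namespace Packed

/-- The number whose binary expansion is the bit string `0 · x_r ⋯ 0 · x_2 · 0 · x_1` of length
`r (f + 1)`, where `x_1, …, x_r` are the bit strings of length `f` in the list. -/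
def bits {f : ℕ} : List (BitVec f) → ℕ
  | [] => 0
  | x :: xs => x.toNat + 2 ^ (f + 1) * bits xs

/-- The number of fields (of `f + 1` bits each) that are stored in one word. -/
def fieldsPerWord (w f : ℕ) : ℕ := w / (f + 1)

/-- The number of words that hold an `f`-packed sequence of length `r`, that is, the quotient
`r / fieldsPerWord w f` rounded up. -/
def numWords (w f r : ℕ) : ℕ := (r + fieldsPerWord w f - 1) / fieldsPerWord w f

/-- The `j`-th word (from `j = 0`) of the packed sequence: it holds the fields number
`j s + 1, …, j s + s`, the first of them rightmost, where `s = fieldsPerWord w f`; positions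
of the word that carry no field are `0`. -/
def word (w : ℕ) {f : ℕ} (X : List (BitVec f)) (j : ℕ) : BitVec w :=
  BitVec.ofNat w (bits ((X.drop (j * fieldsPerWord w f)).take (fieldsPerWord w f)))

/-- The packed sequence `X` is stored in consecutive memory cells from address `a` on. -/
def StoredAt {w f : ℕ} (mem : BitVec w → BitVec w) (a : ℕ) (X : List (BitVec f)) : Prop :=
  ∀ j < numWords w f X.length, mem (BitVec.ofNat w (a + j)) = word w X j

/-- The data of an `f`-packed function: a strictly increasing domain `z_1 < ⋯ < z_u` and a
function `g` on bit strings of length `f`. -/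
structure PackedFunction (f : ℕ) where
  dom : List (BitVec f)
  sorted : dom.Pairwise (· < ·)
  g : BitVec f → BitVec f

/-- The `2f`-packed sequence `⟨(z_1, g z_1), …, (z_u, g z_u)⟩`; the pair `(z, g z)` is the
concatenation of the bit strings, with `z` on the left. -/
def PackedFunction.toSeq {f : ℕ} (G : PackedFunction f) : List (BitVec (f + f)) :=
  G.dom.map fun z => z ++ G.g z

/-- The operation `Map (G, X) = ⟨g x_1, …, g x_r⟩`. -/
def Map {f : ℕ} (G : PackedFunction f) (X : List (BitVec f)) : List (BitVec f) :=
  X.map G.g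

/-- The address of the first word of `G`, which is stored directly after `X`, itself stored from
address `0` on. -/
def funAddr (w : ℕ) {f : ℕ} (X : List (BitVec f)) : ℕ := numWords w f X.length

/-- The address of the first word of the output, directly after `X` and `G`. -/
def outAddr (w : ℕ) {f : ℕ} (G : PackedFunction f) (X : List (BitVec f)) : ℕ :=
  numWords w f X.length + numWords w (f + f) G.dom.length

/-- The memory contains the two inputs `X` and `G`. -/
def InputStored {w f : ℕ} (mem : BitVec w → BitVec w) (G : PackedFunction f)
    (X : List (BitVec f)) : Prop :=
  StoredAt mem 0 X ∧ StoredAt mem (funAddr w X) G.toSeq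

/-- The initial states for the input `(G, X)`: registers `0, …, 5` hold `w`, `f`, the lengths of
`X` and `G`, and the addresses of `G` and of the output; the memory contains `X` and `G`.
All other registers and memory cells are arbitrary. -/
structure IsInitial {w f : ℕ} (s : WordRAM.State w) (G : PackedFunction f)
    (X : List (BitVec f)) : Prop where
  reg_w : s.reg 0 = BitVec.ofNat w w
  reg_f : s.reg 1 = BitVec.ofNat w f
  reg_r : s.reg 2 = BitVec.ofNat w X.length
  reg_u : s.reg 3 = BitVec.ofNat w G.dom.length
  reg_G : s.reg 4 = BitVec.ofNat w (funAddr w X)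
  reg_out : s.reg 5 = BitVec.ofNat w (outAddr w G X)
  input : InputStored s.mem G X

end Packed

/-! ## A small imperative language over the natural numbers, compiled to the word RAM -/

namespace PackedMap

open WordRAM

/-! The fields of X become records with key x_i and payload i. The records are sorted by key, the
sorted keys are matched with the sorted domain of G in one simultaneous scan that writes g(x_i) next
to the position i, and the pairs (i, g(x_i)) are sorted back by position. All of this treats the
fields of a word simultaneously.

A record is spread over two parallel words, in lanes of 2f+2 bits: 2f data bits, a guard bit and a
spare bit. A compare-exchange of all lanes at a given distance takes O(1) instructions: a
subtraction protected by guard bits yields a mask (`compare_lanes`), and xors exchange the masked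
lanes (`delta_swap`). With 2^n lanes, Batcher's bitonic network therefore sorts a word in O(n²)
steps (`sortWord_spec`) and merges two sorted words in O(n) steps (`mergeWords_spec`); that the
network sorts is `ks_sorted`. A merge sort whose items are whole words, with the larger half of each
merge carried along, sorts M words in O(M (n + log M) n) steps (`sortArrays_spec`). Its crux is
`MergeState.step`: the smaller half of a merge lies below everything not yet consumed.

To look up one word of keys in one word of fields (`joinWord_spec`), each z becomes 2z and each x
becomes 2x+1, so that the two kinds never tie, and the fields (z, g(z)), read as numbers, are
replaced by successive differences. After a merge the prefix sums, which a single multiplication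
provides (`prefix_sums`), telescope to the field with the largest z ≤ x. The network is undone with
its stored masks, which brings every result back to the lane of its x, and one more comparison
deletes the results with z < x. The scan (`joinArrays_spec`) advances in X or in G at each step, so
it takes O(M + uf/w + 1) look-ups of cost O(n).

The sorts use only 2^n' lanes with n' = min(⌊log r⌋, n). Hence one factor of their cost is O(log w)
and the other is O(log r + 1), while M = O(rf/w + 1). This gives the first bound (`long_time`); when
X fills a word, rf/w is bounded below and absorbs the added ones (`timeBound_le`). For f ≤ 7 both r
and u are at most 128, and a nested loop takes constant time (`shortMap_spec`). For f ≥ 8 positions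
fit into 2f bits and the scratch memory fits into 2^w cells.

The programs are written in a small language over the natural numbers and verified there with Hoare
triples; `Big.sound` transfers runs and step counts to the machine. -/

inductive Expr where
  | var (i : ℕ)
  | lit (n : ℕ)
  | bin (op : BinOp) (a b : Expr)
  | load (a : Expr)

/-- Abstract states: variables and memory cells hold natural numbers. -/
structure St where
  v : ℕ → ℕ
  m : ℕ → ℕ

def St.set (σ : St) (d x : ℕ) : St := { σ with v := Function.update σ.v d x }

def St.write (σ : St) (a x : ℕ) : St := { σ with m := Function.update σ.m a x }

@[simp] theorem St.set_v (σ : St) (d x i : ℕ) : (σ.set d x).v i = if i = d then x else σ.v i := by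
  simp [St.set, Function.update_apply]

@[simp] theorem St.set_m (σ : St) (d x : ℕ) : (σ.set d x).m = σ.m := rfl

@[simp] theorem St.write_v (σ : St) (a x : ℕ) : (σ.write a x).v = σ.v := rfl

@[simp] theorem St.write_m (σ : St) (a x i : ℕ) :
    (σ.write a x).m i = if i = a then x else σ.m i := by
  simp [St.write, Function.update_apply]

/-- Values are not reduced modulo 2^w. The low w bits of a sum, a product, a bitwise combination or
a left shift depend only on the low w bits of the operands, so overflow there is harmless. Only
subtraction and right shift need the true size of a value, and shift amounts have to be words. -/
def opNat : BinOp → ℕ → ℕ → ℕ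
  | .add, x, y => x + y
  | .sub, x, y => x - y
  | .mul, x, y => x * y
  | .and, x, y => x &&& y
  | .or, x, y => x ||| y
  | .xor, x, y => x ^^^ y
  | .shl, x, y => x * 2 ^ y
  | .shr, x, y => x / 2 ^ y

/-- The side conditions under which the word operation computes the operation on numbers. -/
def opOk (w : ℕ) : BinOp → ℕ → ℕ → Prop
  | .sub, x, y => y ≤ x
  | .shl, _, y => y < 2 ^ w
  | .shr, x, y => x < 2 ^ w ∧ y < 2 ^ w
  | _, _, _ => True

def Expr.eval (σ : St) : Expr → ℕ
  | .var i => σ.v i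
  | .lit n => n
  | .bin op a b => opNat op (a.eval σ) (b.eval σ)
  | .load a => σ.m (a.eval σ)

def Expr.Ok (w : ℕ) (σ : St) : Expr → Prop
  | .var _ => True
  | .lit _ => True
  | .bin op a b => a.Ok w σ ∧ b.Ok w σ ∧ opOk w op (a.eval σ) (b.eval σ)
  | .load a => a.Ok w σ ∧ a.eval σ < 2 ^ w

def Expr.cost : Expr → ℕ
  | .var _ => 1
  | .lit _ => 1
  | .bin _ a b => a.cost + b.cost + 1
  | .load a => a.cost + 1

instance (n : ℕ) : OfNat Expr n := ⟨.lit n⟩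
instance : Add Expr := ⟨.bin .add⟩
instance : Sub Expr := ⟨.bin .sub⟩
instance : Mul Expr := ⟨.bin .mul⟩
instance : AndOp Expr := ⟨.bin .and⟩
instance : XorOp Expr := ⟨.bin .xor⟩
instance : ShiftLeft Expr := ⟨.bin .shl⟩
instance : ShiftRight Expr := ⟨.bin .shr⟩

section simps
variable (σ : St) (w i n : ℕ) (a b : Expr)
@[simp] theorem eval_var : (Expr.var i).eval σ = σ.v i := rfl
@[simp] theorem eval_lit : (no_index (OfNat.ofNat n) : Expr).eval σ = n := rfl
@[simp] theorem eval_load : (Expr.load a).eval σ = σ.m (a.eval σ) := rfl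
@[simp] theorem eval_add : (a + b).eval σ = a.eval σ + b.eval σ := rfl
@[simp] theorem eval_sub : (a - b).eval σ = a.eval σ - b.eval σ := rfl
@[simp] theorem eval_mul : (a * b).eval σ = a.eval σ * b.eval σ := rfl
@[simp] theorem eval_and : (a &&& b).eval σ = a.eval σ &&& b.eval σ := rfl
@[simp] theorem eval_xor : (a ^^^ b).eval σ = a.eval σ ^^^ b.eval σ := rfl
@[simp] theorem eval_shl : (a <<< b).eval σ = a.eval σ * 2 ^ b.eval σ := rfl
@[simp] theorem eval_shr : (a >>> b).eval σ = a.eval σ / 2 ^ b.eval σ := rfl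
@[simp] theorem ok_var : (Expr.var i).Ok w σ ↔ True := Iff.rfl
@[simp] theorem ok_lit : (no_index (OfNat.ofNat n) : Expr).Ok w σ ↔ True := Iff.rfl
@[simp] theorem ok_load : (Expr.load a).Ok w σ ↔ a.Ok w σ ∧ a.eval σ < 2 ^ w := Iff.rfl
@[simp] theorem ok_add : (a + b).Ok w σ ↔ a.Ok w σ ∧ b.Ok w σ :=
  ⟨fun h => ⟨h.1, h.2.1⟩, fun h => ⟨h.1, h.2, trivial⟩⟩
@[simp] theorem ok_mul : (a * b).Ok w σ ↔ a.Ok w σ ∧ b.Ok w σ :=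
  ⟨fun h => ⟨h.1, h.2.1⟩, fun h => ⟨h.1, h.2, trivial⟩⟩
@[simp] theorem ok_and : (a &&& b).Ok w σ ↔ a.Ok w σ ∧ b.Ok w σ :=
  ⟨fun h => ⟨h.1, h.2.1⟩, fun h => ⟨h.1, h.2, trivial⟩⟩
@[simp] theorem ok_xor : (a ^^^ b).Ok w σ ↔ a.Ok w σ ∧ b.Ok w σ :=
  ⟨fun h => ⟨h.1, h.2.1⟩, fun h => ⟨h.1, h.2, trivial⟩⟩
@[simp] theorem ok_sub :
    (a - b).Ok w σ ↔ a.Ok w σ ∧ b.Ok w σ ∧ b.eval σ ≤ a.eval σ := Iff.rfl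
@[simp] theorem ok_shl :
    (a <<< b).Ok w σ ↔ a.Ok w σ ∧ b.Ok w σ ∧ b.eval σ < 2 ^ w := Iff.rfl
@[simp] theorem ok_shr : (a >>> b).Ok w σ ↔
    a.Ok w σ ∧ b.Ok w σ ∧ a.eval σ < 2 ^ w ∧ b.eval σ < 2 ^ w := Iff.rfl
@[simp] theorem cost_var : (Expr.var i).cost = 1 := rfl
@[simp] theorem cost_lit : (no_index (OfNat.ofNat n) : Expr).cost = 1 := rfl
@[simp] theorem cost_load : (Expr.load a).cost = a.cost + 1 := rfl
@[simp] theorem cost_add : (a + b).cost = a.cost + b.cost + 1 := rfl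
@[simp] theorem cost_sub : (a - b).cost = a.cost + b.cost + 1 := rfl
@[simp] theorem cost_mul : (a * b).cost = a.cost + b.cost + 1 := rfl
@[simp] theorem cost_and : (a &&& b).cost = a.cost + b.cost + 1 := rfl
@[simp] theorem cost_xor : (a ^^^ b).cost = a.cost + b.cost + 1 := rfl
@[simp] theorem cost_shl : (a <<< b).cost = a.cost + b.cost + 1 := rfl
@[simp] theorem cost_shr : (a >>> b).cost = a.cost + b.cost + 1 := rfl
end simps

inductive Stmt where
  | skip
  | set (d : ℕ) (e : Expr)
  | store (a e : Expr)
  | seq (p q : Stmt)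
  | ite (a b : Expr) (p q : Stmt)
  | loop (a b : Expr) (p : Stmt)

infixr:60 " ;; " => Stmt.seq

/-- Code that leaves the value of an expression in the register `2 * k`. -/
def Expr.comp : Expr → ℕ → Program
  | .var i, k => .instr (.move (2 * k) (2 * i + 1))
  | .lit n, k => .instr (.const (2 * k) n)
  | .bin op a b, k =>
      .seq (.seq (a.comp k) (b.comp (k + 1))) (.instr (.bin op (2 * k) (2 * k) (2 * (k + 1))))
  | .load a, k => .seq (a.comp k) (.instr (.load (2 * k) (2 * k)))

/-- The variable `i` lives in the register `2 * i + 1`. The condition of `ite a b` and of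
`loop a b` is `a < b`. -/
def Stmt.comp : Stmt → Program
  | .skip => .instr (.move 0 0)
  | .set d e => .seq (e.comp 0) (.instr (.move (2 * d + 1) 0))
  | .store a e => .seq (.seq (a.comp 0) (e.comp 1)) (.instr (.store 0 2))
  | .seq p q => .seq p.comp q.comp
  | .ite a b p q => .seq (.seq (a.comp 0) (b.comp 1)) (.ite (.lt 0 2) p.comp q.comp)
  | .loop a b p =>
      .seq (.seq (a.comp 0) (b.comp 1))
        (.loop (.lt 0 2) (.seq p.comp (.seq (a.comp 0) (b.comp 1))))

/-- The machine state `s` represents the abstract state `σ`. -/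
structure Rel {w : ℕ} (σ : St) (s : State w) : Prop where
  reg : ∀ i, s.reg (2 * i + 1) = BitVec.ofNat w (σ.v i)
  mem : ∀ a < 2 ^ w, s.mem (BitVec.ofNat w a) = BitVec.ofNat w (σ.m a)

theorem opNat_spec {w : ℕ} (op : BinOp) (x y : ℕ) (h : opOk w op x y) :
    op.eval (BitVec.ofNat w x) (BitVec.ofNat w y) = BitVec.ofNat w (opNat op x y) := by
  cases op <;> simp only [BinOp.eval, opNat, opOk] at *
  · simp [BitVec.ofNat_add]
  · obtain ⟨z, rfl⟩ := Nat.exists_eq_add_of_le' h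
    rw [BitVec.ofNat_add, Nat.add_sub_cancel, BitVec.add_sub_cancel]
  · simp [BitVec.ofNat_mul]
  · apply BitVec.eq_of_toNat_eq; simp
  · apply BitVec.eq_of_toNat_eq; simp
  · apply BitVec.eq_of_toNat_eq; simp
  · apply BitVec.eq_of_toNat_eq
    simp [BitVec.toNat_shiftLeft, Nat.mod_eq_of_lt h, Nat.shiftLeft_eq, Nat.mul_mod]
  · apply BitVec.eq_of_toNat_eq
    simp only [BitVec.ushiftRight_eq', BitVec.toNat_ushiftRight, BitVec.toNat_ofNat,
      Nat.mod_eq_of_lt h.1, Nat.mod_eq_of_lt h.2, Nat.shiftRight_eq_div_pow]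
    rw [Nat.mod_eq_of_lt]
    exact (Nat.div_le_self _ _).trans_lt h.1

/-- Variables occupy the odd registers and temporaries the even ones, so temporaries are invisible
to the represented state. -/
theorem Rel.update_temp {w : ℕ} {σ : St} {s : State w} (h : Rel σ s) (k : ℕ) (x : BitVec w) :
    Rel σ { s with reg := Function.update s.reg (2 * k) x } :=
  ⟨fun i => by
    simp only [Function.update_apply]
    rw [if_neg (by omega), h.reg], h.mem⟩

/-- The preservation of lower temporaries carries the induction: the left operand waits in register
`2 * k` while the right one is evaluated one level higher. -/
theorem comp_runs {w : ℕ} {σ : St} (e : Expr) : ∀ (k : ℕ) (s : State w), Rel σ s → e.Ok w σ →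
    ∃ s', Runs (e.comp k) s e.cost s' ∧ Rel σ s' ∧
      s'.reg (2 * k) = BitVec.ofNat w (e.eval σ) ∧ ∀ j < k, s'.reg (2 * j) = s.reg (2 * j) := by
  induction e with
  | var i =>
    intro k s h _
    exact ⟨_, .instr _ _, h.update_temp k _, by simp [Instr.exec, h.reg, Expr.eval],
      fun j hj => by simp [Instr.exec, Function.update_apply]; omega⟩
  | lit n =>
    intro k s h _
    exact ⟨_, .instr _ _, h.update_temp k _, by simp [Instr.exec, Expr.eval],
      fun j hj => by simp [Instr.exec, Function.update_apply]; omega⟩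
  | bin op a b iha ihb =>
    intro k s h hok
    obtain ⟨s1, r1, h1, e1, f1⟩ := iha k s h hok.1
    obtain ⟨s2, r2, h2, e2, f2⟩ := ihb (k + 1) s1 h1 hok.2.1
    refine ⟨_, .seq (.seq r1 r2) (.instr _ _), h2.update_temp k _, ?_, ?_⟩
    · simp only [Instr.exec, Function.update_self, e2, f2 k (by omega), e1]
      exact opNat_spec _ _ _ hok.2.2
    · intro j hj
      simp only [Instr.exec, Function.update_apply]
      rw [if_neg (by omega), f2 j (by omega), f1 j hj]
  | load a iha =>
    intro k s h hok
    obtain ⟨s1, r1, h1, e1, f1⟩ := iha k s h hok.1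
    refine ⟨_, .seq r1 (.instr _ _), h1.update_temp k _, ?_, ?_⟩
    · simp only [Instr.exec, Function.update_self, e1]
      exact h1.mem _ hok.2
    · intro j hj
      simp only [Instr.exec, Function.update_apply]
      rw [if_neg (by omega), f1 j hj]

theorem comp_runs₂ {w : ℕ} {σ : St} (a b : Expr) (s : State w) (h : Rel σ s) (ha : a.Ok w σ)
    (hb : b.Ok w σ) :
    ∃ s', Runs (.seq (a.comp 0) (b.comp 1)) s (a.cost + b.cost) s' ∧ Rel σ s' ∧
      s'.reg 0 = BitVec.ofNat w (a.eval σ) ∧ s'.reg 2 = BitVec.ofNat w (b.eval σ) := by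
  obtain ⟨s1, r1, h1, e1, -⟩ := comp_runs a 0 s h ha
  obtain ⟨s2, r2, h2, e2, f2⟩ := comp_runs b 1 s1 h1 hb
  exact ⟨s2, .seq r1 r2, h2, by have := f2 0 (by omega); simp_all, by simpa using e2⟩

/-- Big-step semantics with running times. -/
inductive Big (w : ℕ) : Stmt → St → ℕ → St → Prop where
  | skip (σ : St) : Big w .skip σ 1 σ
  | set {d : ℕ} {e : Expr} {σ : St} : e.Ok w σ →
      Big w (.set d e) σ (e.cost + 1) (σ.set d (e.eval σ))
  | store {a e : Expr} {σ : St} : a.Ok w σ → e.Ok w σ → a.eval σ < 2 ^ w →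
      Big w (.store a e) σ (a.cost + e.cost + 1) (σ.write (a.eval σ) (e.eval σ))
  | seq {p q : Stmt} {σ σ' σ'' : St} {t t' : ℕ} :
      Big w p σ t σ' → Big w q σ' t' σ'' → Big w (.seq p q) σ (t + t') σ''
  | ite_true {a b : Expr} {p q : Stmt} {σ σ' : St} {t : ℕ} : a.Ok w σ → b.Ok w σ →
      b.eval σ < 2 ^ w → a.eval σ < b.eval σ →
      Big w p σ t σ' → Big w (.ite a b p q) σ (a.cost + b.cost + (1 + t)) σ'
  | ite_false {a b : Expr} {p q : Stmt} {σ σ' : St} {t : ℕ} : a.Ok w σ → b.Ok w σ →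
      a.eval σ < 2 ^ w → b.eval σ ≤ a.eval σ →
      Big w q σ t σ' → Big w (.ite a b p q) σ (a.cost + b.cost + (1 + t)) σ'
  | loop_false {a b : Expr} {p : Stmt} {σ : St} : a.Ok w σ → b.Ok w σ →
      a.eval σ < 2 ^ w → b.eval σ ≤ a.eval σ →
      Big w (.loop a b p) σ (a.cost + b.cost + 1) σ
  | loop_true {a b : Expr} {p : Stmt} {σ σ' σ'' : St} {t t' : ℕ} : a.Ok w σ → b.Ok w σ →
      b.eval σ < 2 ^ w → a.eval σ < b.eval σ →
      Big w p σ t σ' → Big w (.loop a b p) σ' t' σ'' →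
      Big w (.loop a b p) σ (a.cost + b.cost + 1 + t + t') σ''

theorem ofNat_lt {w x y : ℕ} (hx : x < 2 ^ w) (hy : y < 2 ^ w) :
    BitVec.ofNat w x < BitVec.ofNat w y ↔ x < y := by
  simp [BitVec.lt_def, Nat.mod_eq_of_lt hx, Nat.mod_eq_of_lt hy]

theorem Big.sound {w : ℕ} {P : Stmt} {σ σ' : St} {t : ℕ} (h : Big w P σ t σ') :
    ∀ s : State w, Rel σ s → ∃ s', Runs P.comp s t s' ∧ Rel σ' s' := by
  induction h with
  | skip σ =>
    intro s hs
    exact ⟨_, .instr _ _, hs.update_temp 0 _⟩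
  | @set d e σ hok =>
    intro s hs
    obtain ⟨s1, r1, h1, e1, -⟩ := comp_runs e 0 s hs hok
    refine ⟨_, .seq r1 (.instr _ _), ⟨fun i => ?_, h1.mem⟩⟩
    simp only [Instr.exec, Function.update_apply, St.set_v]
    by_cases hi : i = d
    · simpa [hi] using e1
    · rw [if_neg (by omega), if_neg hi, h1.reg]
  | @store a e σ ha he hlt =>
    intro s hs
    obtain ⟨s1, r1, h1, e1, e2⟩ := comp_runs₂ a e s hs ha he
    refine ⟨_, .seq r1 (.instr _ _), ⟨h1.reg, fun i hi => ?_⟩⟩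
    simp only [Instr.exec, Function.update_apply, St.write_m, e1, e2]
    by_cases hia : i = a.eval σ
    · simp [hia]
    · rw [if_neg hia, if_neg, h1.mem i hi]
      intro h
      have := congrArg BitVec.toNat h
      simp [Nat.mod_eq_of_lt hi, Nat.mod_eq_of_lt hlt] at this
      exact hia this
  | seq _ _ ih1 ih2 =>
    intro s hs
    obtain ⟨s1, r1, h1⟩ := ih1 s hs
    obtain ⟨s2, r2, h2⟩ := ih2 s1 h1
    exact ⟨s2, .seq r1 r2, h2⟩
  | @ite_true a b p q σ σ' t ha hb hlt hc _ ih =>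
    intro s hs
    obtain ⟨s1, r1, h1, e1, e2⟩ := comp_runs₂ a b s hs ha hb
    obtain ⟨s2, r2, h2⟩ := ih s1 h1
    refine ⟨s2, .seq r1 (.ite_true ?_ r2), h2⟩
    rw [Cond.Holds, e1, e2]
    exact (ofNat_lt (hc.trans hlt) hlt).2 hc
  | @ite_false a b p q σ σ' t ha hb hlt hc _ ih =>
    intro s hs
    obtain ⟨s1, r1, h1, e1, e2⟩ := comp_runs₂ a b s hs ha hb
    obtain ⟨s2, r2, h2⟩ := ih s1 h1
    refine ⟨s2, .seq r1 (.ite_false ?_ r2), h2⟩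
    rw [Cond.Holds, e1, e2, ofNat_lt hlt (hc.trans_lt hlt)]
    omega
  | @loop_false a b p σ ha hb hlt hc =>
    intro s hs
    obtain ⟨s1, r1, h1, e1, e2⟩ := comp_runs₂ a b s hs ha hb
    refine ⟨s1, .seq r1 (.loop_false ?_), h1⟩
    rw [Cond.Holds, e1, e2, ofNat_lt hlt (hc.trans_lt hlt)]
    omega
  | @loop_true a b p σ σ' σ'' t t' ha hb hlt hc _ _ ih1 ih2 =>
    intro s hs
    obtain ⟨s1, r1, h1, e1, e2⟩ := comp_runs₂ a b s hs ha hb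
    obtain ⟨s2, r2, h2⟩ := ih1 s1 h1
    obtain ⟨s3, r3, h3⟩ := ih2 s2 h2
    -- The compiled loop evaluates the operands of its condition before the loop and again at the
    -- end of each body. The run for the remaining iterations begins with such an evaluation; it is
    -- split off and attached to the end of the current body.
    cases r3 with
    | @seq _ _ _ s4 _ t4 t5 r4 r5 =>
      refine ⟨s3, ?_, h3⟩
      have hh : (Cond.lt 0 2).Holds s1 := by
        rw [Cond.Holds, e1, e2]
        exact (ofNat_lt (hc.trans hlt) hlt).2 hc
      have := Runs.seq r1 (Runs.loop_true hh (.seq r2 r4) r5)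
      have e : a.cost + b.cost + 1 + t + (t4 + t5) = a.cost + b.cost + (1 + (t + t4) + t5) := by
        omega
      rw [e]
      exact this

/-! ### Hoare triples -/

/-- From `σ` the statement `P` terminates within `t` steps in a state that satisfies `Q`. -/
def Tr (w : ℕ) (P : Stmt) (σ : St) (t : ℕ) (Q : St → Prop) : Prop :=
  ∃ t' σ', t' ≤ t ∧ Big w P σ t' σ' ∧ Q σ'

/-- A syntactic frame check, settled by `decide` for each concrete program: if every assignment goes
to a variable with number at least `b`, the lower variables survive. -/
def Stmt.keeps (b : ℕ) : Stmt → Bool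
  | .skip => true
  | .set d _ => b.ble d
  | .store _ _ => true
  | .seq p q => p.keeps b && q.keeps b
  | .ite _ _ p q => p.keeps b && q.keeps b
  | .loop _ _ p => p.keeps b

def Stmt.pure : Stmt → Bool
  | .skip => true
  | .set _ _ => true
  | .store _ _ => false
  | .seq p q => p.pure && q.pure
  | .ite _ _ p q => p.pure && q.pure
  | .loop _ _ p => p.pure

theorem Big.keeps {w b : ℕ} {P : Stmt} {σ σ' : St} {t : ℕ} (h : Big w P σ t σ') :
    P.keeps b = true → ∀ i < b, σ'.v i = σ.v i := by
  induction h with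
  | skip => simp
  | set _ =>
    intro hk i hi
    have := Nat.le_of_ble_eq_true hk
    simp; omega
  | store => simp
  | seq _ _ ih1 ih2 =>
    intro hk i hi
    simp only [Stmt.keeps, Bool.and_eq_true] at hk
    rw [ih2 hk.2 i hi, ih1 hk.1 i hi]
  | ite_true _ _ _ _ _ ih =>
    intro hk
    simp only [Stmt.keeps, Bool.and_eq_true] at hk
    exact ih hk.1
  | ite_false _ _ _ _ _ ih =>
    intro hk
    simp only [Stmt.keeps, Bool.and_eq_true] at hk
    exact ih hk.2
  | loop_false => simp
  | loop_true _ _ _ _ _ _ ih1 ih2 =>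
    intro hk i hi
    rw [ih2 hk i hi, ih1 hk i hi]

theorem Big.pure {w : ℕ} {P : Stmt} {σ σ' : St} {t : ℕ} (h : Big w P σ t σ') :
    P.pure = true → σ'.m = σ.m := by
  induction h with
  | skip => simp
  | set _ => simp
  | store => simp [Stmt.pure]
  | seq _ _ ih1 ih2 =>
    intro hk
    simp only [Stmt.pure, Bool.and_eq_true] at hk
    rw [ih2 hk.2, ih1 hk.1]
  | ite_true _ _ _ _ _ ih =>
    intro hk
    simp only [Stmt.pure, Bool.and_eq_true] at hk
    exact ih hk.1
  | ite_false _ _ _ _ _ ih =>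
    intro hk
    simp only [Stmt.pure, Bool.and_eq_true] at hk
    exact ih hk.2
  | loop_false => simp
  | loop_true _ _ _ _ _ _ ih1 ih2 =>
    intro hk
    rw [ih2 hk, ih1 hk]

namespace Tr

variable {w : ℕ} {P P₂ : Stmt} {σ : St} {t t₁ t₂ : ℕ} {Q R : St → Prop}

theorem le (h : Tr w P σ t Q) (ht : t ≤ t₁) : Tr w P σ t₁ Q := by
  obtain ⟨t', σ', h1, h2, h3⟩ := h
  exact ⟨t', σ', h1.trans ht, h2, h3⟩

theorem imp (h : Tr w P σ t R) (hQ : ∀ σ', R σ' → Q σ') : Tr w P σ t Q := by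
  obtain ⟨t', σ', h1, h2, h3⟩ := h
  exact ⟨t', σ', h1, h2, hQ _ h3⟩

theorem skip (h : Q σ) : Tr w .skip σ 1 Q := ⟨1, σ, le_rfl, .skip σ, h⟩

theorem frame (b : ℕ) (h : Tr w P σ t Q) (hb : P.keeps b = true) :
    Tr w P σ t (fun σ' => Q σ' ∧ ∀ i < b, σ'.v i = σ.v i) := by
  obtain ⟨t', σ', h1, h2, h3⟩ := h
  exact ⟨t', σ', h1, h2, h3, h2.keeps hb⟩

theorem frameMem (h : Tr w P σ t Q) (hb : P.pure = true) :
    Tr w P σ t (fun σ' => Q σ' ∧ σ'.m = σ.m) := by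
  obtain ⟨t', σ', h1, h2, h3⟩ := h
  exact ⟨t', σ', h1, h2, h3, h2.pure hb⟩

theorem seq (h₁ : Tr w P σ t₁ R) (h₂ : ∀ σ', R σ' → Tr w P₂ σ' t₂ Q) :
    Tr w (P ;; P₂) σ (t₁ + t₂) Q := by
  obtain ⟨t', σ', h1, h2, h3⟩ := h₁
  obtain ⟨t'', σ'', h4, h5, h6⟩ := h₂ _ h3
  exact ⟨t' + t'', σ'', by omega, .seq h2 h5, h6⟩

theorem set {d x : ℕ} {e : Expr} (hok : e.Ok w σ) (hx : e.eval σ = x)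
    (h : Tr w P (σ.set d x) t Q) : Tr w (.set d e ;; P) σ (e.cost + 1 + t) Q := by
  subst hx
  obtain ⟨t', σ', h1, h2, h3⟩ := h
  exact ⟨_, σ', by gcongr, .seq (.set hok) h2, h3⟩

theorem store {y x : ℕ} {a e : Expr} (ha : a.Ok w σ) (he : e.Ok w σ) (hy : a.eval σ = y)
    (hx : e.eval σ = x) (hlt : y < 2 ^ w)
    (h : Tr w P (σ.write y x) t Q) : Tr w (.store a e ;; P) σ (a.cost + e.cost + 1 + t) Q := by
  subst hx hy
  obtain ⟨t', σ', h1, h2, h3⟩ := h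
  exact ⟨_, σ', by gcongr, .seq (.store ha he hlt) h2, h3⟩

/-- Charging for both branches avoids a maximum in the time bounds and costs at most a constant
factor where it is used. -/
theorem ite {a b : Expr} (ha : a.Ok w σ) (hb : b.Ok w σ) (ha' : a.eval σ < 2 ^ w)
    (hb' : b.eval σ < 2 ^ w) (h₁ : a.eval σ < b.eval σ → Tr w P σ t₁ Q)
    (h₂ : b.eval σ ≤ a.eval σ → Tr w P₂ σ t₂ Q) :
    Tr w (.ite a b P P₂) σ (a.cost + b.cost + 1 + (t₁ + t₂)) Q := by
  by_cases h : a.eval σ < b.eval σ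
  · obtain ⟨t', σ', h1, h2, h3⟩ := h₁ h
    exact ⟨_, σ', by omega, .ite_true ha hb hb' h h2, h3⟩
  · obtain ⟨t', σ', h1, h2, h3⟩ := h₂ (by omega)
    exact ⟨_, σ', by omega, .ite_false ha hb ha' (by omega) h2, h3⟩

/-- A loop that is executed exactly `n` times. -/
theorem loop_count {a b : Expr} (I : ℕ → St → Prop) (n t : ℕ) (h0 : I 0 σ)
    (hok : ∀ k ≤ n, ∀ σ, I k σ → a.Ok w σ ∧ b.Ok w σ ∧ a.eval σ < 2 ^ w ∧ b.eval σ < 2 ^ w ∧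
      (a.eval σ < b.eval σ ↔ k < n))
    (hstep : ∀ k < n, ∀ σ, I k σ → Tr w P σ t (I (k + 1))) :
    Tr w (.loop a b P) σ (n * (a.cost + b.cost + 1 + t) + (a.cost + b.cost + 1)) (I n) := by
  suffices ∀ j k, k + j = n → ∀ σ, I k σ → Tr w (.loop a b P) σ
      (j * (a.cost + b.cost + 1 + t) + (a.cost + b.cost + 1)) (I n) from
    this n 0 (by omega) σ h0
  intro j
  induction j with
  | zero =>
    intro k hk σ hI
    obtain ⟨ha, hb, ha', hb', hc⟩ := hok k (by omega) σ hI
    refine ⟨_, σ, by simp, .loop_false ha hb ha' (by omega), ?_⟩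
    rwa [show n = k by omega]
  | succ j ih =>
    intro k hk σ hI
    obtain ⟨ha, hb, ha', hb', hc⟩ := hok k (by omega) σ hI
    obtain ⟨t1, σ1, h1, h2, h3⟩ := hstep k (by omega) σ hI
    obtain ⟨t2, σ2, h4, h5, h6⟩ := ih (k + 1) (by omega) σ1 h3
    refine ⟨_, σ2, ?_, .loop_true ha hb hb' (by omega) h2 h5, h6⟩
    rw [Nat.succ_mul]
    omega

/-- A loop with a decreasing measure. -/
theorem loop_measure {a b : Expr} (I : St → Prop) (μ : St → ℕ) (t : ℕ) (h0 : I σ)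
    (hok : ∀ σ, I σ → a.Ok w σ ∧ b.Ok w σ ∧ a.eval σ < 2 ^ w ∧ b.eval σ < 2 ^ w)
    (hstep : ∀ σ, I σ → a.eval σ < b.eval σ →
      Tr w P σ t (fun σ' => I σ' ∧ μ σ' < μ σ)) :
    Tr w (.loop a b P) σ (μ σ * (a.cost + b.cost + 1 + t) + (a.cost + b.cost + 1))
      (fun σ' => I σ' ∧ b.eval σ' ≤ a.eval σ') := by
  induction hm : μ σ using Nat.strong_induction_on generalizing σ with
  | _ m ih =>
    obtain ⟨ha, hb, ha', hb'⟩ := hok σ h0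
    by_cases hc : a.eval σ < b.eval σ
    · obtain ⟨t1, σ1, h1, h2, h3, h4⟩ := hstep σ h0 hc
      obtain ⟨t2, σ2, h5, h6, h7⟩ := ih _ (hm ▸ h4) h3 rfl
      refine ⟨_, σ2, ?_, .loop_true ha hb hb' hc h2 h6, h7⟩
      calc _ ≤ (a.cost + b.cost + 1 + t) +
            (μ σ1 * (a.cost + b.cost + 1 + t) + (a.cost + b.cost + 1)) := by omega
        _ = (μ σ1 + 1) * (a.cost + b.cost + 1 + t) + (a.cost + b.cost + 1) := by ring
        _ ≤ _ := by
          gcongr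
          omega
    · exact ⟨_, σ, by omega, .loop_false ha hb ha' (by omega), h0, by omega⟩

end Tr

end PackedMap

/-! ## Numbers as sequences of lanes -/

namespace PackedMap

open Finset

/-- The number with lanes `a 0, …, a (K - 1)` of width `B`. -/
def pack (B K : ℕ) (a : ℕ → ℕ) : ℕ := ∑ i ∈ range K, a i * 2 ^ (B * i)

section pack
variable {B K q d c : ℕ} {a b : ℕ → ℕ}

@[simp] theorem pack_zero (B : ℕ) (a : ℕ → ℕ) : pack B 0 a = 0 := rfl

theorem pack_succ (B K : ℕ) (a : ℕ → ℕ) : pack B (K + 1) a = pack B K a + a K * 2 ^ (B * K) :=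
  sum_range_succ _ _

@[simp] theorem pack_one (B : ℕ) (a : ℕ → ℕ) : pack B 1 a = a 0 := by simp [pack]

theorem pack_congr (h : ∀ i < K, a i = b i) : pack B K a = pack B K b :=
  sum_congr rfl fun i hi => by rw [h i (mem_range.1 hi)]

theorem pack_mono (h : ∀ i < K, a i ≤ b i) : pack B K a ≤ pack B K b :=
  sum_le_sum fun i hi => Nat.mul_le_mul_right _ (h i (mem_range.1 hi))

theorem pack_add (B K : ℕ) (a b : ℕ → ℕ) :
    pack B K a + pack B K b = pack B K (fun i => a i + b i) := by
  simp [pack, add_mul, sum_add_distrib]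

theorem pack_smul (B K n : ℕ) (a : ℕ → ℕ) : n * pack B K a = pack B K (fun i => n * a i) := by
  simp [pack, mul_sum, mul_assoc]

theorem pack_mul_const (B K n : ℕ) (a : ℕ → ℕ) : pack B K a * n = pack B K (fun i => a i * n) := by
  rw [mul_comm, pack_smul]
  simp only [mul_comm]

/-- No borrow crosses a lane boundary when every lane of the subtrahend fits below the lane of the
minuend. -/
theorem pack_sub (h : ∀ i < K, b i ≤ a i) :
    pack B K a - pack B K b = pack B K (fun i => a i - b i) := by
  rw [Nat.sub_eq_iff_eq_add (pack_mono h), pack_add]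
  exact pack_congr fun i hi => (Nat.sub_add_cancel (h i hi)).symm

theorem pack_const_zero (B K : ℕ) : pack B K (fun _ => 0) = 0 := by simp [pack]

theorem pack_append (B m n : ℕ) (a : ℕ → ℕ) :
    pack B (m + n) a = pack B m a + pack B n (fun i => a (m + i)) * 2 ^ (B * m) := by
  simp only [pack, sum_range_add, sum_mul]
  congr 1
  refine sum_congr rfl fun i _ => ?_
  rw [mul_add, pow_add]; ring

/-- Regrouping lanes. -/
theorem pack_regroup (B n c : ℕ) (a : ℕ → ℕ) :
    pack B (n * c) a = pack (B * n) c (fun h => pack B n (fun l => a (h * n + l))) := by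
  induction c with
  | zero => simp
  | succ c ih =>
    rw [Nat.mul_succ, pack_append, pack_succ, ih]
    simp only [mul_comm c n, mul_assoc]

/-- Only the topmost lane decides the size. Spare bits at its top are what allow lanes of total
width w + 1 in a word of w bits. -/
theorem pack_lt' (hq : q ≤ B) (hK : 0 < K) (h : ∀ i < K, a i < 2 ^ q) :
    pack B K a < 2 ^ (B * (K - 1) + q) := by
  obtain ⟨K, rfl⟩ := Nat.exists_eq_succ_of_ne_zero hK.ne'
  induction K with
  | zero => simpa using h 0 (by omega)
  | succ K ih =>
    rw [pack_succ]
    have h1 := ih (by omega) fun i hi => h i (by omega)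
    have h2 := h (K + 1) (by omega)
    simp only [Nat.add_sub_cancel, Nat.succ_eq_add_one] at *
    calc _ < 2 ^ (B * (K + 1)) + a (K + 1) * 2 ^ (B * (K + 1)) := by
          gcongr
          exact h1.trans_le (Nat.pow_le_pow_right (by omega) (by rw [Nat.mul_succ]; omega))
      _ = (a (K + 1) + 1) * 2 ^ (B * (K + 1)) := by ring
      _ ≤ 2 ^ q * 2 ^ (B * (K + 1)) := by gcongr; omega
      _ = _ := by rw [← pow_add]; congr 1; ring

theorem pack_lt (h : ∀ i < K, a i < 2 ^ B) : pack B K a < 2 ^ (B * K) := by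
  rcases Nat.eq_zero_or_pos K with rfl | hK
  · simp
  · have := pack_lt' le_rfl hK h
    rwa [show B * (K - 1) + B = B * K by
      obtain ⟨K, rfl⟩ := Nat.exists_eq_succ_of_ne_zero hK.ne'
      simp [Nat.mul_succ]] at this

theorem pack_ones (B K : ℕ) : pack B K (fun _ => 2 ^ B - 1) = 2 ^ (B * K) - 1 := by
  induction K with
  | zero => simp
  | succ K ih =>
    rw [pack_succ, ih, Nat.mul_succ, pow_add, Nat.sub_mul, one_mul, mul_comm (2 ^ B)]
    have h1 : 2 ^ (B * K) * 1 ≤ 2 ^ (B * K) * 2 ^ B := by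
      gcongr
      exact Nat.one_le_two_pow
    have h2 : 0 < 2 ^ (B * K) := by positivity
    omega

theorem testBit_pack (hB : 0 < B) (h : ∀ i < K, a i < 2 ^ B) (n : ℕ) :
    (pack B K a).testBit n = (decide (n / B < K) && (a (n / B)).testBit (n % B)) := by
  induction K with
  | zero => simp
  | succ K ih =>
    have h0 := pack_lt (fun i hi => h i (Nat.lt_succ_of_lt hi))
    rw [pack_succ, add_comm, mul_comm, Nat.testBit_two_pow_mul_add _ h0,
      ih (fun i hi => h i (Nat.lt_succ_of_lt hi))]
    have e : n < B * K ↔ n / B < K := by rw [Nat.div_lt_iff_lt_mul hB, mul_comm]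
    by_cases h1 : n < B * K
    · have := e.1 h1
      simp [h1, this, Nat.lt_succ_of_lt this]
    · rw [if_neg h1]
      by_cases h2 : n / B = K
      · have : n - B * K = n % B := by
          rw [← h2]
          exact (Nat.mod_eq_sub_mul_div).symm
        simp [h2, this]
      · have h3 : K < n / B := by rw [e] at h1; omega
        have h4 : ¬ n / B < K + 1 := by omega
        simp only [h4, decide_false, Bool.false_and]
        apply Nat.testBit_lt_two_pow
        refine (h K (by omega)).trans_le (Nat.pow_le_pow_right (by omega) ?_)
        have : B * (K + 1) ≤ n := by
          calc B * (K + 1) ≤ B * (n / B) := by gcongr; omega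
            _ ≤ n := Nat.mul_div_le n B
        rw [Nat.mul_succ] at this
        omega

/-- The tool for all bitwise operations on lanes: a bit is addressed by its lane and its offset in
the lane, and the assertion is checked bit by bit. -/
theorem pack_eq_of_testBit (hB : 0 < B) (h : ∀ i < K, a i < 2 ^ B) {n : ℕ}
    (hn : ∀ i j, j < B → n.testBit (B * i + j) = (decide (i < K) && (a i).testBit j)) :
    n = pack B K a := by
  apply Nat.eq_of_testBit_eq
  intro k
  rw [testBit_pack hB h, ← hn _ _ (Nat.mod_lt _ hB), Nat.div_add_mod]

theorem testBit_pack_lane (h : ∀ i < K, a i < 2 ^ B) {i j : ℕ} (hj : j < B) :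
    (pack B K a).testBit (B * i + j) = (decide (i < K) && (a i).testBit j) := by
  have hB : 0 < B := by omega
  rw [testBit_pack hB h]
  have e1 : (B * i + j) / B = i := by
    rw [Nat.mul_add_div hB, Nat.div_eq_of_lt hj, add_zero]
  have e2 : (B * i + j) % B = j := by rw [Nat.mul_add_mod, Nat.mod_eq_of_lt hj]
  rw [e1, e2]

theorem and_lt_left {x y n : ℕ} (h : x < 2 ^ n) : x &&& y < 2 ^ n :=
  Nat.and_le_left.trans_lt h

theorem and_lt_right {x y n : ℕ} (h : y < 2 ^ n) : x &&& y < 2 ^ n :=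
  Nat.and_le_right.trans_lt h

theorem pack_and (hB : 0 < B) (ha : ∀ i < K, a i < 2 ^ B) (hb : ∀ i < K, b i < 2 ^ B) :
    pack B K a &&& pack B K b = pack B K (fun i => a i &&& b i) := by
  refine pack_eq_of_testBit hB (fun i hi => and_lt_left (ha i hi)) fun i j hj => ?_
  rw [Nat.testBit_and, testBit_pack_lane ha hj, testBit_pack_lane hb hj, Nat.testBit_and]
  cases decide (i < K) <;> simp

theorem pack_xor (hB : 0 < B) (ha : ∀ i < K, a i < 2 ^ B) (hb : ∀ i < K, b i < 2 ^ B) :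
    pack B K a ^^^ pack B K b = pack B K (fun i => a i ^^^ b i) := by
  refine pack_eq_of_testBit hB (fun i hi => Nat.xor_lt_two_pow (ha i hi) (hb i hi))
    fun i j hj => ?_
  rw [Nat.testBit_xor, testBit_pack_lane ha hj, testBit_pack_lane hb hj, Nat.testBit_xor]
  cases decide (i < K) <;> simp

theorem pack_shr (hB : 0 < B) (ha : ∀ i < K, a i < 2 ^ B) (d : ℕ) :
    pack B K a / 2 ^ (d * B) = pack B K (fun i => if i + d < K then a (i + d) else 0) := by
  refine pack_eq_of_testBit hB (fun i hi => ?_) fun i j hj => ?_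
  · split_ifs with h
    · exact ha _ h
    · positivity
  · rw [Nat.testBit_div_two_pow, show B * i + j + d * B = B * (i + d) + j by ring,
      testBit_pack_lane ha hj]
    by_cases h : i + d < K
    · simp [h, show i < K by omega]
    · simp [h]

/-- Natural numbers do not lose bits on a left shift, so the lanes that would leave the word have to
be zero. -/
theorem pack_shl (hB : 0 < B) (ha : ∀ i < K, a i < 2 ^ B) (d : ℕ)
    (h0 : ∀ i < K, K ≤ i + d → a i = 0) :
    pack B K a * 2 ^ (d * B) = pack B K (fun i => if d ≤ i then a (i - d) else 0) := by
  refine pack_eq_of_testBit hB (fun i hi => ?_) fun i j hj => ?_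
  · split_ifs with h
    · exact ha _ (by omega)
    · positivity
  · rw [Nat.testBit_mul_two_pow]
    by_cases h : d ≤ i
    · obtain ⟨e, rfl⟩ := Nat.exists_eq_add_of_le' h
      have h1 : d * B ≤ B * (e + d) + j := by rw [mul_add, mul_comm B d]; omega
      rw [show B * (e + d) + j - d * B = B * e + j by
        rw [mul_add, mul_comm B d]; omega, testBit_pack_lane ha hj]
      simp only [h1, decide_true, Bool.true_and, h, if_true, Nat.add_sub_cancel]
      by_cases h2 : e + d < K
      · simp [h2, show e < K by omega]
      · by_cases h3 : e < K
        · simp [h0 e h3 (by omega)]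
        · simp [h3, show ¬ e + d < K by omega]
    · have h1 : ¬ d * B ≤ B * i + j := by
        have : B * (i + 1) ≤ B * d := by gcongr; omega
        rw [mul_comm d, Nat.mul_succ] at *
        omega
      simp [h, h1]

theorem testBit_two_pow_sub_one' (n i : ℕ) : (2 ^ n - 1).testBit i = decide (i < n) :=
  Nat.testBit_two_pow_sub_one ..

/-- Extracting the bits `s, …, s + s' - 1` of every lane. -/
theorem pack_shr_and {W s s' : ℕ} {Y : ℕ → ℕ} (hW : 0 < W) (hs : s + s' ≤ W)
    (hY : ∀ h < c, Y h < 2 ^ W) :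
    (pack W c Y / 2 ^ s) &&& pack W c (fun _ => 2 ^ s' - 1) =
      pack W c (fun h => Y h / 2 ^ s % 2 ^ s') := by
  have h1 : ∀ i < c, 2 ^ s' - 1 < 2 ^ W := fun i _ => by
    have : 2 ^ s' ≤ 2 ^ W := Nat.pow_le_pow_right (by omega) (by omega)
    have : 0 < 2 ^ s' := by positivity
    omega
  refine pack_eq_of_testBit hW (fun i hi => ?_) fun i j hj => ?_
  · exact (Nat.mod_le _ _).trans_lt ((Nat.div_le_self _ _).trans_lt (hY i hi))
  · rw [Nat.testBit_and, Nat.testBit_div_two_pow, testBit_pack_lane h1 hj,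
      testBit_two_pow_sub_one', Nat.testBit_mod_two_pow, Nat.testBit_div_two_pow]
    by_cases h2 : j < s'
    · rw [add_assoc, testBit_pack_lane hY (by omega)]
      cases decide (i < c) <;> simp [h2]
    · simp [h2]

/-- The lanes with bit `d` of the index clear. -/
theorem lowMask_eq (B d c : ℕ) (hd : 0 < d) :
    pack (2 * d * B) c (fun _ => 1) * (2 ^ (d * B) - 1) =
      pack B (2 * d * c) (fun i => if i / d % 2 = 0 then 2 ^ B - 1 else 0) := by
  -- The multiplier has one unit per group of 2d lanes; multiplied by 2^(dB) - 1, each unit fills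
  -- the lower d lanes of its group with ones.
  rw [pack_regroup, pack_mul_const, mul_comm B (2 * d)]
  refine pack_congr fun h _ => ?_
  rw [one_mul, two_mul, pack_append]
  have e1 : ∀ l < d, (h * (d + d) + l) / d % 2 = 0 := fun l hl => by
    rw [show h * (d + d) + l = d * (2 * h) + l by ring, Nat.mul_add_div hd, Nat.div_eq_of_lt hl]
    simp
  have e2 : ∀ l < d, (h * (d + d) + (d + l)) / d % 2 = 1 := fun l hl => by
    rw [show h * (d + d) + (d + l) = d * (2 * h + 1) + l by ring, Nat.mul_add_div hd,
      Nat.div_eq_of_lt hl]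
    omega
  rw [pack_congr (b := fun _ => 2 ^ B - 1) fun l hl => by rw [if_pos (e1 l hl)], pack_ones,
    pack_congr (b := fun _ => 0) fun l hl => by rw [if_neg (by rw [e2 l hl]; simp)],
    pack_const_zero, mul_comm B d]
  simp

/-- This updates the multiplier behind the masks when the distance is halved, at the price of a
shift and an addition; no mask tables are needed. -/
theorem units_double (W c : ℕ) :
    pack (2 * W) c (fun _ => 1) + pack (2 * W) c (fun _ => 1) * 2 ^ W =
      pack W (2 * c) (fun _ => 1) := by
  rw [pack_regroup, pack_mul_const, pack_add, mul_comm W 2]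
  refine pack_congr fun h _ => ?_
  simp [pack, sum_range_succ]

end pack

/-! ### Delta swaps -/

/-- The involution that exchanges the lanes `i` and `i + d` whenever `C i`. -/
def sw (d : ℕ) (C : ℕ → Prop) [DecidablePred C] (i : ℕ) : ℕ :=
  if i / d % 2 = 0 then (if C i then i + d else i) else (if C (i - d) then i - d else i)

theorem add_div_mod_two {d i : ℕ} (hd : 0 < d) : (i + d) / d % 2 = 1 - i / d % 2 := by
  rw [Nat.add_div_right _ hd]; omega

theorem sub_div_mod_two {d i : ℕ} (hd : 0 < d) (h : i / d % 2 = 1) :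
    d ≤ i ∧ (i - d) / d % 2 = 0 := by
  have h1 : d ≤ i := by
    by_contra h2
    rw [Nat.div_eq_of_lt (by omega)] at h
    simp at h
  have := add_div_mod_two (i := i - d) hd
  rw [Nat.sub_add_cancel h1] at this
  omega

/-- The two partners i and i + d are told apart by the parity of i / d, and both consult the
condition at the lower one, so they agree on whether to swap. -/
theorem sw_sw {d : ℕ} (hd : 0 < d) (C : ℕ → Prop) [DecidablePred C] (i : ℕ) :
    sw d C (sw d C i) = i := by
  by_cases h : i / d % 2 = 0
  · by_cases hC : C i
    · have := add_div_mod_two (i := i) hd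
      simp [sw, h, hC, this]
    · simp [sw, h, hC]
  · have h1 : i / d % 2 = 1 := by omega
    obtain ⟨h2, h3⟩ := sub_div_mod_two hd h1
    by_cases hC : C (i - d)
    · simp [sw, h1, hC, h3, h2]
    · simp [sw, h1, hC]

/-- Since the number of lanes is a multiple of 2d, every lower lane has its partner inside the word.
-/
theorem add_lt_of_even {d c i : ℕ} (hd : 0 < d) (h : i / d % 2 = 0) (hi : i < 2 * d * c) :
    i + d < 2 * d * c := by
  have h1 : i / d < 2 * c := by
    rw [Nat.div_lt_iff_lt_mul hd]; linarith
  have h2 : i / d + 1 < 2 * c := by omega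
  have h3 : (i + d) / d < 2 * c := by rwa [Nat.add_div_right _ hd]
  rw [Nat.div_lt_iff_lt_mul hd] at h3
  linarith

section lanes
variable {B K q d c : ℕ} {x y k : ℕ → ℕ}

theorem lt_of_le_pow {x q B : ℕ} (h : x < 2 ^ q) (hq : q ≤ B) : x < 2 ^ B :=
  h.trans_le (Nat.pow_le_pow_right (by omega) hq)

theorem and_two_pow_sub_one_of_lt {x q : ℕ} (h : x < 2 ^ q) : x &&& (2 ^ q - 1) = x := by
  rw [Nat.and_two_pow_sub_one_eq_mod, Nat.mod_eq_of_lt h]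

theorem two_pow_sub_one_lt (q : ℕ) : 2 ^ q - 1 < 2 ^ q :=
  Nat.sub_lt (by positivity) one_pos

/-- The mask word of a set of lanes. -/
def maskOf (B K q : ℕ) (C : ℕ → Prop) [DecidablePred C] : ℕ :=
  pack B K (fun i => if C i then 2 ^ q - 1 else 0)

theorem maskLane_lt (hq : q ≤ B) (C : ℕ → Prop) [DecidablePred C] (i : ℕ) :
    (if C i then 2 ^ q - 1 else 0) < 2 ^ B := by
  split_ifs
  · exact lt_of_le_pow (two_pow_sub_one_lt q) hq
  · positivity

theorem pack_and_mask (hB : 0 < B) (hq : q ≤ B) (hx : ∀ i < K, x i < 2 ^ q)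
    (C : ℕ → Prop) [DecidablePred C] :
    pack B K x &&& maskOf B K q C = pack B K (fun i => if C i then x i else 0) := by
  rw [maskOf, pack_and hB (fun i hi => lt_of_le_pow (hx i hi) hq) fun i _ => maskLane_lt hq C i]
  refine pack_congr fun i hi => ?_
  split_ifs
  · exact and_two_pow_sub_one_of_lt (hx i hi)
  · simp

/-- The word `t` holds x_i xor x_(i+d) in the lower lanes to be swapped and zero elsewhere. Adding
it by xor at both places of a pair turns each entry into the other. -/
theorem delta_swap (hB : 0 < B) (hq : q ≤ B) (hd : 0 < d) (hK : K = 2 * d * c)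
    (hx : ∀ i < K, x i < 2 ^ q) (C : ℕ → Prop) [DecidablePred C]
    (hC : ∀ i, C i → i / d % 2 = 0) {t : ℕ}
    (ht : t = (pack B K x ^^^ pack B K x / 2 ^ (d * B)) &&& maskOf B K q C) :
    (pack B K x ^^^ t) ^^^ (t * 2 ^ (d * B)) = pack B K (x ∘ sw d C) := by
  have hxB : ∀ i < K, x i < 2 ^ B := fun i hi => lt_of_le_pow (hx i hi) hq
  have h0 : ∀ i < K, (if i + d < K then x (i + d) else 0) < 2 ^ q := fun i hi => by
    split_ifs with h
    · exact hx _ h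
    · positivity
  have hCK : ∀ i < K, C i → i + d < K := fun i hi h =>
    hK ▸ add_lt_of_even hd (hC i h) (hK ▸ hi)
  have ht' : t = pack B K (fun i => if C i then x i ^^^ x (i + d) else 0) := by
    rw [ht, pack_shr hB hxB, pack_xor hB hxB fun i hi => lt_of_le_pow (h0 i hi) hq,
      pack_and_mask hB hq fun i hi => Nat.xor_lt_two_pow (hx i hi) (h0 i hi)]
    refine pack_congr fun i hi => ?_
    split_ifs with h1 h2
    · rfl
    · exact absurd (hCK i hi h1) h2
    · rfl
  have h1 : ∀ i < K, (if C i then x i ^^^ x (i + d) else 0) < 2 ^ B := fun i hi => by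
    split_ifs with h
    · exact Nat.xor_lt_two_pow (hxB i hi) (hxB _ (hCK i hi h))
    · positivity
  rw [ht', pack_xor hB hxB h1, pack_shl hB h1, pack_xor hB]
  · refine pack_congr fun i hi => ?_
    simp only [Function.comp, sw]
    by_cases he : i / d % 2 = 0
    · have h2 : d ≤ i → ¬ C (i - d) := fun h h' => by
        have := add_div_mod_two (i := i - d) hd
        rw [Nat.sub_add_cancel h] at this
        have := hC _ h'
        omega
      rw [if_pos he]
      have h3 : (if d ≤ i then if C (i - d) then x (i - d) ^^^ x (i - d + d) else 0 else 0) = 0 := by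
        split_ifs with h4 h5
        · exact absurd h5 (h2 h4)
        · rfl
        · rfl
      rw [h3]
      split_ifs <;> simp
    · have h2 : ¬ C i := fun h => he (hC i h)
      obtain ⟨h3, h4⟩ := sub_div_mod_two hd (show i / d % 2 = 1 by omega)
      rw [if_neg h2, if_neg he, if_pos h3, Nat.sub_add_cancel h3]
      split_ifs
      · rw [Nat.xor_zero, Nat.xor_comm (x (i - d)), ← Nat.xor_assoc]; simp
      · simp
  · exact fun i hi => Nat.xor_lt_two_pow (hxB i hi) (h1 i hi)
  · intro i hi
    split_ifs with h2 h3
    · have := h1 (i - d) (by omega)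
      simpa [h3] using this
    · positivity
    · positivity
  · intro i hi h
    rw [if_neg]
    intro h'
    have := hCK i hi h'
    omega

/-- Exchanging the lanes in a set between two words. -/
theorem cross_swap (hB : 0 < B) (hq : q ≤ B) (hx : ∀ i < K, x i < 2 ^ q)
    (hy : ∀ i < K, y i < 2 ^ q) (C : ℕ → Prop) [DecidablePred C] {t : ℕ}
    (ht : t = (pack B K x ^^^ pack B K y) &&& maskOf B K q C) :
    pack B K x ^^^ t = pack B K (fun i => if C i then y i else x i) ∧
      pack B K y ^^^ t = pack B K (fun i => if C i then x i else y i) := by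
  have hxB : ∀ i < K, x i < 2 ^ B := fun i hi => lt_of_le_pow (hx i hi) hq
  have hyB : ∀ i < K, y i < 2 ^ B := fun i hi => lt_of_le_pow (hy i hi) hq
  have hz : ∀ i < K, (if C i then x i ^^^ y i else 0) < 2 ^ B := fun i hi => by
    split_ifs
    · exact Nat.xor_lt_two_pow (hxB i hi) (hyB i hi)
    · positivity
  rw [pack_xor hB hxB hyB, pack_and_mask hB hq fun i hi =>
    Nat.xor_lt_two_pow (hx i hi) (hy i hi)] at ht
  rw [ht, pack_xor hB hxB hz, pack_xor hB hyB hz]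
  constructor <;> refine pack_congr fun i hi => ?_
  · split_ifs <;> simp
  · split_ifs
    · rw [Nat.xor_comm (x i), ← Nat.xor_assoc]; simp
    · simp

/-! ### Comparisons and prefix sums in all lanes at once. -/

theorem and_two_pow_of_lt {z q : ℕ} (h : z < 2 ^ (q + 1)) :
    z &&& 2 ^ q = if 2 ^ q ≤ z then 2 ^ q else 0 := by
  rw [Nat.and_two_pow]
  have : z.testBit q = decide (2 ^ q ≤ z) := by
    rw [Nat.testBit_eq_decide_div_mod_eq]
    congr 1
    apply propext
    rw [pow_succ] at h
    have hp : 0 < 2 ^ q := by positivity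
    constructor
    · intro h1
      by_contra h2
      rw [Nat.div_eq_of_lt (by omega)] at h1
      simp at h1
    · intro h1
      have : z / 2 ^ q = 1 := by
        apply Nat.div_eq_of_lt_le <;> omega
      rw [this]
  rw [this]
  by_cases h2 : 2 ^ q ≤ z <;> simp [h2]

/-- Lanewise comparison with the guard bit `q`, on a set of lanes. -/
theorem compare_lanes (hqB : q + 1 ≤ B) (C : ℕ → Prop) [DecidablePred C]
    (hx : ∀ i < K, x i < 2 ^ q) (hy : ∀ i < K, y i < 2 ^ q)
    (hx0 : ∀ i < K, ¬ C i → x i = 0) (hy0 : ∀ i < K, ¬ C i → y i = 0) {Gm ge : ℕ}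
    (hG : Gm = pack B K (fun i => if C i then 2 ^ q else 0))
    (hge : ge = (pack B K x + Gm - pack B K y) &&& Gm) :
    pack B K y ≤ pack B K x + Gm ∧ ge / 2 ^ q ≤ ge ∧ ge < 2 ^ (B * (K - 1) + (q + 1)) ∧
    ge - ge / 2 ^ q = maskOf B K q (fun i => C i ∧ y i ≤ x i) := by
  have hB : 0 < B := by omega
  -- On `C` the guard 2^q exceeds every y, and off `C` both operands vanish, so the subtraction is
  -- lanewise. The guard bit survives exactly where y ≤ x.
  have h1 : ∀ i < K, y i ≤ x i + (if C i then 2 ^ q else 0) := fun i hi => by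
    split_ifs with h
    · have := hy i hi; omega
    · simp [hy0 i hi h]
  have h2 : pack B K x + Gm - pack B K y =
      pack B K (fun i => x i + (if C i then 2 ^ q else 0) - y i) := by
    rw [hG, pack_add, pack_sub h1]
  have h3 : ∀ i < K, x i + (if C i then 2 ^ q else 0) - y i < 2 ^ (q + 1) := fun i hi => by
    have := hx i hi
    rw [pow_succ]
    split_ifs <;> omega
  have hGlt : ∀ i < K, (if C i then 2 ^ q else 0) < 2 ^ (q + 1) := fun i _ => by
    have : 0 < 2 ^ q := by positivity
    rw [pow_succ]
    split_ifs <;> omega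
  have h4 : ge = pack B K (fun i => if C i ∧ y i ≤ x i then 2 ^ q else 0) := by
    rw [hge, h2, hG, pack_and hB (fun i hi => lt_of_le_pow (h3 i hi) hqB)
      fun i hi => lt_of_le_pow (hGlt i hi) hqB]
    refine pack_congr fun i hi => ?_
    by_cases h : C i
    · simp only [h, if_true, true_and]
      have := h3 i hi
      rw [if_pos h] at this
      rw [and_two_pow_of_lt this]
      congr 1
      have := hy i hi
      apply propext
      omega
    · simp [h]
  -- Shifting the surviving guards to bit 0 and subtracting turns 2^q into 2^q - 1, the mask of the
  -- data bits.
  have h5 : ge / 2 ^ q = pack B K (fun i => if C i ∧ y i ≤ x i then 1 else 0) := by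
    have : ge = 2 ^ q * pack B K (fun i => if C i ∧ y i ≤ x i then 1 else 0) := by
      rw [h4, pack_smul]
      exact pack_congr fun i hi => by split_ifs <;> simp
    rw [this, Nat.mul_div_cancel_left _ (by positivity)]
  refine ⟨?_, Nat.div_le_self _ _, ?_, ?_⟩
  · rw [hG, pack_add]
    exact pack_mono h1
  · rcases Nat.eq_zero_or_pos K with rfl | hK
    · simp only [h4, pack_zero]; positivity
    rw [h4]
    refine pack_lt' hqB hK fun i _ => ?_
    have : 0 < 2 ^ q := by positivity
    rw [pow_succ]
    split_ifs <;> omega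
  · rw [h5, h4, pack_sub, maskOf]
    · exact pack_congr fun i hi => by split_ifs <;> simp
    · intro i hi
      have : 0 < 2 ^ q := by positivity
      split_ifs <;> omega

/-- Prefix sums by multiplication. -/
theorem prefix_sums (hB : 0 < B) (hS : ∀ i < K, ∑ j ∈ range (i + 1), x j < 2 ^ q) (hq : q ≤ B) :
    (pack B K x * pack B K (fun _ => 1)) &&& pack B K (fun _ => 2 ^ q - 1) =
      pack B K (fun i => ∑ j ∈ range (i + 1), x j) := by
  set S : ℕ → ℕ := fun i => ∑ j ∈ range (i + 1), x j with hSdef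
  -- The lanes of `S` increase by x_j from one to the next, so multiplication by 2^B - 1, a shift
  -- minus the identity, telescopes and leaves only the total and `pack B K x`.
  have tele : ∀ K, ((2 : ℤ) ^ B - 1) * (pack B K S : ℤ) + pack B K x =
      (∑ j ∈ range K, x j : ℕ) * 2 ^ (B * K) := by
    intro K
    induction K with
    | zero => simp
    | succ K ih =>
      rw [pack_succ, pack_succ, sum_range_succ]
      have : S K = ∑ j ∈ range K, x j + x K := by simp [hSdef, sum_range_succ]
      rw [this]
      push_cast at ih ⊢
      rw [Nat.mul_succ, pow_add]
      linear_combination ih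
  have tele1 : ∀ K, ((2 : ℤ) ^ B - 1) * (pack B K (fun _ => 1) : ℤ) = 2 ^ (B * K) - 1 := by
    intro K
    induction K with
    | zero => simp
    | succ K ih =>
      rw [pack_succ]
      push_cast at ih ⊢
      rw [Nat.mul_succ, pow_add]
      linear_combination ih
  -- By the two identities, 2^B - 1 times the difference is a multiple of 2^(BK). Since 2^B - 1 is
  -- odd, it can be cancelled.
  have hdvd : (2 : ℤ) ^ (B * K) ∣ (pack B K x * pack B K (fun _ => 1) : ℕ) - (pack B K S : ℕ) := by
    have hcop : IsCoprime ((2 : ℤ) ^ (B * K)) (2 ^ B - 1) := by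
      apply IsCoprime.pow_left
      refine ⟨2 ^ (B - 1), -1, ?_⟩
      obtain ⟨B, rfl⟩ := Nat.exists_eq_succ_of_ne_zero hB.ne'
      simp [pow_succ]
    apply hcop.dvd_of_dvd_mul_left
    refine ⟨pack B K x - (∑ j ∈ range K, x j : ℕ), ?_⟩
    push_cast
    have h1 := tele K
    have h2 := tele1 K
    push_cast at h1
    linear_combination (pack B K x : ℤ) * h2 - h1
  have hmod : pack B K x * pack B K (fun _ => 1) % 2 ^ (B * K) = pack B K S := by
    have h1 : pack B K S < 2 ^ (B * K) := pack_lt fun i hi => lt_of_le_pow (hS i hi) hq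
    have h2 : pack B K x * pack B K (fun _ => 1) ≡ pack B K S [MOD 2 ^ (B * K)] := by
      apply Nat.ModEq.symm
      rw [Nat.modEq_iff_dvd]
      exact_mod_cast hdvd
    rw [h2, Nat.mod_eq_of_lt h1]
  -- The mask lies below 2^(BK), so it sees the product only modulo 2^(BK); this discards the upper
  -- half of the convolution.
  have hM : pack B K (fun _ => 2 ^ q - 1) = (2 ^ (B * K) - 1) &&& pack B K (fun _ => 2 ^ q - 1) := by
    rw [Nat.and_comm, Nat.and_two_pow_sub_one_eq_mod, Nat.mod_eq_of_lt]
    exact pack_lt fun i _ => lt_of_le_pow (two_pow_sub_one_lt q) hq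
  rw [hM, ← Nat.and_assoc, Nat.and_two_pow_sub_one_eq_mod, hmod,
    pack_and hB (fun i hi => lt_of_le_pow (hS i hi) hq)
      fun i _ => lt_of_le_pow (two_pow_sub_one_lt q) hq]
  exact pack_congr fun i hi => and_two_pow_sub_one_of_lt (hS i hi)

end lanes

end PackedMap

/-! ## Bitonic sorting networks -/

namespace PackedMap

open Finset

/-- The predicate `P` holds on `[s, s + n)` exactly on an interval, or exactly off an interval. -/
def Bit (P : ℕ → Prop) (s n : ℕ) : Prop :=
  ∃ p q, s ≤ p ∧ p ≤ q ∧ q ≤ s + n ∧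
    ((∀ i, s ≤ i → i < s + n → (P i ↔ p ≤ i ∧ i < q)) ∨
      (∀ i, s ≤ i → i < s + n → (P i ↔ ¬ (p ≤ i ∧ i < q))))

theorem Bit.not {P : ℕ → Prop} {s n : ℕ} (h : Bit P s n) : Bit (fun i => ¬ P i) s n := by
  obtain ⟨p, q, h1, h2, h3, h4 | h4⟩ := h
  · exact ⟨p, q, h1, h2, h3, .inr fun i hi hi' => by beta_reduce; rw [h4 i hi hi']⟩
  · exact ⟨p, q, h1, h2, h3, .inl fun i hi hi' => by beta_reduce; rw [h4 i hi hi', not_not]⟩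

theorem Bit.congr {P Q : ℕ → Prop} {s n : ℕ} (h : Bit P s n)
    (hPQ : ∀ i, s ≤ i → i < s + n → (P i ↔ Q i)) : Bit Q s n := by
  obtain ⟨p, q, h1, h2, h3, h4 | h4⟩ := h
  · exact ⟨p, q, h1, h2, h3, .inl fun i hi hi' => by rw [← hPQ i hi hi', h4 i hi hi']⟩
  · exact ⟨p, q, h1, h2, h3, .inr fun i hi hi' => by rw [← hPQ i hi hi', h4 i hi hi']⟩

theorem Bit.shift {P : ℕ → Prop} {s n d : ℕ} (h : Bit (fun i => P (i + d)) s n) :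
    Bit P (s + d) n := by
  obtain ⟨p, q, h1, h2, h3, h4 | h4⟩ := h
  · refine ⟨p + d, q + d, by omega, by omega, by omega, .inl fun i hi hi' => ?_⟩
    have := h4 (i - d) (by omega) (by omega)
    beta_reduce at this
    rw [Nat.sub_add_cancel (by omega)] at this
    rw [this]; omega
  · refine ⟨p + d, q + d, by omega, by omega, by omega, .inr fun i hi hi' => ?_⟩
    have := h4 (i - d) (by omega) (by omega)
    beta_reduce at this
    rw [Nat.sub_add_cancel (by omega)] at this
    rw [this]; omega

/-- On a circle of 2d points `P` is an arc, and here it is intersected with its rotation by half a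
turn. An arc shorter than a half turn gives nothing; otherwise the cases distinguish where the
endpoints lie relative to the middle. -/
theorem Bit.and_half {P : ℕ → Prop} {s d : ℕ} (h : Bit P s (2 * d)) :
    Bit (fun i => P i ∧ P (i + d)) s d := by
  obtain ⟨p, q, h1, h2, h3, h4 | h4⟩ := h
  · by_cases h5 : p + d ≤ q
    · by_cases h6 : p ≤ s + d
      · refine ⟨p, q - d, h1, by omega, by omega, .inl fun i hi hi' => ?_⟩
        beta_reduce; rw [h4 i hi (by omega), h4 (i + d) (by omega) (by omega)]; omega
      · refine ⟨s, s, le_rfl, le_rfl, by omega, .inl fun i hi hi' => ?_⟩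
        beta_reduce; rw [h4 i hi (by omega), h4 (i + d) (by omega) (by omega)]; omega
    · refine ⟨s, s, le_rfl, le_rfl, by omega, .inl fun i hi hi' => ?_⟩
      beta_reduce; rw [h4 i hi (by omega), h4 (i + d) (by omega) (by omega)]; omega
  · by_cases h5 : q ≤ s + d
    · refine ⟨p, q, h1, by omega, by omega, .inr fun i hi hi' => ?_⟩
      beta_reduce; rw [h4 i hi (by omega), h4 (i + d) (by omega) (by omega)]; omega
    · by_cases h6 : s + d ≤ p
      · refine ⟨p - d, q - d, by omega, by omega, by omega, .inr fun i hi hi' => ?_⟩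
        beta_reduce; rw [h4 i hi (by omega), h4 (i + d) (by omega) (by omega)]; omega
      · by_cases h7 : q ≤ p + d
        · refine ⟨q - d, p, by omega, by omega, by omega, .inl fun i hi hi' => ?_⟩
          beta_reduce; rw [h4 i hi (by omega), h4 (i + d) (by omega) (by omega)]; omega
        · refine ⟨s, s, le_rfl, le_rfl, by omega, .inl fun i hi hi' => ?_⟩
          beta_reduce; rw [h4 i hi (by omega), h4 (i + d) (by omega) (by omega)]; omega

theorem Bit.or_half {P : ℕ → Prop} {s d : ℕ} (h : Bit P s (2 * d)) :
    Bit (fun i => P i ∨ P (i + d)) s d :=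
  h.not.and_half.not.congr fun i _ _ => by tauto

/-- All threshold sets of `k` on `[s, s + n)` are intervals or complements of intervals. -/
def Bitonic (k : ℕ → ℕ) (s n : ℕ) : Prop := ∀ t, Bit (fun i => t ≤ k i) s n

/-- The threshold sets of a minimum are intersections and those of a maximum are unions. Working
with threshold sets replaces the 0-1 principle. -/
theorem Bitonic.half_min {k : ℕ → ℕ} {s d : ℕ} (h : Bitonic k s (2 * d)) :
    Bitonic (fun i => min (k i) (k (i + d))) s d := fun t => by
  simpa only [le_min_iff] using (h t).and_half

theorem Bitonic.half_max {k : ℕ → ℕ} {s d : ℕ} (h : Bitonic k s (2 * d)) :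
    Bitonic (fun i => max (k i) (k (i + d))) s d := fun t => by
  simpa only [le_max_iff] using (h t).or_half

/-- Take the minimum on the left as threshold. Its set is an arc that contains the opposite points i
and i + d, and such an arc meets every pair of opposite points. -/
theorem Bitonic.half_le {k : ℕ → ℕ} {s d i j : ℕ} (h : Bitonic k s (2 * d)) (hi : s ≤ i)
    (hi' : i < s + d) (hj : s ≤ j) (hj' : j < s + d) :
    min (k i) (k (i + d)) ≤ max (k j) (k (j + d)) := by
  obtain ⟨p, q, h1, h2, h3, h4 | h4⟩ := h (min (k i) (k (i + d))) <;>
  · beta_reduce at h4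
    rw [le_max_iff, h4 j hj (by omega), h4 (j + d) (by omega) (by omega)]
    have e1 := (h4 i hi (by omega)).1 (min_le_left _ _)
    have e2 := (h4 (i + d) (by omega) (by omega)).1 (min_le_right _ _)
    omega

theorem Bitonic.congr {k k' : ℕ → ℕ} {s n : ℕ} (h : Bitonic k s n)
    (hk : ∀ i, s ≤ i → i < s + n → k i = k' i) : Bitonic k' s n :=
  fun t => (h t).congr fun i hi hi' => by rw [hk i hi hi']

theorem Bitonic.shift {k : ℕ → ℕ} {s n d : ℕ} (h : Bitonic (fun i => k (i + d)) s n) :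
    Bitonic k (s + d) n := fun t => (h t).shift

theorem exists_threshold {P : ℕ → Prop} {s n : ℕ}
    (h : ∀ i j, s ≤ i → i < j → j < s + n → P i → P j) :
    ∃ p, s ≤ p ∧ p ≤ s + n ∧ ∀ i, s ≤ i → i < s + n → (P i ↔ p ≤ i) := by
  induction n with
  | zero => exact ⟨s, le_rfl, le_rfl, fun i hi hi' => by omega⟩
  | succ n ih =>
    obtain ⟨p, h1, h2, h3⟩ := ih fun i j hi hij hj => h i j hi hij (by omega)
    by_cases hP : P (s + n)
    · refine ⟨p, h1, by omega, fun i hi hi' => ?_⟩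
      rcases Nat.lt_or_ge i (s + n) with h4 | h4
      · exact h3 i hi h4
      · obtain rfl : i = s + n := by omega
        simp [hP, h2]
    · refine ⟨s + n + 1, by omega, by omega, fun i hi hi' => ?_⟩
      refine ⟨fun h4 => ?_, by omega⟩
      rcases Nat.lt_or_ge i (s + n) with h5 | h5
      · exact absurd (h i (s + n) hi h5 (by omega) h4) hP
      · obtain rfl : i = s + n := by omega
        exact absurd h4 hP

/-- An ascending sequence followed by a descending one is bitonic. -/
theorem Bitonic.of_asc_desc {k : ℕ → ℕ} {s d : ℕ}
    (h₁ : ∀ i j, s ≤ i → i < j → j < s + d → k i ≤ k j)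
    (h₂ : ∀ i j, s + d ≤ i → i < j → j < s + 2 * d → k j ≤ k i) : Bitonic k s (2 * d) := by
  intro t
  obtain ⟨p, a1, a2, a3⟩ := exists_threshold (P := fun i => t ≤ k i) (s := s) (n := d)
    fun i j hi hij hj h => h.trans (h₁ i j hi hij hj)
  obtain ⟨q, b1, b2, b3⟩ := exists_threshold (P := fun i => ¬ t ≤ k i) (s := s + d) (n := d)
    fun i j hi hij hj h h' => h (h'.trans (h₂ i j hi hij (by omega)))
  refine ⟨p, q, a1, by omega, by omega, .inl fun i hi hi' => ?_⟩
  rcases Nat.lt_or_ge i (s + d) with h | h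
  · beta_reduce; rw [a3 i hi h]; omega
  · have := b3 i h (by omega)
    rw [not_le] at this
    omega

/-- A descending sequence followed by an ascending one is bitonic. -/
theorem Bitonic.of_desc_asc {k : ℕ → ℕ} {s d : ℕ}
    (h₁ : ∀ i j, s ≤ i → i < j → j < s + d → k j ≤ k i)
    (h₂ : ∀ i j, s + d ≤ i → i < j → j < s + 2 * d → k i ≤ k j) : Bitonic k s (2 * d) := by
  intro t
  obtain ⟨p, a1, a2, a3⟩ := exists_threshold (P := fun i => ¬ t ≤ k i) (s := s) (n := d)
    fun i j hi hij hj h h' => h (h'.trans (h₁ i j hi hij hj))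
  obtain ⟨q, b1, b2, b3⟩ := exists_threshold (P := fun i => t ≤ k i) (s := s + d) (n := d)
    fun i j hi hij hj h => h.trans (h₂ i j hi hij (by omega))
  refine ⟨p, q, a1, by omega, by omega, .inr fun i hi hi' => ?_⟩
  rcases Nat.lt_or_ge i (s + d) with h | h
  · have := a3 i hi h
    rw [not_le] at this
    omega
  · have := b3 i h (by omega)
    omega

/-! ### The stages of the network -/

/-- The lanes that a compare-exchange stage at distance `d` swaps with their partner. -/
def cmpC (d : ℕ) (k : ℕ → ℕ) (i : ℕ) : Prop := i / d % 2 = 0 ∧ k (i + d) ≤ k i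

instance (d : ℕ) (k : ℕ → ℕ) : DecidablePred (cmpC d k) := fun i => by
  unfold cmpC; infer_instance

/-- The permutation performed by one compare-exchange stage. -/
def stage (d : ℕ) (k : ℕ → ℕ) : ℕ → ℕ := sw d (cmpC d k)

/-- The keys after the first `j` of the stages at distances `2 ^ (a - 1), …, 2, 1`. -/
def ks (a : ℕ) (k : ℕ → ℕ) : ℕ → ℕ → ℕ
  | 0 => k
  | j + 1 => ks a k j ∘ stage (2 ^ (a - 1 - j)) (ks a k j)

/-- The permutation performed by the first `j` stages. -/
def netPerm (a : ℕ) (k : ℕ → ℕ) : ℕ → ℕ → ℕ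
  | 0 => id
  | j + 1 => netPerm a k j ∘ stage (2 ^ (a - 1 - j)) (ks a k j)

/-- The inverse of `netPerm`. -/
def netInv (a : ℕ) (k : ℕ → ℕ) : ℕ → ℕ → ℕ
  | 0 => id
  | j + 1 => stage (2 ^ (a - 1 - j)) (ks a k j) ∘ netInv a k j

theorem ks_eq (a : ℕ) (k : ℕ → ℕ) (j : ℕ) : ks a k j = k ∘ netPerm a k j := by
  induction j with
  | zero => rfl
  | succ j ih => rw [ks, netPerm, ← Function.comp_assoc, ← ih]

theorem stage_stage {d : ℕ} (hd : 0 < d) (k : ℕ → ℕ) (i : ℕ) : stage d k (stage d k i) = i :=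
  sw_sw hd _ i

theorem netInv_netPerm (a : ℕ) (k : ℕ → ℕ) (j i : ℕ) : netInv a k j (netPerm a k j i) = i := by
  induction j generalizing i with
  | zero => rfl
  | succ j ih => simp only [netPerm, netInv, Function.comp, ih, stage_stage (Nat.two_pow_pos _)]

theorem netPerm_netInv (a : ℕ) (k : ℕ → ℕ) (j i : ℕ) : netPerm a k j (netInv a k j i) = i := by
  induction j generalizing i with
  | zero => rfl
  | succ j ih => simp only [netPerm, netInv, Function.comp, stage_stage (Nat.two_pow_pos _), ih]

theorem stage_div {d : ℕ} (hd : 0 < d) (k : ℕ → ℕ) (i : ℕ) :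
    stage d k i / (2 * d) = i / (2 * d) := by
  unfold stage sw
  rw [mul_comm 2 d, ← Nat.div_div_eq_div_mul, ← Nat.div_div_eq_div_mul]
  split_ifs with h1 h2 h3
  · rw [Nat.add_div_right _ hd]; omega
  · rfl
  · obtain ⟨h4, h5⟩ := sub_div_mod_two hd (show i / d % 2 = 1 by omega)
    conv_rhs => rw [← Nat.sub_add_cancel h4, Nat.add_div_right _ hd]
    omega
  · rfl

theorem stage_div_pow {a j : ℕ} (hj : j < a) (k : ℕ → ℕ) (i : ℕ) :
    stage (2 ^ (a - 1 - j)) k i / 2 ^ a = i / 2 ^ a := by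
  have h : 2 ^ a = 2 * 2 ^ (a - 1 - j) * 2 ^ j := by
    rw [← pow_succ', ← pow_add]; congr 1; omega
  rw [h, ← Nat.div_div_eq_div_mul, stage_div (Nat.two_pow_pos _), Nat.div_div_eq_div_mul]

theorem netPerm_div {a j : ℕ} (hj : j ≤ a) (k : ℕ → ℕ) (i : ℕ) :
    netPerm a k j i / 2 ^ a = i / 2 ^ a := by
  induction j generalizing i with
  | zero => rfl
  | succ j ih =>
    simp only [netPerm, Function.comp]
    rw [ih (by omega), stage_div_pow (by omega)]

theorem netInv_div {a j : ℕ} (hj : j ≤ a) (k : ℕ → ℕ) (i : ℕ) :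
    netInv a k j i / 2 ^ a = i / 2 ^ a := by
  have := netPerm_div hj k (netInv a k j i)
  rw [netPerm_netInv] at this
  exact this.symm

theorem stage_low {d : ℕ} {k : ℕ → ℕ} {i : ℕ} (h : i / d % 2 = 0) :
    k (stage d k i) = min (k i) (k (i + d)) := by
  simp only [stage, sw, h, cmpC, true_and, if_true]
  split_ifs <;> omega

theorem stage_high {d : ℕ} {k : ℕ → ℕ} {i : ℕ} (hd : 0 < d) (h : i / d % 2 = 0) :
    k (stage d k (i + d)) = max (k i) (k (i + d)) := by
  have h1 := add_div_mod_two (i := i) hd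
  simp only [stage, sw, h1, h, cmpC, true_and, Nat.add_sub_cancel]
  simp only [Nat.sub_zero, one_ne_zero, if_false]
  split_ifs <;> omega

theorem block_even {d h i : ℕ} (h1 : h * (2 * d) ≤ i) (h2 : i < h * (2 * d) + d) :
    i / d % 2 = 0 := by
  have : i / d = 2 * h := by
    apply Nat.div_eq_of_lt_le
    · linarith
    · linarith
  omega

/-- Batcher's half-cleaner: the lower half receives the minima and the upper half the maxima of
opposite positions, and both halves are bitonic again. -/
theorem stage_bitonic {d h : ℕ} {k : ℕ → ℕ} (hd : 0 < d) (hk : Bitonic k (h * (2 * d)) (2 * d)) :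
    Bitonic (k ∘ stage d k) (h * (2 * d)) d ∧ Bitonic (k ∘ stage d k) (h * (2 * d) + d) d ∧
      ∀ i j, h * (2 * d) ≤ i → i < h * (2 * d) + d → h * (2 * d) + d ≤ j →
        j < h * (2 * d) + 2 * d → (k ∘ stage d k) i ≤ (k ∘ stage d k) j := by
  refine ⟨hk.half_min.congr fun i hi hi' => ?_, (hk.half_max.congr fun i hi hi' => ?_).shift,
    fun i j hi hi' hj hj' => ?_⟩
  · exact (stage_low (k := k) (block_even hi hi')).symm
  · exact (stage_high (k := k) hd (block_even hi hi')).symm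
  · obtain ⟨j, rfl⟩ := Nat.exists_eq_add_of_le' (show d ≤ j by omega)
    simp only [Function.comp]
    rw [stage_low (k := k) (block_even hi hi'),
      stage_high (k := k) hd (block_even (h := h) (by omega) (by omega))]
    exact hk.half_le hi hi' (by omega) (by omega)

/-- The network sorts bitonic blocks. -/
theorem ks_sorted {a h : ℕ} {k : ℕ → ℕ} (hk : Bitonic k (h * 2 ^ a) (2 ^ a)) :
    ∀ i j, h * 2 ^ a ≤ i → i < j → j < h * 2 ^ a + 2 ^ a → ks a k a i ≤ ks a k a j := by
  -- After j stages the block consists of bitonic sub-blocks of length 2^(a-j), and the keys of an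
  -- earlier sub-block are at most those of a later one. At j = a the sub-blocks are single
  -- positions.
  have key : ∀ j ≤ a,
      (∀ g, g / 2 ^ j = h → Bitonic (ks a k j) (g * 2 ^ (a - j)) (2 ^ (a - j))) ∧
      (∀ i i', i / 2 ^ a = h → i' / 2 ^ a = h → i / 2 ^ (a - j) < i' / 2 ^ (a - j) →
        ks a k j i ≤ ks a k j i') := by
    intro j
    induction j with
    | zero =>
      intro _
      refine ⟨fun g hg => ?_, fun i i' hi hi' hlt => ?_⟩
      · simp only [pow_zero, Nat.div_one] at hg
        subst hg
        simpa [ks] using hk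
      · simp only [Nat.sub_zero] at hlt
        omega
    | succ j ih =>
      intro hj
      obtain ⟨ih1, ih2⟩ := ih (by omega)
      obtain ⟨e, he⟩ : ∃ e, a - j = e + 1 := ⟨a - j - 1, by omega⟩
      have he' : a - (j + 1) = e := by omega
      have he'' : a - 1 - j = e := by omega
      have h2 : 2 ^ (a - j) = 2 * 2 ^ e := by rw [he, pow_succ']
      have hd : 0 < 2 ^ e := Nat.two_pow_pos e
      have hdiv : ∀ i, i / 2 ^ a = i / 2 ^ e / 2 / 2 ^ j := fun i => by
        rw [Nat.div_div_eq_div_mul, Nat.div_div_eq_div_mul]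
        have : 2 ^ a = 2 ^ e * (2 * 2 ^ j) := by
          rw [← pow_succ', ← pow_add]
          congr 1
          omega
        rw [this]
      rw [h2] at ih1 ih2
      simp only [ks, he', he'']
      refine ⟨fun g hg => ?_, fun i i' hi hi' hlt => ?_⟩
      · have hg2 : g / 2 / 2 ^ j = h := by
          rw [Nat.div_div_eq_div_mul, ← pow_succ', hg]
        obtain ⟨b1, b2, -⟩ := stage_bitonic hd (ih1 (g / 2) hg2)
        rcases Nat.mod_two_eq_zero_or_one g with h0 | h0
        · have : g / 2 * (2 * 2 ^ e) = g * 2 ^ e := by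
            rw [← mul_assoc]; congr 1; omega
          rwa [this] at b1
        · have : g / 2 * (2 * 2 ^ e) + 2 ^ e = g * 2 ^ e := by
            rw [← mul_assoc, ← Nat.succ_mul]; congr 1; omega
          rwa [this] at b2
      -- Either both positions lie in the two halves of one sub-block, which the current stage has
      -- separated, or their sub-blocks differed before; in the latter case the stage does not leave
      -- the sub-blocks and the induction hypothesis applies.
      · rw [hdiv] at hi hi'
        rcases Nat.eq_or_lt_of_le (Nat.div_le_div_right (c := 2) hlt.le) with heq | hlt2
        · obtain ⟨-, -, b3⟩ := stage_bitonic hd (ih1 _ hi)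
          have m1 := Nat.div_add_mod i (2 ^ e)
          have m2 := Nat.div_add_mod i' (2 ^ e)
          have l1 := Nat.mod_lt i hd
          have l2 := Nat.mod_lt i' hd
          have c1 : i / 2 ^ e = 2 * (i / 2 ^ e / 2) := by omega
          have c2 : i' / 2 ^ e = 2 * (i / 2 ^ e / 2) + 1 := by omega
          rw [c1] at m1
          rw [c2] at m2
          have z1 := Nat.zero_le (i % 2 ^ e)
          have z2 := Nat.zero_le (i' % 2 ^ e)
          apply b3 <;> linarith
        · simp only [Function.comp]
          have s1 := stage_div hd (ks a k j) i
          have s2 := stage_div hd (ks a k j) i'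
          have t1 : ∀ i, i / (2 * 2 ^ e) = i / 2 ^ e / 2 := fun i => by
            rw [Nat.div_div_eq_div_mul, mul_comm]
          apply ih2
          · rw [hdiv, ← t1, s1, t1, hi]
          · rw [hdiv, ← t1, s2, t1, hi']
          · rw [s1, s2, t1, t1]; exact hlt2
  intro i j hi hij hj
  have hd : ∀ i, h * 2 ^ a ≤ i → i < h * 2 ^ a + 2 ^ a → i / 2 ^ a = h := fun i h1 h2 => by
    apply Nat.div_eq_of_lt_le h1
    rw [Nat.succ_mul]; exact h2
  apply (key a le_rfl).2 i j (hd i hi (by omega)) (hd j (by omega) hj)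
  simpa using hij

/-! ### Multisets of records -/

/-- The multiset of the records at the positions `lo, …, lo + n - 1`. -/
def recs (F : ℕ → ℕ × ℕ) (lo n : ℕ) : Multiset (ℕ × ℕ) :=
  (Multiset.range n).map fun t => F (lo + t)

theorem recs_add (F : ℕ → ℕ × ℕ) (lo m n : ℕ) :
    recs F lo (m + n) = recs F lo m + recs F (lo + m) n := by
  simp only [recs, Multiset.range_add, Multiset.map_add, Multiset.map_map, Function.comp_def,
    add_assoc]

@[simp] theorem recs_zero (F : ℕ → ℕ × ℕ) (lo : ℕ) : recs F lo 0 = 0 := rfl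

theorem recs_congr {F G : ℕ → ℕ × ℕ} {lo lo' n : ℕ} (h : ∀ t < n, F (lo + t) = G (lo' + t)) :
    recs F lo n = recs G lo' n :=
  Multiset.map_congr rfl fun t ht => h t (Multiset.mem_range.1 ht)

theorem mem_recs {F : ℕ → ℕ × ℕ} {lo n : ℕ} {z : ℕ × ℕ} :
    z ∈ recs F lo n ↔ ∃ t < n, F (lo + t) = z := by
  simp [recs]

theorem card_recs (F : ℕ → ℕ × ℕ) (lo n : ℕ) : (recs F lo n).card = n := by simp [recs]

theorem recs_map (F : ℕ → ℕ × ℕ) (g : ℕ × ℕ → ℕ × ℕ) (lo n : ℕ) :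
    (recs F lo n).map g = recs (g ∘ F) lo n := by
  simp [recs]

theorem map_range_of_inverse {n : ℕ} {p q : ℕ → ℕ} (hp : ∀ i < n, p i < n) (hq : ∀ i < n, q i < n)
    (hqp : ∀ i < n, q (p i) = i) (hpq : ∀ i < n, p (q i) = i) :
    (Multiset.range n).map p = Multiset.range n := by
  refine (Multiset.Nodup.ext ?_ (Multiset.nodup_range n)).2 fun i => ?_
  · refine Multiset.Nodup.map_on (fun x hx y hy hxy => ?_) (Multiset.nodup_range n)
    rw [Multiset.mem_range] at hx hy
    rw [← hqp x hx, hxy, hqp y hy]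
  · simp only [Multiset.mem_map, Multiset.mem_range]
    exact ⟨by rintro ⟨j, hj, rfl⟩; exact hp j hj, fun hi => ⟨q i, hq i hi, hpq i hi⟩⟩

theorem recs_perm {F : ℕ → ℕ × ℕ} {n : ℕ} {p q : ℕ → ℕ} (hp : ∀ i < n, p i < n)
    (hq : ∀ i < n, q i < n) (hqp : ∀ i < n, q (p i) = i) (hpq : ∀ i < n, p (q i) = i) :
    recs (F ∘ p) 0 n = recs F 0 n := by
  conv_rhs => rw [recs, ← map_range_of_inverse hp hq hqp hpq, Multiset.map_map]
  simp [recs]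

theorem lt_mul_of_div_eq {i j m c : ℕ} (hm : 0 < m) (h : i / m = j / m) (hj : j < m * c) :
    i < m * c := by
  rw [mul_comm, ← Nat.div_lt_iff_lt_mul hm] at hj ⊢
  omega

theorem netPerm_lt {a c i : ℕ} (k : ℕ → ℕ) (hi : i < 2 ^ a * c) : netPerm a k a i < 2 ^ a * c :=
  lt_mul_of_div_eq (Nat.two_pow_pos a) (netPerm_div le_rfl k i) hi

theorem netInv_lt {a c i : ℕ} (k : ℕ → ℕ) (hi : i < 2 ^ a * c) : netInv a k a i < 2 ^ a * c :=
  lt_mul_of_div_eq (Nat.two_pow_pos a) (netInv_div le_rfl k i) hi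

theorem recs_netPerm (F : ℕ → ℕ × ℕ) (a c : ℕ) (k : ℕ → ℕ) :
    recs (F ∘ netPerm a k a) 0 (2 ^ a * c) = recs F 0 (2 ^ a * c) :=
  recs_perm (q := netInv a k a) (fun _ => netPerm_lt k) (fun _ => netInv_lt k)
    (fun _ _ => netInv_netPerm ..) (fun _ _ => netPerm_netInv ..)

/-! ### Merging two sorted words -/

section merge
variable {n : ℕ} {x y : ℕ → ℕ}

/-- The smaller keys after the first stage of the merging network. -/
def loKey (n : ℕ) (x y : ℕ → ℕ) (i : ℕ) : ℕ := min (x i) (y (2 ^ n - 1 - i))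

/-- The larger keys after the first stage of the merging network. -/
def hiKey (n : ℕ) (x y : ℕ → ℕ) (i : ℕ) : ℕ := max (x i) (y (2 ^ n - 1 - i))

/-- Reversing the second sequence makes the concatenation ascend and then descend, which is where
the reversal of lanes in `mergeWords` comes from. -/
theorem bitonic_append (hx : ∀ i j, i < j → j < 2 ^ n → x i ≤ x j)
    (hy : ∀ i j, i < j → j < 2 ^ n → y i ≤ y j) :
    Bitonic (fun i => if i < 2 ^ n then x i else y (2 ^ n - 1 - (i - 2 ^ n))) 0 (2 * 2 ^ n) := by
  apply Bitonic.of_asc_desc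
  · intro i j _ hij hj
    simp only [show i < 2 ^ n by omega, show j < 2 ^ n by omega, if_true]
    exact hx i j hij (by omega)
  · intro i j hi hij hj
    simp only [show ¬ i < 2 ^ n by omega, show ¬ j < 2 ^ n by omega, if_false]
    exact hy _ _ (by omega) (by omega)

/-- The first stage of the network on 2 · 2^n positions compares lane i of one word with lane 2^n -
1 - i of the other. It acts across the two words; the remaining stages act inside each word. -/
theorem merge_bitonic (hx : ∀ i j, i < j → j < 2 ^ n → x i ≤ x j)
    (hy : ∀ i j, i < j → j < 2 ^ n → y i ≤ y j) :
    Bitonic (loKey n x y) 0 (2 ^ n) ∧ Bitonic (hiKey n x y) 0 (2 ^ n) ∧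
      ∀ i < 2 ^ n, ∀ j < 2 ^ n, loKey n x y i ≤ hiKey n x y j := by
  have h := bitonic_append hx hy
  refine ⟨h.half_min.congr fun i _ hi => ?_, h.half_max.congr fun i _ hi => ?_,
    fun i hi j hj => ?_⟩
  · simp [loKey, show i < 2 ^ n by omega]
  · simp [hiKey, show i < 2 ^ n by omega]
  · have := h.half_le (i := i) (j := j) (by omega) (by omega) (by omega) (by omega)
    simpa [loKey, hiKey, hi, hj] using this

theorem merge_sorted (hx : ∀ i j, i < j → j < 2 ^ n → x i ≤ x j)
    (hy : ∀ i j, i < j → j < 2 ^ n → y i ≤ y j) :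
    (∀ i j, i < j → j < 2 ^ n → ks n (loKey n x y) n i ≤ ks n (loKey n x y) n j) ∧
    (∀ i j, i < j → j < 2 ^ n → ks n (hiKey n x y) n i ≤ ks n (hiKey n x y) n j) ∧
    ∀ i < 2 ^ n, ∀ j < 2 ^ n, ks n (loKey n x y) n i ≤ ks n (hiKey n x y) n j := by
  obtain ⟨h1, h2, h3⟩ := merge_bitonic hx hy
  refine ⟨fun i j hij hj => ?_, fun i j hij hj => ?_, fun i hi j hj => ?_⟩
  · exact ks_sorted (h := 0) (by simpa using h1) i j (by omega) hij (by omega)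
  · exact ks_sorted (h := 0) (by simpa using h2) i j (by omega) hij (by omega)
  · rw [ks_eq, ks_eq]
    have e1 := netPerm_lt (c := 1) (loKey n x y) (a := n) (i := i) (by omega)
    have e2 := netPerm_lt (c := 1) (hiKey n x y) (a := n) (i := j) (by omega)
    exact h3 _ (by omega) _ (by omega)

end merge

theorem recs_reverse (F : ℕ → ℕ × ℕ) (K : ℕ) : recs (fun i => F (K - 1 - i)) 0 K = recs F 0 K :=
  recs_perm (p := fun i => K - 1 - i) (q := fun i => K - 1 - i) (fun i hi => by omega)
    (fun i hi => by omega) (fun i hi => by omega) (fun i hi => by omega)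

theorem recs_cross (F G : ℕ → ℕ × ℕ) (C : ℕ → Prop) [DecidablePred C] (K : ℕ) :
    recs (fun i => if C i then G i else F i) 0 K + recs (fun i => if C i then F i else G i) 0 K =
      recs F 0 K + recs G 0 K := by
  induction K with
  | zero => simp
  | succ K ih =>
    simp only [recs_add _ 0 K 1]
    have h1 : ∀ H : ℕ → ℕ × ℕ, recs H (0 + K) 1 = {H K} := fun H => by simp [recs]
    simp only [h1]
    rw [add_add_add_comm, ih]
    by_cases h : C K
    · simp only [h, if_true]; abel
    · simp only [h, if_false]; abel

/-! ### In-word sorting -/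

/-- Aligned blocks of length `2 ^ ℓ` are ascending if their number is even, else descending. -/
def DirSorted (ℓ : ℕ) (k : ℕ → ℕ) : Prop :=
  ∀ i j, i < j → i / 2 ^ ℓ = j / 2 ^ ℓ →
    if i / 2 ^ ℓ % 2 = 0 then k i ≤ k j else k j ≤ k i

/-- Complement the keys in the blocks of length `2 ^ ℓ` with odd number. -/
def flipKey (M ℓ : ℕ) (k : ℕ → ℕ) (i : ℕ) : ℕ := if i / 2 ^ ℓ % 2 = 1 then M - k i else k i

theorem flipKey_flipKey {M ℓ : ℕ} {k : ℕ → ℕ} (h : ∀ i, k i ≤ M) :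
    flipKey M ℓ (flipKey M ℓ k) = k := by
  funext i
  have := h i
  simp only [flipKey]
  split_ifs <;> omega

theorem flipKey_comp {M ℓ : ℕ} {k p : ℕ → ℕ} (hp : ∀ i, p i / 2 ^ ℓ = i / 2 ^ ℓ) :
    flipKey M ℓ (k ∘ p) = flipKey M ℓ k ∘ p := by
  funext i
  simp only [flipKey, Function.comp, hp]

/-- The network moves keys only within blocks, so complementing the odd blocks before and after
cancels. What remains is a permutation of the original keys, which the payloads can follow. -/
theorem flip_net {M ℓ : ℕ} {k : ℕ → ℕ} (hM : ∀ i, k i ≤ M) :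
    flipKey M ℓ (ks ℓ (flipKey M ℓ k) ℓ) = k ∘ netPerm ℓ (flipKey M ℓ k) ℓ := by
  rw [ks_eq, flipKey_comp fun i => netPerm_div le_rfl _ i, flipKey_flipKey hM]

/-- The merging step of bitonic sort. Two neighbouring blocks of opposite direction form a bitonic
block; complementing the keys in every second double block lets one and the same ascending network
produce alternating directions. -/
theorem dirSorted_step {M ℓ : ℕ} {k : ℕ → ℕ} (hk : DirSorted ℓ k) :
    DirSorted (ℓ + 1) (flipKey M (ℓ + 1) (ks (ℓ + 1) (flipKey M (ℓ + 1) k) (ℓ + 1))) := by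
  have hb : ∀ h, Bitonic (flipKey M (ℓ + 1) k) (h * 2 ^ (ℓ + 1)) (2 ^ (ℓ + 1)) := by
    intro h
    have hp : 0 < 2 ^ ℓ := Nat.two_pow_pos ℓ
    have e2 : 2 ^ (ℓ + 1) = 2 * 2 ^ ℓ := pow_succ' 2 ℓ
    have d1 : ∀ i, h * (2 * 2 ^ ℓ) ≤ i → i < h * (2 * 2 ^ ℓ) + 2 ^ ℓ → i / 2 ^ ℓ = 2 * h :=
      fun i h1 h2 => by
        apply Nat.div_eq_of_lt_le
        · linarith
        · linarith
    have d2 : ∀ i, h * (2 * 2 ^ ℓ) + 2 ^ ℓ ≤ i → i < h * (2 * 2 ^ ℓ) + 2 * 2 ^ ℓ →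
        i / 2 ^ ℓ = 2 * h + 1 := fun i h1 h2 => by
        apply Nat.div_eq_of_lt_le
        · linarith
        · linarith
    have d3 : ∀ i, h * (2 * 2 ^ ℓ) ≤ i → i < h * (2 * 2 ^ ℓ) + 2 * 2 ^ ℓ →
        i / (2 * 2 ^ ℓ) = h := fun i h1 h2 => by
        apply Nat.div_eq_of_lt_le
        · linarith
        · linarith
    rw [e2]
    -- Complementing turns the ascending-descending pattern of an odd double block into a
    -- descending-ascending one; both are bitonic.
    by_cases hh : h % 2 = 1
    · apply Bitonic.of_desc_asc
      · intro i j hi hij hj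
        simp only [flipKey, e2, d3 i hi (by omega), d3 j (by omega) (by omega), hh, if_true]
        have := hk i j hij (by rw [d1 i hi (by omega), d1 j (by omega) hj])
        rw [d1 i hi (by omega), if_pos (by omega)] at this
        omega
      · intro i j hi hij hj
        simp only [flipKey, e2, d3 i (by omega) (by omega), d3 j (by omega) (by omega), hh, if_true]
        have := hk i j hij (by rw [d2 i hi (by omega), d2 j (by omega) hj])
        rw [d2 i hi (by omega), if_neg (by omega)] at this
        omega
    · apply Bitonic.of_asc_desc
      · intro i j hi hij hj
        simp only [flipKey, e2, d3 i hi (by omega), d3 j (by omega) (by omega), hh, if_false]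
        have := hk i j hij (by rw [d1 i hi (by omega), d1 j (by omega) hj])
        rwa [d1 i hi (by omega), if_pos (by omega)] at this
      · intro i j hi hij hj
        simp only [flipKey, e2, d3 i (by omega) (by omega), d3 j (by omega) (by omega), hh,
          if_false]
        have := hk i j hij (by rw [d2 i hi (by omega), d2 j (by omega) hj])
        rwa [d2 i hi (by omega), if_neg (by omega)] at this
  intro i j hij hdiv
  have hp : 0 < 2 ^ (ℓ + 1) := Nat.two_pow_pos _
  have h1 := Nat.div_mul_le_self i (2 ^ (ℓ + 1))
  have h2 := Nat.lt_div_mul_add (a := j) hp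
  rw [← hdiv] at h2
  have := ks_sorted (hb (i / 2 ^ (ℓ + 1))) i j h1 hij h2
  by_cases h0 : i / 2 ^ (ℓ + 1) % 2 = 0
  · rw [if_pos h0]
    have h0' : ¬ i / 2 ^ (ℓ + 1) % 2 = 1 := by omega
    simpa only [flipKey, ← hdiv, h0', if_false] using this
  · rw [if_neg h0]
    have h0' : i / 2 ^ (ℓ + 1) % 2 = 1 := by omega
    simp only [flipKey, ← hdiv, h0', if_true] at this ⊢
    omega

end PackedMap

/-! ## Programs for the networks -/

namespace PackedMap

open Finset Stmt
open PackedMap.Expr (var load)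

/-- The stages at distances `D / 2, …, B` on the key word `50` and the payload word `51`; the
masks are stored from the address in `54` on. -/
def stageBody : Stmt :=
  .set 52 (var 52 >>> 1) ;;
  .set 55 (var 53 * ((1 <<< var 52) - 1)) ;;
  .set 56 ((((var 50 &&& var 55) + (var 16 &&& var 55)) - ((var 50 >>> var 52) &&& var 55))
    &&& (var 16 &&& var 55)) ;;
  .set 56 (var 56 - (var 56 >>> var 7)) ;;
  .store (var 54) (var 56) ;;
  .set 54 (var 54 + 1) ;;
  .set 57 ((var 50 ^^^ (var 50 >>> var 52)) &&& var 56) ;;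
  .set 50 ((var 50 ^^^ var 57) ^^^ (var 57 <<< var 52)) ;;
  .set 57 ((var 51 ^^^ (var 51 >>> var 52)) &&& var 56) ;;
  .set 51 ((var 51 ^^^ var 57) ^^^ (var 57 <<< var 52)) ;;
  .set 53 (var 53 + (var 53 <<< var 52)) ;;
  .skip

def stageLoop : Stmt := .loop (var 6) (var 52) stageBody

/-- The standing assumptions on word length, lane width, data bits and number of lanes. -/
structure Fits (w B q K : ℕ) : Prop where
  q_add : q + 2 = B
  pos : 0 < K
  le : K * B ≤ w + 1
  w_big : 2 ≤ w

theorem Fits.B_pos {w B q K : ℕ} (h : Fits w B q K) : 0 < B := by have := h.q_add; omega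

/-- Lanes of q + 1 significant bits end at bit B(K-1) + q + 1 = KB - 1 ≤ w. This is why the lanes
have a spare bit and why KB may be w + 1. -/
theorem Fits.pack_lt {w B q K : ℕ} (h : Fits w B q K) {x : ℕ → ℕ} (hx : ∀ i, x i < 2 ^ (q + 1)) :
    pack B K x < 2 ^ w := by
  refine (pack_lt' (q := q + 1) (by have := h.q_add; omega) h.pos fun i _ => hx i).trans_le
    (Nat.pow_le_pow_right (by omega) ?_)
  have h1 := h.q_add
  have h2 := h.le
  have h3 : B * (K - 1) + B = K * B := by
    obtain ⟨K, rfl⟩ := Nat.exists_eq_succ_of_ne_zero h.pos.ne'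
    simp [Nat.mul_succ, mul_comm]
  omega

theorem Fits.pack_lt_q {w B q K : ℕ} (h : Fits w B q K) {x : ℕ → ℕ} (hx : ∀ i, x i < 2 ^ q) :
    pack B K x < 2 ^ w :=
  h.pack_lt fun i => lt_of_le_pow (hx i) (by omega)

theorem succ_lt_two_pow {w : ℕ} (h : 2 ≤ w) : w + 1 < 2 ^ w := by
  induction w, h using Nat.le_induction with
  | base => norm_num
  | succ w _ ih => rw [pow_succ]; omega

theorem Fits.lt_pow {w B q K n : ℕ} (h : Fits w B q K) (hn : n ≤ w + 1) : n < 2 ^ w :=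
  hn.trans_lt (succ_lt_two_pow h.w_big)

theorem pack_shr_and_mask {B K q : ℕ} {x : ℕ → ℕ} {d c : ℕ} (hB : 0 < B) (hq : q ≤ B) (hd : 0 < d)
    (hK : K = 2 * d * c) (hx : ∀ i < K, x i < 2 ^ q) :
    pack B K x / 2 ^ (d * B) &&& maskOf B K B (fun i => i / d % 2 = 0) =
      pack B K (fun i => if i / d % 2 = 0 then x (i + d) else 0) := by
  have hxB : ∀ i < K, x i < 2 ^ B := fun i hi => lt_of_le_pow (hx i hi) hq
  rw [pack_shr hB hxB, pack_and_mask hB le_rfl]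
  · refine pack_congr fun i hi => ?_
    split_ifs with h1 h2
    · rfl
    · exact absurd (hK ▸ add_lt_of_even hd h1 (hK ▸ hi)) h2
    · rfl
  · intro i hi
    split_ifs with h
    · exact hxB _ h
    · positivity

/-- One compare-exchange stage on a word. -/
theorem stage_masks {w B q K d c : ℕ} (F : Fits w B q K) (hd : 0 < d) (hK : K = 2 * d * c)
    {k : ℕ → ℕ} (hk : ∀ i, k i < 2 ^ q) {m ge : ℕ}
    (hm : m = pack (2 * d * B) c (fun _ => 1) * (2 ^ (d * B) - 1))
    (hge : ge = (((pack B K k &&& m) + (pack B K (fun _ => 2 ^ q) &&& m)) -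
      ((pack B K k / 2 ^ (d * B)) &&& m)) &&& (pack B K (fun _ => 2 ^ q) &&& m)) :
    (pack B K k / 2 ^ (d * B)) &&& m ≤ (pack B K k &&& m) + (pack B K (fun _ => 2 ^ q) &&& m) ∧
    ge / 2 ^ q ≤ ge ∧ ge < 2 ^ w ∧ ge - ge / 2 ^ q = maskOf B K q (cmpC d k) := by
  have hqB := F.q_add
  have hB := F.B_pos
  have hm' : m = maskOf B K B (fun i => i / d % 2 = 0) := by
    rw [hm, lowMask_eq B d c hd, hK, maskOf]
  have hkB : ∀ i < K, k i < 2 ^ B := fun i _ => lt_of_le_pow (hk i) (by omega)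
  have e1 : pack B K k &&& m = pack B K (fun i => if i / d % 2 = 0 then k i else 0) := by
    rw [hm', pack_and_mask hB le_rfl hkB]
  have e2 : pack B K (fun _ => 2 ^ q) &&& m =
      pack B K (fun i => if i / d % 2 = 0 then 2 ^ q else 0) := by
    rw [hm', pack_and_mask hB le_rfl]
    intro i _
    exact Nat.pow_lt_pow_right (by omega) (by omega)
  have e3 : (pack B K k / 2 ^ (d * B)) &&& m =
      pack B K (fun i => if i / d % 2 = 0 then k (i + d) else 0) := by
    rw [hm', pack_shr_and_mask hB (show q ≤ B by omega) hd hK fun i _ => hk i]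
  rw [e1, e3] at hge ⊢
  have hpos : 0 < 2 ^ q := by positivity
  obtain ⟨h1, h2, h3, h4⟩ := compare_lanes (B := B) (K := K) (q := q) (by omega)
    (fun i => i / d % 2 = 0)
    (x := fun i => if i / d % 2 = 0 then k i else 0)
    (y := fun i => if i / d % 2 = 0 then k (i + d) else 0)
    (fun i _ => by split_ifs <;> simp [hk, hpos]) (fun i _ => by split_ifs <;> simp [hk, hpos])
    (fun i _ h => by simp [h]) (fun i _ h => by simp [h]) e2 hge
  refine ⟨h1, h2, h3.trans_le (Nat.pow_le_pow_right (by omega) ?_), ?_⟩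
  · have := F.le
    have h3 : B * (K - 1) + B = K * B := by
      obtain ⟨K, rfl⟩ := Nat.exists_eq_succ_of_ne_zero F.pos.ne'
      simp [Nat.mul_succ, mul_comm]
    omega
  · rw [h4]
    unfold maskOf
    refine pack_congr fun i _ => ?_
    by_cases h : i / d % 2 = 0 <;> simp [cmpC, h]

theorem ks_lt {q a : ℕ} {k : ℕ → ℕ} (hk : ∀ i, k i < 2 ^ q) (j i : ℕ) : ks a k j i < 2 ^ q := by
  rw [ks_eq]; exact hk _

/-- The state of the network after `j` stages. -/
structure StageInv (w B q K a c mp : ℕ) (k x : ℕ → ℕ) (m₀ : ℕ → ℕ) (j : ℕ) (σ : St) : Prop where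
  v6 : σ.v 6 = B
  v7 : σ.v 7 = q
  v16 : σ.v 16 = pack B K (fun _ => 2 ^ q)
  v50 : σ.v 50 = pack B K (ks a k j)
  v51 : σ.v 51 = pack B K (x ∘ netPerm a k j)
  v52 : σ.v 52 = 2 ^ (a - j) * B
  v53 : σ.v 53 = pack (2 ^ (a - j) * B) (c * 2 ^ j) (fun _ => 1)
  v54 : σ.v 54 = mp + j
  masks : ∀ i < j, σ.m (mp + i) = maskOf B K q (cmpC (2 ^ (a - 1 - i)) (ks a k i))
  mem : ∀ i, i < mp ∨ mp + j ≤ i → σ.m i = m₀ i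

theorem cmpC_even (d : ℕ) (k : ℕ → ℕ) (i : ℕ) (h : cmpC d k i) : i / d % 2 = 0 := h.1

/-- Stage j works at distance 2^(a-1-j). One mask, derived from the keys, moves keys and payloads
alike, and it is stored so that the stage can be undone later. -/
theorem stageBody_spec {w B q K a c mp j : ℕ} (F : Fits w B q K) (hK : K = 2 ^ a * c)
    (hmp : mp + a ≤ 2 ^ w) (hj : j < a) {k x m₀ : ℕ → ℕ} (hk : ∀ i, k i < 2 ^ q)
    (hx : ∀ i, x i < 2 ^ q) {σ : St} (h : StageInv w B q K a c mp k x m₀ j σ) :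
    Tr w stageBody σ 100 (StageInv w B q K a c mp k x m₀ (j + 1)) := by
  have hB := F.B_pos
  have hqB := F.q_add
  obtain ⟨e, he⟩ : ∃ e, a = j + (e + 1) := ⟨a - j - 1, by omega⟩
  have e1 : a - j = e + 1 := by omega
  have e2 : a - (j + 1) = e := by omega
  have e3 : a - 1 - j = e := by omega
  have hd : 0 < 2 ^ e := Nat.two_pow_pos e
  have hK' : K = 2 * 2 ^ e * (c * 2 ^ j) := by
    rw [hK, he, pow_add, pow_succ]; ring
  have hdK : 2 ^ e * B ≤ w + 1 := by
    refine le_trans (Nat.mul_le_mul_right _ ?_) F.le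
    rw [hK']
    have := F.pos
    have h1 : 0 < c * 2 ^ j := by
      rcases Nat.eq_zero_or_pos (c * 2 ^ j) with h | h
      · rw [hK', h] at this; omega
      · exact h
    calc 2 ^ e ≤ 2 * 2 ^ e * 1 := by omega
      _ ≤ _ := Nat.mul_le_mul_left _ h1
  have hD := F.lt_pow hdK
  have hksl : ∀ i, ks a k j i < 2 ^ q := fun i => ks_lt hk j i
  have hkw := F.pack_lt_q hksl
  have hxl : ∀ i, (x ∘ netPerm a k j) i < 2 ^ q := fun i => hx _
  have hxw := F.pack_lt_q hxl
  have hpw := h.v54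
  obtain ⟨h1, h2, h3, h4⟩ := stage_masks F hd hK' hksl rfl rfl
  set U := pack (2 * 2 ^ e * B) (c * 2 ^ j) (fun _ => 1) with hU
  set m := U * (2 ^ (2 ^ e * B) - 1) with hm
  set ge := (((pack B K (ks a k j) &&& m) + (pack B K (fun _ => 2 ^ q) &&& m)) -
      ((pack B K (ks a k j) / 2 ^ (2 ^ e * B)) &&& m)) &&& (pack B K (fun _ => 2 ^ q) &&& m)
    with hge
  have v50 := h.v50
  have v51 := h.v51
  have v52 := h.v52
  have v53 := h.v53
  have v6 := h.v6
  have v7 := h.v7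
  have v16 := h.v16
  rw [e1, pow_succ'] at v52 v53
  have h1w : 1 < 2 ^ w := F.lt_pow (by have := F.w_big; omega)
  have h52w : 2 * 2 ^ e * B < 2 ^ w := F.lt_pow (by
    refine le_trans (Nat.mul_le_mul_right _ ?_) F.le
    rw [hK']
    refine Nat.le_mul_of_pos_right _ ?_
    have := F.pos
    rcases Nat.eq_zero_or_pos (c * 2 ^ j) with h | h
    · rw [hK', h] at this; omega
    · exact h)
  have hqw : q < 2 ^ w := F.lt_pow (by
    have h1 := F.le
    have h2 := Nat.mul_le_mul_right B F.pos
    simp only [Nat.succ_eq_add_one] at h2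
    omega)
  have hmpw : mp + j < 2 ^ w := by omega
  -- The step count is left open here; the rules applied in `case h` assemble it, and `case ht`
  -- compares it with the claimed bound.
  apply Tr.le
  case h =>
    unfold stageBody
    apply Tr.set (x := 2 ^ e * B)
    · simp [v52, h52w, h1w]
    · simp only [eval_shr, eval_var, v52, eval_lit, pow_one]
      rw [mul_assoc]
      exact Nat.mul_div_cancel_left _ (by omega)
    apply Tr.set (x := m)
    · simp [hD, Nat.one_le_two_pow]
    · simp [v53, hm, hU]
    apply Tr.set (x := ge)
    · simpa [v50, v16, hD, hkw] using h1
    · simp [v50, v16, hge]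
    apply Tr.set (x := maskOf B K q (cmpC (2 ^ e) (ks a k j)))
    · simp [v7, h2, h3, hqw]
    · simp [v7, h4]
    apply Tr.store (y := mp + j) (x := maskOf B K q (cmpC (2 ^ e) (ks a k j)))
    · simp
    · simp
    · simp [h.v54]
    · simp
    · exact hmpw
    apply Tr.set (x := mp + j + 1)
    · simp
    · simp [h.v54]
    apply Tr.set
    · simp [v50, hkw, hD]
    · rfl
    apply Tr.set (x := pack B K (ks a k (j + 1)))
    · simp [hD]
    · simp only [eval_xor, eval_shl, eval_and, eval_shr, eval_var, St.set_v, St.write_v]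
      simp [v50]
      rw [ks, e3]
      exact delta_swap hB (show q ≤ B by omega) hd hK' (fun i _ => hksl i) _ (cmpC_even _ _) rfl
    apply Tr.set
    · simp [v51, hxw, hD]
    · rfl
    apply Tr.set (x := pack B K (x ∘ netPerm a k (j + 1)))
    · simp [hD]
    · simp only [eval_xor, eval_shl, eval_and, eval_shr, eval_var, St.set_v, St.write_v]
      simp [v51]
      rw [netPerm, e3, ← Function.comp_assoc]
      exact delta_swap hB (show q ≤ B by omega) hd hK' (fun i _ => hxl i) _ (cmpC_even _ _) rfl
    apply Tr.set (x := pack (2 ^ e * B) (c * 2 ^ (j + 1)) (fun _ => 1))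
    · simp [hD]
    · simp [v53]
      rw [mul_assoc 2, units_double]
      congr 1
      rw [pow_succ]; ring
    apply Tr.skip
    constructor
    · simp [v6]
    · simp [v7]
    · simp [v16]
    · simp
    · simp
    · simp [e2]
    · simp [e2]
    · simp [add_assoc]
    · intro i hi
      rcases Nat.lt_or_ge i j with hij | hij
      · simp [hij.ne, h.masks i hij]
      · obtain rfl : i = j := by omega
        simp [e3]
    · intro i hi
      have : i ≠ mp + j := by omega
      simp [this]
      exact h.mem i (by omega)
  case ht => simp

theorem stageLoop_spec {w B q K a c mp : ℕ} (F : Fits w B q K) (hK : K = 2 ^ a * c)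
    (hmp : mp + a ≤ 2 ^ w) {k x : ℕ → ℕ} (hk : ∀ i, k i < 2 ^ q)
    (hx : ∀ i, x i < 2 ^ q) {σ : St} (h : StageInv w B q K a c mp k x σ.m 0 σ) :
    Tr w stageLoop σ (103 * (a + 1)) (StageInv w B q K a c mp k x σ.m a) := by
  have hB := F.B_pos
  refine Tr.le (Tr.loop_count (StageInv w B q K a c mp k x σ.m) a 100 h ?_ ?_) ?_
  · intro j hj σ h
    have h1 : 2 ^ (a - j) * B ≤ w + 1 := by
      refine le_trans (Nat.mul_le_mul_right _ ?_) F.le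
      rw [hK]
      calc 2 ^ (a - j) ≤ 2 ^ a * 1 := by
            rw [mul_one]; exact Nat.pow_le_pow_right (by omega) (by omega)
        _ ≤ 2 ^ a * c := by
          refine Nat.mul_le_mul_left _ ?_
          rcases Nat.eq_zero_or_pos c with h | h
          · have := F.pos; rw [hK, h] at this; omega
          · exact h
    have h2 : B ≤ 2 ^ (a - j) * B := Nat.le_mul_of_pos_left _ (Nat.two_pow_pos _)
    refine ⟨by simp, by simp, ?_, ?_, ?_⟩
    · simpa [h.v6] using F.lt_pow (h2.trans h1)
    · simpa [h.v52] using F.lt_pow h1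
    · simp only [eval_var, h.v6, h.v52]
      constructor
      · intro h3
        by_contra h4
        rw [show a - j = 0 by omega] at h3
        simp at h3
      · intro h3
        obtain ⟨e, he⟩ : ∃ e, a - j = e + 1 := ⟨a - j - 1, by omega⟩
        have : 0 < 2 ^ e * B := by positivity
        rw [he, pow_succ]
        nlinarith [Nat.one_le_two_pow (n := e)]
  · intro j hj σ' h'
    exact stageBody_spec F hK hmp hj hk hx h'
  · simp; omega

/-! ### Undoing a network -/

/-- Undo the stages at distances `B, …, D / 2` on the word `51`; the number `2 * D` is in `58`. -/
def unstageBody : Stmt :=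
  .set 54 (var 54 - 1) ;;
  .set 56 (load (var 54)) ;;
  .set 57 ((var 51 ^^^ (var 51 >>> var 52)) &&& var 56) ;;
  .set 51 ((var 51 ^^^ var 57) ^^^ (var 57 <<< var 52)) ;;
  .set 52 (var 52 + var 52) ;;
  .skip

def unstageLoop : Stmt := .loop (var 52) (var 58) unstageBody

/-- The word after undoing the last stages, down to stage `j`. -/
def undo (a : ℕ) (k s : ℕ → ℕ) : ℕ → ℕ → ℕ
  | 0 => s
  | i + 1 => undo a k s i ∘ stage (2 ^ i) (ks a k (a - 1 - i))

/-- At each step the outermost stage of `netInv` passes to the inner end of `undo`, so the composite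
does not change. -/
theorem undo_comp_netInv (a : ℕ) (k s : ℕ → ℕ) (i : ℕ) (hi : i ≤ a) :
    undo a k s i ∘ netInv a k (a - i) = s ∘ netInv a k a := by
  induction i with
  | zero => rfl
  | succ i ih =>
    rw [← ih (by omega), show a - i = (a - (i + 1)) + 1 by omega, netInv]
    funext p
    simp only [undo, Function.comp]
    rw [show a - 1 - i = a - (i + 1) by omega, show a - 1 - (a - (i + 1)) = i by omega]

structure UnstageInv (w B q K a mp : ℕ) (k s : ℕ → ℕ) (m₀ : ℕ → ℕ) (j : ℕ) (σ : St) : Prop where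
  v58 : σ.v 58 = 2 ^ a * B
  v51 : σ.v 51 = pack B K (undo a k s j)
  v52 : σ.v 52 = 2 ^ j * B
  v54 : σ.v 54 = mp + (a - j)
  mem : σ.m = m₀

theorem undo_lt {q a : ℕ} {k s : ℕ → ℕ} (hs : ∀ i, s i < 2 ^ q) (j i : ℕ) :
    undo a k s j i < 2 ^ q := by
  induction j generalizing i with
  | zero => exact hs i
  | succ j ih => exact ih _

/-- A stage is an involution, so the same delta swap with the stored mask undoes it. The masks are
consumed from the last to the first while the distance doubles. -/
theorem unstageLoop_spec {w B q K a c mp : ℕ} (F : Fits w B q K) (hK : K = 2 ^ a * c)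
    (hmp : mp + a ≤ 2 ^ w) {k s : ℕ → ℕ} (hs : ∀ i, s i < 2 ^ q) {σ : St}
    (hm : ∀ i < a, σ.m (mp + i) = maskOf B K q (cmpC (2 ^ (a - 1 - i)) (ks a k i)))
    (h : UnstageInv w B q K a mp k s σ.m 0 σ) :
    Tr w unstageLoop σ (50 * (a + 1)) (fun σ' => σ'.v 51 = pack B K (s ∘ netInv a k a) ∧
      σ'.v 54 = mp) := by
  have hB := F.B_pos
  have hqB := F.q_add
  have hc : 0 < c := by
    rcases Nat.eq_zero_or_pos c with h | h
    · have := F.pos; rw [hK, h] at this; omega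
    · exact h
  have hle : ∀ j ≤ a, 2 ^ j * B ≤ w + 1 := fun j hj => by
    refine le_trans (Nat.mul_le_mul_right _ ?_) F.le
    rw [hK]
    calc 2 ^ j ≤ 2 ^ a * 1 := by
          rw [mul_one]; exact Nat.pow_le_pow_right (by omega) (by omega)
      _ ≤ 2 ^ a * c := Nat.mul_le_mul_left _ hc
  refine Tr.le (Tr.imp
    (Tr.loop_count (UnstageInv w B q K a mp k s σ.m) a 40 h ?_ ?_) ?_) ?_
  · intro j hj σ h
    refine ⟨by simp, by simp, ?_, ?_, ?_⟩
    · simpa [h.v52] using F.lt_pow (hle j hj)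
    · simpa [h.v58] using F.lt_pow (hle a le_rfl)
    · simp only [eval_var, h.v58, h.v52]
      rw [Nat.mul_lt_mul_right hB, Nat.pow_lt_pow_iff_right (by omega)]
  · intro j hj σ' h'
    have hK' : K = 2 * 2 ^ j * (2 ^ (a - 1 - j) * c) := by
      rw [hK, ← mul_assoc]
      congr 1
      rw [← pow_succ', ← pow_add]
      congr 1
      omega
    have hD := F.lt_pow (hle j hj.le)
    have hul : ∀ i, undo a k s j i < 2 ^ q := undo_lt hs j
    have hw := F.pack_lt_q hul
    apply Tr.le
    case h =>
      unfold unstageBody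
      apply Tr.set (x := mp + (a - (j + 1)))
      · simp [h'.v54]; omega
      · simp [h'.v54]; omega
      apply Tr.set (x := maskOf B K q (cmpC (2 ^ j) (ks a k (a - (j + 1)))))
      · simp; omega
      · simp only [eval_load, eval_var, St.set_v, if_true, St.set_m, h'.mem]
        rw [hm _ (by omega), show a - 1 - (a - (j + 1)) = j by omega]
      apply Tr.set
      · simp [h'.v51, h'.v52, hw, hD]
      · rfl
      apply Tr.set (x := pack B K (undo a k s (j + 1)))
      · simp [h'.v52, hD]
      · simp [h'.v51, h'.v52]
        rw [undo, show a - 1 - j = a - (j + 1) by omega]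
        exact delta_swap hB (show q ≤ B by omega) (Nat.two_pow_pos j) hK' (fun i _ => hul i) _
          (cmpC_even _ _) rfl
      apply Tr.set (x := 2 ^ (j + 1) * B)
      · simp
      · simp [h'.v52, pow_succ]; ring
      apply Tr.skip
      constructor
      · simp [h'.v58]
      · simp
      · simp
      · simp
      · simp [h'.mem]
    case ht => simp
  · intro σ' h'
    have := undo_comp_netInv a k s a le_rfl
    simp only [Nat.sub_self, netInv, Function.comp_id] at this
    exact ⟨by rw [h'.v51, this], by simpa using h'.v54⟩
  · simp; omega

/-! ### Reversing the lanes -/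

/-- Reverse the lanes of the word `50` and change their width; block sizes in `52` (target)
and `55` (source). -/
def revBody : Stmt :=
  .set 52 (var 52 >>> 1) ;;
  .set 55 (var 55 >>> 1) ;;
  .set 56 (var 53 * ((1 <<< var 55) - 1)) ;;
  .set 50 (((var 50 &&& var 56) <<< var 52) + ((var 50 >>> var 55) &&& var 56)) ;;
  .set 53 (var 53 + (var 53 <<< var 52)) ;;
  .skip

def revLoop : Stmt := .loop (var 6) (var 52) revBody

/-- The word after the blocks of length `2 ^ b` have been reversed; `2 ^ n` lanes. -/
def revWord (A B n b : ℕ) (x : ℕ → ℕ) : ℕ :=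
  pack (2 ^ b * B) (2 ^ (n - b))
    (fun h => pack A (2 ^ b) (fun l => x ((2 ^ (n - b) - 1 - h) * 2 ^ b + l)))

/-- Each block of 2^(b+1) fields of width A is cut in two: the lower half moves up to stride 2^b · B
and the upper half moves down. Repeated down to single fields, this reverses the order and widens
the fields from A to B bits in the same pass. -/
theorem revWord_step {A B n b : ℕ} {x : ℕ → ℕ} (hA : 0 < A) (hAB : A ≤ B) (hb : b < n)
    (hx : ∀ i, x i < 2 ^ A) {m : ℕ}
    (hm : m = pack (2 ^ (b + 1) * B) (2 ^ (n - (b + 1))) (fun _ => 1) * (2 ^ (2 ^ b * A) - 1)) :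
    (revWord A B n (b + 1) x &&& m) * 2 ^ (2 ^ b * B) +
      ((revWord A B n (b + 1) x / 2 ^ (2 ^ b * A)) &&& m) = revWord A B n b x := by
  obtain ⟨e, rfl⟩ : ∃ e, n = b + (e + 1) := ⟨n - b - 1, by omega⟩
  have e1 : b + (e + 1) - (b + 1) = e := by omega
  have e2 : b + (e + 1) - b = e + 1 := by omega
  have hP : 0 < 2 ^ b := Nat.two_pow_pos b
  simp only [revWord, e1, e2] at hm ⊢
  have hAB' : 2 ^ b * A ≤ 2 ^ b * B := Nat.mul_le_mul_left _ hAB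
  have hBp : 0 < 2 ^ b * B := by have := hA.trans_le hAB; positivity
  have hW : 2 ^ (b + 1) * B = 2 * (2 ^ b * B) := by rw [pow_succ]; ring
  rw [hW] at hm ⊢
  rw [pack_mul_const] at hm
  simp only [one_mul] at hm
  set Y : ℕ → ℕ := fun h => pack A (2 ^ (b + 1)) (fun l => x ((2 ^ e - 1 - h) * 2 ^ (b + 1) + l))
    with hY
  have hYsplit : ∀ h, Y h = pack A (2 ^ b) (fun l => x ((2 ^ e - 1 - h) * 2 ^ (b + 1) + l)) +
      pack A (2 ^ b) (fun l => x ((2 ^ e - 1 - h) * 2 ^ (b + 1) + (2 ^ b + l))) *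
        2 ^ (2 ^ b * A) := fun h => by
    rw [hY]
    simp only
    rw [show 2 ^ (b + 1) = 2 ^ b + 2 ^ b by rw [pow_succ]; ring, pack_append, mul_comm A]
  have hlo : ∀ z : ℕ → ℕ, (∀ i, z i < 2 ^ A) → pack A (2 ^ b) z < 2 ^ (2 ^ b * A) := fun z hz => by
    rw [mul_comm]; exact pack_lt fun i _ => hz i
  have hYlt : ∀ h, Y h < 2 ^ (2 * (2 ^ b * B)) := fun h => by
    refine (pack_lt fun i _ => hx _).trans_le (Nat.pow_le_pow_right (by omega) ?_)
    rw [pow_succ, mul_comm A]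
    linarith
  have a1 := pack_shr_and (s := 0) (s' := 2 ^ b * A) (W := 2 * (2 ^ b * B)) (c := 2 ^ e)
    (Y := Y) (by omega) (by omega) fun h _ => hYlt h
  have a2 := pack_shr_and (s := 2 ^ b * A) (s' := 2 ^ b * A) (W := 2 * (2 ^ b * B)) (c := 2 ^ e)
    (Y := Y) (by omega) (by omega) fun h _ => hYlt h
  rw [pow_zero, Nat.div_one, ← hm] at a1
  rw [← hm] at a2
  rw [a1, a2, pack_mul_const, pack_add, pow_succ', pack_regroup, mul_comm (2 ^ b * B) 2]
  refine pack_congr fun h hh => ?_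
  rw [hYsplit h]
  simp only [Nat.div_one, Nat.add_mul_mod_self_right,
    Nat.mod_eq_of_lt (hlo _ fun i => hx _)]
  rw [Nat.add_mul_div_right _ _ (by positivity), Nat.div_eq_of_lt (hlo _ fun i => hx _), zero_add,
    Nat.mod_eq_of_lt (hlo _ fun i => hx _)]
  simp only [pack, sum_range_succ, range_zero, sum_empty, mul_zero, pow_zero, mul_one, zero_add,
    add_zero]
  rw [add_comm]
  have f1 : (2 ^ e - 1 - h) * 2 ^ (b + 1) = 2 * (2 ^ e - 1 - h) * 2 ^ b := by rw [pow_succ]; ring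
  have f2 : 2 * 2 ^ e - 1 - h * 2 = 2 * (2 ^ e - 1 - h) + 1 := by omega
  have f3 : 2 * 2 ^ e - 1 - (h * 2 + 1) = 2 * (2 ^ e - 1 - h) := by omega
  rw [f1, f2, f3]
  simp only [add_mul, one_mul, add_assoc]

theorem revWord_lt {A B n b c w : ℕ} {x : ℕ → ℕ} (hc : c ≤ A) (hcB : c + 1 ≤ B) (hAB : A ≤ B)
    (hb : b ≤ n) (hx : ∀ i, x i < 2 ^ c) (hw : 2 ^ n * B ≤ w + 1) : revWord A B n b x < 2 ^ w := by
  have hP : 0 < 2 ^ b := Nat.two_pow_pos b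
  have h1 : A * (2 ^ b - 1) + c + 1 ≤ 2 ^ b * B := by
    obtain ⟨p, hp⟩ := Nat.exists_eq_succ_of_ne_zero hP.ne'
    rw [hp, Nat.succ_mul]
    simp only [Nat.succ_eq_add_one, Nat.add_sub_cancel]
    have := Nat.mul_le_mul_left p hAB
    rw [mul_comm A]
    omega
  refine (pack_lt' (q := A * (2 ^ b - 1) + c) (by omega) (Nat.two_pow_pos _) fun h _ =>
    pack_lt' hc hP fun i _ => hx _).trans_le (Nat.pow_le_pow_right (by omega) ?_)
  have h2 : 2 ^ b * B * (2 ^ (n - b) - 1) + 2 ^ b * B = 2 ^ n * B := by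
    have : 2 ^ n = 2 ^ b * 2 ^ (n - b) := by rw [← pow_add]; congr 1; omega
    rw [this]
    obtain ⟨p, hp⟩ := Nat.exists_eq_succ_of_ne_zero (Nat.two_pow_pos (n - b)).ne'
    rw [hp]
    simp only [Nat.succ_eq_add_one, Nat.add_sub_cancel]
    ring
  omega

structure RevInv (w A B n : ℕ) (x : ℕ → ℕ) (j : ℕ) (σ : St) : Prop where
  v6 : σ.v 6 = B
  v50 : σ.v 50 = revWord A B n (n - j) x
  v52 : σ.v 52 = 2 ^ (n - j) * B
  v55 : σ.v 55 = 2 ^ (n - j) * A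
  v53 : σ.v 53 = pack (2 ^ (n - j) * B) (2 ^ j) (fun _ => 1)

/-- With A = B this is a plain reversal, used in merging. With A = 2f + 1 and B = 2f + 2 it spreads
the packed fields of G over the lanes as well. -/
theorem revLoop_spec {w A B n c : ℕ} {x : ℕ → ℕ} (hA : 0 < A) (hc : c ≤ A) (hcB : c + 1 ≤ B)
    (hAB : A ≤ B) (hx : ∀ i, x i < 2 ^ c) (hw : 2 ^ n * B ≤ w + 1) (h2 : 2 ≤ w) {σ : St}
    (h6 : σ.v 6 = B) (h50 : σ.v 50 = pack A (2 ^ n) x) (h52 : σ.v 52 = 2 ^ n * B)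
    (h55 : σ.v 55 = 2 ^ n * A) (h53 : σ.v 53 = 1) :
    Tr w revLoop σ (50 * (n + 1))
      (fun σ' => σ'.v 50 = pack B (2 ^ n) (fun i => x (2 ^ n - 1 - i))) := by
  have hB : 0 < B := by omega
  have hle : ∀ j ≤ n, 2 ^ j * B ≤ w + 1 := fun j hj =>
    (Nat.mul_le_mul_right _ (Nat.pow_le_pow_right (by omega) hj)).trans hw
  have hlt : ∀ j ≤ n, 2 ^ j * B < 2 ^ w := fun j hj => (hle j hj).trans_lt (succ_lt_two_pow h2)
  have hltA : ∀ j ≤ n, 2 ^ j * A < 2 ^ w := fun j hj =>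
    (Nat.mul_le_mul_left _ hAB).trans_lt (hlt j hj)
  have h1w : 1 < 2 ^ w := (show 1 ≤ w + 1 by omega).trans_lt (succ_lt_two_pow h2)
  refine Tr.le (Tr.imp
    (Tr.loop_count (RevInv w A B n x) n 40 ?_ ?_ ?_) ?_) ?_
  · exact ⟨h6, by simp [h50, revWord], by simp [h52], by simp [h55], by simp [h53]⟩
  · intro j hj σ h
    refine ⟨by simp, by simp, ?_, ?_, ?_⟩
    · simpa [h.v6] using hlt 0 (by omega)
    · simpa [h.v52] using hlt (n - j) (by omega)
    · simp only [eval_var, h.v6, h.v52]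
      constructor
      · intro h3
        by_contra h4
        rw [show n - j = 0 by omega] at h3
        simp at h3
      · intro h3
        obtain ⟨e, he⟩ : ∃ e, n - j = e + 1 := ⟨n - j - 1, by omega⟩
        rw [he, pow_succ]
        nlinarith [Nat.one_le_two_pow (n := e)]
  · intro j hj σ h
    obtain ⟨e, he⟩ : ∃ e, n = j + (e + 1) := ⟨n - j - 1, by omega⟩
    have e1 : n - j = e + 1 := by omega
    have e2 : n - (j + 1) = e := by omega
    have e3 : n - (e + 1) = j := by omega
    have v50 := h.v50
    have v52 := h.v52
    have v53 := h.v53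
    have v55 := h.v55
    rw [e1] at v50 v52 v53 v55
    have hrw := revWord_lt (b := e + 1) hc hcB hAB (by omega) hx hw
    have hstep := revWord_step (b := e) (n := n) hA hAB (by omega)
      (fun i => lt_of_le_pow (hx i) hc) rfl
    rw [e3] at hstep
    apply Tr.le
    case h =>
      unfold revBody
      apply Tr.set (x := 2 ^ e * B)
      · simp [v52, hlt (e + 1) (by omega), h1w]
      · simp only [eval_shr, eval_var, v52, eval_lit, pow_succ', mul_assoc]
        exact Nat.mul_div_cancel_left _ (by omega)
      apply Tr.set (x := 2 ^ e * A)
      · simp [v55, hltA (e + 1) (by omega), h1w]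
      · simp only [eval_shr, eval_var, St.set_v, Nat.reduceEqDiff, if_false, v55, eval_lit,
          pow_succ', mul_assoc]
        exact Nat.mul_div_cancel_left _ (by omega)
      apply Tr.set (x := pack (2 ^ (e + 1) * B) (2 ^ j) (fun _ => 1) * (2 ^ (2 ^ e * A) - 1))
      · simp [hltA e (by omega), Nat.one_le_two_pow]
      · simp [v53]
      apply Tr.set (x := revWord A B n e x)
      · simp [v50, hrw, hlt e (by omega), hltA e (by omega)]
      · simp [v50, hstep]
      apply Tr.set (x := pack (2 ^ e * B) (2 ^ (j + 1)) (fun _ => 1))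
      · simp [hlt e (by omega)]
      · simp [v53]
        rw [pow_succ', mul_assoc, units_double]
        rw [pow_succ']
      apply Tr.skip
      constructor
      · simp [h.v6]
      · simp [e2]
      · simp [e2]
      · simp [e2]
      · simp [e2]
    case ht => simp
  · intro σ' h'
    rw [h'.v50, Nat.sub_self, revWord]
    simp
  · simp; omega

end PackedMap

/-! ## Merging and sorting words -/

namespace PackedMap

open Finset Stmt
open PackedMap.Expr (var load)

/-- The constants that the word procedures use: lane width, data bits, width of all lanes,
address of the scratch area, guard bits. -/
structure Glob (B q n sc : ℕ) (σ : St) : Prop where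
  v6 : σ.v 6 = B
  v7 : σ.v 7 = q
  v8 : σ.v 8 = 2 ^ n * B
  v9 : σ.v 9 = sc
  v16 : σ.v 16 = pack B (2 ^ n) (fun _ => 2 ^ q)

theorem Glob.of_eq {B q n sc : ℕ} {σ σ' : St} (h : Glob B q n sc σ)
    (he : ∀ i < 20, σ'.v i = σ.v i) : Glob B q n sc σ' :=
  ⟨(he 6 (by omega)).trans h.v6, (he 7 (by omega)).trans h.v7, (he 8 (by omega)).trans h.v8,
    (he 9 (by omega)).trans h.v9, (he 16 (by omega)).trans h.v16⟩

/-- Reverse the lanes of the word in the variable `a`. -/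
def revVar (a : ℕ) : Stmt :=
  .set 50 (var a) ;; .set 52 (var 8) ;; .set 55 (var 8) ;; .set 53 1 ;;
  revLoop ;; .set a (var 50) ;; .skip

theorem revLoop_keeps : revLoop.keeps 50 = true := by decide

theorem revLoop_pure : revLoop.pure = true := by decide

theorem stageLoop_keeps : stageLoop.keeps 50 = true := by decide

theorem revVar_spec {w B q n sc a : ℕ} (F : Fits w B q (2 ^ n)) {σ : St}
    (h : Glob B q n sc σ) {x : ℕ → ℕ} (hx : ∀ i, x i < 2 ^ q) (hv : σ.v a = pack B (2 ^ n) x) :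
    Tr w (revVar a) σ (70 * (n + 1)) (fun σ' => σ'.v a = pack B (2 ^ n) (fun i => x (2 ^ n - 1 - i)) ∧
      (∀ i < 50, i ≠ a → σ'.v i = σ.v i) ∧ σ'.m = σ.m) := by
  have hq := F.q_add
  apply Tr.le
  case h =>
    unfold revVar
    apply Tr.set (x := pack B (2 ^ n) x)
    · simp
    · simp [hv]
    apply Tr.set (x := 2 ^ n * B)
    · simp
    · simp [h.v8]
    apply Tr.set (x := 2 ^ n * B)
    · simp
    · simp [h.v8]
    apply Tr.set (x := 1)
    · simp
    · simp
    apply Tr.seq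
    · exact Tr.frameMem (Tr.frame 50 (revLoop_spec (A := B) (c := q) F.B_pos (by omega) (by omega)
        le_rfl hx F.le F.w_big (by simp [h.v6]) (by simp) (by simp) (by simp) (by simp))
        revLoop_keeps) revLoop_pure
    rintro σ' ⟨⟨h1, h2⟩, h3⟩
    apply Tr.set (x := pack B (2 ^ n) (fun i => x (2 ^ n - 1 - i)))
    · simp
    · simpa using h1
    apply Tr.skip
    refine ⟨by simp, fun i hi hia => ?_, by simp [h3]⟩
    simp only [St.set_v, if_neg hia, h2 i hi]
    simp [show i ≠ 50 by omega, show i ≠ 52 by omega, show i ≠ 53 by omega, show i ≠ 55 by omega]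
  case ht => simp; omega

/-- Run the network with first distance half the width in `52`, and with `53` units, on the words
in the variables `a` (keys) and `b` (payloads); the address for the masks is in `d`. -/
def netVar (a b d : ℕ) : Stmt :=
  .set 50 (var a) ;; .set 51 (var b) ;; .set 54 (var d) ;;
  stageLoop ;; .set a (var 50) ;; .set b (var 51) ;; .skip

/-- With l < n the network runs in all c aligned blocks of 2^l lanes at the same time, which is what
sorting a word needs; merging uses l = n. -/
theorem netVar_spec {w B q n sc sc' a b d l c : ℕ} (F : Fits w B q (2 ^ n)) (ha : a < 50) (hb : b < 50)
    (hd : d < 50) (hab : a ≠ b) (hn : 2 ^ n = 2 ^ l * c) (hsc : sc' + n ≤ 2 ^ w) {σ : St}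
    (h : Glob B q n sc σ) {k x : ℕ → ℕ} (hk : ∀ i, k i < 2 ^ q) (hx : ∀ i, x i < 2 ^ q)
    (hva : σ.v a = pack B (2 ^ n) k) (hvb : σ.v b = pack B (2 ^ n) x)
    (h52 : σ.v 52 = 2 ^ l * B) (h53 : σ.v 53 = pack (2 ^ l * B) c (fun _ => 1))
    (hvd : σ.v d = sc') :
    Tr w (netVar a b d) σ (120 * (l + 1)) (fun σ' =>
      σ'.v a = pack B (2 ^ n) (ks l k l) ∧ σ'.v b = pack B (2 ^ n) (x ∘ netPerm l k l) ∧
      (∀ i < 50, i ≠ a → i ≠ b → σ'.v i = σ.v i) ∧ (∀ i < sc', σ'.m i = σ.m i) ∧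
      σ'.v 54 = sc' + l ∧ ∀ i < l, σ'.m (sc' + i) = maskOf B (2 ^ n) q (cmpC (2 ^ (l - 1 - i)) (ks l k i))) := by
  have hl : l ≤ n := by
    by_contra hln
    have : 2 ^ n < 2 ^ l := Nat.pow_lt_pow_right (by omega) (by omega)
    rcases Nat.eq_zero_or_pos c with h | h
    · have := Nat.two_pow_pos n; rw [hn, h] at this; omega
    · nlinarith [Nat.two_pow_pos l]
  apply Tr.le
  case h =>
    unfold netVar
    apply Tr.set (x := pack B (2 ^ n) k)
    · simp
    · simp [hva]
    apply Tr.set (x := pack B (2 ^ n) x)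
    · simp
    · simp [hvb, show b ≠ 50 by omega]
    apply Tr.set (x := sc')
    · simp
    · simp [hvd, show d ≠ 50 by omega, show d ≠ 51 by omega]
    apply Tr.seq
    · exact Tr.frame 50 (stageLoop_spec (mp := sc') (c := c) F hn (by omega) hk hx
        ⟨by simp [h.v6], by simp [h.v7], by simp [h.v16], by simp [ks], by simp [netPerm],
          by simp [h52], by simp [h53], by simp, by simp, by simp⟩) stageLoop_keeps
    rintro σ' ⟨h1, h2⟩
    apply Tr.set (x := pack B (2 ^ n) (ks l k l))
    · simp
    · simpa using h1.v50
    apply Tr.set (x := pack B (2 ^ n) (x ∘ netPerm l k l))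
    · simp
    · simpa [show 51 ≠ a by omega] using h1.v51
    apply Tr.skip
    refine ⟨by simp [hab], by simp, fun i hi hia hib => ?_, fun i hi => ?_, ?_, fun i hi => ?_⟩
    · simp only [St.set_v, if_neg hia, if_neg hib, h2 i hi]
      simp [show i ≠ 50 by omega, show i ≠ 51 by omega, show i ≠ 54 by omega]
    · simpa using h1.mem i (by omega)
    · simpa [show 54 ≠ a by omega, show 54 ≠ b by omega] using h1.v54
    · simpa using h1.masks i hi
  case ht => simp; omega

/-- The words `kw` and `pw` hold the keys and the payloads of the records in `S`. -/
def Block (B q n kw pw : ℕ) (S : Multiset (ℕ × ℕ)) : Prop :=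
  ∃ k x : ℕ → ℕ, (∀ i, k i < 2 ^ q) ∧ (∀ i, x i < 2 ^ q) ∧ kw = pack B (2 ^ n) k ∧
    pw = pack B (2 ^ n) x ∧ S = recs (fun i => (k i, x i)) 0 (2 ^ n)

/-- The records are moreover sorted by their keys. -/
def SortedBlock (B q n kw pw : ℕ) (S : Multiset (ℕ × ℕ)) : Prop :=
  ∃ k x : ℕ → ℕ, (∀ i, k i < 2 ^ q) ∧ (∀ i, x i < 2 ^ q) ∧ kw = pack B (2 ^ n) k ∧
    pw = pack B (2 ^ n) x ∧ S = recs (fun i => (k i, x i)) 0 (2 ^ n) ∧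
    ∀ i j, i < j → j < 2 ^ n → k i ≤ k j

/-- All keys in `S` are at most the keys in `T`. -/
def KeyLe (S T : Multiset (ℕ × ℕ)) : Prop := ∀ a ∈ S, ∀ b ∈ T, a.1 ≤ b.1

/-- From sorted words in `40`, `41` and `42`, `43` produce the word with the smaller records in
`44`, `45` and the word with the larger records in `40`, `41`. -/
def mergeWords : Stmt :=
  revVar 42 ;; revVar 43 ;;
  .set 46 (((var 40 + var 16) - var 42) &&& var 16) ;;
  .set 46 (var 46 - (var 46 >>> var 7)) ;;
  .set 47 ((var 40 ^^^ var 42) &&& var 46) ;;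
  .set 44 (var 40 ^^^ var 47) ;;
  .set 40 (var 42 ^^^ var 47) ;;
  .set 47 ((var 41 ^^^ var 43) &&& var 46) ;;
  .set 45 (var 41 ^^^ var 47) ;;
  .set 41 (var 43 ^^^ var 47) ;;
  .set 52 (var 8) ;; .set 53 1 ;; netVar 44 45 9 ;;
  .set 52 (var 8) ;; .set 53 1 ;; netVar 40 41 9 ;; .skip

theorem mergeWords_keeps : mergeWords.keeps 40 = true := by decide

/-- The comparison of all lanes of two words. -/
theorem cross_masks {w B q K : ℕ} (F : Fits w B q K) {x y : ℕ → ℕ} (hx : ∀ i, x i < 2 ^ q)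
    (hy : ∀ i, y i < 2 ^ q) {ge : ℕ}
    (hge : ge = (pack B K x + pack B K (fun _ => 2 ^ q) - pack B K y) &&& pack B K (fun _ => 2 ^ q)) :
    pack B K y ≤ pack B K x + pack B K (fun _ => 2 ^ q) ∧ ge / 2 ^ q ≤ ge ∧ ge < 2 ^ w ∧
      ge - ge / 2 ^ q = maskOf B K q (fun i => y i ≤ x i) := by
  have hq := F.q_add
  obtain ⟨h1, h2, -, h4⟩ := compare_lanes (B := B) (K := K) (by omega) (fun _ => True)
    (fun i _ => hx i) (fun i _ => hy i) (by simp) (by simp) (Gm := pack B K (fun _ => 2 ^ q))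
    (by simp) hge
  refine ⟨h1, h2, ?_, by simpa using h4⟩
  rw [hge]
  exact and_lt_right (F.pack_lt fun i => Nat.pow_lt_pow_right (by omega) (by omega))

/-- After the reversal of the second word, one comparison across the words separates the smaller
from the larger records; each word is then bitonic, and a network of n stages sorts it. -/
theorem mergeWords_spec {w B q n sc : ℕ} (F : Fits w B q (2 ^ n)) (hsc : sc + n ≤ 2 ^ w) {σ : St}
    (h : Glob B q n sc σ) {S T : Multiset (ℕ × ℕ)}
    (hS : SortedBlock B q n (σ.v 40) (σ.v 41) S) (hT : SortedBlock B q n (σ.v 42) (σ.v 43) T) :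
    Tr w mergeWords σ (500 * (n + 1)) (fun σ' => (∃ S' T', S' + T' = S + T ∧ KeyLe S' T' ∧
      SortedBlock B q n (σ'.v 44) (σ'.v 45) S' ∧ SortedBlock B q n (σ'.v 40) (σ'.v 41) T') ∧
      ∀ i < sc, σ'.m i = σ.m i) := by
  have hB := F.B_pos
  have hqB := F.q_add
  obtain ⟨k, x, hk, hx, hkw, hxw, rfl, hks⟩ := hS
  obtain ⟨k', x', hk', hx', hkw', hxw', rfl, hks'⟩ := hT
  set kr := fun i => k' (2 ^ n - 1 - i)
  set xr := fun i => x' (2 ^ n - 1 - i)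
  have hqw : q < 2 ^ w := F.lt_pow (by
    have := F.le
    have h1 : 1 * B ≤ 2 ^ n * B := Nat.mul_le_mul_right _ Nat.one_le_two_pow
    omega)
  obtain ⟨c1, c2, c3, c4⟩ := cross_masks F hk (fun i => hk' (2 ^ n - 1 - i)) rfl
  obtain ⟨ck1, ck2⟩ := cross_swap hB (show q ≤ B by omega) (K := 2 ^ n) (fun i _ => hk i)
    (fun i _ => hk' (2 ^ n - 1 - i)) (fun i => k' (2 ^ n - 1 - i) ≤ k i) rfl
  obtain ⟨cx1, cx2⟩ := cross_swap hB (show q ≤ B by omega) (K := 2 ^ n) (fun i _ => hx i)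
    (fun i _ => hx' (2 ^ n - 1 - i)) (fun i => k' (2 ^ n - 1 - i) ≤ k i) rfl
  -- The mask prescribes an exchange where the reversed key is at most k i, so the exchanged words
  -- hold the minima and the maxima.
  have elo : (fun i => if k' (2 ^ n - 1 - i) ≤ k i then k' (2 ^ n - 1 - i) else k i) =
      loKey n k k' := by
    funext i; simp only [loKey]; split_ifs <;> omega
  have ehi : (fun i => if k' (2 ^ n - 1 - i) ≤ k i then k i else k' (2 ^ n - 1 - i)) =
      hiKey n k k' := by
    funext i; simp only [hiKey]; split_ifs <;> omega
  rw [elo] at ck1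
  rw [ehi] at ck2
  set xl := fun i => if k' (2 ^ n - 1 - i) ≤ k i then x' (2 ^ n - 1 - i) else x i with hxl
  set xh := fun i => if k' (2 ^ n - 1 - i) ≤ k i then x i else x' (2 ^ n - 1 - i) with hxh
  have blo : ∀ i, loKey n k k' i < 2 ^ q := fun i => min_lt_of_left_lt (hk i)
  have bhi : ∀ i, hiKey n k k' i < 2 ^ q := fun i => max_lt (hk i) (hk' _)
  have bxl : ∀ i, xl i < 2 ^ q := fun i => by
    simp only [hxl]; split_ifs; exacts [hx' _, hx i]
  have bxh : ∀ i, xh i < 2 ^ q := fun i => by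
    simp only [hxh]; split_ifs; exacts [hx i, hx' _]
  obtain ⟨s1, s2, s3⟩ := merge_sorted hks hks'
  apply Tr.le
  case h =>
    unfold mergeWords
    apply Tr.seq
    · exact revVar_spec F h hk' hkw'
    rintro σ1 ⟨a1, a2, a3⟩
    have g1 : Glob B q n sc σ1 := h.of_eq fun i hi => a2 i (by omega) (by omega)
    apply Tr.seq
    · exact revVar_spec (a := 43) F g1 hx' (by rw [a2 43 (by omega) (by omega), hxw'])
    rintro σ2 ⟨b1, b2, b3⟩
    have g2 : Glob B q n sc σ2 := g1.of_eq fun i hi => b2 i (by omega) (by omega)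
    have v40 : σ2.v 40 = pack B (2 ^ n) k := by
      rw [b2 _ (by omega) (by omega), a2 _ (by omega) (by omega), hkw]
    have v41 : σ2.v 41 = pack B (2 ^ n) x := by
      rw [b2 _ (by omega) (by omega), a2 _ (by omega) (by omega), hxw]
    have v42 : σ2.v 42 = pack B (2 ^ n) kr := by
      rw [b2 _ (by omega) (by omega), a1]
    apply Tr.set
    · simpa [v40, v42, g2.v16] using c1
    · simp only [eval_and, eval_sub, eval_add, eval_var, v40, v42, g2.v16]
      rfl
    apply Tr.set (x := maskOf B (2 ^ n) q (fun i => kr i ≤ k i))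
    · simpa [g2.v7, hqw] using ⟨c3, c2⟩
    · simpa [g2.v7] using c4
    apply Tr.set
    · simp
    · simp [v40, v42]
      rfl
    apply Tr.set (x := pack B (2 ^ n) (loKey n k k'))
    · simp
    · simp [v40, ← ck1, kr]
    apply Tr.set (x := pack B (2 ^ n) (hiKey n k k'))
    · simp
    · simp [v42, ← ck2, kr]
    apply Tr.set
    · simp
    · simp [v41, b1]
      rfl
    apply Tr.set (x := pack B (2 ^ n) xl)
    · simp
    · simp [v41, ← cx1, kr]
    apply Tr.set (x := pack B (2 ^ n) xh)
    · simp
    · simp [b1, ← cx2, kr]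
    apply Tr.set (x := 2 ^ n * B)
    · simp
    · simp [g2.v8]
    apply Tr.set (x := 1)
    · simp
    · simp
    apply Tr.seq
    · exact netVar_spec (a := 44) (b := 45) (l := n) (c := 1) (d := 9) (sc := sc) F (by omega) (by omega)
        (by omega) (by omega) (by simp) hsc
        ⟨by simp [g2.v6], by simp [g2.v7], by simp [g2.v8], by simp [g2.v9], by simp [g2.v16]⟩
        blo bxl (by simp) (by simp) (by simp) (by simp) (by simp [g2.v9])
    rintro σ3 ⟨d1, d2, d3, d4, -⟩
    apply Tr.set (x := 2 ^ n * B)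
    · simp
    · rw [eval_var, d3 _ (by omega) (by omega) (by omega)]
      simp [g2.v8]
    apply Tr.set (x := 1)
    · simp
    · simp
    apply Tr.seq
    · refine netVar_spec (a := 40) (b := 41) (d := 9) (sc := sc) (l := n) (c := 1) (k := hiKey n k k')
        (x := xh) F (by omega) (by omega) (by omega)
        (by omega) (by simp) hsc ⟨?_, ?_, ?_, ?_, ?_⟩ bhi bxh ?_ ?_ (by simp) (by simp) ?_ <;>
      · simp [d3, g2.v6, g2.v7, g2.v8, g2.v9, g2.v16]
    rintro σ4 ⟨e1, e2, e3, e4, -⟩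
    apply Tr.skip
    refine ⟨⟨_, _, ?_, ?_,
      ⟨ks n (loKey n k k') n, xl ∘ netPerm n (loKey n k k') n, fun i => ks_lt blo _ _,
        fun i => bxl _, ?_, ?_, rfl, s1⟩,
      ⟨ks n (hiKey n k k') n, xh ∘ netPerm n (hiKey n k k') n, fun i => ks_lt bhi _ _,
        fun i => bxh _, e1, e2, rfl, s2⟩⟩, ?_⟩
    -- No record is lost: the two networks permute, the exchange across words preserves the joint
    -- multiset, and the reversal permutes.
    · have r1 := recs_netPerm (fun i => (loKey n k k' i, xl i)) n 1 (loKey n k k')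
      have r2 := recs_netPerm (fun i => (hiKey n k k' i, xh i)) n 1 (hiKey n k k')
      have r3 := recs_cross (fun i => (k i, x i)) (fun i => (kr i, xr i))
        (fun i => kr i ≤ k i) (2 ^ n)
      have r4 := recs_reverse (fun i => (k' i, x' i)) (2 ^ n)
      rw [mul_one] at r1 r2
      rw [ks_eq, ks_eq]
      refine (congrArg₂ (· + ·) r1 r2).trans ?_
      rw [← r4]
      refine Eq.trans (congrArg₂ (· + ·) ?_ ?_) r3
      · refine recs_congr fun t _ => ?_
        simp only [← elo, hxl, kr, xr]
        split_ifs <;> rfl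
      · refine recs_congr fun t _ => ?_
        simp only [← ehi, hxh, kr, xr]
        split_ifs <;> rfl
    · intro a ha b hb
      obtain ⟨i, hi, rfl⟩ := mem_recs.1 ha
      obtain ⟨j, hj, rfl⟩ := mem_recs.1 hb
      simpa using s3 i hi j hj
    · rw [e3 _ (by omega) (by omega) (by omega)]
      simpa using d1
    · rw [e3 _ (by omega) (by omega) (by omega)]
      simpa using d2
    · intro i hi
      rw [e4 i hi]
      simp only [St.set_m]
      rw [d4 i hi]
      simp [a3, b3]
  case ht => simp; omega

end PackedMap

/-! ### Sorting the lanes of a word -/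

namespace PackedMap

open Finset Stmt
open PackedMap.Expr (var load)

theorem xor_two_pow_sub_one {x q : ℕ} (h : x < 2 ^ q) : x ^^^ (2 ^ q - 1) = 2 ^ q - 1 - x := by
  apply Nat.eq_of_testBit_eq
  intro i
  rw [Nat.testBit_xor, Nat.testBit_two_pow_sub_one, show 2 ^ q - 1 - x = 2 ^ q - (x + 1) by omega,
    Nat.testBit_two_pow_sub_succ h]
  by_cases hi : i < q
  · simp [hi]
  · have : x.testBit i = false := Nat.testBit_eq_false_of_lt
      (h.trans_le (Nat.pow_le_pow_right (by omega) (by omega)))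
    simp [hi, this]

/-- The data bits of the lanes in the blocks of length `2 ^ l` with odd number. -/
def dirMask (B K q l : ℕ) : ℕ := pack B K (fun i => if i / 2 ^ l % 2 = 1 then 2 ^ q - 1 else 0)

theorem dirMask_lane_lt {q B : ℕ} (hq : q ≤ B) (P : Prop) [Decidable P] :
    (if P then 2 ^ q - 1 else 0) < 2 ^ B := by
  have := Nat.pow_le_pow_right (n := 2) (by omega) hq
  have := Nat.two_pow_pos q
  split_ifs <;> omega

theorem pack_xor_dirMask {B K q l : ℕ} (hB : 0 < B) (hq : q ≤ B) {k : ℕ → ℕ}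
    (hk : ∀ i, k i < 2 ^ q) :
    pack B K k ^^^ dirMask B K q l = pack B K (flipKey (2 ^ q - 1) l k) := by
  rw [dirMask, pack_xor hB (fun i _ => lt_of_le_pow (hk i) hq) (fun i _ => dirMask_lane_lt hq _)]
  refine pack_congr fun i _ => ?_
  simp only [flipKey]
  split_ifs
  · exact xor_two_pow_sub_one (hk i)
  · simp

theorem dirMask_eq {B q l c : ℕ} (hB : 0 < B) (hq : q ≤ B) :
    pack B (2 * 2 ^ l * c) (fun _ => 2 ^ q - 1) ^^^ (pack B (2 * 2 ^ l * c) (fun _ => 2 ^ q - 1) &&&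
      (pack (2 * 2 ^ l * B) c (fun _ => 1) * (2 ^ (2 ^ l * B) - 1))) =
    dirMask B (2 * 2 ^ l * c) q l := by
  have h1 : ∀ _ : ℕ, 2 ^ q - 1 < 2 ^ B := fun _ => lt_of_le_pow (two_pow_sub_one_lt q) hq
  rw [lowMask_eq _ _ _ (Nat.two_pow_pos l), pack_and hB (fun i _ => h1 i)
    (fun i _ => dirMask_lane_lt le_rfl _), pack_xor hB (fun i _ => h1 i)
    (fun i _ => and_lt_left (h1 i)), dirMask]
  refine pack_congr fun i _ => ?_
  rcases Nat.mod_two_eq_zero_or_one (i / 2 ^ l) with h | h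
  · simp [h, and_two_pow_sub_one_of_lt (h1 i)]
  · simp [h]

/-- Compute in `46`, `47`, `48` the data for blocks of width `44`. -/
def dirBody : Stmt :=
  .set 46 (var 46 >>> 1) ;;
  .set 48 (var 45 ^^^ (var 45 &&& (var 47 * ((1 <<< var 46) - 1)))) ;;
  .set 47 (var 47 + (var 47 <<< var 46)) ;; .skip

def dirLoop : Stmt := .loop (var 44) (var 46) dirBody

theorem dirLoop_keeps : dirLoop.keeps 46 = true := by decide

theorem dirLoop_pure : dirLoop.pure = true := by decide

structure DirInv (B q n l j : ℕ) (σ : St) : Prop where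
  v44 : σ.v 44 = 2 ^ l * B
  v45 : σ.v 45 = pack B (2 ^ n) (fun _ => 2 ^ q - 1)
  v46 : σ.v 46 = 2 ^ (n - j) * B
  v47 : σ.v 47 = pack (2 ^ (n - j) * B) (2 ^ j) (fun _ => 1)
  v48 : σ.v 48 = dirMask B (2 ^ n) q (n - j)

theorem pow_mul_lt_iff {B l m : ℕ} (hB : 0 < B) : 2 ^ l * B < 2 ^ m * B ↔ l < m := by
  rw [Nat.mul_lt_mul_right hB, Nat.pow_lt_pow_iff_right (by omega)]

/-- The direction mask is recomputed on every level by halving from the full width. That costs O(n),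
no more than the network of the level. -/
theorem dirLoop_spec {w B q n l : ℕ} (F : Fits w B q (2 ^ n)) (hl : l ≤ n) {σ : St}
    (h : DirInv B q n l 0 σ) : Tr w dirLoop σ (30 * (n + 1)) (DirInv B q n l (n - l)) := by
  have hB := F.B_pos
  have hq := F.q_add
  have hlt : ∀ j ≤ n, 2 ^ j * B < 2 ^ w := fun j hj => F.lt_pow
    ((Nat.mul_le_mul_right _ (Nat.pow_le_pow_right (by omega) hj)).trans F.le)
  have h1w : 1 < 2 ^ w := F.lt_pow (by omega)
  refine Tr.le (Tr.loop_count (DirInv B q n l) (n - l) 26 h ?_ ?_) ?_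
  · intro j hj σ h
    refine ⟨by simp, by simp, by simpa [h.v44] using hlt l hl, by simpa [h.v46] using hlt _ (by omega),
      ?_⟩
    simp only [eval_var, h.v44, h.v46]
    rw [pow_mul_lt_iff hB]
    omega
  · intro j hj σ h
    obtain ⟨e, he⟩ : ∃ e, n = j + (e + 1) := ⟨n - j - 1, by omega⟩
    have e1 : n - j = e + 1 := by omega
    have e2 : n - (j + 1) = e := by omega
    have v46 := h.v46
    have v47 := h.v47
    rw [e1, pow_succ'] at v46 v47
    have hn : 2 ^ n = 2 * 2 ^ e * 2 ^ j := by rw [he, pow_add, pow_succ]; ring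
    apply Tr.le
    case h =>
      unfold dirBody
      apply Tr.set (x := 2 ^ e * B)
      · have := hlt (e + 1) (by omega)
        rw [pow_succ'] at this
        simp [v46, this, h1w]
      · simp only [eval_shr, eval_var, v46, eval_lit, mul_assoc, pow_one]
        exact Nat.mul_div_cancel_left _ (by omega)
      apply Tr.set (x := dirMask B (2 ^ n) q e)
      · simp [hlt e (by omega), Nat.one_le_two_pow]
      · simp only [eval_xor, eval_and, eval_mul, eval_sub, eval_shl, eval_var, eval_lit,
          St.set_v, if_true, Nat.reduceEqDiff, if_false, h.v45, v47, one_mul]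
        rw [hn]
        exact dirMask_eq hB (by omega)
      apply Tr.set (x := pack (2 ^ e * B) (2 ^ (j + 1)) (fun _ => 1))
      · simp [hlt e (by omega)]
      · simp [v47]
        rw [mul_assoc, units_double, pow_succ']
      apply Tr.skip
      constructor
      · simp [h.v44]
      · simp [h.v45]
      · simp [e2]
      · simp [e2]
      · simp [e2]
    case ht => simp
  · simp only [cost_var]
    have : (n - l) * 29 ≤ n * 29 := Nat.mul_le_mul_right _ (by omega)
    omega

def sortLevel : Stmt :=
  .set 44 (var 44 + var 44) ;; .set 46 (var 8) ;; .set 47 1 ;; .set 48 0 ;;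
  dirLoop ;;
  .set 40 (var 40 ^^^ var 48) ;; .set 52 (var 46) ;; .set 53 (var 47) ;;
  netVar 40 41 9 ;; .set 40 (var 40 ^^^ var 48) ;; .skip

/-- Sort the records with keys in `40` and payloads in `41`. -/
def sortWord : Stmt :=
  .set 44 (var 6) ;; .set 45 (var 16 - (var 16 >>> var 7)) ;; .loop (var 44) (var 8) sortLevel

theorem sortWord_keeps : sortWord.keeps 40 = true := by decide

structure SortInv (B q n sc : ℕ) (S : Multiset (ℕ × ℕ)) (σ₀ : St) (l : ℕ) (σ : St) : Prop where
  word : ∃ k x : ℕ → ℕ, (∀ i, k i < 2 ^ q) ∧ (∀ i, x i < 2 ^ q) ∧ σ.v 40 = pack B (2 ^ n) k ∧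
    σ.v 41 = pack B (2 ^ n) x ∧ S = recs (fun i => (k i, x i)) 0 (2 ^ n) ∧ DirSorted l k
  v44 : σ.v 44 = 2 ^ l * B
  v45 : σ.v 45 = pack B (2 ^ n) (fun _ => 2 ^ q - 1)
  glob : Glob B q n sc σ
  mem : ∀ i < sc, σ.m i = σ₀.m i

/-- Complement the keys of the odd blocks, run the network on all blocks, complement again. -/
theorem sortLevel_spec {w B q n sc l : ℕ} (F : Fits w B q (2 ^ n)) (hsc : sc + n ≤ 2 ^ w)
    (hl : l < n) {S : Multiset (ℕ × ℕ)} {σ₀ σ : St} (h : SortInv B q n sc S σ₀ l σ) :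
    Tr w sortLevel σ (200 * (n + 1)) (SortInv B q n sc S σ₀ (l + 1)) := by
  have hB := F.B_pos
  have hq := F.q_add
  obtain ⟨k, x, hk, hx, hkw, hxw, hS, hd⟩ := h.word
  have hfk : ∀ i, flipKey (2 ^ q - 1) (l + 1) k i < 2 ^ q := fun i => by
    have := hk i
    simp only [flipKey]; split_ifs <;> omega
  have hn : 2 ^ n = 2 ^ (l + 1) * 2 ^ (n - (l + 1)) := by rw [← pow_add]; congr 1; omega
  have g := h.glob
  apply Tr.le
  case h =>
    unfold sortLevel
    apply Tr.set (x := 2 ^ (l + 1) * B)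
    · simp
    · simp [h.v44, pow_succ]; ring
    apply Tr.set (x := 2 ^ n * B)
    · simp
    · simp [g.v8]
    apply Tr.set (x := 1)
    · simp
    · simp
    apply Tr.set (x := 0)
    · simp
    · simp
    apply Tr.seq
    · refine Tr.frameMem (Tr.frame 46 (dirLoop_spec (l := l + 1) F (by omega)
        ⟨by simp, by simp [h.v45], by simp, by simp, ?_⟩) dirLoop_keeps) dirLoop_pure
      simp only [St.set_v, if_true, Nat.sub_zero, dirMask]
      refine (pack_const_zero B (2 ^ n)).symm.trans (pack_congr fun i hi => ?_)
      simp [Nat.div_eq_of_lt hi]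
    rintro σ1 ⟨⟨h1, h2⟩, h3⟩
    have e : n - (n - (l + 1)) = l + 1 := by omega
    have v46 := h1.v46
    have v47 := h1.v47
    have v48 := h1.v48
    rw [e] at v46 v47 v48
    have g1 : Glob B q n sc σ1 := g.of_eq fun i hi => by
      rw [h2 i (by omega)]
      simp [show i ≠ 44 by omega, show i ≠ 46 by omega, show i ≠ 47 by omega,
        show i ≠ 48 by omega]
    apply Tr.set (x := pack B (2 ^ n) (flipKey (2 ^ q - 1) (l + 1) k))
    · simp
    · rw [← pack_xor_dirMask hB (by omega) hk]
      simp [v48, h2, hkw]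
    apply Tr.set (x := 2 ^ (l + 1) * B)
    · simp
    · simp [v46]
    apply Tr.set (x := pack (2 ^ (l + 1) * B) (2 ^ (n - (l + 1))) (fun _ => 1))
    · simp
    · simp [v47]
    apply Tr.seq
    · exact netVar_spec (a := 40) (b := 41) (d := 9) (sc := sc) (x := x) F (by omega) (by omega) (by omega)
        (by omega) hn hsc
        ⟨by simp [g1.v6], by simp [g1.v7], by simp [g1.v8], by simp [g1.v9], by simp [g1.v16]⟩
        hfk hx (by simp) (by simp [h2, hxw]) (by simp) (by simp) (by simp [g1.v9])
    rintro σ2 ⟨a1, a2, a3, a4, -⟩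
    have hks : ∀ i, ks (l + 1) (flipKey (2 ^ q - 1) (l + 1) k) (l + 1) i < 2 ^ q :=
      fun i => ks_lt hfk _ _
    have hnet := flip_net (M := 2 ^ q - 1) (ℓ := l + 1) (k := k) fun i => by
      have := hk i; omega
    apply Tr.set (x := pack B (2 ^ n) (flipKey (2 ^ q - 1) (l + 1)
      (ks (l + 1) (flipKey (2 ^ q - 1) (l + 1) k) (l + 1))))
    · simp
    · rw [← pack_xor_dirMask hB (by omega) hks]
      simp [a1, a3, v48]
    apply Tr.skip
    refine ⟨⟨_, x ∘ netPerm (l + 1) (flipKey (2 ^ q - 1) (l + 1) k) (l + 1), ?_, fun i => hx _, by rw [St.set_v, if_pos rfl], by simp [a2], ?_, dirSorted_step hd⟩,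
      ?_, ?_, ?_, ?_⟩
    · intro i
      rw [hnet]
      exact hk _
    · rw [hnet, hS]
      have := recs_netPerm (fun i => (k i, x i)) (l + 1) (2 ^ (n - (l + 1)))
        (flipKey (2 ^ q - 1) (l + 1) k)
      rw [← hn] at this
      exact this.symm
    · simp [a3, h1.v44]
    · simp [a3, h1.v45]
    · refine g1.of_eq fun i hi => ?_
      simp only [St.set_v, if_neg (show i ≠ 40 by omega)]
      rw [a3 i (by omega) (by omega) (by omega)]
      simp [show i ≠ 40 by omega, show i ≠ 52 by omega, show i ≠ 53 by omega]
    · intro i hi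
      simp only [St.set_m]
      rw [a4 i hi]
      simp [h3, h.mem i hi]
  case ht => simp; nlinarith

/-- Blocks of length 1 are sorted trivially. After n levels there is one block, whose number 0 is
even, so it ascends. The n levels cost O(n) each. -/
theorem sortWord_spec {w B q n sc : ℕ} (F : Fits w B q (2 ^ n)) (hsc : sc + n ≤ 2 ^ w) {σ : St}
    (g : Glob B q n sc σ) {S : Multiset (ℕ × ℕ)}
    (hS : Block B q n (σ.v 40) (σ.v 41) S) :
    Tr w sortWord σ (250 * ((n + 1) * (n + 1))) (fun σ' =>
      SortedBlock B q n (σ'.v 40) (σ'.v 41) S ∧ ∀ i < sc, σ'.m i = σ.m i) := by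
  have hB := F.B_pos
  have hq := F.q_add
  have hlt : ∀ j ≤ n, 2 ^ j * B < 2 ^ w := fun j hj => F.lt_pow
    ((Nat.mul_le_mul_right _ (Nat.pow_le_pow_right (by omega) hj)).trans F.le)
  have hqw : q < 2 ^ w := lt_of_le_of_lt (by omega) (hlt 0 (by omega))
  have hG : pack B (2 ^ n) (fun _ => 2 ^ q) < 2 ^ w :=
    F.pack_lt fun i => Nat.pow_lt_pow_right (by omega) (by omega)
  have hGq : pack B (2 ^ n) (fun _ => 2 ^ q) / 2 ^ q = pack B (2 ^ n) (fun _ => 1) := by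
    have : pack B (2 ^ n) (fun _ => 2 ^ q) = 2 ^ q * pack B (2 ^ n) (fun _ => 1) := by
      rw [pack_smul]; simp
    rw [this, Nat.mul_div_cancel_left _ (Nat.two_pow_pos q)]
  obtain ⟨k, x, hk, hx, hkw, hxw, hS⟩ := hS
  apply Tr.le
  case h =>
    unfold sortWord
    apply Tr.set (x := B)
    · simp
    · simp [g.v6]
    apply Tr.set (x := pack B (2 ^ n) (fun _ => 2 ^ q - 1))
    · simp [g.v16, g.v7, hG, hqw, Nat.div_le_self]
    · simp [g.v16, g.v7, hGq]
      exact pack_sub fun i _ => Nat.one_le_two_pow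
    refine Tr.imp (Tr.loop_count (SortInv B q n sc S σ) n (200 * (n + 1)) ?_ ?_ ?_) ?_
    · refine ⟨⟨k, x, hk, hx, by simp [hkw], by simp [hxw], hS, ?_⟩, by simp, by simp, ?_, by simp⟩
      · intro i j hij h
        simp at h
        omega
      · exact ⟨by simp [g.v6], by simp [g.v7], by simp [g.v8], by simp [g.v9], by simp [g.v16]⟩
    · intro j hj σ h
      refine ⟨by simp, by simp, by simpa [h.v44] using hlt j hj,
        by simpa [h.glob.v8] using hlt n le_rfl, ?_⟩
      simp only [eval_var, h.v44, h.glob.v8]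
      exact pow_mul_lt_iff hB
    · intro j hj σ h
      exact sortLevel_spec F hsc hj h
    · intro σ' h
      obtain ⟨k, x, h1, h2, h3, h4, h5, h6⟩ := h.word
      refine ⟨⟨k, x, h1, h2, h3, h4, h5, fun i j hij hj => ?_⟩, h.mem⟩
      have e1 : i / 2 ^ n = 0 := Nat.div_eq_of_lt (by omega)
      have e2 : j / 2 ^ n = 0 := Nat.div_eq_of_lt hj
      have := h6 i j hij (by rw [e1, e2])
      simpa [e1] using this
  case ht => simp; nlinarith

end PackedMap

/-! ### Merging runs of sorted words: the invariant -/

namespace PackedMap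

open Finset Stmt
open PackedMap.Expr (var load)

/-- The blocks with numbers in `[lo, hi)` are in the order of their keys. -/
def RunSorted (S : ℕ → Multiset (ℕ × ℕ)) (lo hi : ℕ) : Prop :=
  ∀ i j, lo ≤ i → i < j → j < hi → KeyLe (S i) (S j)

/-- A counting argument: if a record of `lo` exceeded y, so would all K records of `hi`, which makes
more than K records above y. None of them is in T, and S has only K. -/
theorem lower_le {S T lo hi : Multiset (ℕ × ℕ)} {K y : ℕ} (hs : lo + hi = S + T)
    (hle : KeyLe lo hi) (hS : S.card = K) (hhi : hi.card = K)
    (hT : ∀ a ∈ T, a.1 ≤ y) : ∀ a ∈ lo, a.1 ≤ y := by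
  intro a ha
  by_contra hy
  have h1 : hi.countP (fun z => y < z.1) = K := by
    rw [← hhi, Multiset.countP_eq_card]
    intro b hb
    have := hle a ha b hb
    omega
  have h2 : 0 < lo.countP (fun z => y < z.1) :=
    Multiset.countP_pos.2 ⟨a, ha, by omega⟩
  have h3 : T.countP (fun z => y < z.1) = 0 := by
    rw [Multiset.countP_eq_zero]
    intro b hb
    have := hT b hb
    omega
  have h4 := congrArg (Multiset.countP (fun z : ℕ × ℕ => y < z.1)) hs
  rw [Multiset.countP_add, Multiset.countP_add, h1, h3] at h4
  have h5 := Multiset.countP_le_card (fun z : ℕ × ℕ => y < z.1) S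
  omega

/-- Merging the runs `[a, e)` and `[b, f)` of `S`: the blocks before `i` and `j` are consumed,
`k` blocks have been written to `S'` from `p` on, and `T` is carried along. -/
structure MergeState (S S' : ℕ → Multiset (ℕ × ℕ)) (p k a i e b j f : ℕ)
    (T : Multiset (ℕ × ℕ)) : Prop where
  runA : RunSorted S a e
  runB : RunSorted S b f
  ai : a ≤ i
  ie : i ≤ e
  bj : b ≤ j
  jf : j ≤ f
  cnt : i + j = a + b + k + 1
  out : RunSorted S' p (p + k)
  outT : ∀ t, p ≤ t → t < p + k → KeyLe (S' t) T
  outA : ∀ t, p ≤ t → t < p + k → ∀ c, i ≤ c → c < e → KeyLe (S' t) (S c)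
  outB : ∀ t, p ≤ t → t < p + k → ∀ c, j ≤ c → c < f → KeyLe (S' t) (S c)
  sum : ∑ t ∈ Ico p (p + k), S' t + T = ∑ c ∈ Ico a i, S c + ∑ c ∈ Ico b j, S c

namespace MergeState

variable {S S' : ℕ → Multiset (ℕ × ℕ)} {p k a i e b j f : ℕ} {T : Multiset (ℕ × ℕ)}

theorem swap (h : MergeState S S' p k a i e b j f T) : MergeState S S' p k b j f a i e T :=
  ⟨h.runB, h.runA, h.bj, h.jf, h.ai, h.ie, by have := h.cnt; omega, h.out, h.outT, h.outB, h.outA,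
    by rw [h.sum, add_comm]⟩

/-- The carried records come from consumed blocks, so the order of the two runs bounds them. -/
theorem carry_mem (h : MergeState S S' p k a i e b j f T) {z : ℕ × ℕ} (hz : z ∈ T) :
    (∃ c, a ≤ c ∧ c < i ∧ z ∈ S c) ∨ ∃ c, b ≤ c ∧ c < j ∧ z ∈ S c := by
  have h1 : z ∈ ∑ c ∈ Ico a i, S c + ∑ c ∈ Ico b j, S c := by
    rw [← h.sum]; exact Multiset.mem_add.2 (Or.inr hz)
  rcases Multiset.mem_add.1 h1 with h2 | h2 <;> obtain ⟨c, hc, hz⟩ := Multiset.mem_sum.1 h2 <;>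
    rw [mem_Ico] at hc
  · exact Or.inl ⟨c, hc.1, hc.2, hz⟩
  · exact Or.inr ⟨c, hc.1, hc.2, hz⟩

theorem sum_update (S' : ℕ → Multiset (ℕ × ℕ)) (p k : ℕ) (lo : Multiset (ℕ × ℕ)) :
    ∑ t ∈ Ico p (p + (k + 1)), Function.update S' (p + k) lo t =
      ∑ t ∈ Ico p (p + k), S' t + lo := by
  rw [← add_assoc, Finset.sum_Ico_succ_top (by omega), Function.update_self]
  congr 1
  refine Finset.sum_congr rfl fun t ht => ?_
  rw [mem_Ico] at ht
  rw [Function.update_of_ne (by omega)]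

theorem runSorted_update {lo : Multiset (ℕ × ℕ)} (h : RunSorted S' p (p + k))
    (hlo : ∀ t, p ≤ t → t < p + k → KeyLe (S' t) lo) :
    RunSorted (Function.update S' (p + k) lo) p (p + (k + 1)) := by
  intro s t hs hst ht
  rw [Function.update_of_ne (show s ≠ p + k by omega)]
  by_cases h1 : t = p + k
  · rw [h1, Function.update_self]
    exact hlo s hs (by omega)
  · rw [Function.update_of_ne h1]
    exact h s t hs hst (by omega)

/-- The block with the smaller head is merged with the carried block; the smaller half is written
and the larger half is carried on. What has to be shown is that the written half lies below all
unconsumed blocks of both runs, and `lower_le` does this twice with exchanged roles. -/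
theorem step {K : ℕ} {lo hi : Multiset (ℕ × ℕ)} (h : MergeState S S' p k a i e b j f T)
    (hie : i < e) (hK : 0 < K) (hT : T.card = K) (hhi : hi.card = K)
    (hS : (S i).card = K) (hSj : j < f → (S j).card = K)
    (hd : j < f → ∃ w ∈ S i, ∀ y ∈ S j, w.1 ≤ y.1) (hs : lo + hi = T + S i) (hle : KeyLe lo hi) :
    MergeState S (Function.update S' (p + k) lo) p (k + 1) a (i + 1) e b j f hi := by
  have hmem : ∀ z, z ∈ lo ∨ z ∈ hi → z ∈ T ∨ z ∈ S i := fun z hz => by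
    rw [← Multiset.mem_add, ← hs, Multiset.mem_add]; exact hz
  have hbefore : ∀ t, p ≤ t → t < p + k → ∀ y ∈ S' t, ∀ z, z ∈ lo ∨ z ∈ hi → y.1 ≤ z.1 := by
    intro t ht ht' y hy z hz
    rcases hmem z hz with h1 | h1
    · exact h.outT t ht ht' y hy z h1
    · exact h.outA t ht ht' i le_rfl hie y hy z h1
  -- For the run of the chosen block: the whole block is below y, and the carried block has K
  -- records.
  have hloA : ∀ c, i + 1 ≤ c → c < e → KeyLe lo (S c) := by
    intro c hc hc' x hx y hy
    exact lower_le hs hle hT hhi (fun z hz => h.runA i c h.ai (by omega) hc' z hz y hy) x hx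
  -- For the other run: all carried records are below y. Those from the run of the chosen block
  -- precede its head, which is at most the head of the other run and hence at most y; those from
  -- the other run precede y itself. The chosen block has K records.
  have hloB : ∀ c, j ≤ c → c < f → KeyLe lo (S c) := by
    intro c hc hc' x hx y hy
    obtain ⟨w, hw, hwj⟩ := hd (by omega)
    have hwy : w.1 ≤ y.1 := by
      rcases Nat.eq_or_lt_of_le hc with h1 | h1
      · exact hwj y (h1 ▸ hy)
      · have h2 : 0 < (S j).card := by rw [hSj (by omega)]; exact hK
        obtain ⟨v, hv⟩ := Multiset.card_pos_iff_exists_mem.1 h2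
        exact (hwj v hv).trans (h.runB j c h.bj h1 hc' v hv y hy)
    rw [add_comm] at hs
    refine lower_le (S := S i) (T := T) (by rw [add_comm lo, hs, add_comm]) hle hS hhi ?_ x hx
    intro z hz
    rcases h.carry_mem hz with ⟨d, hd1, hd2, hd3⟩ | ⟨d, hd1, hd2, hd3⟩
    · exact (h.runA d i hd1 hd2 hie z hd3 w hw).trans hwy
    · exact h.runB d c hd1 (by omega) hc' z hd3 y hy
  have hsplit : ∀ (R : ℕ → Prop), R (p + k) → (∀ t, p ≤ t → t < p + k → R t) →
      ∀ t, p ≤ t → t < p + (k + 1) → R t := by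
    intro R h1 h2 t ht ht'
    by_cases h3 : t = p + k
    · exact h3 ▸ h1
    · exact h2 t ht (by omega)
  refine ⟨h.runA, h.runB, h.ai.trans (Nat.le_succ i), hie, h.bj, h.jf, by have := h.cnt; omega,
    runSorted_update h.out fun t ht ht' y hy z hz => hbefore t ht ht' y hy z (Or.inl hz),
    hsplit _ ?_ ?_, hsplit _ ?_ ?_, hsplit _ ?_ ?_, ?_⟩
  · rw [Function.update_self]
    exact hle
  · intro t ht ht'
    rw [Function.update_of_ne (by omega)]
    exact fun y hy z hz => hbefore t ht ht' y hy z (Or.inr hz)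
  · rw [Function.update_self]
    exact hloA
  · intro t ht ht' c hc hc'
    rw [Function.update_of_ne (by omega)]
    exact h.outA t ht ht' c (by omega) hc'
  · rw [Function.update_self]
    exact hloB
  · intro t ht ht' c hc hc'
    rw [Function.update_of_ne (by omega)]
    exact h.outB t ht ht' c hc hc'
  · rw [sum_update, add_assoc, hs, ← add_assoc, h.sum, Finset.sum_Ico_succ_top h.ai]
    abel

theorem finish (h : MergeState S S' p k a i e b j f T) (hi : i = e) (hj : j = f) :
    RunSorted (Function.update S' (p + k) T) p (p + (k + 1)) ∧
      ∑ t ∈ Ico p (p + (k + 1)), Function.update S' (p + k) T t =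
        ∑ c ∈ Ico a e, S c + ∑ c ∈ Ico b f, S c := by
  subst hi hj
  exact ⟨runSorted_update h.out h.outT, by rw [sum_update, h.sum]⟩

theorem start (hA : RunSorted S a e) (hB : RunSorted S b f) (hae : a < e) (hbf : b ≤ f) :
    MergeState S S' p 0 a (a + 1) e b b f (S a) :=
  ⟨hA, hB, by omega, hae, le_rfl, hbf, by omega, fun i j _ _ _ => by omega, fun t _ _ => by omega,
    fun t _ _ => by omega, fun t _ _ => by omega, by simp⟩

end MergeState

theorem SortedBlock.card {B q n kw pw : ℕ} {S : Multiset (ℕ × ℕ)} (h : SortedBlock B q n kw pw S) :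
    S.card = 2 ^ n := by
  obtain ⟨k, x, -, -, -, -, rfl, -⟩ := h
  exact card_recs _ _ _

theorem pack_mod {B K q : ℕ} (hq : q ≤ B) (hK : 0 < K) {k : ℕ → ℕ} (hk : ∀ i, k i < 2 ^ q) :
    pack B K k &&& (2 ^ q - 1) = k 0 := by
  obtain ⟨K, rfl⟩ := Nat.exists_eq_succ_of_ne_zero hK.ne'
  rw [Nat.and_two_pow_sub_one_eq_mod, Nat.succ_eq_add_one, add_comm, pack_append, pack_one]
  have h1 : 2 ^ q ∣ 2 ^ (B * 1) := pow_dvd_pow 2 (by omega)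
  rw [Nat.add_mod, Nat.mod_eq_zero_of_dvd (h1.mul_left _), Nat.add_zero, Nat.mod_mod,
    Nat.mod_eq_of_lt (hk 0)]

/-- The first key of a word is a smallest key. -/
theorem SortedBlock.head {B q n kw pw : ℕ} {S : Multiset (ℕ × ℕ)} (hq : q ≤ B)
    (h : SortedBlock B q n kw pw S) :
    (∃ z ∈ S, z.1 = kw &&& (2 ^ q - 1)) ∧ ∀ z ∈ S, kw &&& (2 ^ q - 1) ≤ z.1 := by
  obtain ⟨k, x, hk, -, rfl, -, rfl, hs⟩ := h
  rw [pack_mod hq (Nat.two_pow_pos n) hk]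
  refine ⟨⟨_, mem_recs.2 ⟨0, Nat.two_pow_pos n, rfl⟩, rfl⟩, fun z hz => ?_⟩
  obtain ⟨t, ht, rfl⟩ := mem_recs.1 hz
  rcases Nat.eq_zero_or_pos t with rfl | h0
  · simp
  · simpa using hs 0 t h0 ht

end PackedMap

/-! ### Sorting arrays of words -/

namespace PackedMap

open Finset Stmt
open PackedMap.Expr (var load)

/-- The arrays at `ka` (keys) and `va` (payloads) hold sorted words with the records `S j`. -/
def SortedArr (B q n : ℕ) (m : ℕ → ℕ) (ka va : ℕ) (S : ℕ → Multiset (ℕ × ℕ)) (lo hi : ℕ) : Prop :=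
  ∀ j, lo ≤ j → j < hi → SortedBlock B q n (m (ka + j)) (m (va + j)) (S j)

def takeWord (i : ℕ) : Stmt :=
  .set 42 (load (var 20 + var i)) ;; .set 43 (load (var 21 + var i)) ;;
  .set i (var i + 1) ;; .skip

/-- Take the word with the smaller head from the runs at `28` (up to `29`) and `30` (up to `31`). -/
def takeSmaller : Stmt :=
  .ite (var 28) (var 29)
    (.ite (var 30) (var 31)
      (.ite (load (var 20 + var 30) &&& var 33) (load (var 20 + var 28) &&& var 33)
        (takeWord 30) (takeWord 28))
      (takeWord 28))
    (takeWord 30)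

def mergeStep : Stmt :=
  takeSmaller ;; mergeWords ;;
  .store (var 22 + var 32) (var 44) ;; .store (var 23 + var 32) (var 45) ;;
  .set 32 (var 32 + 1) ;; .skip

/-- Merge two adjacent runs of length `25`, from position `26` on. -/
def mergeRuns : Stmt :=
  .set 28 (var 26) ;; .set 29 (var 26 + var 25) ;; .set 30 (var 29) ;; .set 31 (var 29 + var 25) ;;
  .set 32 (var 26) ;; .set 33 ((1 <<< var 7) - 1) ;;
  .set 40 (load (var 20 + var 28)) ;; .set 41 (load (var 21 + var 28)) ;;
  .set 28 (var 28 + 1) ;;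
  .loop (var 32 + 1) (var 31) mergeStep ;;
  .store (var 22 + var 32) (var 40) ;; .store (var 23 + var 32) (var 41) ;; .skip

/-- The result of choosing a word: from the position `i`, in the variable `vi`. -/
structure Taken (σ : St) (vi i : ℕ) (σ' : St) : Prop where
  vi_eq : σ'.v vi = i + 1
  v42 : σ'.v 42 = σ.m (σ.v 20 + i)
  v43 : σ'.v 43 = σ.m (σ.v 21 + i)
  keep : ∀ l < 50, l ≠ vi → l ≠ 42 → l ≠ 43 → σ'.v l = σ.v l
  mem : σ'.m = σ.m

theorem takeWord_spec {w i x : ℕ} {σ : St} (hi : 22 ≤ i) (hi' : i < 42) (hx : σ.v i = x)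
    (h1 : σ.v 20 + x < 2 ^ w) (h2 : σ.v 21 + x < 2 ^ w) :
    Tr w (takeWord i) σ 20 (Taken σ i x) := by
  subst hx
  apply Tr.le
  case h =>
    unfold takeWord
    apply Tr.set
    · simpa using h1
    · rfl
    apply Tr.set
    · simpa [show i ≠ 42 by omega] using h2
    · rfl
    apply Tr.set
    · simp
    · rfl
    apply Tr.skip
    refine ⟨?_, ?_, ?_, fun l hl h1 h2 h3 => by simp [h1, h2, h3], by simp⟩
    · simp [show i ≠ 42 by omega, show i ≠ 43 by omega]
    · simp [show 42 ≠ i by omega]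
    · simp [show 43 ≠ i by omega, show i ≠ 42 by omega]
  case ht => simp

/-- Masking a word to its lowest q bits gives its first key, which is its smallest because the word
is sorted. -/
theorem takeSmaller_spec {w i e j f Mk : ℕ} {σ : St} (v28 : σ.v 28 = i) (v29 : σ.v 29 = e)
    (v30 : σ.v 30 = j) (v31 : σ.v 31 = f) (v33 : σ.v 33 = Mk) (hij : i < e ∨ j < f)
    (he : σ.v 20 + e ≤ 2 ^ w) (hf : σ.v 20 + f ≤ 2 ^ w) (he' : σ.v 21 + e ≤ 2 ^ w)
    (hf' : σ.v 21 + f ≤ 2 ^ w) (hie : i ≤ e) (hjf : j ≤ f)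
    (hm : ∀ x, σ.m x &&& Mk < 2 ^ w) (h20 : 0 < σ.v 20) :
    Tr w takeSmaller σ 100 (fun σ' =>
      (i < e ∧ (j < f → σ.m (σ.v 20 + i) &&& Mk ≤ σ.m (σ.v 20 + j) &&& Mk) ∧ Taken σ 28 i σ') ∨
      (j < f ∧ (i < e → σ.m (σ.v 20 + j) &&& Mk ≤ σ.m (σ.v 20 + i) &&& Mk) ∧ Taken σ 30 j σ')) := by
  apply Tr.le
  case h =>
    unfold takeSmaller
    apply Tr.ite
    · simp
    · simp
    · simp [v28]; omega
    · simp [v29]; omega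
    · intro h1
      simp only [eval_var, v28, v29] at h1
      apply Tr.ite
      · simp
      · simp
      · simp [v30]; omega
      · simp [v31]; omega
      · intro h2
        simp only [eval_var, v30, v31] at h2
        apply Tr.ite
        · simp [v30]; omega
        · simp [v28]; omega
        · simpa [v33] using hm _
        · simpa [v33] using hm _
        · intro h3
          refine Tr.imp (takeWord_spec (by omega) (by omega) v30 (by omega) (by omega)) fun σ' h => ?_
          simp [v28, v30, v33] at h3
          exact Or.inr ⟨h2, fun _ => h3.le, h⟩
        · intro h3
          refine Tr.imp (takeWord_spec (by omega) (by omega) v28 (by omega) (by omega)) fun σ' h => ?_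
          simp [v28, v30, v33] at h3
          exact Or.inl ⟨h1, fun _ => h3, h⟩
      · intro h2
        simp only [eval_var, v30, v31] at h2
        refine Tr.imp (takeWord_spec (by omega) (by omega) v28 (by omega) (by omega)) fun σ' h => ?_
        exact Or.inl ⟨h1, fun h => by omega, h⟩
    · intro h1
      simp only [eval_var, v28, v29] at h1
      refine Tr.imp (takeWord_spec (by omega) (by omega) v30 (by omega) (by omega)) fun σ' h => ?_
      exact Or.inr ⟨by omega, fun h => by omega, h⟩
  case ht => simp

/-- Two disjoint arrays of length `M`. -/
def Apart (M a b : ℕ) : Prop := ∀ i j, i < M → j < M → a + i ≠ b + j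

theorem Apart.symm {M a b : ℕ} (h : Apart M a b) : Apart M b a :=
  fun i j hi hj => (h j i hj hi).symm

/-- The arrays `ka`, `va`, `kb`, `vb` of length `M` lie below the scratch area. -/
structure Arrays (w n sc M ka va kb vb : ℕ) : Prop where
  sc_le : sc + n ≤ 2 ^ w
  ka_pos : 0 < ka
  kb_pos : 0 < kb
  ka_le : ka + M ≤ sc
  va_le : va + M ≤ sc
  kb_le : kb + M ≤ sc
  vb_le : vb + M ≤ sc
  ka_va : Apart M ka va
  ka_kb : Apart M ka kb
  ka_vb : Apart M ka vb
  va_kb : Apart M va kb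
  va_vb : Apart M va vb
  kb_vb : Apart M kb vb

theorem Arrays.swap {w n sc M ka va kb vb : ℕ} (h : Arrays w n sc M ka va kb vb) :
    Arrays w n sc M kb vb ka va :=
  ⟨h.sc_le, h.kb_pos, h.ka_pos, h.kb_le, h.vb_le, h.ka_le, h.va_le, h.kb_vb, h.ka_kb.symm,
    h.va_kb.symm, h.ka_vb.symm, h.va_vb.symm, h.ka_va⟩

/-- The invariant of the merge loop. -/
structure MergeInv (B q n sc : ℕ) (σ₀ : St) (ka va kb vb ρ p : ℕ) (S : ℕ → Multiset (ℕ × ℕ)) (k : ℕ)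
    (σ : St) : Prop where
  keep : ∀ l < 28, σ.v l = σ₀.v l
  glob : Glob B q n sc σ
  v29 : σ.v 29 = p + ρ
  v31 : σ.v 31 = p + ρ + ρ
  v32 : σ.v 32 = p + k
  v33 : σ.v 33 = 2 ^ q - 1
  state : ∃ S' T, MergeState S S' p k p (σ.v 28) (p + ρ) (p + ρ) (σ.v 30) (p + ρ + ρ) T ∧
    SortedArr B q n σ.m kb vb S' p (p + k) ∧ SortedBlock B q n (σ.v 40) (σ.v 41) T
  mem : ∀ i < sc, (∀ j, p ≤ j → j < p + ρ + ρ → i ≠ kb + j ∧ i ≠ vb + j) → σ.m i = σ₀.m i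

theorem mergeStep_spec {w B q n sc M ka va kb vb ρ p k : ℕ} (F : Fits w B q (2 ^ n))
    (A : Arrays w n sc M ka va kb vb) (hp : p + ρ + ρ ≤ M) (hk : k + 1 < ρ + ρ)
    {σ₀ : St} (h20 : σ₀.v 20 = ka) (h21 : σ₀.v 21 = va) (h22 : σ₀.v 22 = kb) (h23 : σ₀.v 23 = vb)
    {S : ℕ → Multiset (ℕ × ℕ)} (hS : SortedArr B q n σ₀.m ka va S p (p + ρ + ρ))
    {σ : St} (h : MergeInv B q n sc σ₀ ka va kb vb ρ p S k σ) :
    Tr w mergeStep σ (700 * (n + 1)) (MergeInv B q n sc σ₀ ka va kb vb ρ p S (k + 1)) := by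
  have hq := F.q_add
  have A1 := A.sc_le
  have A2 := A.ka_le
  have A3 := A.va_le
  have A4 := A.kb_le
  have A5 := A.vb_le
  have A6 := A.ka_pos
  have hqw : 2 ^ q - 1 < 2 ^ w := by
    have h1 : 2 ^ q ≤ 2 ^ w := Nat.pow_le_pow_right (by omega) (by
      have := F.le
      have h1 : 1 * B ≤ 2 ^ n * B := Nat.mul_le_mul_right _ Nat.one_le_two_pow
      omega)
    have := Nat.two_pow_pos q
    omega
  have k20 : σ.v 20 = ka := by rw [h.keep _ (by omega), h20]
  have k21 : σ.v 21 = va := by rw [h.keep _ (by omega), h21]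
  have k22 : σ.v 22 = kb := by rw [h.keep _ (by omega), h22]
  have k23 : σ.v 23 = vb := by rw [h.keep _ (by omega), h23]
  obtain ⟨S', T, hst, harr, hT⟩ := h.state
  have hcnt := hst.cnt
  have hsrc : ∀ j, p ≤ j → j < p + ρ + ρ → σ.m (ka + j) = σ₀.m (ka + j) ∧
      σ.m (va + j) = σ₀.m (va + j) := by
    intro j hj hj'
    exact ⟨h.mem _ (by omega) fun t ht ht' =>
      ⟨A.ka_kb j t (by omega) (by omega), A.ka_vb j t (by omega) (by omega)⟩,
      h.mem _ (by omega) fun t ht ht' =>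
      ⟨A.va_kb j t (by omega) (by omega), A.va_vb j t (by omega) (by omega)⟩⟩
  have hblk : ∀ j, p ≤ j → j < p + ρ + ρ → SortedBlock B q n (σ.m (ka + j)) (σ.m (va + j)) (S j) := by
    intro j hj hj'
    rw [(hsrc j hj hj').1, (hsrc j hj hj').2]
    exact hS j hj hj'
  apply Tr.le
  case h =>
    unfold mergeStep
    apply Tr.seq
    · exact takeSmaller_spec rfl h.v29 rfl h.v31 h.v33 (by have := hst.ie; have := hst.jf; omega)
        (by omega) (by omega) (by omega) (by omega) hst.ie hst.jf
        (fun x => (Nat.and_le_right).trans_lt hqw) (by omega)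
    intro σ1 h1
    -- The two runs play symmetric roles, so both outcomes of the choice are brought to one form
    -- here, the second by `MergeState.swap`.
    have hboth : ∃ i W, Taken σ i W σ1 ∧ (i = 28 ∨ i = 30) ∧ p ≤ W ∧ W < p + ρ + ρ ∧
        ∀ lo hi, lo + hi = T + S W → KeyLe lo hi → hi.card = 2 ^ n →
        MergeState S (Function.update S' (p + k) lo) p (k + 1) p (σ1.v 28) (p + ρ) (p + ρ) (σ1.v 30)
          (p + ρ + ρ) hi := by
      have hhead : ∀ i j, p ≤ i → i < p + ρ + ρ → p ≤ j → j < p + ρ + ρ →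
          σ.m (σ.v 20 + i) &&& (2 ^ q - 1) ≤ σ.m (σ.v 20 + j) &&& (2 ^ q - 1) →
          ∃ z ∈ S i, ∀ y ∈ S j, z.1 ≤ y.1 := by
        intro i j hi hi' hj hj' hle
        rw [k20] at hle
        obtain ⟨⟨z, hz, hz'⟩, -⟩ := (hblk i hi hi').head (by omega)
        exact ⟨z, hz, fun y hy => by
          have := ((hblk j hj hj').head (by omega)).2 y hy
          omega⟩
      have := hst.ai
      have := hst.bj
      rcases h1 with ⟨g1, g2, g3⟩ | ⟨g1, g2, g3⟩
      · refine ⟨28, _, g3, Or.inl rfl, hst.ai, by omega, fun lo hi hs hle hc => ?_⟩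
        rw [g3.vi_eq, g3.keep 30 (by omega) (by omega) (by omega) (by omega)]
        exact hst.step g1 (Nat.two_pow_pos n) hT.card hc (hblk _ (by omega) (by omega)).card
          (fun g => (hblk _ (by omega) g).card)
          (fun g => hhead _ _ (by omega) (by omega) (by omega) g (g2 g)) hs hle
      · refine ⟨30, _, g3, Or.inr rfl, by omega, by omega, fun lo hi hs hle hc => ?_⟩
        rw [g3.vi_eq, g3.keep 28 (by omega) (by omega) (by omega) (by omega)]
        exact (hst.swap.step g1 (Nat.two_pow_pos n) hT.card hc (hblk _ (by omega) (by omega)).card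
          (fun g => (hblk _ (by omega) (by omega)).card)
          (fun g => hhead _ _ (by omega) (by omega) (by omega) (by omega) (g2 g)) hs hle).swap
    obtain ⟨i, W, ht, hi, hW, hW', hmerge⟩ := hboth
    have hi28 : 28 ≤ i ∧ i ≠ 29 ∧ i ≠ 31 ∧ i < 32 := by omega
    have g1 : Glob B q n sc σ1 := h.glob.of_eq fun l hl =>
      ht.keep l (by omega) (by omega) (by omega) (by omega)
    apply Tr.seq
    · refine Tr.frame 40 (mergeWords_spec F A1 g1 (S := T) (T := S W) ?_ ?_) mergeWords_keeps
      · rw [ht.keep 40 (by omega) (by omega) (by omega) (by omega),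
          ht.keep 41 (by omega) (by omega) (by omega) (by omega)]
        exact hT
      · rw [ht.v42, ht.v43, k20, k21]
        exact hblk W hW hW'
    rintro σ2 ⟨⟨⟨lo, hi', hs, hle, hlo, hhi⟩, hm2⟩, hk2⟩
    have e22 : σ2.v 22 = kb := by
      rw [hk2 _ (by omega), ht.keep _ (by omega) (by omega) (by omega) (by omega), k22]
    have e23 : σ2.v 23 = vb := by
      rw [hk2 _ (by omega), ht.keep _ (by omega) (by omega) (by omega) (by omega), k23]
    have e32 : σ2.v 32 = p + k := by
      rw [hk2 _ (by omega), ht.keep _ (by omega) (by omega) (by omega) (by omega), h.v32]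
    apply Tr.store (y := kb + (p + k)) (x := σ2.v 44)
    · simp
    · simp
    · simp [e22, e32]
    · simp
    · omega
    apply Tr.store (y := vb + (p + k)) (x := σ2.v 45)
    · simp
    · simp
    · simp [e23, e32]
    · simp
    · omega
    apply Tr.set (x := p + (k + 1))
    · simp
    · simp [e32, add_assoc]
    apply Tr.skip
    have hne : ∀ t, p ≤ t → t < p + k → kb + t ≠ kb + (p + k) ∧ kb + t ≠ vb + (p + k) ∧
        vb + t ≠ kb + (p + k) ∧ vb + t ≠ vb + (p + k) := fun t ht ht' =>
      ⟨by omega, A.kb_vb _ _ (by omega) (by omega), (A.kb_vb _ _ (by omega) (by omega)).symm,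
        by omega⟩
    refine ⟨fun l hl => ?_, ?_, ?_, ?_, by simp, ?_, ⟨Function.update S' (p + k) lo, hi', ?_, ?_, ?_⟩, ?_⟩
    · simp only [St.set_v, St.write_v]
      rw [if_neg (by omega), hk2 _ (by omega), ht.keep _ (by omega) (by omega) (by omega) (by omega),
        h.keep _ hl]
    · refine g1.of_eq fun l hl => ?_
      simp only [St.set_v, St.write_v]
      rw [if_neg (by omega), hk2 _ (by omega)]
    · simp only [St.set_v, St.write_v]
      rw [if_neg (by omega), hk2 _ (by omega), ht.keep _ (by omega) (by omega) (by omega) (by omega),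
        h.v29]
    · simp only [St.set_v, St.write_v]
      rw [if_neg (by omega), hk2 _ (by omega), ht.keep _ (by omega) (by omega) (by omega) (by omega),
        h.v31]
    · simp only [St.set_v, St.write_v]
      rw [if_neg (by omega), hk2 _ (by omega), ht.keep _ (by omega) (by omega) (by omega) (by omega),
        h.v33]
    · simp only [St.set_v, St.write_v]
      rw [if_neg (by omega), if_neg (by omega), hk2 28 (by omega), hk2 30 (by omega)]
      exact hmerge lo hi' hs hle hhi.card
    · intro t ht1 ht2
      simp only [St.set_m, St.write_m]
      by_cases hteq : t = p + k
      · subst hteq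
        rw [Function.update_self, if_neg (A.kb_vb _ _ (by omega) (by omega)), if_pos rfl, if_pos rfl]
        exact hlo
      · obtain ⟨n1, n2, n3, n4⟩ := hne t ht1 (by omega)
        rw [Function.update_of_ne hteq, if_neg n2, if_neg n1, if_neg n4, if_neg n3,
          hm2 _ (by omega), hm2 _ (by omega), ht.mem]
        exact harr t ht1 (by omega)
    · simp only [St.set_v, St.write_v]
      exact hhi
    · intro t ht1 ht2
      have := ht2 (p + k) (by omega) (by omega)
      simp only [St.set_m, St.write_m]
      rw [if_neg this.2, if_neg this.1, hm2 _ ht1, ht.mem]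
      exact h.mem t ht1 ht2
  case ht => simp; omega

theorem mergeRuns_keeps : mergeRuns.keeps 28 = true := by decide

theorem mergeRuns_spec {w B q n sc M ka va kb vb ρ p : ℕ} (F : Fits w B q (2 ^ n))
    (A : Arrays w n sc M ka va kb vb) (hp : p + ρ + ρ ≤ M) (hρ : 0 < ρ)
    {σ : St} (g : Glob B q n sc σ) (h20 : σ.v 20 = ka) (h21 : σ.v 21 = va) (h22 : σ.v 22 = kb)
    (h23 : σ.v 23 = vb) (h25 : σ.v 25 = ρ) (h26 : σ.v 26 = p)
    {S : ℕ → Multiset (ℕ × ℕ)} (hS : SortedArr B q n σ.m ka va S p (p + ρ + ρ))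
    (hA : RunSorted S p (p + ρ)) (hB : RunSorted S (p + ρ) (p + ρ + ρ)) :
    Tr w mergeRuns σ (ρ * (2000 * (n + 1))) (fun σ' => ∃ S',
      SortedArr B q n σ'.m kb vb S' p (p + ρ + ρ) ∧ RunSorted S' p (p + ρ + ρ) ∧
      ∑ t ∈ Ico p (p + ρ + ρ), S' t = ∑ t ∈ Ico p (p + ρ + ρ), S t ∧
      ∀ i < sc, (∀ j, p ≤ j → j < p + ρ + ρ → i ≠ kb + j ∧ i ≠ vb + j) → σ'.m i = σ.m i) := by
  have A1 := A.sc_le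
  have A2 := A.ka_le
  have A3 := A.va_le
  have A4 := A.kb_le
  have A5 := A.vb_le
  have A7 := A.kb_pos
  have hqw : q < 2 ^ w := F.lt_pow (by
    have := F.le
    have := F.q_add
    have h1 : 1 * B ≤ 2 ^ n * B := Nat.mul_le_mul_right _ Nat.one_le_two_pow
    omega)
  apply Tr.le
  case h =>
    unfold mergeRuns
    apply Tr.set (x := p)
    · simp
    · simp [h26]
    apply Tr.set (x := p + ρ)
    · simp
    · simp [h26, h25]
    apply Tr.set (x := p + ρ)
    · simp
    · simp
    apply Tr.set (x := p + ρ + ρ)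
    · simp
    · simp [h25]
    apply Tr.set (x := p)
    · simp
    · simp [h26]
    apply Tr.set (x := 2 ^ q - 1)
    · simp [g.v7, hqw, Nat.one_le_two_pow]
    · simp [g.v7]
    apply Tr.set (x := σ.m (ka + p))
    · simp [h20]; omega
    · simp [h20]
    apply Tr.set (x := σ.m (va + p))
    · simp [h21]; omega
    · simp [h21]
    apply Tr.set (x := p + 1)
    · simp
    · simp
    apply Tr.seq
    -- One of the 2ρ blocks is loaded before the loop. Each of the 2ρ - 1 rounds consumes one block
    -- and writes one, and the block carried at the end is stored after the loop.
    · refine Tr.frame 28 (Tr.loop_count (MergeInv B q n sc σ ka va kb vb ρ p S) (2 * ρ - 1)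
        (700 * (n + 1)) ?_ ?_ ?_) (by decide)
      · refine ⟨fun l hl => ?_, g.of_eq fun l hl => ?_, by simp, by simp, by simp, by simp,
          ⟨S, S p, ?_, fun j hj hj' => by omega, ?_⟩, fun i _ _ => by simp⟩
        · simp only [St.set_v]
          rw [if_neg (by omega), if_neg (by omega), if_neg (by omega), if_neg (by omega),
            if_neg (by omega), if_neg (by omega), if_neg (by omega), if_neg (by omega),
            if_neg (by omega)]
        · simp only [St.set_v]
          rw [if_neg (by omega), if_neg (by omega), if_neg (by omega), if_neg (by omega),
            if_neg (by omega), if_neg (by omega), if_neg (by omega), if_neg (by omega),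
            if_neg (by omega)]
        · simpa using MergeState.start hA hB (by omega) (by omega)
        · simpa using hS p (by omega) (by omega)
      · intro k hk σ' h
        refine ⟨by simp, by simp, ?_, ?_, ?_⟩
        · simp only [eval_add, eval_var, eval_lit, h.v32]; omega
        · simp only [eval_var, h.v31]; omega
        · simp only [eval_add, eval_var, eval_lit, h.v32, h.v31]; omega
      · intro k hk σ' h
        exact mergeStep_spec F A hp (by omega) h20 h21 h22 h23 hS h
    rintro σ1 ⟨h1, -⟩
    obtain ⟨S', T, hst, harr, hT⟩ := h1.state
    have c1 := hst.cnt
    have c2 := hst.ie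
    have c3 := hst.jf
    obtain ⟨f1, f2⟩ := hst.finish (by omega) (by omega)
    have e1 : p + (2 * ρ - 1 + 1) = p + ρ + ρ := by omega
    rw [e1] at f1 f2
    apply Tr.store (y := kb + (p + (2 * ρ - 1))) (x := σ1.v 40)
    · simp
    · simp
    · simp [h1.v32, h1.keep 22, h22]
    · simp
    · omega
    apply Tr.store (y := vb + (p + (2 * ρ - 1))) (x := σ1.v 41)
    · simp
    · simp
    · simp [h1.v32, h1.keep 23, h23]
    · simp
    · omega
    apply Tr.skip
    refine ⟨_, ?_, f1, ?_, ?_⟩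
    · intro t ht1 ht2
      simp only [St.write_m]
      by_cases hteq : t = p + (2 * ρ - 1)
      · subst hteq
        rw [Function.update_self, if_neg (A.kb_vb _ _ (by omega) (by omega)), if_pos rfl, if_pos rfl]
        exact hT
      · rw [Function.update_of_ne hteq, if_neg (A.kb_vb _ _ (by omega) (by omega)), if_neg (by omega),
          if_neg (by omega), if_neg (A.kb_vb _ _ (by omega) (by omega)).symm]
        exact harr t ht1 (by omega)
    · rw [f2, Finset.sum_Ico_consecutive _ (by omega) (by omega)]
    · intro t ht1 ht2
      have := ht2 (p + (2 * ρ - 1)) (by omega) (by omega)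
      simp only [St.write_m]
      rw [if_neg this.2, if_neg this.1]
      exact h1.mem t ht1 ht2
  case ht =>
    simp only [cost_add, cost_var, cost_lit, cost_sub, cost_shl, cost_load]
    obtain ⟨ρ, rfl⟩ := Nat.exists_eq_succ_of_ne_zero hρ.ne'
    rw [show 2 * ρ.succ - 1 = 2 * ρ + 1 by omega]
    have : (2 * ρ + 1) * (5 + 700 * (n + 1)) ≤ (2 * ρ + 2) * (705 * (n + 1)) :=
      Nat.mul_le_mul (by omega) (by omega)
    have h3 : (2 * ρ + 2) * (705 * (n + 1)) = 1410 * ((ρ + 1) * (n + 1)) := by ring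
    have h4 : (ρ + 1) * (2000 * (n + 1)) = 2000 * ((ρ + 1) * (n + 1)) := by ring
    have h5 : 1 * 1 ≤ (ρ + 1) * (n + 1) := Nat.mul_le_mul (by omega) (by omega)
    norm_num at this ⊢
    omega

/-- Runs of length `ρ`. -/
def Runs (S : ℕ → Multiset (ℕ × ℕ)) (ρ M : ℕ) : Prop :=
  ∀ i j, i < j → j < M → i / ρ = j / ρ → KeyLe (S i) (S j)

theorem Runs.runSorted {S : ℕ → Multiset (ℕ × ℕ)} {ρ M h : ℕ} (hS : Runs S ρ M)
    (hM : (h + 1) * ρ ≤ M) : RunSorted S (h * ρ) ((h + 1) * ρ) := by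
  intro i j hi hij hj
  refine hS i j hij (by omega) ?_
  rw [Nat.div_eq_of_lt_le hi (by omega), Nat.div_eq_of_lt_le (by omega : h * ρ ≤ j) hj]

def mergePass : Stmt :=
  .set 26 0 ;; .loop (var 26) (var 10) (mergeRuns ;; .set 26 (var 26 + (var 25 + var 25)) ;; .skip)

theorem mergePass_keeps : mergePass.keeps 26 = true := by decide

structure PassInv (B q n sc M : ℕ) (σ₀ : St) (kb vb ρ : ℕ) (S : ℕ → Multiset (ℕ × ℕ)) (h : ℕ)
    (σ : St) : Prop where
  keep : ∀ l < 26, σ.v l = σ₀.v l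
  v26 : σ.v 26 = h * (ρ + ρ)
  out : ∃ S', SortedArr B q n σ.m kb vb S' 0 (h * (ρ + ρ)) ∧ Runs S' (ρ + ρ) (h * (ρ + ρ)) ∧
    ∑ t ∈ Ico 0 (h * (ρ + ρ)), S' t = ∑ t ∈ Ico 0 (h * (ρ + ρ)), S t
  mem : ∀ i < sc, (∀ j < M, i ≠ kb + j ∧ i ≠ vb + j) → σ.m i = σ₀.m i

theorem mergePass_spec {w B q n sc M ka va kb vb ρ c : ℕ} (F : Fits w B q (2 ^ n))
    (A : Arrays w n sc M ka va kb vb) (hM : M = c * (ρ + ρ)) (hρ : 0 < ρ)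
    {σ : St} (g : Glob B q n sc σ) (h20 : σ.v 20 = ka) (h21 : σ.v 21 = va) (h22 : σ.v 22 = kb)
    (h23 : σ.v 23 = vb) (h25 : σ.v 25 = ρ) (h10 : σ.v 10 = M)
    {S : ℕ → Multiset (ℕ × ℕ)} (hS : SortedArr B q n σ.m ka va S 0 M) (hR : Runs S ρ M) :
    Tr w mergePass σ (M * (1010 * (n + 1)) + 10) (fun σ' => (∃ S',
      SortedArr B q n σ'.m kb vb S' 0 M ∧ Runs S' (ρ + ρ) M ∧
      ∑ t ∈ Ico 0 M, S' t = ∑ t ∈ Ico 0 M, S t) ∧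
      ∀ i < sc, (∀ j < M, i ≠ kb + j ∧ i ≠ vb + j) → σ'.m i = σ.m i) := by
  have A1 := A.sc_le
  have A2 := A.ka_le
  have hA7 := A.ka_pos
  have hle : ∀ h ≤ c, h * (ρ + ρ) ≤ M := fun h hh => hM ▸ Nat.mul_le_mul_right _ hh
  apply Tr.le
  case h =>
    unfold mergePass
    apply Tr.set (x := 0)
    · simp
    · simp
    refine Tr.imp (Tr.loop_count (PassInv B q n sc M σ kb vb ρ S) c (ρ * (2000 * (n + 1)) + 10)
      ?_ ?_ ?_) ?_
    · refine ⟨fun l hl => by simp [show l ≠ 26 by omega], by simp,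
        ⟨S, fun j hj hj' => by omega, fun i j _ hj => by omega, rfl⟩, by simp⟩
    · intro h hh σ' I
      refine ⟨by simp, by simp, ?_, ?_, ?_⟩
      · simp only [eval_var, I.v26]; have := hle h hh; omega
      · simp only [eval_var, I.keep 10 (by omega), h10]; omega
      · simp only [eval_var, I.keep 10 (by omega), h10, I.v26, hM]
        exact Nat.mul_lt_mul_right (by omega)
    · intro h hh σ' I
      have hle1 := hle (h + 1) hh
      have e0 : (h + 1) * (ρ + ρ) = h * (ρ + ρ) + ρ + ρ := by ring
      have e1 : h * (ρ + ρ) = (2 * h) * ρ := by ring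
      have e2 : h * (ρ + ρ) + ρ = (2 * h + 1) * ρ := by ring
      have e3 : h * (ρ + ρ) + ρ + ρ = (2 * h + 1 + 1) * ρ := by ring
      rw [e0] at hle1
      have g' : Glob B q n sc σ' := g.of_eq fun l hl => I.keep l (by omega)
      obtain ⟨S', o1, o2, o3⟩ := I.out
      apply Tr.le
      case h =>
        apply Tr.seq
        · refine Tr.frame 28 (mergeRuns_spec (p := h * (ρ + ρ)) (S := S) F A hle1 hρ g'
            (by rw [I.keep 20 (by omega), h20]) (by rw [I.keep 21 (by omega), h21])
            (by rw [I.keep 22 (by omega), h22]) (by rw [I.keep 23 (by omega), h23])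
            (by rw [I.keep 25 (by omega), h25]) I.v26 ?_ ?_ ?_) mergeRuns_keeps
          · intro j hj hj'
            rw [I.mem _ (by omega) fun t ht =>
                ⟨A.ka_kb j t (by omega) (by omega), A.ka_vb j t (by omega) (by omega)⟩,
              I.mem _ (by have := A.va_le; omega) fun t ht =>
                ⟨A.va_kb j t (by omega) (by omega), A.va_vb j t (by omega) (by omega)⟩]
            exact hS j (by omega) (by omega)
          · rw [e2, e1]
            exact hR.runSorted (by omega)
          · rw [e3, e2]
            exact hR.runSorted (by omega)
        rintro σ1 ⟨⟨S1, s1, s2, s3, s4⟩, k1⟩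
        apply Tr.set (x := (h + 1) * (ρ + ρ))
        · simp
        · simp only [eval_add, eval_var]
          rw [k1 26 (by omega), k1 25 (by omega), I.v26, I.keep 25 (by omega), h25]
          ring
        apply Tr.skip
        -- The record blocks of the earlier pairs of runs and those of the pair just merged are
        -- joined into a single function.
        refine ⟨fun l hl => ?_, by simp,
          ⟨fun t => if t < h * (ρ + ρ) then S' t else S1 t, ?_, ?_, ?_⟩, ?_⟩
        · simp only [St.set_v]
          rw [if_neg (by omega), k1 l (by omega), I.keep l hl]
        · intro t _ ht
          simp only [St.set_m]
          split_ifs with hth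
          · rw [s4 _ (by have := A.kb_le; omega) fun j hj hj' =>
              ⟨by omega, A.kb_vb _ _ (by omega) (by omega)⟩,
              s4 _ (by have := A.vb_le; omega) fun j hj hj' =>
              ⟨(A.kb_vb _ _ (by omega) (by omega)).symm, by omega⟩]
            exact o1 t (by omega) hth
          · exact s1 t (by omega) (by omega)
        · intro i j hij hj hdiv
          simp only
          by_cases hj' : j < h * (ρ + ρ)
          · rw [if_pos hj', if_pos (by omega)]
            exact o2 i j hij hj' hdiv
          · have h1 : j / (ρ + ρ) = h := Nat.div_eq_of_lt_le (by omega) (by omega)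
            have h2 : h * (ρ + ρ) ≤ i := by
              rw [← h1, ← hdiv]
              exact Nat.div_mul_le_self _ _
            rw [if_neg hj', if_neg (by omega)]
            exact s2 i j h2 hij (by omega)
        · rw [e0, ← Finset.sum_Ico_consecutive _ (Nat.zero_le (h * (ρ + ρ))) (by omega),
            ← Finset.sum_Ico_consecutive S (Nat.zero_le (h * (ρ + ρ))) (by omega), ← o3, ← s3]
          congr 1
          · refine Finset.sum_congr rfl fun t ht => ?_
            rw [mem_Ico] at ht
            rw [if_pos ht.2]
          · refine Finset.sum_congr rfl fun t ht => ?_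
            rw [mem_Ico] at ht
            rw [if_neg (by omega)]
        · intro i hi hi'
          simp only [St.set_m]
          rw [s4 i hi fun j _ hj => hi' j (by omega), I.mem i hi hi']
      case ht => simp
    · intro σ' I
      obtain ⟨S', h1, h2, h3⟩ := I.out
      rw [← hM] at h1 h2 h3
      exact ⟨⟨S', h1, h2, h3⟩, I.mem⟩
  case ht =>
    simp only [cost_var, cost_lit]
    have h1 : c * (1 + 1 + 1 + (ρ * (2000 * (n + 1)) + 10)) ≤ c * ((ρ + ρ) * (1010 * (n + 1))) := by
      refine Nat.mul_le_mul_left _ ?_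
      have h4 : (ρ + ρ) * (1010 * (n + 1)) = 2020 * (ρ * (n + 1)) := by ring
      have h3 : ρ * (2000 * (n + 1)) = 2000 * (ρ * (n + 1)) := by ring
      have h5 : 1 * 1 ≤ ρ * (n + 1) := Nat.mul_le_mul hρ (by omega)
      omega
    rw [hM, mul_assoc]
    omega

/-! ### The complete sort: single words, then runs of doubling length. -/

def sortWordsBody : Stmt :=
  .set 40 (load (var 20 + var 24)) ;; .set 41 (load (var 21 + var 24)) ;;
  sortWord ;;
  .store (var 20 + var 24) (var 40) ;; .store (var 21 + var 24) (var 41) ;;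
  .set 24 (var 24 + 1) ;; .skip

def mergeLevel : Stmt :=
  mergePass ;;
  .set 27 (var 20) ;; .set 20 (var 22) ;; .set 22 (var 27) ;;
  .set 27 (var 21) ;; .set 21 (var 23) ;; .set 23 (var 27) ;;
  .set 25 (var 25 + var 25) ;; .skip

/-- Sort the records in the arrays `20` (keys) and `21` (payloads) of length `10`, with the help of
the arrays `22` and `23`; the names of the arrays may be exchanged. -/
def sortArrays : Stmt :=
  .set 24 0 ;; .loop (var 24) (var 10) sortWordsBody ;;
  .set 25 1 ;; .loop (var 25) (var 10) mergeLevel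

theorem sortArrays_keeps : sortArrays.keeps 20 = true := by decide

structure WordsInv (B q n sc M ka va : ℕ) (σ₀ : St) (S : ℕ → Multiset (ℕ × ℕ)) (h : ℕ)
    (σ : St) : Prop where
  keep : ∀ l < 24, σ.v l = σ₀.v l
  v24 : σ.v 24 = h
  done : SortedArr B q n σ.m ka va S 0 h
  todo : ∀ j, h ≤ j → j < M → Block B q n (σ.m (ka + j)) (σ.m (va + j)) (S j)
  mem : ∀ i < sc, (∀ j < M, i ≠ ka + j ∧ i ≠ va + j) → σ.m i = σ₀.m i

theorem sortWords_spec {w B q n sc M ka va kb vb h : ℕ} (F : Fits w B q (2 ^ n))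
    (A : Arrays w n sc M ka va kb vb) {σ₀ : St} (g : Glob B q n sc σ₀) (h20 : σ₀.v 20 = ka)
    (h21 : σ₀.v 21 = va) {S : ℕ → Multiset (ℕ × ℕ)} (hh : h < M) {σ : St}
    (I : WordsInv B q n sc M ka va σ₀ S h σ) :
    Tr w sortWordsBody σ (300 * ((n + 1) * (n + 1))) (WordsInv B q n sc M ka va σ₀ S (h + 1)) := by
  have A1 := A.sc_le
  have A2 := A.ka_le
  have A3 := A.va_le
  have k20 : σ.v 20 = ka := by rw [I.keep _ (by omega), h20]
  have k21 : σ.v 21 = va := by rw [I.keep _ (by omega), h21]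
  apply Tr.le
  case h =>
    unfold sortWordsBody
    apply Tr.set (x := σ.m (ka + h))
    · simp [k20, I.v24]; omega
    · simp [k20, I.v24]
    apply Tr.set (x := σ.m (va + h))
    · simp [k21, I.v24]; omega
    · simp [k21, I.v24]
    apply Tr.seq
    · refine Tr.frame 40 (sortWord_spec F A1 (S := S h) (g.of_eq fun l hl => ?_) ?_) sortWord_keeps
      · simp only [St.set_v]
        rw [if_neg (by omega), if_neg (by omega), I.keep l (by omega)]
      · simpa using I.todo h le_rfl hh
    rintro σ1 ⟨⟨h1, h2⟩, h3⟩
    have e20 : σ1.v 20 = ka := by rw [h3 20 (by omega)]; simpa using k20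
    have e21 : σ1.v 21 = va := by rw [h3 21 (by omega)]; simpa using k21
    have e24 : σ1.v 24 = h := by rw [h3 24 (by omega)]; simpa using I.v24
    apply Tr.store (y := ka + h) (x := σ1.v 40)
    · simp
    · simp
    · simp [e20, e24]
    · simp
    · omega
    apply Tr.store (y := va + h) (x := σ1.v 41)
    · simp
    · simp
    · simp [e21, e24]
    · simp
    · omega
    apply Tr.set (x := h + 1)
    · simp
    · simp [e24]
    apply Tr.skip
    have hne := A.ka_va h h hh hh
    refine ⟨fun l hl => ?_, by simp, fun j _ hj => ?_, fun j hj hj' => ?_, fun i hi hi' => ?_⟩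
    · simp only [St.set_v, St.write_v]
      rw [if_neg (by omega), h3 l (by omega)]
      simp only [St.set_v]
      rw [if_neg (by omega), if_neg (by omega), I.keep l hl]
    · simp only [St.set_m, St.write_m]
      by_cases hjh : j = h
      · subst hjh
        rw [if_neg hne, if_pos rfl, if_pos rfl]
        exact h1
      · rw [if_neg (A.ka_va _ _ (by omega) hh), if_neg (by omega), if_neg (by omega),
          if_neg (A.ka_va _ _ (by omega) (by omega)).symm, h2 _ (by omega), h2 _ (by omega)]
        exact I.done j (by omega) (by omega)
    · simp only [St.set_m, St.write_m]
      rw [if_neg (A.ka_va _ _ (by omega) hh), if_neg (by omega), if_neg (by omega),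
        if_neg (A.ka_va _ _ (by omega) (by omega)).symm, h2 _ (by omega), h2 _ (by omega)]
      exact I.todo j (by omega) hj'
    · have := hi' h hh
      simp only [St.set_m, St.write_m]
      rw [if_neg this.2, if_neg this.1, h2 i hi]
      simpa using I.mem i hi hi'
  case ht =>
    simp
    have : 1 * 1 ≤ (n + 1) * (n + 1) := Nat.mul_le_mul (by omega) (by omega)
    omega

structure LevelInv (w B q n sc M ka va kb vb : ℕ) (σ₀ : St) (R : Multiset (ℕ × ℕ)) (j : ℕ)
    (σ : St) : Prop where
  keep : ∀ l < 20, σ.v l = σ₀.v l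
  v25 : σ.v 25 = 2 ^ j
  names : (σ.v 20 = ka ∧ σ.v 21 = va ∧ σ.v 22 = kb ∧ σ.v 23 = vb) ∨
    (σ.v 20 = kb ∧ σ.v 21 = vb ∧ σ.v 22 = ka ∧ σ.v 23 = va)
  arr : ∃ S, SortedArr B q n σ.m (σ.v 20) (σ.v 21) S 0 M ∧ PackedMap.Runs S (2 ^ j) M ∧
    ∑ t ∈ Ico 0 M, S t = R
  mem : ∀ i < sc, (∀ j < M, i ≠ ka + j ∧ i ≠ va + j ∧ i ≠ kb + j ∧ i ≠ vb + j) → σ.m i = σ₀.m i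

/-- Merging is not in place: a pass writes to the other two arrays, whose addresses are then
exchanged with the sources. Where the result ends up depends on the parity of the number of passes.
-/
theorem mergeLevel_spec {w B q n sc M ka va kb vb j c : ℕ} (F : Fits w B q (2 ^ n))
    (A : Arrays w n sc M ka va kb vb) (hM : M = c * 2 ^ (j + 1)) {σ₀ : St} (g : Glob B q n sc σ₀)
    (h10 : σ₀.v 10 = M) {R : Multiset (ℕ × ℕ)} {σ : St}
    (I : LevelInv w B q n sc M ka va kb vb σ₀ R j σ) :
    Tr w mergeLevel σ (M * (1010 * (n + 1)) + 50)
      (LevelInv w B q n sc M ka va kb vb σ₀ R (j + 1)) := by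
  obtain ⟨S, s1, s2, s3⟩ := I.arr
  have A' : Arrays w n sc M (σ.v 20) (σ.v 21) (σ.v 22) (σ.v 23) := by
    rcases I.names with ⟨h1, h2, h3, h4⟩ | ⟨h1, h2, h3, h4⟩ <;> rw [h1, h2, h3, h4]
    exacts [A, A.swap]
  apply Tr.le
  case h =>
    unfold mergeLevel
    apply Tr.seq
    · exact Tr.frame 26 (mergePass_spec (ρ := 2 ^ j) (c := c) F A' (by rw [hM, pow_succ]; ring)
        (Nat.two_pow_pos j) (g.of_eq I.keep) rfl rfl rfl rfl I.v25 (by rw [I.keep 10 (by omega), h10])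
        s1 s2) mergePass_keeps
    rintro σ1 ⟨⟨⟨S', t1, t2, t3⟩, t4⟩, t5⟩
    apply Tr.set (x := σ.v 20)
    · simp
    · simp [t5]
    apply Tr.set (x := σ.v 22)
    · simp
    · simp [t5]
    apply Tr.set (x := σ.v 20)
    · simp
    · simp
    apply Tr.set (x := σ.v 21)
    · simp
    · simp [t5]
    apply Tr.set (x := σ.v 23)
    · simp
    · simp [t5]
    apply Tr.set (x := σ.v 21)
    · simp
    · simp
    apply Tr.set (x := 2 ^ (j + 1))
    · simp
    · simp [t5, I.v25, pow_succ]; ring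
    apply Tr.skip
    refine ⟨fun l hl => ?_, by simp, ?_, ⟨S', ?_, ?_, t3.trans s3⟩, fun i hi hi' => ?_⟩
    · simp only [St.set_v]
      rw [if_neg (by omega), if_neg (by omega), if_neg (by omega), if_neg (by omega),
        if_neg (by omega), if_neg (by omega), if_neg (by omega), t5 l (by omega), I.keep l hl]
    · simp
      have := I.names
      tauto
    · simpa using t1
    · rw [pow_succ, mul_two]
      exact t2
    · simp only [St.set_m]
      rw [t4 i hi fun j hj => ?_, I.mem i hi hi']
      have := hi' j hj
      rcases I.names with ⟨h1, h2, h3, h4⟩ | ⟨h1, h2, h3, h4⟩ <;> rw [h3, h4] <;> tauto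
  case ht => simp

/-- Sorting the single words costs O(M n²) and each of the μ passes costs O(M n), where n stands for
n + 1. -/
theorem sortArrays_spec {w B q n sc M ka va kb vb μ : ℕ} (F : Fits w B q (2 ^ n))
    (A : Arrays w n sc M ka va kb vb) (hM : M = 2 ^ μ) {σ : St} (g : Glob B q n sc σ)
    (h10 : σ.v 10 = M) (h20 : σ.v 20 = ka) (h21 : σ.v 21 = va) (h22 : σ.v 22 = kb)
    (h23 : σ.v 23 = vb) {S : ℕ → Multiset (ℕ × ℕ)}
    (hS : ∀ j < M, Block B q n (σ.m (ka + j)) (σ.m (va + j)) (S j)) :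
    Tr w sortArrays σ (2000 * (M * (n + μ + 1) * (n + 1))) (fun σ' =>
      ((σ'.v 20 = ka ∧ σ'.v 21 = va ∧ σ'.v 22 = kb ∧ σ'.v 23 = vb) ∨
        (σ'.v 20 = kb ∧ σ'.v 21 = vb ∧ σ'.v 22 = ka ∧ σ'.v 23 = va)) ∧
      (∃ S', SortedArr B q n σ'.m (σ'.v 20) (σ'.v 21) S' 0 M ∧ RunSorted S' 0 M ∧
        ∑ t ∈ Ico 0 M, S' t = ∑ t ∈ Ico 0 M, S t) ∧
      ∀ i < sc, (∀ j < M, i ≠ ka + j ∧ i ≠ va + j ∧ i ≠ kb + j ∧ i ≠ vb + j) → σ'.m i = σ.m i) := by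
  have A1 := A.sc_le
  have A2 := A.ka_le
  have A7 := A.ka_pos
  apply Tr.le
  case h =>
    unfold sortArrays
    apply Tr.set (x := 0)
    · simp
    · simp
    apply Tr.seq
    · refine Tr.loop_count (WordsInv B q n sc M ka va σ S) M (300 * ((n + 1) * (n + 1))) ?_ ?_ ?_
      · exact ⟨fun l hl => by simp [show l ≠ 24 by omega], by simp, fun j _ hj => by omega,
          fun j _ hj => by simpa using hS j hj, by simp⟩
      · intro h hh σ' I
        refine ⟨by simp, by simp, ?_, ?_, ?_⟩
        · simp only [eval_var, I.v24]; omega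
        · simp only [eval_var, I.keep 10 (by omega), h10]; omega
        · simp only [eval_var, I.v24, I.keep 10 (by omega), h10]
      · intro h hh σ' I
        exact sortWords_spec F A g h20 h21 hh I
    intro σ1 I
    apply Tr.set (x := 1)
    · simp
    · simp
    refine Tr.imp (Tr.loop_count (LevelInv w B q n sc M ka va kb vb σ (∑ t ∈ Ico 0 M, S t)) μ
      (M * (1010 * (n + 1)) + 50) ?_ ?_ ?_) ?_
    · refine ⟨fun l hl => ?_, by simp, Or.inl ?_, ⟨S, ?_, ?_, rfl⟩, fun i hi hi' => ?_⟩
      · simp only [St.set_v]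
        rw [if_neg (by omega), I.keep l (by omega)]
      · simp [I.keep, h20, h21, h22, h23]
      · simpa [I.keep, h20, h21] using I.done
      · intro i j hij hj hd
        simp at hd
        omega
      · simp only [St.set_m]
        exact I.mem i hi fun j hj => ⟨(hi' j hj).1, (hi' j hj).2.1⟩
    · intro j hj σ' I
      refine ⟨by simp, by simp, ?_, ?_, ?_⟩
      · simp only [eval_var, I.v25]
        have : 2 ^ j ≤ M := hM ▸ Nat.pow_le_pow_right (by omega) hj
        omega
      · simp only [eval_var, I.keep 10 (by omega), h10]; omega
      · simp only [eval_var, I.v25, I.keep 10 (by omega), h10, hM]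
        exact Nat.pow_lt_pow_iff_right (by omega)
    · intro j hj σ' I
      exact mergeLevel_spec (c := 2 ^ (μ - (j + 1))) F A
        (by rw [hM, ← pow_add]; congr 1; omega) g h10 I
    · intro σ' I
      obtain ⟨S', s1, s2, s3⟩ := I.arr
      refine ⟨I.names, ⟨S', s1, fun i j _ hij hj => s2 i j hij hj ?_, s3⟩, I.mem⟩
      rw [Nat.div_eq_of_lt (by omega), Nat.div_eq_of_lt (by omega)]
  case ht =>
    simp only [cost_var, cost_lit]
    have hM1 : 1 ≤ M := hM ▸ Nat.one_le_two_pow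
    have e1 : M * (n + μ + 1) * (n + 1) = M * (n + 1) * (n + 1) + M * (μ * (n + 1)) := by ring
    have e2 : M * (1 + 1 + 1 + 300 * ((n + 1) * (n + 1))) = 3 * M + 300 * (M * (n + 1) * (n + 1)) := by
      ring
    have e3 : μ * (1 + 1 + 1 + (M * (1010 * (n + 1)) + 50)) = 53 * μ + 1010 * (M * (μ * (n + 1))) := by
      ring
    have h1 : M * 1 * 1 ≤ M * (n + 1) * (n + 1) := Nat.mul_le_mul (Nat.mul_le_mul_left _ (by omega))
      (by omega)
    have h2 : 1 * (μ * 1) ≤ M * (μ * (n + 1)) := Nat.mul_le_mul hM1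
      (Nat.mul_le_mul_left _ (by omega))
    rw [e1, e2, e3]
    omega

end PackedMap

/-! ## Looking up the records of one word in another: the arithmetic -/

namespace PackedMap

open Finset Stmt
open PackedMap.Expr (var load)

theorem sum_netPerm (a : ℕ) (k y : ℕ → ℕ) :
    ∑ j ∈ range (2 ^ a), y (netPerm a k a j) = ∑ l ∈ range (2 ^ a), y l := by
  refine Finset.sum_nbij' (netPerm a k a) (netInv a k a) ?_ ?_ ?_ ?_ ?_
  · intro i hi
    rw [mem_range] at hi ⊢
    simpa using netPerm_lt (c := 1) k (by simpa using hi)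
  · intro i hi
    rw [mem_range] at hi ⊢
    simpa using netInv_lt (c := 1) k (by simpa using hi)
  · intro i _; exact netInv_netPerm a k a i
  · intro i _; exact netPerm_netInv a k a i
  · intro i _; rfl

theorem sum_prefix_eq (y : ℕ → ℕ) {m K : ℕ} (hm : m < K) :
    ∑ j ∈ range (m + 1), y j = ∑ j ∈ range K, if j ≤ m then y j else 0 := by
  rw [← Finset.sum_filter]
  refine Finset.sum_congr ?_ fun _ _ => rfl
  ext j
  simp only [mem_range, mem_filter]
  omega

/-- After sorting, a prefix sum adds up the payloads of the records with smaller keys. -/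
theorem net_prefix {a i : ℕ} {k x : ℕ → ℕ}
    (hs : ∀ i j, i < j → j < 2 ^ a → ks a k a i ≤ ks a k a j) (hi : i < 2 ^ a)
    (h0 : ∀ l < 2 ^ a, k l = k i → x l = 0) :
    ∑ j ∈ range (netInv a k a i + 1), (x ∘ netPerm a k a) j =
      ∑ l ∈ range (2 ^ a), if k l ≤ k i then x l else 0 := by
  have hm : netInv a k a i < 2 ^ a := by simpa using netInv_lt (c := 1) k (by simpa using hi)
  rw [sum_prefix_eq _ hm, ← sum_netPerm a k (fun l => if k l ≤ k i then x l else 0)]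
  refine Finset.sum_congr rfl fun j hj => ?_
  rw [mem_range] at hj
  rw [ks_eq] at hs
  simp only [Function.comp] at hs ⊢
  -- Positions before that of i hold keys at most k i, later ones hold keys at least k i. A later
  -- key can equal k i, but then its payload is zero by `h0`.
  rcases lt_trichotomy j (netInv a k a i) with h | h | h
  · have := hs _ _ h hm
    rw [netPerm_netInv] at this
    rw [if_pos h.le, if_pos this]
  · rw [h, netPerm_netInv]
    simp
  · have := hs _ _ h hj
    rw [netPerm_netInv] at this
    rw [if_neg (by omega)]
    split_ifs with h1
    · exact (h0 _ (by simpa using netPerm_lt (c := 1) k (by simpa using hj)) (by omega)).symm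
    · rfl

/-- The sum of successive differences from l₀ on telescopes. Monotonicity makes the truncated
subtractions genuine. -/
theorem sum_antitone {g : ℕ → ℕ} {l₀ K : ℕ} (hl : l₀ ≤ K) (hg : ∀ l < K, g (l + 1) ≤ g l)
    (h0 : g K = 0) {P : ℕ → Prop} [DecidablePred P] (hP : ∀ l < K, P l ↔ l₀ ≤ l) :
    ∑ l ∈ range K, (if P l then g l - g (l + 1) else 0) = g l₀ := by
  obtain ⟨d, rfl⟩ := Nat.exists_eq_add_of_le hl
  rw [← Finset.sum_filter]
  have e : (range (l₀ + d)).filter P = Ico l₀ (l₀ + d) := by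
    ext l
    simp only [mem_filter, mem_range, mem_Ico]
    constructor
    · exact fun h => ⟨(hP l h.1).1 h.2, h.1⟩
    · exact fun h => ⟨h.2, (hP l h.2).2 h.1⟩
  rw [e, Finset.sum_Ico_eq_sum_range, Nat.add_sub_cancel_left]
  have : ∀ c ≤ d, ∑ t ∈ range c, (g (l₀ + t) - g (l₀ + t + 1)) + g (l₀ + c) = g l₀ := by
    intro c
    induction c with
    | zero => simp
    | succ c ih =>
      intro hc
      have h1 := ih (by omega)
      have h2 := hg (l₀ + c) (by omega)
      rw [Finset.sum_range_succ, ← add_assoc l₀ c 1]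
      omega
  have := this d le_rfl
  omega

section join

variable (n : ℕ) (xk gk pay : ℕ → ℕ)

/-- The keys of the two words after the first compare-exchange, and the payloads of the second word
at their new places. -/
def joinLo (i : ℕ) : ℕ := if gk i ≤ xk i then gk i else xk i
def joinHi (i : ℕ) : ℕ := if gk i ≤ xk i then xk i else gk i
def payLo (i : ℕ) : ℕ := if gk i ≤ xk i then pay i else 0
def payHi (i : ℕ) : ℕ := if gk i ≤ xk i then 0 else pay i

/-- The prefix sums over the merged sequence, at the places of the first word. -/
def joinRes (i : ℕ) : ℕ :=
  if gk i ≤ xk i then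
    ∑ j ∈ range (2 ^ n), (payLo xk gk pay ∘ netPerm n (joinLo xk gk) n) j +
      ∑ j ∈ range (netInv n (joinHi xk gk) n i + 1), (payHi xk gk pay ∘ netPerm n (joinHi xk gk) n) j
  else ∑ j ∈ range (netInv n (joinLo xk gk) n i + 1), (payLo xk gk pay ∘ netPerm n (joinLo xk gk) n) j

variable {n xk gk pay}

theorem joinLo_eq (n : ℕ) (xk gk : ℕ → ℕ) (i : ℕ) (hi : i < 2 ^ n) :
    joinLo xk gk i = loKey n xk (fun i => gk (2 ^ n - 1 - i)) i := by
  simp only [joinLo, loKey]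
  rw [show 2 ^ n - 1 - (2 ^ n - 1 - i) = i by omega]
  split_ifs <;> omega

theorem joinHi_eq (n : ℕ) (xk gk : ℕ → ℕ) (i : ℕ) (hi : i < 2 ^ n) :
    joinHi xk gk i = hiKey n xk (fun i => gk (2 ^ n - 1 - i)) i := by
  simp only [joinHi, hiKey]
  rw [show 2 ^ n - 1 - (2 ^ n - 1 - i) = i by omega]
  split_ifs <;> omega

/-- The second sequence is already descending, so the two words can be merged without another
reversal. -/
theorem join_sorted (hx : ∀ i j, i < j → j < 2 ^ n → xk i ≤ xk j)
    (hg : ∀ i j, i < j → j < 2 ^ n → gk j ≤ gk i) :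
    (∀ i j, i < j → j < 2 ^ n → ks n (joinLo xk gk) n i ≤ ks n (joinLo xk gk) n j) ∧
    (∀ i j, i < j → j < 2 ^ n → ks n (joinHi xk gk) n i ≤ ks n (joinHi xk gk) n j) ∧
    ∀ i < 2 ^ n, ∀ j < 2 ^ n, joinLo xk gk i ≤ joinHi xk gk j := by
  obtain ⟨h1, h2, h3⟩ := merge_bitonic (y := fun i => gk (2 ^ n - 1 - i)) hx
    fun i j hij hj => hg _ _ (by omega) (by omega)
  have b1 : Bitonic (joinLo xk gk) 0 (2 ^ n) :=
    h1.congr fun i _ hi => (joinLo_eq n xk gk i (by omega)).symm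
  have b2 : Bitonic (joinHi xk gk) 0 (2 ^ n) :=
    h2.congr fun i _ hi => (joinHi_eq n xk gk i (by omega)).symm
  refine ⟨fun i j hij hj => ?_, fun i j hij hj => ?_, fun i hi j hj => ?_⟩
  · exact ks_sorted (h := 0) (by simpa using b1) i j (by omega) hij (by omega)
  · exact ks_sorted (h := 0) (by simpa using b2) i j (by omega) hij (by omega)
  · rw [joinLo_eq n xk gk i hi, joinHi_eq n xk gk j hj]
    exact h3 i hi j hj

theorem payLo_add_payHi (xk gk pay : ℕ → ℕ) (i : ℕ) :
    payLo xk gk pay i + payHi xk gk pay i = pay i := by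
  simp only [payLo, payHi]; split_ifs <;> simp

theorem sum_payLo_add (xk gk pay : ℕ → ℕ) (n : ℕ) :
    ∑ j ∈ range (2 ^ n), (payLo xk gk pay ∘ netPerm n (joinLo xk gk) n) j +
      ∑ j ∈ range (2 ^ n), (payHi xk gk pay ∘ netPerm n (joinHi xk gk) n) j =
        ∑ l ∈ range (2 ^ n), pay l := by
  simp only [Function.comp]
  rw [sum_netPerm n _ (payLo xk gk pay), sum_netPerm n _ (payHi xk gk pay), ← Finset.sum_add_distrib]
  exact Finset.sum_congr rfl fun l _ => payLo_add_payHi xk gk pay l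

theorem joinRes_eq (hx : ∀ i j, i < j → j < 2 ^ n → xk i ≤ xk j)
    (hg : ∀ i j, i < j → j < 2 ^ n → gk j ≤ gk i) (hne : ∀ i j, gk i ≠ xk j) {i : ℕ}
    (hi : i < 2 ^ n) :
    joinRes n xk gk pay i = ∑ l ∈ range (2 ^ n), if gk l ≤ xk i then pay l else 0 := by
  obtain ⟨h1, h2, h3⟩ := join_sorted hx hg
  simp only [joinRes]
  -- If x_i went to the upper word, it lies above every key of the lower word, whose payloads
  -- therefore count in full. If it stayed in the lower word, no payload of the upper word counts,
  -- since the keys there are at least x_i and never equal to it.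
  by_cases hc : gk i ≤ xk i
  · have ehi : joinHi xk gk i = xk i := by simp [joinHi, hc]
    rw [if_pos hc, net_prefix h2 hi, ehi]
    · simp only [Function.comp]
      rw [sum_netPerm n _ (payLo xk gk pay), ← Finset.sum_add_distrib]
      refine Finset.sum_congr rfl fun l hl => ?_
      rw [mem_range] at hl
      have h4 := h3 l hl i hi
      rw [ehi] at h4
      have h5 := hne l i
      by_cases hcl : gk l ≤ xk l
      · simp only [joinLo, hcl, if_true] at h4
        simp [payLo, payHi, hcl, h4]
      · simp [payLo, payHi, joinHi, hcl]
    · intro l hl hli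
      rw [ehi] at hli
      by_cases hcl : gk l ≤ xk l
      · simp [payHi, hcl]
      · simp only [joinHi, hcl, if_false] at hli
        exact absurd hli (hne l i)
  · have elo : joinLo xk gk i = xk i := by simp [joinLo, hc]
    rw [if_neg hc, net_prefix h1 hi, elo]
    · refine Finset.sum_congr rfl fun l hl => ?_
      rw [mem_range] at hl
      have h4 := h3 i hi l hl
      rw [elo] at h4
      have h5 := hne l i
      by_cases hcl : gk l ≤ xk l
      · simp [payLo, joinLo, hcl]
      · simp only [joinHi, hcl, if_false] at h4
        simp [payLo, hcl, show ¬ gk l ≤ xk i by omega]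
    · intro l hl hli
      rw [elo] at hli
      by_cases hcl : gk l ≤ xk l
      · simp only [joinLo, hcl, if_true] at hli
        exact absurd hli (hne l i)
      · simp [payLo, hcl]

end join

/-- The field that the join of the keys `x` with the fields `g` finds for the lane `i`: the fields
are lanes of a key (`z`) and of `f` bits of data, the word of the fields is reversed. -/
theorem joinRes_field {n f : ℕ} {x g : ℕ → ℕ} {xk : ℕ → ℕ} {i : ℕ} (hi : i < 2 ^ n)
    (hxi : xk i = 2 * x i + 1) (hodd : ∀ j, xk j % 2 = 1)
    (hxk : ∀ i j, i < j → j < 2 ^ n → xk i ≤ xk j)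
    (hg : ∀ i j, i < j → j < 2 ^ n → g i ≤ g j)
    (hgq : ∀ i j, i < j → j < 2 ^ n → g i % 2 ^ (2 * f) ≤ g j % 2 ^ (2 * f)) :
    ∃ l₀ ≤ 2 ^ n, (∀ l < 2 ^ n, g (2 ^ n - 1 - l) / 2 ^ f ≤ x i ↔ l₀ ≤ l) ∧
      joinRes n xk (fun i => 2 * (g (2 ^ n - 1 - i) / 2 ^ f))
        (fun i => g (2 ^ n - 1 - i) % 2 ^ (2 * f) -
          if i + 1 < 2 ^ n then g (2 ^ n - 1 - (i + 1)) % 2 ^ (2 * f) else 0) i =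
        if l₀ < 2 ^ n then g (2 ^ n - 1 - l₀) % 2 ^ (2 * f) else 0 := by
  -- In the reversed word keys do not increase along the lanes, so those at most x i fill a final
  -- segment. Its first lane l₀ holds the last field with such a key; l₀ = 2^n means that there is
  -- none.
  obtain ⟨l₀, -, h1, h2⟩ := exists_threshold (P := fun l => g (2 ^ n - 1 - l) / 2 ^ f ≤ x i) (s := 0)
    (n := 2 ^ n) fun a b _ hab hb h =>
      (Nat.div_le_div_right (hg (2 ^ n - 1 - b) (2 ^ n - 1 - a) (by omega) (by omega))).trans h
  rw [Nat.zero_add] at h1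
  refine ⟨l₀, h1, fun l hl => h2 l (Nat.zero_le _) (by omega), ?_⟩
  rw [joinRes_eq hxk _ _ hi]
  · set G : ℕ → ℕ := fun l => if l < 2 ^ n then g (2 ^ n - 1 - l) % 2 ^ (2 * f) else 0 with hG
    have hs := sum_antitone (g := G) (l₀ := l₀) (K := 2 ^ n) h1 (fun l hl => ?_) (by simp [hG])
      (P := fun l => 2 * (g (2 ^ n - 1 - l) / 2 ^ f) ≤ xk i) (fun l hl => ?_)
    · rw [show (if l₀ < 2 ^ n then g (2 ^ n - 1 - l₀) % 2 ^ (2 * f) else 0) = G l₀ from rfl, ← hs]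
      refine Finset.sum_congr rfl fun l hl => ?_
      rw [mem_range] at hl
      simp [hG, hl]
    · simp only [hG, if_pos hl]
      split_ifs with h
      · exact hgq _ _ (by omega) (by omega)
      · exact Nat.zero_le _
    · have := h2 l (Nat.zero_le _) (by omega)
      rw [hxi, ← this]
      omega
  · intro a b hab hb
    have := Nat.div_le_div_right (c := 2 ^ f)
      (hg (2 ^ n - 1 - b) (2 ^ n - 1 - a) (by omega) (by omega))
    omega
  · intro a b
    have := hodd b
    omega

end PackedMap

/-! ### Looking up the records of one word in another: the program -/

namespace PackedMap

open Finset Stmt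
open PackedMap.Expr (var load)

theorem pack_top {B m : ℕ} {a : ℕ → ℕ} (h : ∀ i < m, a i < 2 ^ B) :
    pack B (m + 1) a / 2 ^ (B * m) = a m := by
  rw [pack_succ, Nat.add_mul_div_right _ _ (Nat.two_pow_pos _), Nat.div_eq_of_lt (pack_lt h),
    Nat.zero_add]

/-- The prefix sums of the lanes that the join works with. -/
def prefixLane (K : ℕ) (x : ℕ → ℕ) (i : ℕ) : ℕ := if i < K then ∑ j ∈ range (i + 1), x j else 0

theorem prefixLane_le {K : ℕ} (x : ℕ → ℕ) (i : ℕ) : prefixLane K x i ≤ ∑ j ∈ range K, x j := by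
  unfold prefixLane
  split_ifs with h
  · exact Finset.sum_le_sum_of_subset (by simpa using h)
  · exact Nat.zero_le _

theorem prefix_word {w B q K : ℕ} (F : Fits w B q K) {x : ℕ → ℕ}
    (h : ∑ j ∈ range K, x j < 2 ^ q) :
    (pack B K x * pack B K (fun _ => 1)) &&& pack B K (fun _ => 2 ^ q - 1) =
      pack B K (prefixLane K x) := by
  have hq := F.q_add
  rw [prefix_sums F.B_pos (q := q) _ (by omega)]
  · exact pack_congr fun i hi => by simp [prefixLane, hi]
  · intro i hi
    have := prefixLane_le (K := K) x i
    simp only [prefixLane, hi, if_true] at this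
    omega

/-- Split the fields in `30` into keys (in `32`) and differences of the data (in `33`), and make the
keys of the word `31` odd (in `35`); `34` is the mask of the data bits. -/
def joinSplit : Stmt :=
  .set 50 (var 30) ;; .set 52 (var 8) ;; .set 55 (var 19) ;; .set 53 1 ;; revLoop ;;
  .set 32 (((var 50 >>> var 1) &&& (var 15 * ((2 <<< var 1) - 1))) * 2) ;;
  .set 34 (var 16 - (var 16 >>> var 7)) ;;
  .set 33 (var 50 &&& var 34) ;;
  .set 33 (var 33 - (var 33 >>> var 6)) ;;
  .set 35 (var 31 * 2 + var 18) ;; .skip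

/-- Merge the two words and form prefix sums, at the original places of the word `35`. -/
def joinSums : Stmt :=
  .set 36 (((var 35 + var 16) - var 32) &&& var 16) ;;
  .set 36 (var 36 - (var 36 >>> var 7)) ;;
  .set 37 ((var 35 ^^^ var 32) &&& var 36) ;;
  .set 38 (var 35 ^^^ var 37) ;; .set 32 (var 32 ^^^ var 37) ;;
  .set 39 (var 33 &&& var 36) ;; .set 33 (var 33 ^^^ var 39) ;;
  .set 52 (var 8) ;; .set 53 1 ;; netVar 38 39 9 ;;
  .set 40 (var 54) ;; .set 41 (var 9 + var 0) ;; .set 52 (var 8) ;; .set 53 1 ;;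
  netVar 32 33 41 ;;
  .set 37 ((var 39 * var 15) &&& var 34) ;;
  .set 51 (((var 33 * var 15) &&& var 34) + (var 37 >>> (var 8 - var 6)) * var 15) ;;
  .set 52 (var 6) ;; .set 58 (var 8) ;; unstageLoop ;; .set 38 (var 51) ;;
  .set 51 (var 37) ;; .set 52 (var 6) ;; .set 58 (var 8) ;; .set 54 (var 40) ;; unstageLoop ;;
  .set 37 (var 51 ^^^ ((var 51 ^^^ var 38) &&& var 36)) ;; .skip

/-- Keep the data where the key that has been found is the right one. -/
def joinMatch : Stmt :=
  .set 38 ((var 37 >>> var 1) &&& (var 15 * ((1 <<< var 1) - 1))) ;;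
  .set 38 (((var 38 + var 16) - var 31) &&& var 16) ;;
  .set 38 (var 38 - (var 38 >>> var 7)) ;;
  .set 33 ((var 37 &&& var 17) &&& var 38) ;; .skip

def joinWord : Stmt := joinSplit ;; joinSums ;; joinMatch

theorem joinWord_keeps : joinWord.keeps 30 = true := by decide

theorem unstageLoop_keeps : unstageLoop.keeps 50 = true := by decide

theorem unstageLoop_pure : unstageLoop.pure = true := by decide

theorem Fits.guard_lt {w B q K : ℕ} (F : Fits w B q K) : pack B K (fun _ => 2 ^ q) < 2 ^ w :=
  F.pack_lt fun _ => Nat.pow_lt_pow_right (by omega) (by omega)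

theorem Fits.lt_q {w B q K : ℕ} (F : Fits w B q K) : q < 2 ^ w := by
  refine F.lt_pow ?_
  have := F.le
  have := F.q_add
  have h1 : 1 * B ≤ K * B := Nat.mul_le_mul_right _ F.pos
  omega

theorem guard_sub {w B q K : ℕ} (_ : Fits w B q K) :
    pack B K (fun _ => 2 ^ q) - pack B K (fun _ => 2 ^ q) / 2 ^ q =
      pack B K (fun _ => 2 ^ q - 1) := by
  have : pack B K (fun _ => 2 ^ q) = 2 ^ q * pack B K (fun _ => 1) := by rw [pack_smul]; simp
  rw [this, Nat.mul_div_cancel_left _ (Nat.two_pow_pos q), ← this]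
  exact pack_sub fun i _ => Nat.one_le_two_pow

/-- Keys are read with f + 1 bits because the padding beyond a chunk uses fields of 2f + 1 ones. The
data differences are nonnegative in every lane since the reversed fields do not increase. -/
theorem joinSplit_spec {w f n sc : ℕ} (hf : 2 ≤ f) (F : Fits w (2 * f + 2) (2 * f) (2 ^ n)) {σ : St}
    (g : Glob (2 * f + 2) (2 * f) n sc σ) (h1 : σ.v 1 = f)
    (h15 : σ.v 15 = pack (2 * f + 2) (2 ^ n) (fun _ => 1)) (h19 : σ.v 19 = 2 ^ n * (2 * f + 1))
    {gl x pad : ℕ → ℕ} (hgl : ∀ i, gl i < 2 ^ (2 * f + 1))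
    (hmono : ∀ i j, i < j → j < 2 ^ n → gl i % 2 ^ (2 * f) ≤ gl j % 2 ^ (2 * f))
    (h30 : σ.v 30 = pack (2 * f + 1) (2 ^ n) gl) (h31 : σ.v 31 = pack (2 * f + 2) (2 ^ n) x)
    (h18 : σ.v 18 = pack (2 * f + 2) (2 ^ n) pad) :
    Tr w joinSplit σ (50 * (n + 1) + 80) (fun σ' =>
      σ'.v 32 = pack (2 * f + 2) (2 ^ n) (fun i => 2 * (gl (2 ^ n - 1 - i) / 2 ^ f)) ∧
      σ'.v 33 = pack (2 * f + 2) (2 ^ n) (fun i => gl (2 ^ n - 1 - i) % 2 ^ (2 * f) -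
        if i + 1 < 2 ^ n then gl (2 ^ n - 1 - (i + 1)) % 2 ^ (2 * f) else 0) ∧
      σ'.v 34 = pack (2 * f + 2) (2 ^ n) (fun _ => 2 ^ (2 * f) - 1) ∧
      σ'.v 35 = pack (2 * f + 2) (2 ^ n) (fun i => x i * 2 + pad i)) := by
  have hB : 0 < 2 * f + 2 := by omega
  have hfw : f < 2 ^ w := lt_of_le_of_lt (by omega) F.lt_q
  have hBw : 2 * f + 2 < 2 ^ w := F.lt_pow (by
    have := F.le
    have h1 : 1 * (2 * f + 2) ≤ 2 ^ n * (2 * f + 2) := Nat.mul_le_mul_right _ F.pos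
    omega)
  have hgB : ∀ i, gl i < 2 ^ (2 * f + 2) := fun i => lt_of_le_pow (hgl i) (by omega)
  have hmod : ∀ i, gl (2 ^ n - 1 - i) % 2 ^ (2 * f) < 2 ^ (2 * f + 2) := fun i =>
    lt_of_le_pow (Nat.mod_lt _ (Nat.two_pow_pos _)) (by omega)
  have hgw : pack (2 * f + 2) (2 ^ n) (fun i => gl (2 ^ n - 1 - i)) < 2 ^ w :=
    F.pack_lt fun i => hgl _
  have hmw : pack (2 * f + 2) (2 ^ n) (fun i => gl (2 ^ n - 1 - i) % 2 ^ (2 * f)) < 2 ^ w :=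
    F.pack_lt_q fun i => Nat.mod_lt _ (Nat.two_pow_pos _)
  have hsh : pack (2 * f + 2) (2 ^ n) (fun i => gl (2 ^ n - 1 - i) % 2 ^ (2 * f)) /
      2 ^ (2 * f + 2) = pack (2 * f + 2) (2 ^ n) (fun i =>
        if i + 1 < 2 ^ n then gl (2 ^ n - 1 - (i + 1)) % 2 ^ (2 * f) else 0) := by
    have := pack_shr (K := 2 ^ n) hB (fun i _ => hmod i) 1
    rwa [one_mul] at this
  apply Tr.le
  case h =>
    unfold joinSplit
    apply Tr.set (x := pack (2 * f + 1) (2 ^ n) gl)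
    · simp
    · simp [h30]
    apply Tr.set (x := 2 ^ n * (2 * f + 2))
    · simp
    · simp [g.v8]
    apply Tr.set (x := 2 ^ n * (2 * f + 1))
    · simp
    · simp [h19]
    apply Tr.set (x := 1)
    · simp
    · simp
    apply Tr.seq
    · exact Tr.frame 50 (revLoop_spec (A := 2 * f + 1) (B := 2 * f + 2) (n := n) (c := 2 * f + 1)
        (x := gl) (by omega) le_rfl (by omega) (by omega) hgl F.le F.w_big (by simp [g.v6]) (by simp)
        (by simp) (by simp) (by simp)) revLoop_keeps
    rintro σ1 ⟨a1, a2⟩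
    apply Tr.set (x := pack (2 * f + 2) (2 ^ n) (fun i => 2 * (gl (2 ^ n - 1 - i) / 2 ^ f)))
    · simp [a1, a2, hgw, h1, hfw]
      have := Nat.two_pow_pos f
      omega
    · have e1 : σ1.v 15 * (2 * 2 ^ f - 1) = pack (2 * f + 2) (2 ^ n) (fun _ => 2 ^ (f + 1) - 1) := by
        rw [a2 15 (by omega)]
        simp [h15, pack_mul_const, pow_succ']
      have e2 := pack_shr_and (W := 2 * f + 2) (s := f) (s' := f + 1) (c := 2 ^ n)
        (Y := fun i => gl (2 ^ n - 1 - i)) (by omega) (by omega) (fun i _ => hgB _)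
      simp only [eval_mul, eval_and, eval_shr, eval_var, eval_sub, eval_shl, eval_lit]
      rw [a2 1 (by omega)]
      simp only [St.set_v, Nat.reduceEqDiff, if_false, h1]
      rw [e1, a1, e2, pack_mul_const]
      refine pack_congr fun i _ => ?_
      rw [Nat.mod_eq_of_lt, mul_comm]
      rw [Nat.div_lt_iff_lt_mul (Nat.two_pow_pos f), ← pow_add]
      exact lt_of_le_pow (hgl _) (by omega)
    apply Tr.set (x := pack (2 * f + 2) (2 ^ n) (fun _ => 2 ^ (2 * f) - 1))
    · simp [a2, g.v16, g.v7, F.guard_lt, F.lt_q, Nat.div_le_self]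
    · simp [a2, g.v16, g.v7, guard_sub F]
    apply Tr.set (x := pack (2 * f + 2) (2 ^ n) (fun i => gl (2 ^ n - 1 - i) % 2 ^ (2 * f)))
    · simp
    · simp only [eval_and, eval_var, St.set_v, Nat.reduceEqDiff, if_false, if_true, a1]
      rw [pack_and hB (fun i _ => hgB _) (fun i _ => lt_of_le_pow (two_pow_sub_one_lt _) (by omega))]
      exact pack_congr fun i _ => Nat.and_two_pow_sub_one_eq_mod _ _
    apply Tr.set (x := pack (2 * f + 2) (2 ^ n) (fun i => gl (2 ^ n - 1 - i) % 2 ^ (2 * f) -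
        if i + 1 < 2 ^ n then gl (2 ^ n - 1 - (i + 1)) % 2 ^ (2 * f) else 0))
    · simp [a2, g.v6, hmw, hBw, Nat.div_le_self]
    · simp only [eval_sub, eval_shr, eval_var, St.set_v, Nat.reduceEqDiff, if_false, if_true,
        a2 6 (by omega), g.v6]
      rw [hsh]
      refine pack_sub fun i hi => ?_
      split_ifs with h
      · exact hmono _ _ (by omega) (by omega)
      · exact Nat.zero_le _
    apply Tr.set (x := pack (2 * f + 2) (2 ^ n) (fun i => x i * 2 + pad i))
    · simp
    · simp [a2, h31, h18, pack_mul_const, pack_add]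
    apply Tr.skip
    exact ⟨by simp, by simp, by simp, by simp⟩
  case ht => simp; omega

/-- The two networks store their masks in separate areas, at `sc` and at `sc + w`, because both are
undone after the prefix sums have been formed. A final selection takes the sum from the word to
which the comparison sent x_i. -/
theorem joinSums_spec {w B q n sc : ℕ} (F : Fits w B q (2 ^ n)) (hsc : sc + w + n ≤ 2 ^ w)
    (hnw : n ≤ w) {σ : St} (g : Glob B q n sc σ) (h0 : σ.v 0 = w)
    (h15 : σ.v 15 = pack B (2 ^ n) (fun _ => 1)) {xk gk pay : ℕ → ℕ} (hx : ∀ i, xk i < 2 ^ q)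
    (hgk : ∀ i, gk i < 2 ^ q) (hpay : ∀ i, pay i < 2 ^ q)
    (hsum : ∑ l ∈ range (2 ^ n), pay l < 2 ^ q)
    (h32 : σ.v 32 = pack B (2 ^ n) gk) (h33 : σ.v 33 = pack B (2 ^ n) pay)
    (h34 : σ.v 34 = pack B (2 ^ n) (fun _ => 2 ^ q - 1)) (h35 : σ.v 35 = pack B (2 ^ n) xk) :
    Tr w joinSums σ (500 * (n + 1)) (fun σ' =>
      (∀ i < 2 ^ n, joinRes n xk gk pay i < 2 ^ q) ∧
      σ'.v 37 = pack B (2 ^ n) (joinRes n xk gk pay) ∧ ∀ i < sc, σ'.m i = σ.m i) := by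
  have hB := F.B_pos
  have hqB := F.q_add
  have hqle : q ≤ B := by omega
  obtain ⟨c1, c2, c3, c4⟩ := cross_masks F hx hgk rfl
  obtain ⟨ck1, ck2⟩ := cross_swap hB hqle (K := 2 ^ n) (fun i _ => hx i)
    (fun i _ => hgk i) (fun i => gk i ≤ xk i) rfl
  have hpl := pack_and_mask hB hqle (K := 2 ^ n) (fun i _ => hpay i) (fun i => gk i ≤ xk i)
  change _ = pack B (2 ^ n) (joinLo xk gk) at ck1
  change _ = pack B (2 ^ n) (joinHi xk gk) at ck2
  change _ = pack B (2 ^ n) (payLo xk gk pay) at hpl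
  have blo : ∀ i, joinLo xk gk i < 2 ^ q := fun i => by
    simp only [joinLo]; split_ifs; exacts [hgk i, hx i]
  have bhi : ∀ i, joinHi xk gk i < 2 ^ q := fun i => by
    simp only [joinHi]; split_ifs; exacts [hx i, hgk i]
  have bpl : ∀ i, payLo xk gk pay i < 2 ^ q := fun i => by
    have := payLo_add_payHi xk gk pay i; have := hpay i; omega
  have bph : ∀ i, payHi xk gk pay i < 2 ^ q := fun i => by
    have := payLo_add_payHi xk gk pay i; have := hpay i; omega
  have hph : pack B (2 ^ n) pay ^^^ pack B (2 ^ n) (payLo xk gk pay) =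
      pack B (2 ^ n) (payHi xk gk pay) := by
    rw [pack_xor hB (fun i _ => lt_of_le_pow (hpay i) hqle)
      (fun i _ => lt_of_le_pow (bpl i) hqle)]
    refine pack_congr fun i _ => ?_
    simp only [payLo, payHi]
    split_ifs <;> simp
  set sl := payLo xk gk pay ∘ netPerm n (joinLo xk gk) n with hsl
  set sh := payHi xk gk pay ∘ netPerm n (joinHi xk gk) n with hsh
  have htot : ∑ j ∈ range (2 ^ n), sl j + ∑ j ∈ range (2 ^ n), sh j < 2 ^ q := by
    rw [sum_payLo_add]; exact hsum
  set T := ∑ j ∈ range (2 ^ n), sl j with hT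
  set s1 := prefixLane (2 ^ n) sl with hs1
  set s2 : ℕ → ℕ := fun i => prefixLane (2 ^ n) sh i + T with hs2
  have b1 : ∀ i, s1 i < 2 ^ q := fun i => (prefixLane_le sl i).trans_lt (by omega)
  have b2 : ∀ i, s2 i < 2 ^ q := fun i => by
    have := prefixLane_le (K := 2 ^ n) sh i
    simp only [hs2]
    omega
  have hw1 := prefix_word F (x := sl) (by omega)
  have hw2 := prefix_word F (x := sh) (by omega)
  -- The top lane of the lower prefix sums is their total. It has to be added to every prefix sum of
  -- the upper word.
  have htop : pack B (2 ^ n) s1 / 2 ^ (2 ^ n * B - B) = T := by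
    obtain ⟨m, hm⟩ := Nat.exists_eq_succ_of_ne_zero (Nat.two_pow_pos n).ne'
    rw [Nat.succ_eq_add_one] at hm
    have e1 : 2 ^ n * B - B = B * m := by rw [hm, Nat.succ_mul, Nat.add_sub_cancel, mul_comm]
    have e2 : pack B (2 ^ n) s1 = pack B (m + 1) s1 := by rw [← hm]
    rw [e1, e2, pack_top (fun i _ => lt_of_le_pow (b1 i) hqle), hs1, hT]
    simp [prefixLane, hm]
  have hin : ∀ k, ∀ i < 2 ^ n, netInv n k n i < 2 ^ n := fun k i hi => by
    simpa using netInv_lt (c := 1) k (by simpa using hi)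
  have hres : ∀ i < 2 ^ n, joinRes n xk gk pay i = if gk i ≤ xk i then
      (s2 ∘ netInv n (joinHi xk gk) n) i else (s1 ∘ netInv n (joinLo xk gk) n) i := by
    intro i hi
    simp only [joinRes, Function.comp, hs1, hs2, prefixLane, hin _ i hi, if_true, hT, hsl, hsh]
    split_ifs
    · rw [add_comm]
    · rfl
  obtain ⟨r1, -⟩ := cross_swap hB hqle (K := 2 ^ n)
    (fun i _ => b1 (netInv n (joinLo xk gk) n i)) (fun i _ => b2 (netInv n (joinHi xk gk) n i))
    (fun i => gk i ≤ xk i) rfl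
  have hKw : 2 ^ n * B < 2 ^ w := F.lt_pow F.le
  have hBK : B ≤ 2 ^ n * B := Nat.le_mul_of_pos_left _ (Nat.two_pow_pos n)
  apply Tr.le
  case h =>
    unfold joinSums
    apply Tr.set
    · simpa [h35, h32, g.v16] using c1
    · simp only [eval_and, eval_sub, eval_add, eval_var, h35, h32, g.v16]
      rfl
    apply Tr.set (x := maskOf B (2 ^ n) q (fun i => gk i ≤ xk i))
    · simpa [g.v7, F.lt_q] using ⟨c3, c2⟩
    · simpa [g.v7] using c4
    apply Tr.set
    · simp
    · simp [h35, h32]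
      rfl
    apply Tr.set (x := pack B (2 ^ n) (joinLo xk gk))
    · simp
    · simpa [h35] using ck1
    apply Tr.set (x := pack B (2 ^ n) (joinHi xk gk))
    · simp
    · simpa [h32] using ck2
    apply Tr.set (x := pack B (2 ^ n) (payLo xk gk pay))
    · simp
    · simpa [h33] using hpl
    apply Tr.set (x := pack B (2 ^ n) (payHi xk gk pay))
    · simp
    · simpa [h33] using hph
    apply Tr.set (x := 2 ^ n * B)
    · simp
    · simp [g.v8]
    apply Tr.set (x := 1)
    · simp
    · simp
    apply Tr.seq
    · exact netVar_spec (a := 38) (b := 39) (d := 9) (sc := sc) (sc' := sc) (l := n) (c := 1) F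
        (by omega) (by omega) (by omega) (by omega) (by simp) (by omega)
        ⟨by simp [g.v6], by simp [g.v7], by simp [g.v8], by simp [g.v9], by simp [g.v16]⟩
        blo bpl (by simp) (by simp) (by simp) (by simp) (by simp [g.v9])
    rintro σ1 ⟨-, d2, d3, d4, d5, d6⟩
    apply Tr.set (x := sc + n)
    · simp
    · simp [d5]
    apply Tr.set (x := sc + w)
    · simp
    · simp [d3, g.v9, h0]
    apply Tr.set (x := 2 ^ n * B)
    · simp
    · simp [d3, g.v8]
    apply Tr.set (x := 1)
    · simp
    · simp
    apply Tr.seq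
    · refine netVar_spec (a := 32) (b := 33) (d := 41) (sc := sc) (sc' := sc + w) (l := n) (c := 1)
        (k := joinHi xk gk) (x := payHi xk gk pay) F
        (by omega) (by omega) (by omega) (by omega) (by simp) hsc ⟨?_, ?_, ?_, ?_, ?_⟩
        bhi bph ?_ ?_ (by simp) (by simp) (by simp) <;>
      · simp [d3, g.v6, g.v7, g.v8, g.v9, g.v16]
    rintro σ2 ⟨-, e2, e3, e4, e5, e6⟩
    have f39 : σ2.v 39 = pack B (2 ^ n) sl := by rw [e3 _ (by omega) (by omega) (by omega)]; simp [d2, hsl]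
    have f34 : σ2.v 34 = pack B (2 ^ n) (fun _ => 2 ^ q - 1) := by
      rw [e3 _ (by omega) (by omega) (by omega)]; simp [d3, h34]
    have f15 : σ2.v 15 = pack B (2 ^ n) (fun _ => 1) := by
      rw [e3 _ (by omega) (by omega) (by omega)]; simp [d3, h15]
    have f36 : σ2.v 36 = maskOf B (2 ^ n) q (fun i => gk i ≤ xk i) := by
      rw [e3 _ (by omega) (by omega) (by omega)]; simp [d3]
    have f40 : σ2.v 40 = sc + n := by
      rw [e3 _ (by omega) (by omega) (by omega)]; simp
    have f8 : σ2.v 8 = 2 ^ n * B := by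
      rw [e3 _ (by omega) (by omega) (by omega)]; simp [d3, g.v8]
    have f6 : σ2.v 6 = B := by
      rw [e3 _ (by omega) (by omega) (by omega)]; simp [d3, g.v6]
    apply Tr.set (x := pack B (2 ^ n) s1)
    · simp
    · simpa [f39, f15, f34] using hw1
    apply Tr.set (x := pack B (2 ^ n) s2)
    · simp [f8, f6, F.pack_lt_q b1, hBK]
      omega
    · simp [e2, f15, f34, f8, f6, htop]
      rw [hw2, pack_smul, pack_add]
      simp [hs2]
    apply Tr.set (x := B)
    · simp
    · simp [f6]
    apply Tr.set (x := 2 ^ n * B)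
    · simp
    · simp [f8]
    apply Tr.seq
    · refine Tr.frameMem (Tr.frame 50 (unstageLoop_spec (a := n) (c := 1) (mp := sc + w)
        (k := joinHi xk gk) (s := s2) F (by simp) hsc b2 (by simpa using e6)
        ⟨by simp, by simp [undo], by simp, by simp [e5], rfl⟩) unstageLoop_keeps) unstageLoop_pure
    rintro σ3 ⟨⟨⟨p1, -⟩, p2⟩, p3⟩
    apply Tr.set (x := pack B (2 ^ n) (s2 ∘ netInv n (joinHi xk gk) n))
    · simp
    · simpa using p1
    apply Tr.set (x := pack B (2 ^ n) s1)
    · simp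
    · simp [p2]
    apply Tr.set (x := B)
    · simp
    · simp [p2, f6]
    apply Tr.set (x := 2 ^ n * B)
    · simp
    · simp [p2, f8]
    apply Tr.set (x := sc + n)
    · simp
    · simp [p2, f40]
    apply Tr.seq
    · refine Tr.frameMem (Tr.frame 50 (unstageLoop_spec (a := n) (c := 1) (mp := sc)
        (k := joinLo xk gk) (s := s1) F (by simp) (by omega) b1 ?_
        ⟨by simp, by simp [undo], by simp, by simp, rfl⟩) unstageLoop_keeps) unstageLoop_pure
      intro i hi
      simp only [St.set_m, p3]
      rw [e4 _ (by omega)]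
      simpa using d6 i hi
    rintro σ4 ⟨⟨⟨t1, -⟩, t2⟩, t3⟩
    apply Tr.set (x := pack B (2 ^ n) (joinRes n xk gk pay))
    · simp
    · simp [t1, t2, p2, f36]
      refine Eq.trans r1 (pack_congr fun i hi => ?_)
      rw [hres i hi]
      rfl
    apply Tr.skip
    refine ⟨fun i hi => ?_, by simp, fun i hi => ?_⟩
    · rw [hres i hi]
      split_ifs
      exacts [b2 _, b1 _]
    · simp only [St.set_m, t3, p3]
      rw [e4 _ (by omega)]
      simp only [St.set_m]
      rw [d4 _ hi]
      simp
  case ht => clear * -; simp; omega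

/-- The prefix sum yields a key that does not exceed x, so testing x ≤ key amounts to testing
equality. A missing field shows as R = 0, whose data are zero. -/
theorem joinMatch_spec {w f n sc K' : ℕ} (hf : 1 ≤ f) (F : Fits w (2 * f + 2) (2 * f) (2 ^ n)) {σ : St}
    (g : Glob (2 * f + 2) (2 * f) n sc σ) (h1 : σ.v 1 = f)
    (h15 : σ.v 15 = pack (2 * f + 2) (2 ^ n) (fun _ => 1))
    (h17 : σ.v 17 = pack (2 * f + 2) (2 ^ n) (fun i => if i < K' then 2 ^ f - 1 else 0))
    {x R : ℕ → ℕ} (hx : ∀ i, x i < 2 ^ f) (hR : ∀ i < 2 ^ n, R i < 2 ^ (2 * f))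
    (h31 : σ.v 31 = pack (2 * f + 2) (2 ^ n) x) (h37 : σ.v 37 = pack (2 * f + 2) (2 ^ n) R) :
    Tr w joinMatch σ 100 (fun σ' => σ'.v 33 = pack (2 * f + 2) (2 ^ n)
      (fun i => if x i ≤ R i / 2 ^ f ∧ i < K' then R i % 2 ^ f else 0)) := by
  have hB : 0 < 2 * f + 2 := by omega
  have hfw : f < 2 ^ w := lt_of_le_of_lt (by omega) F.lt_q
  have hRw : pack (2 * f + 2) (2 ^ n) R < 2 ^ w := by
    have := F.pack_lt_q (x := fun i => if i < 2 ^ n then R i else 0) fun i => by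
      split_ifs with h
      exacts [hR i h, Nat.two_pow_pos _]
    rwa [pack_congr (b := R) fun i hi => by simp [hi]] at this
  have e2 := pack_shr_and (W := 2 * f + 2) (s := f) (s' := f) (c := 2 ^ n) (Y := R) (by omega)
    (by omega) (fun i hi => lt_of_le_pow (hR i hi) (by omega))
  have hz : ∀ i, R i / 2 ^ f % 2 ^ f < 2 ^ (2 * f) := fun i =>
    lt_of_le_pow (Nat.mod_lt _ (Nat.two_pow_pos _)) (by omega)
  obtain ⟨c1, c2, c3, c4⟩ := cross_masks F hz (fun i => lt_of_le_pow (hx i) (by omega)) rfl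
  have hf17 : ∀ i, (if i < K' then 2 ^ f - 1 else 0) < 2 ^ (2 * f + 2) := fun i =>
    dirMask_lane_lt (by omega) _
  apply Tr.le
  case h =>
    unfold joinMatch
    apply Tr.set (x := pack (2 * f + 2) (2 ^ n) (fun i => R i / 2 ^ f % 2 ^ f))
    · simp [h1, h37, hRw, hfw, Nat.one_le_two_pow]
    · simp only [eval_and, eval_shr, eval_mul, eval_sub, eval_shl, eval_var, eval_lit, h37, h1, h15,
        pack_mul_const, one_mul]
      exact e2
    apply Tr.set
    · simpa [h31, g.v16] using c1
    · simp only [eval_and, eval_sub, eval_add, eval_var, St.set_v, if_true, Nat.reduceEqDiff,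
        if_false, h31, g.v16]
      rfl
    apply Tr.set (x := maskOf (2 * f + 2) (2 ^ n) (2 * f) (fun i => x i ≤ R i / 2 ^ f % 2 ^ f))
    · simpa [g.v7, F.lt_q] using ⟨c3, c2⟩
    · simpa [g.v7] using c4
    apply Tr.set (x := pack (2 * f + 2) (2 ^ n)
      (fun i => if x i ≤ R i / 2 ^ f ∧ i < K' then R i % 2 ^ f else 0))
    · simp
    · simp only [eval_and, eval_var, St.set_v, if_true, Nat.reduceEqDiff, if_false, h37, h17]
      rw [pack_and hB (fun i hi => lt_of_le_pow (hR i hi) (by omega)) (fun i _ => hf17 i),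
        pack_and_mask hB (show 2 * f ≤ 2 * f + 2 by omega)]
      · refine pack_congr fun i hi => ?_
        have h2 : R i / 2 ^ f % 2 ^ f = R i / 2 ^ f := by
          rw [Nat.mod_eq_of_lt]
          rw [Nat.div_lt_iff_lt_mul (Nat.two_pow_pos f), ← pow_add, ← two_mul]
          exact hR i hi
        rw [h2]
        by_cases h3 : i < K'
        · simp [h3, Nat.and_two_pow_sub_one_eq_mod]
        · simp [h3]
      · exact fun i hi => and_lt_left (hR i hi)
    apply Tr.skip
    simp
  case ht => simp

/-- The constants for the join of words with `2 ^ n` lanes, of which the first `K'` are in use. -/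
structure JoinGlob (w f n sc K' : ℕ) (σ : St) : Prop where
  glob : Glob (2 * f + 2) (2 * f) n sc σ
  v0 : σ.v 0 = w
  v1 : σ.v 1 = f
  v15 : σ.v 15 = pack (2 * f + 2) (2 ^ n) (fun _ => 1)
  v17 : σ.v 17 = pack (2 * f + 2) (2 ^ n) (fun i => if i < K' then 2 ^ f - 1 else 0)
  v18 : σ.v 18 = pack (2 * f + 2) (2 ^ n) (fun i => if i < K' then 1 else 2 ^ (2 * f) - 1)
  v19 : σ.v 19 = 2 ^ n * (2 * f + 1)

theorem JoinGlob.of_eq {w f n sc K' : ℕ} {σ σ' : St} (h : JoinGlob w f n sc K' σ)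
    (he : ∀ i < 20, σ'.v i = σ.v i) : JoinGlob w f n sc K' σ' :=
  ⟨h.glob.of_eq he, (he 0 (by omega)).trans h.v0, (he 1 (by omega)).trans h.v1,
    (he 15 (by omega)).trans h.v15, (he 17 (by omega)).trans h.v17,
    (he 18 (by omega)).trans h.v18, (he 19 (by omega)).trans h.v19⟩

/-- `c` is the result of looking up `x` in the fields `gl t` with `t < K`. -/
def Looked (f K : ℕ) (gl : ℕ → ℕ) (x c : ℕ) : Prop :=
  (∀ t < K, gl t / 2 ^ f = x → (∀ t', t < t' → t' < K → x < gl t' / 2 ^ f) → c = gl t % 2 ^ f) ∧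
    ((∀ t < K, gl t / 2 ^ f ≠ x) → c = 0)

/-- A field of 2f + 1 ones has a key of at least 2^f, above every x, so padding is never found. -/
theorem pad_div (f : ℕ) : 2 ^ f ≤ (2 ^ (2 * f + 1) - 1) / 2 ^ f := by
  rw [Nat.le_div_iff_mul_le (Nat.two_pow_pos f), ← pow_add, ← two_mul, pow_succ]
  have := Nat.two_pow_pos (2 * f)
  omega

/-- The work lies in checking that padding disturbs nothing: fields beyond the chunk act as a
largest key, unused lanes of the x word get the largest odd key, and the order needed by the merge
persists on both sides. -/
theorem joinWord_spec {w f n sc K' : ℕ} (hf : 2 ≤ f) (F : Fits w (2 * f + 2) (2 * f) (2 ^ n))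
    (hsc : sc + w + n ≤ 2 ^ w) (hnw : n ≤ w) (hK' : K' ≤ 2 ^ n) {σ : St}
    (g : JoinGlob w f n sc K' σ) {gl x : ℕ → ℕ}
    (hgl : ∀ i, gl i < 2 ^ (2 * f) ∨ gl i = 2 ^ (2 * f + 1) - 1)
    (hmono : ∀ i j, i < j → j < 2 ^ n → gl i ≤ gl j) (hx : ∀ i, x i < 2 ^ f)
    (hxs : ∀ i j, i < j → j < K' → x i ≤ x j)
    (h30 : σ.v 30 = pack (2 * f + 1) (2 ^ n) gl)
    (h31 : σ.v 31 = pack (2 * f + 2) (2 ^ n) (fun i => if i < K' then x i else 0)) :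
    Tr w joinWord σ (800 * (n + 1)) (fun σ' => (∃ c, σ'.v 33 = pack (2 * f + 2) (2 ^ n) c ∧
      (∀ i, K' ≤ i → c i = 0) ∧ ∀ i < K', Looked f (2 ^ n) gl (x i) (c i)) ∧
      ∀ i < sc, σ'.m i = σ.m i) := by
  have hq1 : 2 ^ (2 * f + 1) = 2 * 2 ^ (2 * f) := by rw [pow_succ]; ring
  have hqpos := Nat.two_pow_pos (2 * f)
  have hq2 : 2 ^ (2 * f) = 2 ^ f * 2 ^ f := by rw [← pow_add, two_mul]
  have hglt : ∀ i, gl i < 2 ^ (2 * f + 1) := fun i => by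
    rcases hgl i with h | h <;> omega
  have hmodpad : (2 ^ (2 * f + 1) - 1) % 2 ^ (2 * f) = 2 ^ (2 * f) - 1 := by
    rw [hq1, show 2 * 2 ^ (2 * f) - 1 = 2 ^ (2 * f) - 1 + 2 ^ (2 * f) by omega, Nat.add_mod_right,
      Nat.mod_eq_of_lt (by omega)]
  have hmm : ∀ i j, i < j → j < 2 ^ n → gl i % 2 ^ (2 * f) ≤ gl j % 2 ^ (2 * f) := by
    intro i j hij hj
    have h1 := hmono i j hij hj
    have h2 := Nat.mod_lt (gl i) hqpos
    rcases hgl j with h | h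
    · rw [Nat.mod_eq_of_lt h, Nat.mod_eq_of_lt (by omega)]
      exact h1
    · rw [h, hmodpad]
      omega
  set xk : ℕ → ℕ := fun i => if i < K' then 2 * x i + 1 else 2 ^ (2 * f) - 1 with hxk
  -- The doubled keys, padding included, stay below 4 · 2^f. They fit into the 2f data bits because
  -- f ≥ 2.
  have h2f : 4 * 2 ^ f ≤ 2 ^ (2 * f) := by
    rw [hq2]
    refine Nat.mul_le_mul_right _ ?_
    calc 4 = 2 ^ 2 := by norm_num
      _ ≤ 2 ^ f := Nat.pow_le_pow_right (by omega) hf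
  have hfpos := Nat.two_pow_pos f
  have hxklt : ∀ i, xk i < 2 ^ (2 * f) := fun i => by
    have := hx i
    simp only [hxk]
    split_ifs <;> omega
  have hodd : ∀ i, xk i % 2 = 1 := fun i => by
    have : 2 ^ (2 * f) % 2 = 0 := by
      rw [show 2 * f = (2 * f - 1) + 1 by omega, pow_succ]; omega
    simp only [hxk]
    split_ifs <;> omega
  have hxks : ∀ i j, i < j → j < 2 ^ n → xk i ≤ xk j := by
    intro i j hij hj
    simp only [hxk]
    by_cases h1 : j < K'
    · have := hxs i j hij h1
      rw [if_pos h1, if_pos (by omega)]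
      omega
    · have := hx i
      rw [if_neg h1]
      split_ifs <;> omega
  have hgk : ∀ i, 2 * (gl (2 ^ n - 1 - i) / 2 ^ f) < 2 ^ (2 * f) := fun i => by
    have h1 : gl (2 ^ n - 1 - i) / 2 ^ f < 2 ^ (f + 1) := by
      rw [Nat.div_lt_iff_lt_mul hfpos, ← pow_add]
      exact lt_of_le_pow (hglt _) (by omega)
    rw [pow_succ] at h1
    omega
  set pay : ℕ → ℕ := fun i => gl (2 ^ n - 1 - i) % 2 ^ (2 * f) -
    if i + 1 < 2 ^ n then gl (2 ^ n - 1 - (i + 1)) % 2 ^ (2 * f) else 0 with hpay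
  have hpaylt : ∀ i, pay i < 2 ^ (2 * f) := fun i =>
    (Nat.sub_le _ _).trans_lt (Nat.mod_lt _ hqpos)
  have hsum : ∑ l ∈ range (2 ^ n), pay l < 2 ^ (2 * f) := by
    set G : ℕ → ℕ := fun l => if l < 2 ^ n then gl (2 ^ n - 1 - l) % 2 ^ (2 * f) else 0 with hG
    have h1 := sum_antitone (g := G) (l₀ := 0) (K := 2 ^ n) (Nat.zero_le _) (fun l hl => by
      simp only [hG, if_pos hl]
      split_ifs
      · exact hmm _ _ (by omega) (by omega)
      · exact Nat.zero_le _) (by simp [hG]) (P := fun _ => True) (by simp)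
    have h2 : ∑ l ∈ range (2 ^ n), pay l = G 0 := by
      rw [← h1]
      refine Finset.sum_congr rfl fun l hl => ?_
      rw [mem_range] at hl
      simp [hpay, hG, hl]
    rw [h2]
    simp only [hG]
    split_ifs
    exacts [Nat.mod_lt _ hqpos, hqpos]
  apply Tr.le
  case h =>
    unfold joinWord
    apply Tr.seq
    · exact Tr.frameMem (Tr.frame 32 (joinSplit_spec hf F g.glob g.v1 g.v15 g.v19 hglt hmm h30 h31
        g.v18) (by decide)) (by decide)
    rintro σ1 ⟨⟨⟨a1, a2, a3, a4⟩, a5⟩, a6⟩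
    have g1 := g.of_eq fun i hi => a5 i (by omega)
    apply Tr.seq
    · refine Tr.frame 32 (joinSums_spec (xk := xk) F hsc hnw g1.glob g1.v0 g1.v15 hxklt hgk hpaylt hsum
        a1 a2 a3 ?_) (by decide)
      rw [a4]
      refine pack_congr fun i _ => ?_
      simp only [hxk]
      split_ifs <;> omega
    rintro σ2 ⟨⟨b1, b2, b3⟩, b4⟩
    have g2 := g1.of_eq fun i hi => b4 i (by omega)
    refine Tr.frameMem (joinMatch_spec (by omega) F g2.glob g2.v1 g2.v15 g2.v17 (fun i => ?_) b1
      ((b4 31 (by omega)).trans ((a5 31 (by omega)).trans h31)) b2) (by decide) |>.imp ?_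
    · split_ifs
      exacts [hx i, hfpos]
    rintro σ3 ⟨c1, c2⟩
    refine ⟨⟨_, c1, fun i hi => by simp [show ¬ i < K' by omega], fun i hi => ?_⟩, fun i hi => by
      rw [c2, b3 i hi, a6]⟩
    simp only [hi, if_true, and_true]
    obtain ⟨l₀, l1, l2, l3⟩ := joinRes_field (f := f) (x := x) (g := gl) (xk := xk) (i := i)
      (by omega) (by simp [hxk, hi]) hodd hxks hmono hmm
    rw [← hpay] at l3
    rw [l3]
    -- A field whose key is at most x i cannot be padding, so reducing it modulo 2^(2f) has changed
    -- nothing.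
    have hnp : ∀ t, gl t / 2 ^ f ≤ x i → gl t % 2 ^ (2 * f) = gl t := by
      intro t ht
      rcases hgl t with h | h
      · exact Nat.mod_eq_of_lt h
      · have := hx i
        have := pad_div f
        rw [h] at ht
        omega
    constructor
    · intro t ht he hlast
      have h1 := (l2 (2 ^ n - 1 - t) (by omega)).1 (by
        rw [show 2 ^ n - 1 - (2 ^ n - 1 - t) = t by omega]; exact he.le)
      -- The field t qualifies, so l₀ cannot come after its lane; an earlier lane would mean a later
      -- field with key at most x, which is excluded.
      have h2 : l₀ = 2 ^ n - 1 - t := by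
        by_contra hne
        have h3 := (l2 l₀ (by omega)).2 le_rfl
        have h4 := hlast (2 ^ n - 1 - l₀) (by omega) (by omega)
        omega
      rw [if_pos (show l₀ < 2 ^ n by omega), show 2 ^ n - 1 - l₀ = t by omega, hnp t he.le, he]
      simp
    · intro hno
      by_cases h : l₀ < 2 ^ n
      · have h3 := (l2 l₀ h).2 le_rfl
        have h4 := hno (2 ^ n - 1 - l₀) (by omega)
        rw [if_pos h, hnp _ h3, if_neg (by omega)]
      · rw [if_neg h]
        simp
  case ht => clear * -; omega

end PackedMap

/-! ## The join of a sorted array of words with the packed function -/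

namespace PackedMap

open Finset Stmt
open PackedMap.Expr (var load)

theorem pack_extract {A s off c : ℕ} {a : ℕ → ℕ} (h : off + c ≤ s) (ha : ∀ i, a i < 2 ^ A) :
    (pack A s a / 2 ^ (A * off)) &&& (2 ^ (A * c) - 1) = pack A c (fun i => a (off + i)) := by
  obtain ⟨d, rfl⟩ := Nat.exists_eq_add_of_le h
  rw [Nat.and_two_pow_sub_one_eq_mod, add_assoc, pack_append,
    Nat.add_mul_div_right _ _ (Nat.two_pow_pos _), Nat.div_eq_of_lt (pack_lt fun i _ => ha i),
    Nat.zero_add, pack_append, Nat.add_mul_mod_self_right, Nat.mod_eq_of_lt (pack_lt fun i _ => ha _)]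

theorem pack_pad {A c K : ℕ} (h : c ≤ K) (a : ℕ → ℕ) :
    pack A c a + (2 ^ (A * K) - 2 ^ (A * c)) =
      pack A K (fun i => if i < c then a i else 2 ^ A - 1) := by
  obtain ⟨d, rfl⟩ := Nat.exists_eq_add_of_le h
  rw [pack_append]
  congr 1
  · exact pack_congr fun i hi => by simp [hi]
  · rw [pack_congr (b := fun _ => 2 ^ A - 1) (fun i _ => by simp), pack_ones, Nat.sub_mul, one_mul,
      ← pow_add]
    congr 2
    ring

theorem pack_extend {B K K' : ℕ} (h : K' ≤ K) (x : ℕ → ℕ) :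
    pack B K (fun i => if i < K' then x i else 0) = pack B K' x := by
  obtain ⟨d, rfl⟩ := Nat.exists_eq_add_of_le h
  rw [pack_append, pack_congr (a := fun i => if K' + i < K' then x (K' + i) else 0)
    (b := fun _ => 0) (fun i _ => by simp), pack_const_zero, zero_mul, add_zero]
  exact pack_congr fun i hi => by simp [hi]

/-- `b := min a b` -/
def setMin (a b : ℕ) : Stmt := .ite (var a) (var b) (.set b (var a) ;; .skip) .skip

theorem setMin_spec {w a b : ℕ} {σ : St} (ha : σ.v a < 2 ^ w) (hb : σ.v b < 2 ^ w) :
    Tr w (setMin a b) σ 10 (fun σ' => σ' = σ.set b (min (σ.v a) (σ.v b))) := by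
  apply Tr.le
  case h =>
    unfold setMin
    apply Tr.ite
    · simp
    · simp
    · simpa using ha
    · simpa using hb
    · intro h
      simp only [eval_var] at h
      apply Tr.set (x := σ.v a)
      · simp
      · simp
      apply Tr.skip
      rw [min_eq_left h.le]
    · intro h
      simp only [eval_var] at h
      apply Tr.skip
      rw [min_eq_right h]
      simp [St.set]
  case ht => simp

/-- Look up the word number `23` in the current chunk of fields; `29` is the last key of the
chunk, `28` its length. -/
def joinChunk : Stmt :=
  .set 28 (var 13 - var 25) ;; setMin 14 28 ;; setMin 26 28 ;;
  .set 30 ((load (var 24) >>> (var 11 * var 25)) &&& ((1 <<< (var 11 * var 28)) - 1)) ;;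
  .set 29 ((var 30 >>> (var 11 * (var 28 - 1))) >>> var 1) ;;
  .set 30 (var 30 + ((1 <<< var 19) - (1 <<< (var 11 * var 28)))) ;;
  .set 31 (load (var 20 + var 23)) ;;
  joinWord ;;
  .set 27 (var 27 + var 33) ;; .skip

def nextWord : Stmt :=
  .store (var 22 + var 23) (var 27) ;; .set 23 (var 23 + 1) ;; .set 27 0 ;; .skip

def nextChunk : Stmt :=
  .set 26 (var 26 - var 28) ;; .set 25 (var 25 + var 28) ;;
  .ite (var 25) (var 13) .skip (.set 25 0 ;; .set 24 (var 24 + 1) ;; .skip)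

def joinStep : Stmt :=
  joinChunk ;; .ite (var 29) (load (var 20 + var 23) >>> var 12) nextChunk nextWord

/-- Look up the keys in the array `20`, and write the values to the array `22`. -/
def joinArrays : Stmt :=
  .set 23 0 ;; .set 24 (var 4) ;; .set 25 0 ;; .set 26 (var 3) ;; .set 27 0 ;;
  .loop (var 23) (var 10) joinStep

theorem joinArrays_keeps : joinArrays.keeps 23 = true := by decide

/-- `y` is the value of `x` under the first `c` fields of the packed function. -/
def Val (f : ℕ) (zg : ℕ → ℕ) (c x y : ℕ) : Prop :=
  (∀ t < c, zg t / 2 ^ f = x → y = zg t % 2 ^ f) ∧ ((∀ t < c, zg t / 2 ^ f ≠ x) → y = 0)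

/-- The situation in which the join is carried out: constants, the fields of the packed function
(`s` of them in a word), the sorted keys `xx`. -/
structure JoinSetup (w f n sc K' s M u ga ka yb : ℕ) (zg : ℕ → ℕ) (xx : ℕ → ℕ → ℕ) (σ : St) :
    Prop where
  two_le : 2 ≤ f
  fits : Fits w (2 * f + 2) (2 * f) (2 ^ n)
  sc_le : sc + w + n ≤ 2 ^ w
  n_le : n ≤ w
  K'_pos : 0 < K'
  K'_le : K' ≤ 2 ^ n
  s_pos : 0 < s
  s_le : s ≤ 4 * 2 ^ n
  s_mul : s * (2 * f + 1) ≤ w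
  u_pos : 0 < u
  u_lt : u < 2 ^ w
  ga_le : ga + u / s < sc
  ka_pos : 0 < ka
  ka_le : ka + M ≤ sc
  yb_le : yb + M ≤ sc
  ka_yb : Apart M ka yb
  ga_yb : ∀ j i, j * s < u → i < M → ga + j ≠ yb + i
  glob : JoinGlob w f n sc K' σ
  v3 : σ.v 3 = u
  v4 : σ.v 4 = ga
  v10 : σ.v 10 = M
  v11 : σ.v 11 = 2 * f + 1
  v12 : σ.v 12 = (2 * f + 2) * (K' - 1)
  v13 : σ.v 13 = s
  v14 : σ.v 14 = 2 ^ n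
  v20 : σ.v 20 = ka
  v22 : σ.v 22 = yb
  zg_lt : ∀ t, zg t < 2 ^ (2 * f)
  zg_mono : ∀ i j, i < j → j < u → zg i / 2 ^ f < zg j / 2 ^ f
  fields : ∀ j, j * s < u → σ.m (ga + j) = pack (2 * f + 1) s
    (fun i => if j * s + i < u then zg (j * s + i) else 0)
  xx_lt : ∀ i l, xx i l < 2 ^ f
  xx_mono : ∀ i l l', i < M → l < l' → l' < K' → xx i l ≤ xx i l'
  xx_mono' : ∀ i i' l l', i < i' → i' < M → l < K' → l' < K' → xx i l ≤ xx i' l'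
  xx_le : ∀ i l, i < M → l < K' → xx i l ≤ zg (u - 1) / 2 ^ f
  keys : ∀ i < M, σ.m (ka + i) = pack (2 * f + 2) K' (xx i)

/-- The invariant of the join: word `i`, chunk from field `off` of word `j` on. -/
structure JoinState (f sc K' s M u ga yb : ℕ) (zg : ℕ → ℕ) (xx : ℕ → ℕ → ℕ) (σ₀ : St)
    (i j off : ℕ) (σ : St) : Prop where
  i_le : i ≤ M
  off_lt : off < s
  lt_u : j * s + off < u
  keep : ∀ l < 23, σ.v l = σ₀.v l
  v23 : σ.v 23 = i
  v24 : σ.v 24 = ga + j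
  v25 : σ.v 25 = off
  v26 : σ.v 26 = u - (j * s + off)
  acc : ∃ y, σ.v 27 = pack (2 * f + 2) K' y ∧
    (i < M → ∀ l < K', Val f zg (j * s + off) (xx i l) (y l))
  later : ∀ i', i < i' → i' < M → ∀ l < K', ∀ t < j * s + off, zg t / 2 ^ f < xx i' l
  done : ∀ i' < i, ∃ y, σ.m (yb + i') = pack (2 * f + 2) K' y ∧ ∀ l < K', Val f zg u (xx i' l) (y l)
  mem : ∀ a < sc, (∀ i < M, a ≠ yb + i) → σ.m a = σ₀.m a

/-- Extending the range of fields by a chunk. -/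
theorem Val.extend {f u c d K x y y' : ℕ} {zg gl : ℕ → ℕ} (hd : d ≤ K)
    (hu : c + d ≤ u) (hmono : ∀ i j, i < j → j < u → zg i / 2 ^ f < zg j / 2 ^ f) (hx : x < 2 ^ f)
    (hgl : ∀ i < K, gl i = if i < d then zg (c + i) else 2 ^ (2 * f + 1) - 1)
    (h : Val f zg c x y) (h' : Looked f K gl x y') : Val f zg (c + d) x (y + y') := by
  have hpad : ∀ t < K, ¬ t < d → x < gl t / 2 ^ f := by
    intro t ht htd
    rw [hgl t ht, if_neg htd]
    exact hx.trans_le (pad_div f)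
  constructor
  · intro t ht he
    by_cases htc : t < c
    · have h1 : y' = 0 := by
        refine h'.2 fun t' ht' => ?_
        by_cases h2 : t' < d
        · rw [hgl t' ht', if_pos h2]
          have := hmono t (c + t') (by omega) (by omega)
          omega
        · exact (hpad t' ht' h2).ne'
      rw [h.1 t htc he, h1, add_zero]
    · have h1 : y = 0 := by
        refine h.2 fun t' ht' => ?_
        have := hmono t' t (by omega) (by omega)
        omega
      obtain ⟨e, rfl⟩ := Nat.exists_eq_add_of_le (Nat.le_of_not_lt htc)
      have h2 := h'.1 e (by omega) (by rw [hgl e (by omega), if_pos (by omega), he]) fun t' h3 h4 => by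
        by_cases h5 : t' < d
        · rw [hgl t' h4, if_pos h5, ← he]
          exact hmono _ _ (by omega) (by omega)
        · exact hpad t' h4 h5
      rw [h1, h2, hgl e (by omega), if_pos (by omega), zero_add]
  · intro hno
    rw [h.2 fun t ht => hno t (by omega), h'.2 fun t ht => ?_]
    by_cases h5 : t < d
    · rw [hgl t ht, if_pos h5]
      exact hno _ (by omega)
    · exact (hpad t ht h5).ne'

/-- The state after the look-up in a chunk of length `c`. -/
structure ChunkDone (f sc K' s M u ga yb : ℕ) (zg : ℕ → ℕ) (xx : ℕ → ℕ → ℕ) (σ₀ : St)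
    (i j off c : ℕ) (σ : St) : Prop where
  keep : ∀ l < 23, σ.v l = σ₀.v l
  v23 : σ.v 23 = i
  v24 : σ.v 24 = ga + j
  v25 : σ.v 25 = off
  v26 : σ.v 26 = u - (j * s + off)
  v28 : σ.v 28 = c
  v29 : σ.v 29 = zg (j * s + off + c - 1) / 2 ^ f
  acc : ∃ y, σ.v 27 = pack (2 * f + 2) K' y ∧
    ∀ l < K', Val f zg (j * s + off + c) (xx i l) (y l)
  done : ∀ i' < i, ∃ y, σ.m (yb + i') = pack (2 * f + 2) K' y ∧ ∀ l < K', Val f zg u (xx i' l) (y l)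
  mem : ∀ a < sc, (∀ i < M, a ≠ yb + i) → σ.m a = σ₀.m a

/-- A chunk ends with G, with its word, or after 2^n fields. A key is found in at most one chunk and
contributes zero in the others, so the results are simply added up. -/
theorem joinChunk_spec {w f n sc K' s M u ga ka yb : ℕ} {zg : ℕ → ℕ} {xx : ℕ → ℕ → ℕ} {σ₀ σ : St}
    (H : JoinSetup w f n sc K' s M u ga ka yb zg xx σ₀) {i j off c : ℕ} (hi : i < M)
    (hc : c = min (u - (j * s + off)) (min (2 ^ n) (s - off)))
    (I : JoinState f sc K' s M u ga yb zg xx σ₀ i j off σ) :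
    Tr w joinChunk σ (900 * (n + 1)) (ChunkDone f sc K' s M u ga yb zg xx σ₀ i j off c) := by
  have F := H.fits
  have hoff := I.off_lt
  have hlt := I.lt_u
  have hn := Nat.two_pow_pos n
  have hc0 : 0 < c := by omega
  have hcK : c ≤ 2 ^ n := by omega
  have hcs : off + c ≤ s := by omega
  have hcu : j * s + off + c ≤ u := by omega
  have hww : w < 2 ^ w := F.lt_pow (by omega)
  have hsw : s < 2 ^ w := by
    have h1 := H.s_mul
    have h2 : s * 1 ≤ s * (2 * f + 1) := Nat.mul_le_mul_left _ (by omega)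
    omega
  have hKw : 2 ^ n < 2 ^ w := by
    have h1 := F.le
    have h2 : 2 ^ n * 1 ≤ 2 ^ n * (2 * f + 2) := Nat.mul_le_mul_left _ (by omega)
    exact F.lt_pow (by omega)
  have hfw : f < 2 ^ w := lt_of_le_of_lt (by omega) F.lt_q
  have hAs : ∀ d ≤ s, (2 * f + 1) * d ≤ w := fun d hd => by
    have h1 := H.s_mul
    have h2 := Nat.mul_le_mul_left (2 * f + 1) hd
    rw [mul_comm s] at h1
    omega
  have hAw : ∀ d ≤ s, (2 * f + 1) * d < 2 ^ w := fun d hd => (hAs d hd).trans_lt hww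
  have hKA : 2 ^ n * (2 * f + 1) < 2 ^ w := F.lt_pow ((Nat.mul_le_mul_left _ (by omega)).trans F.le)
  have hsc := H.sc_le
  have hjs : j ≤ u / s := by
    rw [Nat.le_div_iff_mul_le H.s_pos]; omega
  have hga := H.ga_le
  have hmj : σ.m (ga + j) = pack (2 * f + 1) s
      (fun i => if j * s + i < u then zg (j * s + i) else 0) := by
    rw [I.mem _ (by omega) fun i hi => H.ga_yb j i (by omega) hi]
    exact H.fields j (by omega)
  have hfl : ∀ i, (if j * s + i < u then zg (j * s + i) else 0) < 2 ^ (2 * f + 1) := fun i => by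
    have := H.zg_lt (j * s + i)
    have := Nat.two_pow_pos (2 * f)
    rw [pow_succ]
    split_ifs <;> omega
  have hgw : pack (2 * f + 1) s (fun i => if j * s + i < u then zg (j * s + i) else 0) < 2 ^ w := by
    refine (pack_lt fun i _ => hfl i).trans_le (Nat.pow_le_pow_right (by omega) (hAs s le_rfl))
  have hex := pack_extract (a := fun i => if j * s + i < u then zg (j * s + i) else 0) hcs hfl
  have hex2 : pack (2 * f + 1) c (fun i =>
      if j * s + (off + i) < u then zg (j * s + (off + i)) else 0) =
      pack (2 * f + 1) c (fun i => zg (j * s + off + i)) :=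
    pack_congr fun i hi => by rw [← add_assoc, if_pos (by omega)]
  rw [hex2] at hex
  have hzA : ∀ t, zg t < 2 ^ (2 * f + 1) := fun t => lt_of_le_pow (H.zg_lt t) (by omega)
  have hvw : pack (2 * f + 1) c (fun i => zg (j * s + off + i)) < 2 ^ w :=
    (pack_lt fun i _ => hzA _).trans_le (Nat.pow_le_pow_right (by omega) (hAs c (by omega)))
  have hlast : pack (2 * f + 1) c (fun i => zg (j * s + off + i)) / 2 ^ ((2 * f + 1) * (c - 1)) =
      zg (j * s + off + c - 1) := by
    obtain ⟨d, rfl⟩ := Nat.exists_eq_succ_of_ne_zero hc0.ne'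
    rw [Nat.succ_eq_add_one, Nat.add_sub_cancel, pack_top fun i _ => hzA _]
    congr 1
  have k : ∀ l < 23, σ.v l = σ₀.v l := I.keep
  have hkey : σ.m (ka + i) = pack (2 * f + 2) K' (xx i) := by
    rw [I.mem _ (by have := H.ka_le; omega) fun t ht => H.ka_yb i t hi ht, H.keys i hi]
  have hka := H.ka_le
  apply Tr.le
  case h =>
    unfold joinChunk
    apply Tr.set (x := s - off)
    · simp [I.v25, k, H.v13, hoff.le]
    · simp [I.v25, k, H.v13]
    apply Tr.seq
    · apply setMin_spec
      · simpa [k, H.v14] using hKw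
      · simp only [St.set_v, if_true]; omega
    rintro _ rfl
    apply Tr.seq
    · apply setMin_spec
      · simp only [St.set_v, Nat.reduceEqDiff, if_false, I.v26]; have := H.u_lt; omega
      · simp only [St.set_v, Nat.reduceEqDiff, if_true, if_false, k 14 (by omega), H.v14]; omega
    rintro _ rfl
    simp only [St.set_v, Nat.reduceEqDiff, if_true, if_false, I.v26, k 14 (by omega), H.v14]
    rw [← hc]
    apply Tr.set (x := pack (2 * f + 1) c (fun i => zg (j * s + off + i)))
    · simp [I.v24, I.v25, k, H.v11, hmj, hgw, hAw off hoff.le, hAw c (by omega), Nat.one_le_two_pow]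
      omega
    · simp [I.v24, I.v25, k, H.v11, hmj]
      exact (Nat.and_two_pow_sub_one_eq_mod _ _).symm.trans hex
    apply Tr.set (x := zg (j * s + off + c - 1) / 2 ^ f)
    · simp [k, H.v11, H.glob.v1, hvw, hfw, hAw (c - 1) (by omega)]
      exact ⟨by omega, (Nat.div_le_self _ _).trans_lt hvw⟩
    · simp [k, H.v11, H.glob.v1, hlast]
    apply Tr.set (x := pack (2 * f + 1) (2 ^ n)
      (fun i => if i < c then zg (j * s + off + i) else 2 ^ (2 * f + 1) - 1))
    · simp [k, H.v11, H.glob.v19, hKA, hAw c (by omega)]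
      refine Nat.pow_le_pow_right (by omega) ?_
      rw [mul_comm]
      exact Nat.mul_le_mul_right _ hcK
    · simp [k, H.v11, H.glob.v19]
      rw [mul_comm (2 ^ n), pack_pad hcK]
    apply Tr.set (x := pack (2 * f + 2) K' (xx i))
    · simp [k, H.v20, I.v23]; omega
    · simp [k, H.v20, I.v23, hkey]
    apply Tr.seq
    · refine Tr.frame 30 (joinWord_spec H.two_le F hsc H.n_le H.K'_le (H.glob.of_eq fun l hl => ?_)
        (gl := fun t => if t < c then zg (j * s + off + t) else 2 ^ (2 * f + 1) - 1)
        (x := xx i) ?_ ?_ (H.xx_lt i) (fun l l' h1 h2 => H.xx_mono i l l' hi h1 h2) ?_ ?_)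
        joinWord_keeps
      · simp [k l (by omega), show l ≠ 31 by omega, show l ≠ 30 by omega, show l ≠ 29 by omega,
          show l ≠ 28 by omega]
      · intro t
        split_ifs
        exacts [Or.inl (H.zg_lt _), Or.inr rfl]
      · intro t t' htt ht'
        have h1 := hzA (j * s + off + t)
        by_cases h2 : t' < c
        · rw [if_pos h2, if_pos (by omega)]
          have h3 := H.zg_mono (j * s + off + t) (j * s + off + t') (by omega) (by omega)
          by_contra h4
          have := Nat.div_le_div_right (c := 2 ^ f) (show zg (j * s + off + t') ≤
            zg (j * s + off + t) by omega)
          omega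
        · rw [if_neg h2]
          split_ifs <;> omega
      · simp
      · simp only [St.set_v, if_true]
        exact (pack_extend H.K'_le _).symm
    rintro σ1 ⟨⟨⟨y', b1, b2, b3⟩, b4⟩, b5⟩
    obtain ⟨y, hy, hval⟩ := I.acc
    apply Tr.set (x := pack (2 * f + 2) K' (fun l => y l + y' l))
    · simp
    · simp [b1, b5, hy]
      rw [← pack_add, ← pack_extend H.K'_le y']
      congr 1
      exact pack_congr fun l _ => by
        split_ifs with h
        exacts [rfl, b2 l (by omega)]
    apply Tr.skip
    have hm : ∀ a < sc, σ1.m a = σ.m a := fun a ha => by rw [b4 a ha]; simp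
    refine ⟨fun l hl => ?_, ?_, ?_, ?_, ?_, ?_, ?_, ⟨_, by rw [St.set_v, if_pos rfl], fun l hl => ?_⟩, ?_, ?_⟩
    · simp only [St.set_v, if_neg (show l ≠ 27 by omega), b5 l (by omega)]
      simp only [if_neg (show l ≠ 31 by omega), if_neg (show l ≠ 30 by omega),
        if_neg (show l ≠ 29 by omega), if_neg (show l ≠ 28 by omega), k l hl]
    · simp [b5, I.v23]
    · simp [b5, I.v24]
    · simp [b5, I.v25]
    · simp [b5, I.v26]
    · simp [b5]
    · simp [b5]
    · exact Val.extend hcK hcu H.zg_mono (H.xx_lt _ _) (fun _ _ => rfl) (hval hi l hl) (b3 l hl)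
    · intro i' hi'
      obtain ⟨z, h1, h2⟩ := I.done i' hi'
      refine ⟨z, ?_, h2⟩
      rw [St.set_m, hm _ (by have := H.yb_le; omega), h1]
    · intro a ha h
      rw [St.set_m, hm a ha, I.mem a ha h]
  case ht => clear * -; simp; omega

/-- The number of chunks and words that are still to be processed. -/
def joinMeasure (M N K ga : ℕ) (σ : St) : ℕ :=
  (M - σ.v 23) + 4 * (ga + N - σ.v 24) + (4 - σ.v 25 / K)

/-- If the last key of the chunk is below the last key of the word, the chunk can serve no later
word and is passed over; otherwise no later chunk can serve this word. In both cases the measure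
drops. -/
theorem joinStep_spec {w f n sc K' s M u ga ka yb : ℕ} {zg : ℕ → ℕ} {xx : ℕ → ℕ → ℕ} {σ₀ σ : St}
    (H : JoinSetup w f n sc K' s M u ga ka yb zg xx σ₀) {i j off : ℕ} (hi : i < M)
    (hoffK : 2 ^ n ∣ off) (I : JoinState f sc K' s M u ga yb zg xx σ₀ i j off σ) :
    Tr w joinStep σ (1000 * (n + 1)) (fun σ' =>
      (∃ i j off, 2 ^ n ∣ off ∧ JoinState f sc K' s M u ga yb zg xx σ₀ i j off σ') ∧
      joinMeasure M (u / s) (2 ^ n) ga σ' < joinMeasure M (u / s) (2 ^ n) ga σ) := by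
  have F := H.fits
  have hoff := I.off_lt
  have hlt := I.lt_u
  have hn := Nat.two_pow_pos n
  have hsc := H.sc_le
  have hka := H.ka_le
  have hyb := H.yb_le
  have hfw : f < 2 ^ w := lt_of_le_of_lt (by omega) F.lt_q
  have hsw : s < 2 ^ w := by
    have h1 := H.s_mul
    have h2 : s * 1 ≤ s * (2 * f + 1) := Nat.mul_le_mul_left _ (by omega)
    exact F.lt_pow (by omega)
  have hBK' : (2 * f + 2) * (K' - 1) < 2 ^ w := by
    have h1 : (K' - 1) * (2 * f + 2) ≤ 2 ^ n * (2 * f + 2) :=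
      Nat.mul_le_mul_right _ (by have := H.K'_le; omega)
    rw [mul_comm]
    exact F.lt_pow (h1.trans F.le)
  have hpow : 2 ^ (2 * f) ≤ 2 ^ w := Nat.pow_le_pow_right (by omega) (by
    have h1 := F.le
    have h2 : 1 * (2 * f + 2) ≤ 2 ^ n * (2 * f + 2) := Nat.mul_le_mul_right _ hn
    omega)
  have hzw : ∀ t, zg t / 2 ^ f < 2 ^ w := fun t =>
    (Nat.div_le_self _ _).trans_lt ((H.zg_lt t).trans_le hpow)
  have hxw : pack (2 * f + 2) K' (xx i) < 2 ^ w := by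
    rw [← pack_extend H.K'_le]
    refine F.pack_lt_q fun l => ?_
    have := Nat.two_pow_pos (2 * f)
    split_ifs
    · exact lt_of_le_pow (H.xx_lt _ _) (by omega)
    · exact this
  have htop : pack (2 * f + 2) K' (xx i) / 2 ^ ((2 * f + 2) * (K' - 1)) = xx i (K' - 1) := by
    obtain ⟨d, hd⟩ := Nat.exists_eq_succ_of_ne_zero H.K'_pos.ne'
    rw [hd, Nat.succ_eq_add_one, Nat.add_sub_cancel,
      pack_top fun l _ => lt_of_le_pow (H.xx_lt i l) (by omega)]
  have hjs : j ≤ u / s := by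
    rw [Nat.le_div_iff_mul_le H.s_pos]; omega
  have hlastx : ∀ l < K', xx i l ≤ xx i (K' - 1) := fun l hl => by
    rcases Nat.lt_or_ge l (K' - 1) with h | h
    · exact H.xx_mono i _ _ hi h (by omega)
    · rw [show l = K' - 1 by omega]
  obtain ⟨c, hc⟩ : ∃ c, c = min (u - (j * s + off)) (min (2 ^ n) (s - off)) := ⟨_, rfl⟩
  apply Tr.le
  case h =>
    unfold joinStep
    apply Tr.seq
    · exact joinChunk_spec H hi hc I
    intro σ1 D
    have hkey : σ1.m (ka + i) = pack (2 * f + 2) K' (xx i) := by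
      rw [D.mem _ (by omega) fun t ht => H.ka_yb i t hi ht, H.keys i hi]
    have e20 : σ1.v 20 = ka := by rw [D.keep _ (by omega), H.v20]
    have e22 : σ1.v 22 = yb := by rw [D.keep _ (by omega), H.v22]
    have e12 : σ1.v 12 = (2 * f + 2) * (K' - 1) := by rw [D.keep _ (by omega), H.v12]
    have e13 : σ1.v 13 = s := by rw [D.keep _ (by omega), H.v13]
    apply Tr.ite
    · simp
    · simp [e20, e12, D.v23, hkey, hxw, hBK']; omega
    · simp [D.v29, hzw]
    · simp [e20, e12, D.v23, hkey, htop]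
      exact (H.xx_lt _ _).trans_le (Nat.pow_le_pow_right (by omega) (by
        have := F.le
        have h2 : 1 * (2 * f + 2) ≤ 2 ^ n * (2 * f + 2) := Nat.mul_le_mul_right _ hn
        omega))
    · intro hcond
      simp [e20, e12, D.v23, hkey, htop, D.v29] at hcond
      -- G cannot be exhausted here, because all keys are at most the last domain element.
      have hcu : j * s + off + c < u := by
        by_contra h
        have h1 := H.xx_le i (K' - 1) hi (by have := H.K'_pos; omega)
        rw [show j * s + off + c - 1 = u - 1 by omega] at hcond
        omega
      obtain ⟨y, hy, hval⟩ := D.acc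
      -- Everything passed over is below the last key of word i but perhaps not below its earlier
      -- keys; for later words it is below all keys, so their accumulator may start at zero.
      have hlater : ∀ i', i < i' → i' < M → ∀ l < K', ∀ t < j * s + off + c,
          zg t / 2 ^ f < xx i' l := by
        intro i' h1 h2 l hl t ht
        have h3 : zg t / 2 ^ f ≤ zg (j * s + off + c - 1) / 2 ^ f := by
          rcases Nat.lt_or_ge t (j * s + off + c - 1) with h | h
          · exact (H.zg_mono _ _ h (by omega)).le
          · rw [show t = j * s + off + c - 1 by omega]
        have h4 := H.xx_mono' i i' (K' - 1) l h1 h2 (by have := H.K'_pos; omega) hl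
        omega
      -- A word of G has at most 4 · 2^n fields, which is where the fours in the measure come from.
      have hoffdiv : off / 2 ^ n < 4 := by
        rw [Nat.div_lt_iff_lt_mul hn]
        have := H.s_le
        omega
      unfold nextChunk
      apply Tr.set (x := u - (j * s + off + c))
      · simp [D.v26, D.v28]; omega
      · simp [D.v26, D.v28]; omega
      apply Tr.set (x := off + c)
      · simp
      · simp [D.v25, D.v28]
      apply Tr.ite
      · simp
      · simp
      · simp; omega
      · simp [e13, hsw]
      · intro h1
        simp [e13] at h1
        have hcn : c = 2 ^ n := by omega
        apply Tr.skip
        refine ⟨⟨i, j, off + c, ?_, I.i_le, h1, by omega, fun l hl => ?_, ?_, ?_, ?_, ?_, ⟨y, ?_, ?_⟩,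
          ?_, ?_, ?_⟩, ?_⟩
        · rw [hcn]
          exact Dvd.dvd.add hoffK (dvd_refl _)
        · simp [show l ≠ 25 by omega, show l ≠ 26 by omega, D.keep l hl]
        · simp [D.v23]
        · simp [D.v24]
        · simp
        · simp [add_assoc]
        · simp [hy]
        · intro _ l hl
          rw [← add_assoc]
          exact hval l hl
        · rw [← add_assoc]
          exact hlater
        · simpa using D.done
        · simpa using D.mem
        · simp only [joinMeasure, St.set_v, Nat.reduceEqDiff, if_true, if_false, D.v23, D.v24, I.v23,
            I.v24, I.v25]
          rw [hcn, Nat.add_div_right _ hn]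
          omega
      · intro h1
        simp [e13] at h1
        have hjs' : j + 1 ≤ u / s := by
          rw [Nat.le_div_iff_mul_le H.s_pos, Nat.succ_mul]; omega
        have e : (j + 1) * s + 0 = j * s + off + c := by rw [Nat.succ_mul]; omega
        apply Tr.set (x := 0)
        · simp
        · simp
        apply Tr.set (x := ga + (j + 1))
        · simp
        · simp [D.v24, add_assoc]
        apply Tr.skip
        refine ⟨⟨i, j + 1, 0, dvd_zero _, I.i_le, H.s_pos, by omega, fun l hl => ?_, ?_, ?_, ?_, ?_,
          ⟨y, ?_, ?_⟩, ?_, ?_, ?_⟩, ?_⟩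
        · simp [show l ≠ 25 by omega, show l ≠ 26 by omega, show l ≠ 24 by omega, D.keep l hl]
        · simp [D.v23]
        · simp
        · simp
        · rw [e]; simp
        · simp [hy]
        · intro _ l hl
          rw [e]
          exact hval l hl
        · rw [e]
          exact hlater
        · simpa using D.done
        · simpa using D.mem
        -- A new word of G lowers the second term by 4, while resetting the offset raises the third
        -- by at most 3.
        · simp only [joinMeasure, St.set_v, Nat.reduceEqDiff, if_true, if_false, D.v23, I.v23,
            I.v24, I.v25, Nat.zero_div]
          omega
    · intro hcond
      simp [e20, e12, D.v23, hkey, htop, D.v29] at hcond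
      obtain ⟨y, hy, hval⟩ := D.acc
      unfold nextWord
      apply Tr.store (y := yb + i) (x := pack (2 * f + 2) K' y)
      · simp
      · simp
      · simp [e22, D.v23]
      · simp [hy]
      · omega
      apply Tr.set (x := i + 1)
      · simp
      · simp [D.v23]
      apply Tr.set (x := 0)
      · simp
      · simp
      apply Tr.skip
      refine ⟨⟨i + 1, j, off, hoffK, hi, hoff, hlt, fun l hl => ?_, ?_, ?_, ?_, ?_,
        ⟨fun _ => 0, ?_, ?_⟩, ?_, ?_, ?_⟩, ?_⟩
      · simp [show l ≠ 27 by omega, show l ≠ 23 by omega, D.keep l hl]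
      · simp
      · simp [D.v24]
      · simp [D.v25]
      · simp [D.v26]
      · simp [pack_const_zero]
      · intro h1 l hl
        have h2 := I.later (i + 1) (by omega) h1 l hl
        exact ⟨fun t ht he => absurd he (h2 t ht).ne, fun _ => rfl⟩
      · exact fun i' h1 h2 => I.later i' (by omega) h2
      · intro i' hi'
        simp only [St.set_m, St.write_m]
        by_cases h1 : i' = i
        · refine ⟨y, by rw [if_pos (by rw [h1])], fun l hl => ?_⟩
          rw [h1]
          have h2 := hval l hl
          -- Fields after the chunk have keys above the last key of the word, so the value with
          -- respect to the fields seen so far is final.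
          have h3 : ∀ t < u, zg t / 2 ^ f = xx i l → t < j * s + off + c := by
            intro t ht he
            by_contra h4
            have h5 := H.zg_mono (j * s + off + c - 1) t (by omega) ht
            have := hlastx l hl
            omega
          exact ⟨fun t ht he => h2.1 t (h3 t ht he) he, fun hno => h2.2 fun t ht => hno t (by omega)⟩
        · rw [if_neg (by omega)]
          exact D.done i' (by omega)
      · intro a ha h
        simp only [St.set_m, St.write_m]
        rw [if_neg (h i hi)]
        exact D.mem a ha h
      · simp only [joinMeasure, St.set_v, Nat.reduceEqDiff, if_true, if_false, D.v24, D.v25, I.v23,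
          I.v24, I.v25, St.write_v]
        omega
  case ht => clear * -; simp; omega

theorem joinArrays_spec {w f n sc K' s M u ga ka yb : ℕ} {zg : ℕ → ℕ} {xx : ℕ → ℕ → ℕ} {σ : St}
    (H : JoinSetup w f n sc K' s M u ga ka yb zg xx σ) :
    Tr w joinArrays σ (5000 * ((M + u / s + 1) * (n + 1))) (fun σ' =>
      (∀ i < M, ∃ y, σ'.m (yb + i) = pack (2 * f + 2) K' y ∧ ∀ l < K', Val f zg u (xx i l) (y l)) ∧
      ∀ a < sc, (∀ i < M, a ≠ yb + i) → σ'.m a = σ.m a) := by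
  have hka := H.ka_le
  have hka' := H.ka_pos
  have hsc := H.sc_le
  set σ1 := ((((σ.set 23 0).set 24 ga).set 25 0).set 26 u).set 27 0 with hσ1
  have hμ : joinMeasure M (u / s) (2 ^ n) ga σ1 ≤ 4 * (M + u / s + 1) := by
    simp [joinMeasure, σ1]
    omega
  apply Tr.le
  case h =>
    unfold joinArrays
    apply Tr.set (x := 0)
    · simp
    · simp
    apply Tr.set (x := ga)
    · simp
    · simp [H.v4]
    apply Tr.set (x := 0)
    · simp
    · simp
    apply Tr.set (x := u)
    · simp
    · simp [H.v3]
    apply Tr.set (x := 0)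
    · simp
    · simp
    rw [← hσ1]
    refine Tr.imp (Tr.loop_measure (fun σ' => ∃ i j off, 2 ^ n ∣ off ∧
      JoinState f sc K' s M u ga yb zg xx σ i j off σ') (joinMeasure M (u / s) (2 ^ n) ga)
      (1000 * (n + 1)) ?_ ?_ ?_) ?_
    · refine ⟨0, 0, 0, dvd_zero _, Nat.zero_le _, H.s_pos, by simpa using H.u_pos, fun l hl => ?_,
        by simp [σ1], by simp [σ1], by simp [σ1], by simp [σ1],
        ⟨fun _ => 0, by simp [σ1, pack_const_zero], fun _ l _ => ⟨fun t ht => by simp at ht, fun _ => rfl⟩⟩, by simp, by simp, by simp [σ1]⟩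
      simp [σ1, show l ≠ 23 by omega, show l ≠ 24 by omega, show l ≠ 25 by omega,
        show l ≠ 26 by omega, show l ≠ 27 by omega]
    · rintro σ' ⟨i, j, off, -, I⟩
      have := I.i_le
      refine ⟨by simp, by simp, ?_, ?_⟩
      · simp only [eval_var, I.v23]; omega
      · simp only [eval_var, I.keep 10 (by omega), H.v10]; omega
    · rintro σ' ⟨i, j, off, hd, I⟩ hlt
      simp only [eval_var, I.v23, I.keep 10 (by omega), H.v10] at hlt
      exact joinStep_spec H hlt hd I
    · rintro σ' ⟨⟨i, j, off, hd, I⟩, hge⟩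
      simp only [eval_var, I.v23, I.keep 10 (by omega), H.v10] at hge
      exact ⟨fun i' hi' => I.done i' (by omega), I.mem⟩
  case ht =>
    simp only [cost_var, cost_lit]
    have h1 : joinMeasure M (u / s) (2 ^ n) ga σ1 * (1 + 1 + 1 + 1000 * (n + 1)) ≤
        4 * (M + u / s + 1) * (1003 * (n + 1)) := Nat.mul_le_mul hμ (by omega)
    have h2 : 4 * (M + u / s + 1) * (1003 * (n + 1)) = 4012 * ((M + u / s + 1) * (n + 1)) := by ring
    have h3 : 1 * 1 ≤ (M + u / s + 1) * (n + 1) :=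
      Nat.mul_le_mul (Nat.le_add_left _ _) (Nat.le_add_left _ _)
    omega

end PackedMap

/-! ## Sorting, joining and sorting back -/

namespace PackedMap

open Finset Stmt
open PackedMap.Expr (var load)

theorem sum_recs (F : ℕ → ℕ × ℕ) (M K : ℕ) :
    ∑ i ∈ Ico 0 M, recs (fun l => F (i * K + l)) 0 K = recs F 0 (M * K) := by
  induction M with
  | zero => simp
  | succ M ih =>
    rw [sum_Ico_succ_top (Nat.zero_le M), ih, Nat.succ_mul, recs_add]
    congr 1
    exact recs_congr fun t _ => by simp

/-- Records that are sorted by keys, which are the positions `0, …, L - 1`, are in place. -/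
theorem positions_of_sorted {L : ℕ} {p v G : ℕ → ℕ}
    (h : recs (fun e => (p e, v e)) 0 L = recs (fun e => (e, G e)) 0 L)
    (hp : ∀ i j, i < j → j < L → p i ≤ p j) : ∀ e < L, p e = e ∧ v e = G e := by
  -- Equality of the multisets makes the list of keys a permutation of 0, …, L - 1, and a sorted
  -- permutation of a sorted list is that list.
  have h1 : (List.range L).map p = List.range L := by
    have h2 : (((List.range L).map p : List ℕ) : Multiset ℕ) = (List.range L : List ℕ) := by
      have := congrArg (Multiset.map Prod.fst) h
      simpa [recs, Multiset.map_map, Function.comp_def, Multiset.range] using this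
    refine List.Perm.eq_of_pairwise (le := (· ≤ ·)) (fun a b _ _ => le_antisymm) ?_ ?_
      (Multiset.coe_eq_coe.1 h2)
    · rw [List.pairwise_map, List.pairwise_iff_getElem]
      intro i j hi hj hij
      simp only [List.length_range] at hi hj
      simpa using hp i j hij hj
    · exact List.pairwise_lt_range.imp le_of_lt
  intro e he
  have h3 : p e = e := by
    have := congrArg (fun l => l[e]?) h1
    simpa [he] using this
  refine ⟨h3, ?_⟩
  have h4 : (p e, v e) ∈ recs (fun e => (e, G e)) 0 L :=
    h ▸ mem_recs.2 ⟨e, he, by simp⟩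
  obtain ⟨t, -, ht⟩ := mem_recs.1 h4
  simp only [zero_add, Prod.mk.injEq, h3] at ht
  rw [← ht.2, ht.1]

/-- Passes from one multiset per word to a single sequence of records indexed by global position;
order within words and order between words combine to order throughout. -/
theorem SortedArr.flat {B q n M ka va : ℕ} {m : ℕ → ℕ} {S : ℕ → Multiset (ℕ × ℕ)}
    (h : SortedArr B q n m ka va S 0 M) (hr : RunSorted S 0 M) :
    ∃ k x : ℕ → ℕ, (∀ e, k e < 2 ^ q) ∧ (∀ e, x e < 2 ^ q) ∧
      (∀ i < M, m (ka + i) = pack B (2 ^ n) (fun l => k (i * 2 ^ n + l)) ∧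
        m (va + i) = pack B (2 ^ n) (fun l => x (i * 2 ^ n + l))) ∧
      ∑ i ∈ Ico 0 M, S i = recs (fun e => (k e, x e)) 0 (M * 2 ^ n) ∧
      ∀ e e', e < e' → e' < M * 2 ^ n → k e ≤ k e' := by
  have h1 : ∀ i, ∃ k x : ℕ → ℕ, (∀ l, k l < 2 ^ q) ∧ (∀ l, x l < 2 ^ q) ∧ (i < M →
      m (ka + i) = pack B (2 ^ n) k ∧ m (va + i) = pack B (2 ^ n) x ∧
      S i = recs (fun l => (k l, x l)) 0 (2 ^ n) ∧ ∀ l l', l < l' → l' < 2 ^ n → k l ≤ k l') := by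
    intro i
    by_cases hi : i < M
    · obtain ⟨k, x, h1, h2, h3⟩ := h i (Nat.zero_le _) hi
      exact ⟨k, x, h1, h2, fun _ => h3⟩
    · exact ⟨fun _ => 0, fun _ => 0, fun _ => Nat.two_pow_pos _, fun _ => Nat.two_pow_pos _,
        fun h => absurd h hi⟩
  choose k x hk hx hs using h1
  have hK := Nat.two_pow_pos n
  have e1 : ∀ i, ∀ l < 2 ^ n, (i * 2 ^ n + l) / 2 ^ n = i := fun i l hl => by
    rw [mul_comm, Nat.mul_add_div hK, Nat.div_eq_of_lt hl, add_zero]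
  have e2 : ∀ i, ∀ l < 2 ^ n, (i * 2 ^ n + l) % 2 ^ n = l := fun i l hl => by
    rw [mul_comm, Nat.mul_add_mod, Nat.mod_eq_of_lt hl]
  refine ⟨fun e => k (e / 2 ^ n) (e % 2 ^ n), fun e => x (e / 2 ^ n) (e % 2 ^ n), fun e => hk _ _,
    fun e => hx _ _, fun i hi => ⟨?_, ?_⟩, ?_, fun e e' he he' => ?_⟩
  · rw [(hs i hi).1]
    exact pack_congr fun l hl => by dsimp only; rw [e1 i l hl, e2 i l hl]
  · rw [(hs i hi).2.1]
    exact pack_congr fun l hl => by dsimp only; rw [e1 i l hl, e2 i l hl]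
  · rw [← sum_recs]
    refine sum_congr rfl fun i hi => ?_
    rw [(hs i (mem_Ico.1 hi).2).2.2.1]
    exact recs_congr fun l hl => by simp only [zero_add]; rw [e1 i l hl, e2 i l hl]
  · have h2 : e' / 2 ^ n < M := by rwa [Nat.div_lt_iff_lt_mul hK]
    have h3 : e / 2 ^ n ≤ e' / 2 ^ n := Nat.div_le_div_right he.le
    have h4 := Nat.mod_lt e hK
    have h5 := Nat.mod_lt e' hK
    dsimp only
    rcases h3.lt_or_eq with h6 | h6
    · refine hr _ _ (Nat.zero_le _) h6 h2 (k (e / 2 ^ n) (e % 2 ^ n), x (e / 2 ^ n) (e % 2 ^ n)) ?_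
        (k (e' / 2 ^ n) (e' % 2 ^ n), x (e' / 2 ^ n) (e' % 2 ^ n)) ?_
      · rw [(hs _ (by omega)).2.2.1]
        exact mem_recs.2 ⟨_, h4, by simp⟩
      · rw [(hs _ h2).2.2.1]
        exact mem_recs.2 ⟨_, h5, by simp⟩
    · rw [h6]
      refine (hs _ h2).2.2.2 _ _ ?_ h5
      have := Nat.div_add_mod e (2 ^ n)
      have := Nat.div_add_mod e' (2 ^ n)
      rw [h6] at *
      omega

/-- The domain elements are distinct, so `Val` determines its value. The function also fixes the
value 0 outside the domain, which is needed for the filler entries of the arrays. -/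
theorem val_fun {f u : ℕ} {zg : ℕ → ℕ}
    (h : ∀ i j, i < j → j < u → zg i / 2 ^ f < zg j / 2 ^ f) :
    ∃ φ : ℕ → ℕ, (∀ x, φ x < 2 ^ f) ∧ (∀ x, Val f zg u x (φ x)) ∧
      ∀ x y, Val f zg u x y → y = φ x := by
  have h1 : ∀ x, ∃ y < 2 ^ f, Val f zg u x y ∧ ∀ y', Val f zg u x y' → y' = y := by
    intro x
    by_cases hx : ∃ t < u, zg t / 2 ^ f = x
    · obtain ⟨t, ht, rfl⟩ := hx
      refine ⟨zg t % 2 ^ f, Nat.mod_lt _ (Nat.two_pow_pos f), ⟨fun t' ht' he => ?_,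
        fun h => absurd rfl (h t ht)⟩, fun y hy => hy.1 t ht rfl⟩
      rcases Nat.lt_trichotomy t t' with h1 | rfl | h1
      · exact absurd he (h t t' h1 ht').ne'
      · rfl
      · exact absurd he (h t' t h1 ht).ne
    · push Not at hx
      exact ⟨0, Nat.two_pow_pos f, ⟨fun t ht he => absurd he (hx t ht), fun _ => rfl⟩,
        fun y hy => hy.2 hx⟩
  choose φ h1 h2 h3 using h1
  exact ⟨φ, h1, h2, h3⟩

/-- The sorts use 2^n' lanes and the join uses all 2^n. The switch changes only the total width in
variable 8 and the guard word in variable 16. -/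
def toSort : Stmt :=
  .set 8 (var 12 + var 6) ;; .set 16 ((var 15 <<< var 7) &&& ((1 <<< var 8) - 1)) ;; .skip

def toJoin : Stmt :=
  .set 8 (var 14 * var 6) ;; .set 16 (var 15 <<< var 7) ;; .skip

/-- Sort by key, join with the packed function, sort by position. -/
def sortJoinSort : Stmt :=
  toSort ;; sortArrays ;; toJoin ;; joinArrays ;; toSort ;;
  .set 23 (var 22 + var 10) ;; .set 24 (var 20) ;; .set 20 (var 21) ;; .set 21 (var 22) ;; .set 22 (var 24) ;; sortArrays

theorem sortJoinSort_keeps : sortJoinSort.keeps 8 = true := by decide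

/-- The constants: `2 ^ n` lanes fit in a word, and `2 ^ n'` of them are used. -/
structure Consts (w f n n' sc s M u ga : ℕ) (σ : St) : Prop where
  two_le : 2 ≤ f
  fits : Fits w (2 * f + 2) (2 * f) (2 ^ n)
  n'_le : n' ≤ n
  v0 : σ.v 0 = w
  v1 : σ.v 1 = f
  v3 : σ.v 3 = u
  v4 : σ.v 4 = ga
  v6 : σ.v 6 = 2 * f + 2
  v7 : σ.v 7 = 2 * f
  v9 : σ.v 9 = sc
  v10 : σ.v 10 = M
  v11 : σ.v 11 = 2 * f + 1
  v12 : σ.v 12 = (2 * f + 2) * (2 ^ n' - 1)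
  v13 : σ.v 13 = s
  v14 : σ.v 14 = 2 ^ n
  v15 : σ.v 15 = pack (2 * f + 2) (2 ^ n) (fun _ => 1)
  v17 : σ.v 17 = pack (2 * f + 2) (2 ^ n) (fun i => if i < 2 ^ n' then 2 ^ f - 1 else 0)
  v18 : σ.v 18 = pack (2 * f + 2) (2 ^ n) (fun i => if i < 2 ^ n' then 1 else 2 ^ (2 * f) - 1)
  v19 : σ.v 19 = 2 ^ n * (2 * f + 1)

/-- The variables below `20` that are not specific to a phase are unchanged. -/
def SameConsts (σ σ' : St) : Prop := ∀ i < 20, i ≠ 8 → i ≠ 16 → σ'.v i = σ.v i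

theorem Consts.of_same {w f n n' sc s M u ga : ℕ} {σ σ' : St} (h : Consts w f n n' sc s M u ga σ)
    (e : SameConsts σ σ') : Consts w f n n' sc s M u ga σ' := by
  obtain ⟨h1, h2, h3, h4, h5, h6, h7, h8, h9, h10, h11, h12, h13, h14, h15, h16, h17, h18, h19⟩ := h
  constructor <;> first | assumption | (rw [e _ (by omega) (by omega) (by omega)]; assumption)

theorem toSort_spec {w f n n' sc s M u ga : ℕ} {σ : St} (h : Consts w f n n' sc s M u ga σ) :
    Tr w toSort σ 30 (fun σ' => Glob (2 * f + 2) (2 * f) n' sc σ' ∧ SameConsts σ σ' ∧ σ'.m = σ.m ∧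
      ∀ i ≥ 20, σ'.v i = σ.v i) := by
  have F := h.fits
  have hK := Nat.two_pow_pos n'
  have h8 : (2 * f + 2) * (2 ^ n' - 1) + (2 * f + 2) = 2 ^ n' * (2 * f + 2) := by
    obtain ⟨d, hd⟩ := Nat.exists_eq_succ_of_ne_zero hK.ne'
    rw [hd, Nat.succ_eq_add_one, Nat.add_sub_cancel]
    ring
  have hKK : 2 ^ n' ≤ 2 ^ n := Nat.pow_le_pow_right (by omega) h.n'_le
  have h8w : 2 ^ n' * (2 * f + 2) < 2 ^ w := F.lt_pow ((Nat.mul_le_mul_right _ hKK).trans F.le)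
  apply Tr.le
  case h =>
    unfold toSort
    apply Tr.set (x := 2 ^ n' * (2 * f + 2))
    · simp
    · simp [h.v12, h.v6, h8]
    apply Tr.set (x := pack (2 * f + 2) (2 ^ n') (fun _ => 2 ^ (2 * f)))
    · simp [h.v7, F.lt_q, h8w, Nat.one_le_two_pow]
    · simp only [eval_and, eval_shl, eval_var, eval_sub, eval_lit, St.set_v, h.v7, h.v15, if_true,
        Nat.reduceEqDiff, if_false, one_mul, pack_mul_const]
      obtain ⟨d, hd⟩ := Nat.exists_eq_add_of_le hKK
      rw [Nat.and_two_pow_sub_one_eq_mod, hd, pack_append, mul_comm (2 ^ n'),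
        Nat.add_mul_mod_self_right, Nat.mod_eq_of_lt]
      exact pack_lt fun i _ => Nat.pow_lt_pow_right (by omega) (by omega)
    apply Tr.skip
    refine ⟨⟨?_, ?_, ?_, ?_, ?_⟩, fun i hi h1 h2 => ?_, by simp, fun i hi => ?_⟩
    · simp [h.v6]
    · simp [h.v7]
    · simp
    · simp [h.v9]
    · simp
    · simp [h1, h2]
    · simp [show i ≠ 8 by omega, show i ≠ 16 by omega]
  case ht => clear * -; simp

theorem toJoin_spec {w f n n' sc s M u ga : ℕ} {σ : St} (h : Consts w f n n' sc s M u ga σ) :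
    Tr w toJoin σ 30 (fun σ' => JoinGlob w f n sc (2 ^ n') σ' ∧ SameConsts σ σ' ∧ σ'.m = σ.m ∧
      ∀ i ≥ 20, σ'.v i = σ.v i) := by
  have F := h.fits
  apply Tr.le
  case h =>
    unfold toJoin
    apply Tr.set (x := 2 ^ n * (2 * f + 2))
    · simp
    · simp [h.v14, h.v6]
    apply Tr.set (x := pack (2 * f + 2) (2 ^ n) (fun _ => 2 ^ (2 * f)))
    · simp [h.v7, F.lt_q]
    · simp [h.v7, h.v15, pack_mul_const]
    apply Tr.skip
    refine ⟨⟨⟨?_, ?_, ?_, ?_, ?_⟩, ?_, ?_, ?_, ?_, ?_, ?_⟩, fun i hi h1 h2 => ?_, by simp,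
      fun i hi => ?_⟩
    · simp [h.v6]
    · simp [h.v7]
    · simp
    · simp [h.v9]
    · simp
    · simp [h.v0]
    · simp [h.v1]
    · simp [h.v15]
    · simp [h.v17]
    · simp [h.v18]
    · simp [h.v19]
    · simp [h1, h2]
    · simp [show i ≠ 8 by omega, show i ≠ 16 by omega]
  case ht => clear * -; simp

/-- Fields of a packed function: `s` of them in a word, from address `ga` on. -/
structure FieldsAt (f s u ga : ℕ) (zg : ℕ → ℕ) (m : ℕ → ℕ) : Prop where
  lt : ∀ t, zg t < 2 ^ (2 * f)
  mono : ∀ i j, i < j → j < u → zg i / 2 ^ f < zg j / 2 ^ f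
  word : ∀ j, j * s < u → m (ga + j) = pack (2 * f + 1) s
    (fun i => if j * s + i < u then zg (j * s + i) else 0)

/-- Four arrays of length `M` from address `S` on, below the scratch area. -/
structure ArraysAt (w n S M ka va kb vb : ℕ) : Prop extends
    Arrays w n (S + 4 * M) M ka va kb vb where
  ka_ge : S ≤ ka
  va_ge : S ≤ va
  kb_ge : S ≤ kb
  vb_ge : S ≤ vb

theorem ArraysAt.init {w n S M : ℕ} (hS : 0 < S) (h : S + 4 * M + n ≤ 2 ^ w) :
    ArraysAt w n S M S (S + M) (S + 2 * M) (S + 3 * M) := by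
  constructor
  · constructor <;> first | omega | (intro i j hi hj; omega)
  all_goals omega

theorem ArraysAt.sort_cases {w n S M ka va kb vb : ℕ} (h : ArraysAt w n S M ka va kb vb) {σ : St}
    (hc : (σ.v 20 = ka ∧ σ.v 21 = va ∧ σ.v 22 = kb ∧ σ.v 23 = vb) ∨
      (σ.v 20 = kb ∧ σ.v 21 = vb ∧ σ.v 22 = ka ∧ σ.v 23 = va)) :
    ArraysAt w n S M (σ.v 20) (σ.v 21) (σ.v 22) (σ.v 23) := by
  rcases hc with ⟨h1, h2, h3, h4⟩ | ⟨h1, h2, h3, h4⟩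
  · rw [h1, h2, h3, h4]
    exact h
  · rw [h1, h2, h3, h4]
    exact ⟨h.swap, h.kb_ge, h.vb_ge, h.ka_ge, h.va_ge⟩

/-- Make the payloads the keys and the first free array the payloads. -/
theorem ArraysAt.rotate {w n S M a b c d : ℕ} (hS : 0 < S) (h : ArraysAt w n S M a b c d) :
    ArraysAt w n S M b c a d := by
  have := h.va_ge
  exact ⟨⟨h.sc_le, by omega, h.ka_pos, h.va_le, h.kb_le, h.ka_le, h.vb_le, h.va_kb, h.ka_va.symm,
    h.va_vb, h.ka_kb.symm, h.kb_vb, h.ka_vb⟩, h.va_ge, h.kb_ge, h.ka_ge, h.vb_ge⟩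

structure SortJoinSetup (w f n n' S s M u ga : ℕ) (zg X : ℕ → ℕ) (σ : St) : Prop where
  consts : Consts w f n n' (S + 4 * M) s M u ga σ
  S_pos : 0 < S
  sc_le : S + 4 * M + w + n ≤ 2 ^ w
  n_le : n ≤ w
  s_pos : 0 < s
  s_le : s ≤ 4 * 2 ^ n
  s_mul : s * (2 * f + 1) ≤ w
  u_pos : 0 < u
  u_lt : u < 2 ^ w
  ga_lt : ∀ j, j * s < u → ga + j < S
  v20 : σ.v 20 = S
  v21 : σ.v 21 = S + M
  v22 : σ.v 22 = S + 2 * M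
  v23 : σ.v 23 = S + 3 * M
  fields : FieldsAt f s u ga zg σ.m
  X_lt : ∀ e, X e < 2 ^ f
  X_le : ∀ e, X e ≤ zg (u - 1) / 2 ^ f
  pos_le : M * 2 ^ n' ≤ 2 ^ (2 * f)
  keys : ∀ i < M, σ.m (S + i) = pack (2 * f + 2) (2 ^ n') (fun l => X (i * 2 ^ n' + l))
  pays : ∀ i < M, σ.m (S + M + i) = pack (2 * f + 2) (2 ^ n') (fun l => i * 2 ^ n' + l)

/-- Between the sorts the arrays change roles: the positions become keys, the values found by the
join become payloads, and the old keys turn into free space. -/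
theorem sortJoinSort_spec {w f n n' S s M u ga μ : ℕ} {zg X : ℕ → ℕ} {σ : St}
    (H : SortJoinSetup w f n n' S s M u ga zg X σ) (hM : M = 2 ^ μ) :
    Tr w sortJoinSort σ (4000 * (M * (n' + μ + 1) * (n' + 1)) +
        5000 * ((M + u / s + 1) * (n + 1)) + 120)
      (fun σ' => SameConsts σ σ' ∧ S ≤ σ'.v 21 ∧ σ'.v 21 + M ≤ S + 4 * M ∧
        (∃ Y : ℕ → ℕ, (∀ e, Y e < 2 ^ f) ∧ (∀ e < M * 2 ^ n', Val f zg u (X e) (Y e)) ∧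
          ∀ i < M, σ'.m (σ'.v 21 + i) = pack (2 * f + 2) (2 ^ n') (fun l => Y (i * 2 ^ n' + l))) ∧
        ∀ i < S, σ'.m i = σ.m i) := by
  have F := H.consts.fits
  have hsc := H.sc_le
  have hKK : 2 ^ n' ≤ 2 ^ n := Nat.pow_le_pow_right (by omega) H.consts.n'_le
  have F' : Fits w (2 * f + 2) (2 * f) (2 ^ n') :=
    ⟨F.q_add, Nat.two_pow_pos _, (Nat.mul_le_mul_right _ hKK).trans F.le, F.w_big⟩
  have hnn := H.consts.n'_le
  have hMpos : 0 < M := hM ▸ Nat.two_pow_pos μ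
  have hidx : ∀ i < M, ∀ l < 2 ^ n', i * 2 ^ n' + l < M * 2 ^ n' := fun i hi l hl => by
    have : (i + 1) * 2 ^ n' ≤ M * 2 ^ n' := Nat.mul_le_mul_right _ hi
    rw [Nat.succ_mul] at this
    omega
  have hfq : 2 ^ f ≤ 2 ^ (2 * f) := Nat.pow_le_pow_right (by omega) (by omega)
  obtain ⟨φ, φlt, φval, φeq⟩ := val_fun H.fields.mono
  have A0 : ArraysAt w n' S M S (S + M) (S + 2 * M) (S + 3 * M) := .init H.S_pos (by omega)
  apply Tr.le
  case h =>
    unfold sortJoinSort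
    apply Tr.seq
    · exact toSort_spec H.consts
    rintro σ1 ⟨g1, c1, m1, l1⟩
    have C1 := H.consts.of_same c1
    apply Tr.seq
    · refine Tr.frame 20 (sortArrays_spec F' A0.toArrays hM g1 C1.v10 ((l1 20 (by omega)).trans H.v20)
        ((l1 21 (by omega)).trans H.v21) ((l1 22 (by omega)).trans H.v22)
        ((l1 23 (by omega)).trans H.v23)
        (S := fun i => recs (fun l => (X (i * 2 ^ n' + l), i * 2 ^ n' + l)) 0 (2 ^ n'))
        fun i hi => ?_) sortArrays_keeps
      rw [m1, H.keys i hi, H.pays i hi]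
      refine ⟨fun l => X (i * 2 ^ n' + l), fun l => if l < 2 ^ n' then i * 2 ^ n' + l else 0,
        fun l => (H.X_lt _).trans_le hfq, fun l => ?_, rfl,
        pack_congr fun l hl => by rw [if_pos hl],
        recs_congr fun l hl => by simp only [zero_add]; rw [if_pos hl]⟩
      dsimp only
      split_ifs with hl
      · exact (hidx i hi l hl).trans_le H.pos_le
      · exact Nat.two_pow_pos _
    rintro σ2 ⟨⟨names2, ⟨S2, sa2, rs2, sum2⟩, mem2⟩, k2⟩
    have C2 := C1.of_same fun i hi _ _ => k2 i hi
    have A2 := A0.sort_cases names2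
    obtain ⟨k, x, -, hx, arr2, flat2, mono2⟩ := sa2.flat rs2
    rw [flat2, sum_recs (fun e => (X e, e))] at sum2
    have low2 : ∀ i < S, σ2.m i = σ.m i := fun i hi => by
      rw [mem2 i (by omega) fun j hj => by omega, m1]
    -- Sorted keys are keys of the input, so they inherit the bounds that the join requires.
    have hkX : ∀ e < M * 2 ^ n', ∃ e', k e = X e' := fun e he => by
      have : (k e, x e) ∈ recs (fun e => (X e, e)) 0 (M * 2 ^ n') :=
        sum2 ▸ mem_recs.2 ⟨e, he, by simp⟩
      obtain ⟨t, -, ht⟩ := mem_recs.1 this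
      simp only [zero_add, Prod.mk.injEq] at ht
      exact ⟨t, ht.1.symm⟩
    apply Tr.seq
    · exact toJoin_spec C2
    rintro σ3 ⟨g3, c3, m3, l3⟩
    have C3 := C2.of_same c3
    have hus : ga + u / s < S + 4 * M := by
      rcases Nat.eq_zero_or_pos (u / s) with h | h
      · have := H.ga_lt 0 (by simpa using H.u_pos)
        omega
      · have h1 := H.ga_lt (u / s - 1) (by
          have h2 := Nat.div_mul_le_self u s
          have h3 : (u / s - 1) * s + s = u / s * s := by
            rw [← Nat.succ_mul]
            congr 1
            omega
          have := H.s_pos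
          omega)
        omega
    have B1 := A2.ka_ge
    have B2 := A2.va_ge
    have B3 := A2.kb_ge
    have B4 := A2.ka_le
    have B5 := A2.kb_le
    apply Tr.seq
    · refine Tr.frame 23 (joinArrays_spec (ka := σ2.v 20) (yb := σ2.v 22) (zg := zg) (s := s) (M := M)
        (u := u) (ga := ga) (K' := 2 ^ n')
        (xx := fun i l => if i * 2 ^ n' + l < M * 2 ^ n' then k (i * 2 ^ n' + l) else 0)
        (w := w) (f := f) (n := n) (sc := S + 4 * M) ?_) joinArrays_keeps
      refine ⟨H.consts.two_le, F, by omega, H.n_le, Nat.two_pow_pos _, hKK, H.s_pos, H.s_le, H.s_mul,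
        H.u_pos, H.u_lt, hus, A2.ka_pos, B4, B5, A2.ka_kb, fun j i hj hi => ?_, g3, C3.v3, C3.v4,
        C3.v10, C3.v11, C3.v12, C3.v13, C3.v14, l3 20 (by omega), l3 22 (by omega), H.fields.lt,
        H.fields.mono, fun j hj => ?_, fun i l => ?_, fun i l l' hi h1 h2 => ?_,
        fun i i' l l' h1 h2 h3 h4 => ?_, fun i l hi hl => ?_, fun i hi => ?_⟩
      · have := H.ga_lt j hj
        omega
      · rw [m3, low2 _ (H.ga_lt j hj), H.fields.word j hj]
      · split_ifs with h
        · obtain ⟨e, he⟩ := hkX _ h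
          exact he ▸ H.X_lt e
        · exact Nat.two_pow_pos f
      · have h3 := hidx i hi l' h2
        rw [if_pos h3, if_pos (by omega)]
        exact mono2 _ _ (by omega) h3
      · have h5 := hidx i' h2 l' h4
        have h6 : i * 2 ^ n' + l < i' * 2 ^ n' + l' := by
          have : (i + 1) * 2 ^ n' ≤ i' * 2 ^ n' := Nat.mul_le_mul_right _ h1
          rw [Nat.succ_mul] at this
          omega
        rw [if_pos h5, if_pos (by omega)]
        exact mono2 _ _ h6 h5
      · rw [if_pos (hidx i hi l hl)]
        obtain ⟨e, he⟩ := hkX _ (hidx i hi l hl)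
        exact he ▸ H.X_le e
      · rw [m3, (arr2 i hi).1]
        exact pack_congr fun l hl => by rw [if_pos (hidx i hi l hl)]
    rintro σ4 ⟨⟨vals4, mem4⟩, k4⟩
    have k4' : ∀ i, 20 ≤ i → i < 23 → σ4.v i = σ2.v i := fun i h1 h2 => by
      rw [k4 i h2, l3 i h1]
    have C4 := C3.of_same fun i hi _ _ => k4 i (by omega)
    apply Tr.seq
    · exact toSort_spec C4
    rintro σ5 ⟨g5, c5, m5, l5⟩
    have C5 := C4.of_same c5
    -- The join has used variable 23 as a counter. The address is recovered because the fourth array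
    -- follows the third directly, whichever pair ended up as the free one.
    apply Tr.set (x := σ2.v 23)
    · simp
    · simp only [eval_add, eval_var, l5 22 (by omega), k4' 22 (by omega) (by omega), C5.v10]
      omega
    apply Tr.set (x := σ2.v 20)
    · simp
    · simp [l5, k4']
    apply Tr.set (x := σ2.v 21)
    · simp
    · simp [l5, k4']
    apply Tr.set (x := σ2.v 22)
    · simp
    · simp [l5, k4']
    apply Tr.set (x := σ2.v 20)
    · simp
    · simp
    have A5 := A2.rotate H.S_pos
    refine Tr.imp (Tr.frame 20 (sortArrays_spec F' A5.toArrays hM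
      (g5.of_eq fun l hl => by
        simp [show l ≠ 24 by omega, show l ≠ 23 by omega, show l ≠ 20 by omega, show l ≠ 21 by omega,
          show l ≠ 22 by omega]) (by simp [C5.v10]) (by simp) (by simp) (by simp) ?_
        (S := fun i => recs (fun l => (x (i * 2 ^ n' + l), φ (k (i * 2 ^ n' + l)))) 0 (2 ^ n'))
        fun i hi => ?_) sortArrays_keeps) ?_
    · simp
    · obtain ⟨y, hy, hv⟩ := vals4 i hi
      refine ⟨fun l => x (i * 2 ^ n' + l), fun l => φ (k (i * 2 ^ n' + l)), fun l => hx _,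
        fun l => (φlt _).trans_le hfq, ?_, ?_, rfl⟩
      · simp only [St.set_m, m5]
        rw [mem4 _ (by have := A2.va_le; omega) fun j hj => A2.va_kb i j hi hj, m3, (arr2 i hi).2]
      · simp only [St.set_m, m5]
        rw [hy]
        refine pack_congr fun l hl => ?_
        have := hv l hl
        rw [if_pos (hidx i hi l hl)] at this
        exact φeq _ _ this
    rintro σ7 ⟨⟨names7, ⟨S7, sa7, rs7, sum7⟩, mem7⟩, k7⟩
    have A7 := A5.sort_cases names7
    obtain ⟨p, y, -, -, arr7, flat7, mono7⟩ := sa7.flat rs7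
    rw [flat7, sum_recs (fun e => (x e, φ (k e)))] at sum7
    -- Applying (key, position) ↦ (position, value of key) to the multiset of the first sort
    -- describes the records of the second sort in terms of the original positions.
    have hpos := positions_of_sorted (G := fun e => φ (X e)) (sum7.trans (by
      have := congrArg (Multiset.map fun z : ℕ × ℕ => (z.2, φ z.1)) sum2
      simpa only [recs_map, Function.comp_def] using this)) mono7
    refine ⟨fun i hi h1 h2 => ?_, A7.va_ge, A7.va_le, ⟨fun e => φ (X e), fun e => φlt _,
      fun e _ => φval _, fun i hi => ?_⟩, fun i hi => ?_⟩
    · rw [k7 i hi]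
      simp only [St.set_v]
      rw [if_neg (by omega), if_neg (by omega), if_neg (by omega), if_neg (by omega),
        if_neg (by omega), c5 i hi h1 h2, k4 i (by omega), c3 i hi h1 h2, k2 i hi, c1 i hi h1 h2]
    · rw [(arr7 i hi).2]
      exact pack_congr fun l hl => (hpos _ (hidx i hi l hl)).2
    · have D1 := A5.ka_ge
      have D2 := A5.va_ge
      have D3 := A5.kb_ge
      have D4 := A5.vb_ge
      rw [mem7 i (by omega) fun j hj => by omega]
      simp only [St.set_m, m5]
      rw [mem4 i (by omega) fun j hj => by omega, m3, low2 i hi]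
  case ht =>
    simp only [cost_var, cost_add]
    omega

end PackedMap

/-! ## Distributing the input over the arrays -/

namespace PackedMap

open Finset Stmt
open PackedMap.Expr (var load)

theorem pack_even_odd (A K : ℕ) (a : ℕ → ℕ) :
    pack A (2 * K) a = pack (2 * A) K (fun t => a (2 * t) + a (2 * t + 1) * 2 ^ A) := by
  induction K with
  | zero => rfl
  | succ K ih =>
    rw [Nat.mul_succ, pack_succ, pack_succ, ih, pack_succ]
    ring

/-- Every other field, from field `o` on. -/
theorem pack_piece {f s o K K' : ℕ} (hK : K' ≤ K) {a : ℕ → ℕ} (ha : ∀ i, a i < 2 ^ f)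
    (h0 : ∀ i, s ≤ i → a i = 0) :
    (pack (f + 1) s a / 2 ^ ((f + 1) * o)) &&&
        pack (2 * f + 2) K (fun i => if i < K' then 2 ^ f - 1 else 0) =
      pack (2 * f + 2) K' (fun t => a (o + 2 * t)) := by
  -- Zero fields are appended so that shifting past the end of the word and pairing neighbouring
  -- fields raise no boundary cases.
  have h1 : pack (f + 1) s a = pack (f + 1) (o + 2 * (s + K)) a := by
    rw [← pack_extend (show s ≤ o + 2 * (s + K) by omega)]
    refine pack_congr fun i _ => ?_
    split_ifs with h
    · rfl
    · exact (h0 i (by omega)).symm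
  have ha' : ∀ i, a i < 2 ^ (f + 1) := fun i => lt_of_le_pow (ha i) (by omega)
  have hm : pack (2 * f + 2) K (fun i => if i < K' then 2 ^ f - 1 else 0) =
      pack (2 * f + 2) (s + K) (fun i => if i < K' then 2 ^ f - 1 else 0) := by
    rw [pack_extend hK, pack_extend (by omega)]
  have hf := Nat.two_pow_pos f
  have hlt : ∀ x y, x < 2 ^ f → y < 2 ^ f → x + y * 2 ^ (f + 1) < 2 ^ (2 * f + 2) := by
    intro x y hx hy
    have h2 : y * 2 ^ (f + 1) + 2 ^ (f + 1) ≤ 2 ^ f * 2 ^ (f + 1) := by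
      rw [← Nat.succ_mul]
      exact Nat.mul_le_mul_right _ hy
    have h3 : 2 ^ (2 * f + 2) = 2 * (2 ^ f * 2 ^ (f + 1)) := by ring
    have h4 : 2 ^ (f + 1) = 2 * 2 ^ f := by ring
    omega
  rw [h1, pack_append, Nat.add_mul_div_right _ _ (Nat.two_pow_pos _),
    Nat.div_eq_of_lt (pack_lt fun i _ => ha' i), zero_add, pack_even_odd, hm,
    show 2 * (f + 1) = 2 * f + 2 by ring, pack_and (by omega) (fun i _ => hlt _ _ (ha _) (ha _))
      (fun i _ => by
        have := Nat.pow_lt_pow_right (a := 2) (by omega) (show f < 2 * f + 2 by omega)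
        split_ifs <;> omega), ← pack_extend (K' := K') (K := s + K) (by omega)]
  refine pack_congr fun i _ => ?_
  split_ifs with h
  -- A lane of width 2f + 2 now holds two neighbouring fields; its f low bits are the first of them.
  · rw [Nat.and_two_pow_sub_one_eq_mod, pow_succ, ← mul_assoc, mul_right_comm,
      Nat.add_mul_mod_self_right, Nat.mod_eq_of_lt (ha _)]
  · simp

/-- The input field that is stored at position `e` of the arrays: array word `m` holds every other
field of half of the input word `m / 4`. -/
def layout (s K : ℕ) (x : ℕ → ℕ) (e : ℕ) : ℕ :=
  if 2 * K * (e / K / 2 % 2) + e / K % 2 + 2 * (e % K) < s then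
    x (e / K / 4 * s + (2 * K * (e / K / 2 % 2) + e / K % 2 + 2 * (e % K))) else 0

theorem layout_at {s K j q p t : ℕ} (x : ℕ → ℕ) (hq : q < 2) (hp : p < 2) (ht : t < K) :
    layout s K x ((4 * j + 2 * q + p) * K + t) =
      if 2 * K * q + p + 2 * t < s then x (j * s + (2 * K * q + p + 2 * t)) else 0 := by
  have h1 : ((4 * j + 2 * q + p) * K + t) / K = 4 * j + 2 * q + p := by
    rw [mul_comm, Nat.mul_add_div (by omega), Nat.div_eq_of_lt ht, add_zero]
  have h2 : ((4 * j + 2 * q + p) * K + t) % K = t := by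
    rw [mul_comm, Nat.mul_add_mod, Nat.mod_eq_of_lt ht]
  rw [layout, h1, h2, show (4 * j + 2 * q + p) / 2 % 2 = q by omega,
    show (4 * j + 2 * q + p) % 2 = p by omega, show (4 * j + 2 * q + p) / 4 = j by omega]

theorem four_mul_lt_two_pow {w B q K : ℕ} (F : Fits w B q K) (hq : 4 ≤ q) :
    4 * w < 2 ^ w ∧ 5 ≤ w := by
  have h1 := F.q_add
  have h2 := F.le
  have h3 : 1 * B ≤ K * B := Nat.mul_le_mul_right _ F.pos
  have h4 := succ_lt_two_pow (w := w - 3) (by omega)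
  have h5 : 2 ^ w = 8 * 2 ^ (w - 3) := by
    rw [show w = w - 3 + 3 by omega, pow_add]
    simp [mul_comm]
  omega

/-- Store every other field of the word `28`, from the bit `sh` on, together with the positions. -/
def loadPiece (sh : Expr) : Stmt :=
  .store (var 25) ((var 28 >>> sh) &&& var 17) ;; .store (var 25 + var 10) (var 26) ;;
  .set 25 (var 25 + 1) ;; .set 26 (var 26 + var 27) ;; .skip

def loadStep : Stmt :=
  .seq (.ite (var 24) (var 4) (.set 28 (load (var 24)) ;; .skip) (.set 28 0 ;; .skip)) <|
  .seq (loadPiece 0) <| .seq (loadPiece (var 1 + 1)) <| .seq (loadPiece (var 29)) <|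
  .seq (loadPiece (var 29 + (var 1 + 1))) <| .set 24 (var 24 + 1) ;; .skip

/-- Fill the keys and the payloads (from `20` on); `28` is the number of lanes in use. -/
def loadArrays : Stmt :=
  .set 29 (var 12 + var 6) ;; .set 27 (var 15 &&& ((1 <<< var 29) - 1)) ;;
  .set 26 (((var 27 * var 27) &&& ((1 <<< var 29) - 1)) - var 27) ;;
  .set 27 (var 27 * var 28) ;; .set 24 0 ;; .set 25 (var 20) ;;
  .loop (var 25) (var 20 + var 10) loadStep

theorem loadArrays_keeps : loadArrays.keeps 24 = true := by decide

/-- The state after `m` array words have been stored. -/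
structure LoadInv (f n' s S M : ℕ) (x : ℕ → ℕ) (σ₀ : St) (m : ℕ) (σ : St) : Prop where
  keep : ∀ i < 24, σ.v i = σ₀.v i
  v25 : σ.v 25 = S + m
  v26 : σ.v 26 = pack (2 * f + 2) (2 ^ n') (fun l => m * 2 ^ n' + l)
  v27 : σ.v 27 = pack (2 * f + 2) (2 ^ n') (fun _ => 2 ^ n')
  v29 : σ.v 29 = 2 ^ n' * (2 * f + 2)
  keys : ∀ i < m, σ.m (S + i) = pack (2 * f + 2) (2 ^ n') (fun l => layout s (2 ^ n') x (i * 2 ^ n' + l))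
  pays : ∀ i < m, σ.m (S + M + i) = pack (2 * f + 2) (2 ^ n') (fun l => i * 2 ^ n' + l)
  mem : ∀ i < S, σ.m i = σ₀.m i

/-- The four pieces of a word are addressed by the half q and the parity p. A lane is as wide as two
fields, so alternate fields land in lanes by a shift and a mask. -/
theorem loadPiece_spec {w f n n' sc s s₂ S M u ga j p q : ℕ} {x : ℕ → ℕ} {σ₀ σ : St}
    (C : Consts w f n n' sc s₂ M u ga σ₀) (hx : ∀ e, x e < 2 ^ f)
    (hs : (f + 1) * s ≤ w) (hS : S + 4 * M ≤ 2 ^ w) {sh : Expr} (hp : p < 2) (hq : q < 2)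
    (hm : 4 * j + 2 * q + p < M) (h24 : σ.v 24 = j)
    (h28 : σ.v 28 = pack (f + 1) s (fun i => x (j * s + i)))
    (I : LoadInv f n' s S M x σ₀ (4 * j + 2 * q + p) σ)
    (hok : sh.Ok w σ) (hsh : sh.eval σ = (f + 1) * (2 * 2 ^ n' * q + p)) :
    Tr w (loadPiece sh) σ (sh.cost + 100) (fun σ' => σ'.v 24 = j ∧
      σ'.v 28 = pack (f + 1) s (fun i => x (j * s + i)) ∧
      LoadInv f n' s S M x σ₀ (4 * j + 2 * q + p + 1) σ') := by
  have F := C.fits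
  have hKK : 2 ^ n' ≤ 2 ^ n := Nat.pow_le_pow_right (by omega) C.n'_le
  have h17 : σ.v 17 = _ := (I.keep 17 (by omega)).trans C.v17
  have h10 : σ.v 10 = M := (I.keep 10 (by omega)).trans C.v10
  have hshw : (f + 1) * (2 * 2 ^ n' * q + p) < 2 ^ w := by
    have h1 : 2 ^ n' * (2 * f + 2) ≤ w + 1 := (Nat.mul_le_mul_right _ hKK).trans F.le
    have h2 : 1 * (2 * f + 2) ≤ 2 ^ n' * (2 * f + 2) := Nat.mul_le_mul_right _ (Nat.two_pow_pos n')
    have h3 : (f + 1) * (2 * 2 ^ n' * q + p) = (2 ^ n' * (2 * f + 2)) * q + (f + 1) * p := by ring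
    have h4 : 2 ^ n' * (2 * f + 2) * q ≤ 2 ^ n' * (2 * f + 2) * 1 := Nat.mul_le_mul_left _ (by omega)
    have h5 : (f + 1) * p ≤ (f + 1) * 1 := Nat.mul_le_mul_left _ (by omega)
    have h6 := four_mul_lt_two_pow F (by have := C.two_le; omega)
    omega
  have hw28 : pack (f + 1) s (fun i => x (j * s + i)) < 2 ^ w :=
    (pack_lt fun i _ => lt_of_le_pow (hx _) (by omega)).trans_le
      (Nat.pow_le_pow_right (by omega) hs)
  have hkey : (pack (f + 1) s (fun i => x (j * s + i)) / 2 ^ ((f + 1) * (2 * 2 ^ n' * q + p))) &&&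
      σ.v 17 = pack (2 * f + 2) (2 ^ n')
        (fun l => layout s (2 ^ n') x ((4 * j + 2 * q + p) * 2 ^ n' + l)) := by
    rw [h17, pack_congr (b := fun i => if i < s then x (j * s + i) else 0)
      fun i hi => by rw [if_pos hi], pack_piece hKK (fun i => ?_) fun i hi => by rw [if_neg (by omega)]]
    · exact pack_congr fun l hl => (layout_at x hq hp hl).symm
    · split_ifs
      exacts [hx _, Nat.two_pow_pos f]
  apply Tr.le
  case h =>
    unfold loadPiece
    apply Tr.store (y := S + (4 * j + 2 * q + p)) (x := _)
    · simp
    · simp [hok, h28, hw28, hsh, hshw]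
    · simp [I.v25]
    · simp only [eval_and, eval_shr, eval_var, h28, hsh]
      exact hkey
    · omega
    apply Tr.store (y := S + M + (4 * j + 2 * q + p)) (x := _)
    · simp
    · simp
    · simp [I.v25, h10]; omega
    · simp only [eval_var, St.write_v]
      exact I.v26
    · omega
    apply Tr.set (x := S + (4 * j + 2 * q + p + 1))
    · simp
    · simp [I.v25]; omega
    apply Tr.set (x := pack (2 * f + 2) (2 ^ n') (fun l => (4 * j + 2 * q + p + 1) * 2 ^ n' + l))
    · simp
    · simp only [eval_add, eval_var, St.set_v, St.write_v, Nat.reduceEqDiff, if_false, I.v26, I.v27,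
        pack_add]
      exact pack_congr fun l _ => by ring
    apply Tr.skip
    refine ⟨by simp [h24], by simp [h28], fun i hi => ?_, by simp, by simp, by simp [I.v27],
      by simp [I.v29], fun i hi => ?_, fun i hi => ?_, fun i hi => ?_⟩
    · simp [show i ≠ 26 by omega, show i ≠ 25 by omega, I.keep i hi]
    · simp only [St.set_m, St.write_m]
      rw [if_neg (by omega)]
      split_ifs with h
      · rw [show i = 4 * j + 2 * q + p by omega]
      · exact I.keys i (by omega)
    · simp only [St.set_m, St.write_m]
      split_ifs with h h'
      · rw [show i = 4 * j + 2 * q + p by omega]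
      · omega
      · exact I.pays i (by omega)
    · simp only [St.set_m, St.write_m]
      rw [if_neg (by omega), if_neg (by omega)]
      exact I.mem i hi
  case ht => clear * -; simp; omega

/-- The number of array words is rounded up to four times a power of two; beyond the input the
arrays are filled with zero keys. -/
theorem loadStep_spec {w f n n' sc s s₂ S M u ga j : ℕ} {x : ℕ → ℕ} {σ₀ σ : St}
    (C : Consts w f n n' sc s₂ M u ga σ₀) (hx : ∀ e, x e < 2 ^ f)
    (hs : (f + 1) * s ≤ w) (hS : S + 4 * M ≤ 2 ^ w) (hga : ga ≤ S)
    (hX : ∀ j < ga, σ₀.m j = pack (f + 1) s (fun i => x (j * s + i)))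
    (hx0 : ∀ e, ga * s ≤ e → x e = 0) (hj : 4 * j + 4 ≤ M) (h24 : σ.v 24 = j)
    (I : LoadInv f n' s S M x σ₀ (4 * j) σ) :
    Tr w loadStep σ 600 (fun σ' => σ'.v 24 = j + 1 ∧
      LoadInv f n' s S M x σ₀ (4 * (j + 1)) σ') := by
  have keep28 : ∀ y, LoadInv f n' s S M x σ₀ (4 * j) (σ.set 28 y) := fun y =>
    ⟨fun i hi => by simp [show i ≠ 28 by omega, I.keep i hi], by simp [I.v25], by simp [I.v26],
      by simp [I.v27], by simp [I.v29], I.keys, I.pays, I.mem⟩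
  have h4 : σ.v 4 = ga := (I.keep 4 (by omega)).trans C.v4
  apply Tr.le
  case h =>
    unfold loadStep
    apply Tr.seq (R := fun σ' => σ'.v 24 = j ∧ σ'.v 28 = pack (f + 1) s (fun i => x (j * s + i)) ∧
      LoadInv f n' s S M x σ₀ (4 * j) σ')
    · apply Tr.ite
      · simp
      · simp
      · simp [h24]; omega
      · simp [h4]; omega
      · intro h
        simp only [eval_var, h24, h4] at h
        apply Tr.set (x := pack (f + 1) s (fun i => x (j * s + i)))
        · simp [h24]; omega
        · simp [h24, I.mem j (by omega), hX j h]
        apply Tr.skip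
        exact ⟨by simp [h24], by simp, keep28 _⟩
      · intro h
        simp only [eval_var, h24, h4] at h
        apply Tr.set (x := pack (f + 1) s (fun i => x (j * s + i)))
        · simp
        · rw [pack_congr (b := fun _ => 0) fun i _ => hx0 _ ?_, pack_const_zero]
          · simp
          · have := Nat.mul_le_mul_right s h
            omega
        apply Tr.skip
        exact ⟨by simp [h24], by simp, keep28 _⟩
    rintro σ1 ⟨a1, b1, I1⟩
    apply Tr.seq
    · exact loadPiece_spec C hx hs hS (p := 0) (q := 0) (by omega) (by omega) (by omega) a1 b1 I1
        (by simp) (by simp)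
    rintro σ2 ⟨a2, b2, I2⟩
    apply Tr.seq
    · exact loadPiece_spec C hx hs hS (p := 1) (q := 0) (by omega) (by omega) (by omega) a2 b2 I2
        (by simp) (by simp [I2.keep, C.v1])
    rintro σ3 ⟨a3, b3, I3⟩
    apply Tr.seq
    · exact loadPiece_spec C hx hs hS (p := 0) (q := 1) (by omega) (by omega) (by omega) a3 b3 I3
        (by simp) (by simp [I3.v29]; ring)
    rintro σ4 ⟨a4, b4, I4⟩
    apply Tr.seq
    · exact loadPiece_spec C hx hs hS (p := 1) (q := 1) (by omega) (by omega) (by omega) a4 b4 I4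
        (by simp) (by simp [I4.v29, I4.keep, C.v1]; ring)
    rintro σ5 ⟨a5, b5, I5⟩
    apply Tr.set (x := j + 1)
    · simp
    · simp [a5]
    apply Tr.skip
    exact ⟨by simp, fun i hi => by simp [show i ≠ 24 by omega, I5.keep i hi], by simp [I5.v25]; ring,
      by simp [I5.v26]; rfl, by simp [I5.v27], by simp [I5.v29], I5.keys, I5.pays, I5.mem⟩
  case ht => clear * -; simp

theorem low_mask {B K K' : ℕ} (h : K' ≤ K) {a : ℕ → ℕ} (ha : ∀ i < K', a i < 2 ^ B) :
    pack B K a &&& (2 ^ (K' * B) - 1) = pack B K' a := by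
  obtain ⟨d, rfl⟩ := Nat.exists_eq_add_of_le h
  rw [Nat.and_two_pow_sub_one_eq_mod, pack_append, mul_comm K' B, Nat.add_mul_mod_self_right,
    Nat.mod_eq_of_lt (pack_lt ha)]

theorem loadArrays_spec {w f n n' sc s s₂ S M u ga : ℕ} {x : ℕ → ℕ} {σ : St}
    (C : Consts w f n n' sc s₂ M u ga σ) (hx : ∀ e, x e < 2 ^ f)
    (hs : (f + 1) * s ≤ w) (hS : S + 4 * M < 2 ^ w) (hga : ga ≤ S)
    (hX : ∀ j < ga, σ.m j = pack (f + 1) s (fun i => x (j * s + i)))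
    (hx0 : ∀ e, ga * s ≤ e → x e = 0) (hM : 4 ∣ M) (hK' : 2 ^ n' ≤ 2 ^ f) (h20 : σ.v 20 = S)
    (h28 : σ.v 28 = 2 ^ n') :
    Tr w loadArrays σ (160 * M + 60) (fun σ' =>
      (∀ i < M, σ'.m (S + i) = pack (2 * f + 2) (2 ^ n') (fun l => layout s (2 ^ n') x (i * 2 ^ n' + l)) ∧
        σ'.m (S + M + i) = pack (2 * f + 2) (2 ^ n') (fun l => i * 2 ^ n' + l)) ∧
      ∀ i < S, σ'.m i = σ.m i) := by
  have F := C.fits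
  have hKK : 2 ^ n' ≤ 2 ^ n := Nat.pow_le_pow_right (by omega) C.n'_le
  have hK := Nat.two_pow_pos n'
  have hKw : 2 ^ n' * (2 * f + 2) < 2 ^ w := F.lt_pow ((Nat.mul_le_mul_right _ hKK).trans F.le)
  have h8 : (2 * f + 2) * (2 ^ n' - 1) + (2 * f + 2) = 2 ^ n' * (2 * f + 2) := by
    obtain ⟨d, hd⟩ := Nat.exists_eq_succ_of_ne_zero hK.ne'
    rw [hd, Nat.succ_eq_add_one, Nat.add_sub_cancel]
    ring
  have hKB : 2 ^ n' < 2 ^ (2 * f + 2) :=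
    hK'.trans_lt (Nat.pow_lt_pow_right (by omega) (by omega))
  -- The prefix sums of all-ones lanes are 1, 2, 3, …; subtracting the ones afterwards numbers the
  -- lanes from 0.
  have hiota : (pack (2 * f + 2) (2 ^ n') (fun _ => 1) * pack (2 * f + 2) (2 ^ n') (fun _ => 1)) &&&
      (2 ^ (2 ^ n' * (2 * f + 2)) - 1) = pack (2 * f + 2) (2 ^ n') (fun i => i + 1) := by
    rw [mul_comm (2 ^ n') (2 * f + 2), ← pack_ones,
      prefix_sums (by omega) (fun i hi => ?_) le_rfl]
    · simp
    · simp; omega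
  obtain ⟨c, rfl⟩ := hM
  apply Tr.le
  case h =>
    unfold loadArrays
    apply Tr.set (x := 2 ^ n' * (2 * f + 2))
    · simp
    · simp [C.v12, C.v6, h8]
    apply Tr.set (x := pack (2 * f + 2) (2 ^ n') (fun _ => 1))
    · simp [hKw, Nat.one_le_two_pow]
    · simp only [eval_and, eval_shl, eval_var, eval_sub, eval_lit, St.set_v, if_true,
        Nat.reduceEqDiff, if_false, one_mul, C.v15]
      exact low_mask hKK fun _ _ => Nat.one_lt_two_pow (by omega)
    apply Tr.set (x := pack (2 * f + 2) (2 ^ n') (fun i => i))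
    · simp only [ok_sub, ok_and, ok_mul, ok_shl, ok_var, ok_lit, eval_and, eval_shl, eval_var,
        eval_sub, eval_lit, eval_mul, St.set_v, if_true, Nat.reduceEqDiff, if_false, one_mul, hiota,
        true_and, and_true]
      exact ⟨⟨hKw, Nat.one_le_two_pow⟩, pack_mono fun i _ => by omega⟩
    · simp only [eval_and, eval_shl, eval_var, eval_sub, eval_lit, eval_mul, St.set_v, if_true,
        Nat.reduceEqDiff, if_false, one_mul, hiota]
      rw [pack_sub fun i _ => by omega]
      exact pack_congr fun i _ => by omega
    apply Tr.set (x := pack (2 * f + 2) (2 ^ n') (fun _ => 2 ^ n'))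
    · simp
    · simp [h28, pack_mul_const]
    apply Tr.set (x := 0)
    · simp
    · simp
    apply Tr.set (x := S)
    · simp
    · simp [h20]
    refine Tr.imp (Tr.loop_count (fun j σ' => σ'.v 24 = j ∧
      LoadInv f n' s S (4 * c) x σ (4 * j) σ') c 600 ?_ ?_ ?_) ?_
    · refine ⟨by simp, fun i hi => ?_, by simp, by simp, by simp, by simp, by simp, by simp, by simp⟩
      simp [show i ≠ 29 by omega, show i ≠ 27 by omega, show i ≠ 26 by omega,
        show i ≠ 25 by omega, show i ≠ 24 by omega]
    · rintro j hj σ' ⟨-, I⟩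
      refine ⟨by simp, by simp, ?_, ?_, ?_⟩
      · simp only [eval_var, I.v25]; omega
      · simp only [eval_var, eval_add, I.keep 20 (by omega), I.keep 10 (by omega), h20, C.v10]; omega
      · simp only [eval_var, eval_add, I.v25, I.keep 20 (by omega), I.keep 10 (by omega), h20, C.v10]
        omega
    · rintro j hj σ' ⟨h24, I⟩
      exact loadStep_spec C hx hs hS.le hga hX hx0 (by omega) h24 I
    · rintro σ' ⟨-, I⟩
      exact ⟨fun i hi => ⟨I.keys i hi, I.pays i hi⟩, I.mem⟩
  case ht => clear * -; simp; omega

end PackedMap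

/-! ## Division, and the output -/

namespace PackedMap

open Finset Stmt
open PackedMap.Expr (var load)

/-- `26` becomes the quotient of the word length and `24`; `25` is a large power of two. -/
def divide : Stmt :=
  .set 26 0 ;; .set 27 (var 0) ;;
  .loop 0 (var 25) (
    .seq (.ite (var 27) (var 24 * var 25) .skip
      (.set 27 (var 27 - var 24 * var 25) ;; .set 26 (var 26 + var 25) ;; .skip)) <|
    .set 25 (var 25 >>> 1) ;; .skip)

theorem divide_pure : divide.pure = true := by decide

/-- Binary long division, as the machine has no division. It needs only a starting power of two
above half the quotient, and the lane count supplies one within O(n) rounds. -/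
theorem divide_spec {w A k : ℕ} {σ : St} (h0 : σ.v 0 = w) (h24 : σ.v 24 = A) (h25 : σ.v 25 = 2 ^ k)
    (hw : 2 ≤ w) (hA : 0 < A) (hlt : w < A * 2 ^ (k + 1)) (hAk : A * 2 ^ k < 2 ^ w) :
    Tr w divide σ (50 * (k + 2)) (fun σ' => σ'.v 26 = w / A) := by
  have hww := succ_lt_two_pow hw
  apply Tr.le
  case h =>
    unfold divide
    apply Tr.set (x := 0)
    · simp
    · simp
    apply Tr.set (x := w)
    · simp
    · simp [h0]
    -- The trial power is 2^(k+1-i) / 2. After round k + 1 this quotient is 0, and that value ends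
    -- the loop.
    refine Tr.imp (Tr.loop_count (fun i σ' => σ'.v 24 = A ∧ σ'.v 25 = 2 ^ (k + 1 - i) / 2 ∧
      σ'.v 26 * A + σ'.v 27 = w ∧ σ'.v 27 < A * 2 ^ (k + 1 - i)) (k + 1) 40 ?_ ?_ ?_) ?_
    · refine ⟨by simp [h24], ?_, by simp, by simpa using hlt⟩
      simp [h25, pow_succ]
    · rintro i hi σ' ⟨-, i2, -, -⟩
      have h1 : 2 ^ (k + 1 - i) / 2 < 2 ^ w := by
        have : 2 ^ (k + 1 - i) ≤ 2 ^ (k + 1) := Nat.pow_le_pow_right (by omega) (by omega)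
        have : 1 * 2 ^ k ≤ A * 2 ^ k := Nat.mul_le_mul_right _ hA
        rw [pow_succ] at *
        omega
      refine ⟨by simp, by simp, by simp, by simpa [i2], ?_⟩
      simp only [eval_var, eval_lit, i2]
      rcases Nat.lt_or_ge i (k + 1) with h | h
      · rw [show k + 1 - i = k - i + 1 by omega, pow_succ]
        have := Nat.two_pow_pos (k - i)
        omega
      · rw [show k + 1 - i = 0 by omega]
        simp
        omega
    · rintro i hi σ' ⟨i1, i2, i3, i4⟩
      rw [show k + 1 - i = k - i + 1 by omega, pow_succ] at i2 i4
      rw [Nat.mul_div_cancel _ (by omega)] at i2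
      have e1 : A * 2 ^ (k - i) ≤ A * 2 ^ k :=
        Nat.mul_le_mul_left _ (Nat.pow_le_pow_right (by omega) (by omega))
      apply Tr.le
      case h =>
        apply Tr.seq (R := fun σ' => σ'.v 24 = A ∧ σ'.v 25 = 2 ^ (k - i) ∧
          σ'.v 26 * A + σ'.v 27 = w ∧ σ'.v 27 < A * 2 ^ (k - i))
        · apply Tr.ite
          · simp
          · simp
          · simp only [eval_var]; omega
          · simp only [eval_var, eval_mul, i1, i2]; omega
          · intro h
            simp only [eval_var, eval_mul, i1, i2] at h
            exact Tr.skip ⟨i1, i2, i3, h⟩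
          · intro h
            simp only [eval_var, eval_mul, i1, i2] at h
            apply Tr.set (x := σ'.v 27 - A * 2 ^ (k - i))
            · simpa [i1, i2]
            · simp [i1, i2]
            apply Tr.set (x := σ'.v 26 + 2 ^ (k - i))
            · simp
            · simp [i2]
            apply Tr.skip
            refine ⟨by simp [i1], by simp [i2], ?_, ?_⟩
            · simp only [St.set_v, if_true, Nat.reduceEqDiff, if_false, add_mul]
              rw [mul_comm (2 ^ (k - i))]
              omega
            · simp only [St.set_v, if_true, Nat.reduceEqDiff, if_false]
              rw [← mul_assoc] at i4
              omega
        rintro σ'' ⟨j1, j2, j3, j4⟩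
        apply Tr.set (x := 2 ^ (k - i) / 2)
        · simp only [ok_shr, ok_var, ok_lit, eval_var, eval_lit, j2, true_and]
          have : 1 * 2 ^ (k - i) ≤ A * 2 ^ (k - i) := Nat.mul_le_mul_right _ hA
          omega
        · simp [j2]
        apply Tr.skip
        refine ⟨by simp [j1], ?_, by simpa using j3, ?_⟩
        · simp [show k + 1 - (i + 1) = k - i by omega]
        · simpa [show k + 1 - (i + 1) = k - i by omega] using j4
      case ht => clear * -; simp
    · rintro σ' ⟨-, -, i3, i4⟩
      simp only [Nat.sub_self, pow_zero, mul_one] at i4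
      rw [← i3, mul_comm, Nat.mul_add_div hA, Nat.div_eq_of_lt i4, add_zero]
  case ht => clear * -; simp; omega

/-- Interleave four groups of lanes. -/
theorem pack_four (f K : ℕ) (b : ℕ → ℕ) :
    pack (f + 1) (4 * K) b = pack (2 * f + 2) K (fun t => b (2 * t)) +
      pack (2 * f + 2) K (fun t => b (1 + 2 * t)) * 2 ^ (f + 1) +
      pack (2 * f + 2) K (fun t => b (2 * K + 2 * t)) * 2 ^ (K * (2 * f + 2)) +
      pack (2 * f + 2) K (fun t => b (2 * K + 1 + 2 * t)) * 2 ^ (K * (2 * f + 2) + (f + 1)) := by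
  rw [show 4 * K = 2 * K + 2 * K by ring, pack_append, pack_even_odd, pack_even_odd, ← pack_add,
    ← pack_mul_const, ← pack_add, ← pack_mul_const, show 2 * (f + 1) = 2 * f + 2 by ring,
    show (f + 1) * (2 * K) = K * (2 * f + 2) by ring, pow_add _ (K * (2 * f + 2))]
  simp only [show ∀ t, 2 * t + 1 = 1 + 2 * t by intro t; ring,
    show ∀ t, 2 * K + (1 + 2 * t) = 2 * K + 1 + 2 * t by intro t; ring]
  ring

def outStep : Stmt :=
  .set 27 (var 22) ;; setMin 26 27 ;;
  .set 28 (load (var 25) + (load (var 25 + 1) <<< (var 1 + 1)) + (load (var 25 + 2) <<< var 29) +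
    (load (var 25 + 3) <<< (var 29 + (var 1 + 1)))) ;;
  .store (var 5 + var 24) (var 28 &&& ((1 <<< (var 27 * (var 1 + 1))) - 1)) ;;
  .set 26 (var 26 - var 27) ;; .set 25 (var 25 + 4) ;; .set 24 (var 24 + 1) ;; .skip

/-- Store the output, from the array in `21`. -/
def storeOutput : Stmt :=
  .set 24 (var 1 + 1) ;; .set 25 (var 14 * 4) ;; divide ;;
  .set 22 (var 26) ;; .set 24 0 ;; .set 25 (var 21) ;; .set 26 (var 2) ;; .set 29 (var 12 + var 6) ;;
  .loop (var 24) (var 4) outStep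

/-- The output is in the array at `b`. -/
structure OutSetup (w f n n' s r S M N oa b : ℕ) (Y y : ℕ → ℕ) (σ : St) : Prop where
  f_big : 8 ≤ f
  S_le : S + 4 * M + w ≤ 2 ^ w
  N_le : 4 * N ≤ M
  oa_le : oa + N ≤ S
  b_ge : S ≤ b
  b_le : b + M ≤ S + 4 * M
  s_eq : s = w / (f + 1)
  lt_r : ∀ j < N, j * s < r
  r_lt : r < 2 ^ w
  cnt_le : min s r ≤ 4 * 2 ^ n'
  v2 : σ.v 2 = r
  v5 : σ.v 5 = oa
  v21 : σ.v 21 = b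
  Y_lt : ∀ e, Y e < 2 ^ f
  arr : ∀ i < M, σ.m (b + i) = pack (2 * f + 2) (2 ^ n') (fun l => Y (i * 2 ^ n' + l))
  val : ∀ j < N, ∀ q < 2, ∀ p < 2, ∀ t < 2 ^ n', 2 * 2 ^ n' * q + p + 2 * t < s →
    j * s + (2 * 2 ^ n' * q + p + 2 * t) < r →
    Y ((4 * j + 2 * q + p) * 2 ^ n' + t) = y (j * s + (2 * 2 ^ n' * q + p + 2 * t))

structure OutInv (f n' s r S N oa b : ℕ) (y : ℕ → ℕ) (σ₀ : St) (j : ℕ) (σ : St) : Prop where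
  keep : ∀ i < 22, σ.v i = σ₀.v i
  v22 : σ.v 22 = s
  v24 : σ.v 24 = j
  v25 : σ.v 25 = b + 4 * j
  v26 : σ.v 26 = r - j * s
  v29 : σ.v 29 = 2 ^ n' * (2 * f + 2)
  done : ∀ i < j, σ.m (oa + i) = pack (f + 1) (min s (r - i * s)) (fun l => y (i * s + l))
  mem : ∀ a, (∀ i < N, a ≠ oa + i) → σ.m a = σ₀.m a

/-- Loading in reverse: the four pieces occupy complementary positions and are added without
overlap. The mask cuts off the values of filler fields in the last word. -/
theorem outWord_eq {w f n n' s r S M N oa b : ℕ} {Y y : ℕ → ℕ} {σ : St}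
    (H : OutSetup w f n n' s r S M N oa b Y y σ) {j : ℕ} (hj : j < N) :
    (pack (2 * f + 2) (2 ^ n') (fun l => Y ((4 * j) * 2 ^ n' + l)) +
      pack (2 * f + 2) (2 ^ n') (fun l => Y ((4 * j + 1) * 2 ^ n' + l)) * 2 ^ (f + 1) +
      pack (2 * f + 2) (2 ^ n') (fun l => Y ((4 * j + 2) * 2 ^ n' + l)) * 2 ^ (2 ^ n' * (2 * f + 2)) +
      pack (2 * f + 2) (2 ^ n') (fun l => Y ((4 * j + 3) * 2 ^ n' + l)) *
        2 ^ (2 ^ n' * (2 * f + 2) + (f + 1))) &&&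
      (2 ^ (min s (r - j * s) * (f + 1)) - 1) =
      pack (f + 1) (min s (r - j * s)) (fun l => y (j * s + l)) := by
  obtain ⟨K, hK⟩ : ∃ K, K = 2 ^ n' := ⟨_, rfl⟩
  have hKpos : 0 < K := hK ▸ Nat.two_pow_pos n'
  have hcnt := H.cnt_le
  have hval := H.val j hj
  rw [← hK] at hcnt hval ⊢
  -- The sequence whose even and odd members in the two halves are the four pieces; it inverts the
  -- layout of the input.
  let b : ℕ → ℕ := fun i => Y ((4 * j + 2 * (i / (2 * K)) + i % 2) * K + i % (2 * K) / 2)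
  have hb : ∀ q p t, p < 2 → t < K → b (2 * K * q + p + 2 * t) = Y ((4 * j + 2 * q + p) * K + t) := by
    intro q p t hp ht
    have h1 : (2 * K * q + p + 2 * t) / (2 * K) = q := by
      rw [add_assoc, Nat.mul_add_div (by omega), Nat.div_eq_of_lt (by omega), add_zero]
    have h2 : (2 * K * q + p + 2 * t) % (2 * K) = p + 2 * t := by
      rw [add_assoc, Nat.mul_add_mod, Nat.mod_eq_of_lt (by omega)]
    have h3 : (2 * K * q + p + 2 * t) % 2 = p := by
      rw [add_assoc, mul_assoc, Nat.mul_add_mod]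
      omega
    dsimp only [b]
    rw [h1, h2, h3]
    congr 2
    omega
  have e0 : ∀ t < K, Y (4 * j * K + t) = b (2 * t) := fun t ht => by
    simpa using (hb 0 0 t (by omega) ht).symm
  have e1 : ∀ t < K, Y ((4 * j + 1) * K + t) = b (1 + 2 * t) := fun t ht => by
    simpa using (hb 0 1 t (by omega) ht).symm
  have e2 : ∀ t < K, Y ((4 * j + 2) * K + t) = b (2 * K + 2 * t) := fun t ht => by
    simpa using (hb 1 0 t (by omega) ht).symm
  have e3 : ∀ t < K, Y ((4 * j + 3) * K + t) = b (2 * K + 1 + 2 * t) := fun t ht => by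
    simpa using (hb 1 1 t (by omega) ht).symm
  rw [pack_congr e0, pack_congr e1, pack_congr e2, pack_congr e3, ← pack_four,
    low_mask (by omega) fun i _ => lt_of_le_pow (H.Y_lt _) (by omega)]
  refine pack_congr fun i hi => ?_
  have d1 := Nat.div_add_mod i (2 * K)
  have d2 := Nat.mod_lt i (show 0 < 2 * K by omega)
  have d3 : i % (2 * K) % 2 = i % 2 := Nat.mod_mul_right_mod i 2 K
  have d4 : i / (2 * K) < 2 := by
    rw [Nat.div_lt_iff_lt_mul (by omega)]
    omega
  have d5 : 2 * K * (i / (2 * K)) + i % 2 + 2 * (i % (2 * K) / 2) = i := by omega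
  have := hval (i / (2 * K)) d4 (i % 2) (by omega) (i % (2 * K) / 2) (by omega)
  rw [d5] at this
  exact this (by omega) (by omega)

theorem outStep_spec {w f n n' s r S M N oa b s₂ u sc : ℕ} {Y y : ℕ → ℕ} {σ₀ σ : St}
    (C : Consts w f n n' sc s₂ M u N σ₀)
    (H : OutSetup w f n n' s r S M N oa b Y y σ₀) {j : ℕ} (hj : j < N)
    (I : OutInv f n' s r S N oa b y σ₀ j σ) :
    Tr w outStep σ 100 (OutInv f n' s r S N oa b y σ₀ (j + 1)) := by
  have F := C.fits
  have hKK : 2 ^ n' ≤ 2 ^ n := Nat.pow_le_pow_right (by omega) C.n'_le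
  have hKw : 2 ^ n' * (2 * f + 2) ≤ w + 1 := (Nat.mul_le_mul_right _ hKK).trans F.le
  have h1B : 1 * (2 * f + 2) ≤ 2 ^ n' * (2 * f + 2) := Nat.mul_le_mul_right _ (Nat.two_pow_pos n')
  have hbig := four_mul_lt_two_pow F (by have := C.two_le; omega)
  have hsw : s * (f + 1) ≤ w := H.s_eq ▸ Nat.div_mul_le_self _ _
  have hs1 : s * 1 ≤ s * (f + 1) := Nat.mul_le_mul_left _ (by omega)
  have hr := H.r_lt
  have hcs : min s (r - j * s) * (f + 1) ≤ s * (f + 1) := Nat.mul_le_mul_right _ (by omega)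
  have h1 : σ.v 1 = f := (I.keep 1 (by omega)).trans C.v1
  have h5 : σ.v 5 = oa := (I.keep 5 (by omega)).trans H.v5
  have B1 := H.S_le
  have B2 := H.N_le
  have B3 := H.oa_le
  have B4 := H.b_ge
  have B5 := H.b_le
  have hm : ∀ i < 4, σ.m (b + 4 * j + i) =
      pack (2 * f + 2) (2 ^ n') (fun l => Y ((4 * j + i) * 2 ^ n' + l)) := fun i hi => by
    rw [I.mem _ fun i' hi' => by omega, add_assoc, H.arr _ (by omega)]
  have hm0 := hm 0 (by omega)
  rw [add_zero, add_zero] at hm0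
  apply Tr.le
  case h =>
    unfold outStep
    apply Tr.set (x := s)
    · simp
    · simp [I.v22]
    apply Tr.seq
    · apply setMin_spec
      · simp [I.v26]; omega
      · simp; omega
    intro σ1 hσ1
    have e1 : σ1 = (σ.set 27 s).set 27 (min s (r - j * s)) := by
      rw [hσ1]
      simp [I.v26, min_comm]
    rw [e1]
    apply Tr.set (x := _)
    · simp [I.v25, I.v29, h1]; omega
    · simp only [eval_add, eval_load, eval_var, eval_shl, eval_lit, St.set_v, St.set_m,
        Nat.reduceEqDiff, if_false, I.v25, I.v29, h1, hm0, hm 1 (by omega), hm 2 (by omega),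
        hm 3 (by omega)]
      rfl
    apply Tr.store (y := oa + j) (x := pack (f + 1) (min s (r - j * s)) (fun l => y (j * s + l)))
    · simp
    · simp only [ok_and, ok_sub, ok_shl, ok_mul, ok_add, ok_var, ok_lit, eval_mul, eval_add, eval_shl,
        eval_lit, eval_var, St.set_v, Nat.reduceEqDiff, if_false, if_true, h1, true_and, one_mul]
      exact ⟨by omega, Nat.one_le_two_pow⟩
    · simp [h5, I.v24]
    · simp only [eval_and, eval_sub, eval_shl, eval_mul, eval_add, eval_lit, eval_var, St.set_v,
        Nat.reduceEqDiff, if_false, if_true, h1, one_mul]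
      exact outWord_eq H hj
    · omega
    apply Tr.set (x := r - (j + 1) * s)
    · simp [I.v26]
    · simp [I.v26, Nat.succ_mul]; omega
    apply Tr.set (x := b + 4 * (j + 1))
    · simp
    · simp [I.v25]; ring
    apply Tr.set (x := j + 1)
    · simp
    · simp [I.v24]
    apply Tr.skip
    refine ⟨fun i hi => ?_, by simp [I.v22], by simp, by simp, by simp, by simp [I.v29],
      fun i hi => ?_, fun a ha => ?_⟩
    · simp [show i ≠ 27 by omega, show i ≠ 28 by omega, show i ≠ 26 by omega,
        show i ≠ 25 by omega, show i ≠ 24 by omega, I.keep i hi]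
    · simp only [St.set_m, St.write_m]
      split_ifs with h
      · rw [show i = j by omega]
      · exact I.done i (by omega)
    · simp only [St.set_m, St.write_m]
      rw [if_neg (ha j hj)]
      exact I.mem a ha
  case ht => clear * -; simp

theorem storeOutput_spec {w f n n' s r S M N oa b s₂ u sc : ℕ} {Y y : ℕ → ℕ} {σ : St}
    (C : Consts w f n n' sc s₂ M u N σ) (hmax : w + 1 < 2 * (2 ^ n * (2 * f + 2)))
    (H : OutSetup w f n n' s r S M N oa b Y y σ) :
    Tr w storeOutput σ (110 * N + 50 * n + 300) (fun σ' =>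
      (∀ j < N, σ'.m (oa + j) = pack (f + 1) (min s (r - j * s)) (fun l => y (j * s + l))) ∧
      ∀ a, (∀ i < N, a ≠ oa + i) → σ'.m a = σ.m a) := by
  have F := C.fits
  have hbig := four_mul_lt_two_pow F (by have := C.two_le; omega)
  have h8 : (2 * f + 2) * (2 ^ n' - 1) + (2 * f + 2) = 2 ^ n' * (2 * f + 2) := by
    obtain ⟨d, hd⟩ := Nat.exists_eq_succ_of_ne_zero (Nat.two_pow_pos n').ne'
    rw [hd, Nat.succ_eq_add_one, Nat.add_sub_cancel]
    ring
  have e4 : 2 ^ n * 4 = 2 ^ (n + 2) := by ring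
  have B1 := H.S_le
  have B2 := H.N_le
  apply Tr.le
  case h =>
    unfold storeOutput
    apply Tr.set (x := f + 1)
    · simp
    · simp [C.v1]
    apply Tr.set (x := 2 ^ (n + 2))
    · simp
    · simp [C.v14, e4]
    apply Tr.seq
    · refine Tr.frame 24 (Tr.frameMem (divide_spec (w := w) (A := f + 1) (k := n + 2) ?_ ?_ ?_ F.w_big
        (by omega) ?_ ?_) divide_pure) (by decide)
      · simp [C.v0]
      · simp
      · simp
      · have : (f + 1) * 2 ^ (n + 2 + 1) = 4 * (2 ^ n * (2 * f + 2)) := by ring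
        omega
      · have : (f + 1) * 2 ^ (n + 2) = 2 * (2 ^ n * (2 * f + 2)) := by ring
        have := F.le
        omega
    rintro σ1 ⟨⟨q1, m1⟩, k1⟩
    have k1' : ∀ i < 24, σ1.v i = σ.v i := fun i hi => by
      rw [k1 i hi]
      simp [show i ≠ 25 by omega, show i ≠ 24 by omega]
    apply Tr.set (x := s)
    · simp
    · simp [q1, H.s_eq]
    apply Tr.set (x := 0)
    · simp
    · simp
    apply Tr.set (x := b)
    · simp
    · simp [k1', H.v21]
    apply Tr.set (x := r)
    · simp
    · simp [k1', H.v2]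
    apply Tr.set (x := 2 ^ n' * (2 * f + 2))
    · simp
    · simp [k1', C.v12, C.v6, h8]
    refine Tr.imp (Tr.loop_count (OutInv f n' s r S N oa b y σ) N 100 ?_ ?_ ?_) ?_
    · refine ⟨fun i hi => ?_, by simp, by simp, by simp, by simp, by simp, by simp, by simp [m1]⟩
      simp [show i ≠ 29 by omega, show i ≠ 26 by omega, show i ≠ 25 by omega,
        show i ≠ 24 by omega, show i ≠ 22 by omega, k1' i (by omega)]
    · intro j hj σ' I
      refine ⟨by simp, by simp, ?_, ?_, ?_⟩
      · simp only [eval_var, I.v24]; omega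
      · simp only [eval_var, I.keep 4 (by omega), C.v4]; omega
      · simp only [eval_var, I.v24, I.keep 4 (by omega), C.v4]
    · intro j hj σ' I
      exact outStep_spec C H hj I
    · intro σ' I
      exact ⟨I.done, I.mem⟩
  case ht => clear * -; simp; omega

end PackedMap

/-! ## Computing the constants -/

namespace PackedMap

open Finset Stmt
open PackedMap.Expr (var load)

/-- `14` becomes the number of lanes of a word, `15` the word with ones in all lanes, `28` the number
of lanes in use. -/
def countLanes : Stmt :=
  .set 14 1 ;; .set 15 1 ;; .set 28 1 ;;
  .loop (var 14 * var 6 * 2) (var 0 + 2) (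
    .set 15 (var 15 + (var 15 <<< (var 14 * var 6))) ;; .set 14 (var 14 * 2) ;;
    .ite (var 14) (var 2 + 1) (.set 28 (var 14) ;; .skip) .skip)

theorem countLanes_keeps : countLanes.keeps 14 = true := by decide

theorem countLanes_pure : countLanes.pure = true := by decide

/-- The largest power of two that fits. Its lanes occupy more than half of the w + 1 available bits,
so splitting a word into a bounded number of pieces suffices. -/
theorem exists_lanes {w B : ℕ} (hB : 0 < B) (hBw : B ≤ w + 1) :
    ∃ n, 2 ^ n * B ≤ w + 1 ∧ w + 1 < 2 * (2 ^ n * B) := by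
  refine ⟨Nat.log 2 ((w + 1) / B), ?_, ?_⟩
  · rw [← Nat.le_div_iff_mul_le hB]
    exact Nat.pow_log_le_self 2 (Nat.div_pos hBw hB).ne'
  · have := Nat.lt_pow_succ_log_self (b := 2) (by omega) ((w + 1) / B)
    rwa [Nat.div_lt_iff_lt_mul hB, pow_succ', mul_assoc] at this

/-- While the lanes are doubled, a second count stops growing once it would exceed r. It ends as the
largest power of two that is at most both r and 2^n. -/
theorem countLanes_spec {w B r n : ℕ} {σ : St} (hw : 2 * w + 2 < 2 ^ w) (hB : 0 < B)
    (h3 : 2 ^ n * B ≤ w + 1) (h4 : w + 1 < 2 * (2 ^ n * B))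
    (hr : 1 ≤ r) (hrw : r + 1 < 2 ^ w) (h0 : σ.v 0 = w) (h2 : σ.v 2 = r) (h6 : σ.v 6 = B) :
    Tr w countLanes σ (50 * n + 20) (fun σ' => σ'.v 14 = 2 ^ n ∧
      σ'.v 15 = pack B (2 ^ n) (fun _ => 1) ∧
      ∃ n' ≤ n, σ'.v 28 = 2 ^ n' ∧ 2 ^ n' ≤ r ∧ (n' = n ∨ r < 2 * 2 ^ n')) := by
  have hmono : ∀ k ≤ n, 2 ^ k * B ≤ 2 ^ n * B := fun k hk =>
    Nat.mul_le_mul_right _ (Nat.pow_le_pow_right (by omega) hk)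
  apply Tr.le
  case h =>
    unfold countLanes
    apply Tr.set (x := 1)
    · simp
    · simp
    apply Tr.set (x := 1)
    · simp
    · simp
    apply Tr.set (x := 1)
    · simp
    · simp
    refine Tr.imp (Tr.loop_count (fun k σ' => (∀ i < 14, σ'.v i = σ.v i) ∧ σ'.v 14 = 2 ^ k ∧
      σ'.v 15 = pack B (2 ^ k) (fun _ => 1) ∧
      ∃ n' ≤ k, σ'.v 28 = 2 ^ n' ∧ 2 ^ n' ≤ r ∧ (n' = k ∨ r < 2 * 2 ^ n')) n 40 ?_ ?_ ?_) ?_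
    · refine ⟨fun i hi => ?_, by simp, by simp, 0, le_rfl, by simp, by simpa using hr, Or.inl rfl⟩
      simp [show i ≠ 14 by omega, show i ≠ 15 by omega, show i ≠ 28 by omega]
    · rintro k hk σ' ⟨keep, i1, -, -⟩
      have h5 := hmono k hk
      simp only [ok_mul, ok_add, ok_var, ok_lit, eval_mul, eval_add, eval_var, eval_lit, i1,
        keep 6 (by omega), keep 0 (by omega), h0, h6, true_and]
      have h6 : k < n → 2 ^ k * B * 2 ≤ 2 ^ n * B := fun h => by
        have := hmono (k + 1) h
        rw [pow_succ] at this
        linarith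
      refine ⟨by omega, by omega, fun h => ?_, fun h => by have := h6 h; omega⟩
      by_contra h8
      rw [show k = n by omega] at h
      omega
    · rintro k hk σ' ⟨keep, i1, i2, n', hn', i3, i4, i5⟩
      have h5 := hmono (k + 1) hk
      have h8 : 2 ^ (k + 1) = 2 ^ k + 2 ^ k := by ring
      have h9 : 2 ^ (k + 1) * 1 ≤ 2 ^ (k + 1) * B := Nat.mul_le_mul_left _ hB
      have h10 := hmono k hk.le
      apply Tr.le
      case h =>
        apply Tr.set (x := pack B (2 ^ (k + 1)) (fun _ => 1))
        · simp [i1, keep, h6]; omega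
        · simp only [eval_add, eval_shl, eval_mul, eval_var, i1, i2, keep 6 (by omega), h6]
          rw [h8, pack_append, mul_comm B]
        apply Tr.set (x := 2 ^ (k + 1))
        · simp
        · simp [i1]; ring
        apply Tr.ite
        · simp
        · simp
        · simp; omega
        · simp [keep, h2]; omega
        · intro h
          simp [keep, h2] at h
          apply Tr.set (x := 2 ^ (k + 1))
          · simp
          · simp
          apply Tr.skip
          refine ⟨fun i hi => ?_, by simp, by simp, k + 1, le_rfl, by simp, by omega, Or.inl rfl⟩
          simp [show i ≠ 14 by omega, show i ≠ 15 by omega, show i ≠ 28 by omega, keep i hi]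
        · intro h
          simp [keep, h2] at h
          apply Tr.skip
          refine ⟨fun i hi => ?_, by simp, by simp, n', by omega, by simp [i3], i4, Or.inr ?_⟩
          · simp [show i ≠ 14 by omega, show i ≠ 15 by omega, keep i hi]
          · rcases i5 with rfl | h1
            · omega
            · exact h1
      case ht => clear * -; simp
    · rintro σ' ⟨-, h⟩
      exact h
  case ht => clear * -; simp; omega

/-- `10` becomes four times a power of two that is at least `4`. -/
def countWords : Stmt :=
  .set 10 4 ;; .loop (var 10) (var 4 * 4) (.set 10 (var 10 * 2) ;; .skip)

theorem two_pow_clog_lt {N : ℕ} (hN : 0 < N) : 2 ^ Nat.clog 2 N < 2 * N := by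
  rcases Nat.eq_or_lt_of_le hN with rfl | h
  · simp
  · have h2 := Nat.pow_pred_clog_lt_self (b := 2) (by omega) h
    have h3 : Nat.clog 2 N = (Nat.clog 2 N).pred + 1 :=
      (Nat.succ_pred_eq_of_pos (Nat.clog_pos (b := 2) (by omega) h)).symm
    rw [h3, pow_succ]
    omega

theorem countWords_spec {w N : ℕ} {σ : St} (hN : 0 < N) (hNw : 8 * N < 2 ^ w) (h4 : σ.v 4 = N) :
    Tr w countWords σ (30 * Nat.clog 2 N + 20) (fun σ' => σ'.v 10 = 2 ^ (Nat.clog 2 N + 2) ∧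
      (∀ i, i ≠ 10 → σ'.v i = σ.v i) ∧ σ'.m = σ.m) := by
  have h1 := two_pow_clog_lt hN
  apply Tr.le
  case h =>
    unfold countWords
    apply Tr.set (x := 4)
    · simp
    · simp
    refine Tr.imp (Tr.loop_count (fun k σ' => σ'.v 10 = 2 ^ (k + 2) ∧ (∀ i, i ≠ 10 → σ'.v i = σ.v i) ∧
      σ'.m = σ.m) (Nat.clog 2 N) 10 ?_ ?_ ?_) fun σ' h => h
    · exact ⟨by simp, fun i hi => by simp [hi], by simp⟩
    · rintro k hk σ' ⟨i1, i2, -⟩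
      have h5 : 2 ^ k ≤ 2 ^ Nat.clog 2 N := Nat.pow_le_pow_right (by omega) hk
      have h6 : 2 ^ (k + 2) = 2 ^ k * 4 := by ring
      refine ⟨by simp, by simp, ?_, ?_, ?_⟩
      · simp only [eval_var, i1]; omega
      · simp [i2, h4]; omega
      · simp [i1, i2, h4, h6, Nat.lt_clog_iff_pow_lt]
    · rintro k hk σ' ⟨i1, i2, i3⟩
      apply Tr.le
      case h =>
        apply Tr.set (x := 2 ^ (k + 1 + 2))
        · simp
        · simp [i1, pow_succ]
        exact Tr.skip ⟨by simp, fun i hi => by simp [hi, i2 i hi], by simp [i3]⟩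
      case ht => clear * -; simp
  case ht => clear * -; simp; omega

/-- From the input in the variables `0` to `5` compute the constants and the addresses of the arrays. -/
def prepare : Stmt :=
  .set 11 (var 1 + var 1 + 1) ;; .set 6 (var 11 + 1) ;; .set 7 (var 1 + var 1) ;; countLanes ;;
  .set 12 (var 28) ;; .set 24 (var 11) ;; .set 25 (var 14 * 4) ;; divide ;; .set 13 (var 26) ;; .set 28 (var 12) ;;
  countWords ;;
  .set 12 (var 6 * (var 28 - 1)) ;; .set 29 (var 15 &&& ((1 <<< (var 12 + var 6)) - 1)) ;;
  .set 17 (var 29 * ((1 <<< var 1) - 1)) ;;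
  .set 18 (var 29 + (var 15 - var 29) * ((1 <<< var 7) - 1)) ;; .set 19 (var 14 * var 11) ;;
  .set 20 (var 5 + var 4) ;; .set 21 (var 20 + var 10) ;; .set 22 (var 21 + var 10) ;;
  .set 23 (var 22 + var 10) ;; .set 9 (var 23 + var 10) ;; .skip

theorem prepare_spec {w f r u N oa n : ℕ} {σ : St} (hf : 8 ≤ f) (hfw : 2 * f + 1 ≤ w) (hr : 1 ≤ r)
    (hrw : r + 1 < 2 ^ w) (hN : 0 < N) (hNw : 8 * N < 2 ^ w) (hn : 2 ^ n * (2 * f + 2) ≤ w + 1)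
    (hn' : w + 1 < 2 * (2 ^ n * (2 * f + 2))) (h0 : σ.v 0 = w) (h1 : σ.v 1 = f) (h2 : σ.v 2 = r)
    (h3 : σ.v 3 = u) (h4 : σ.v 4 = N) (h5 : σ.v 5 = oa) {M : ℕ} (hM : M = 2 ^ (Nat.clog 2 N + 2)) :
    Tr w prepare σ (100 * n + 30 * Nat.clog 2 N + 500) (fun σ' => ∃ n' ≤ n, 2 ^ n' ≤ r ∧
      (n' = n ∨ r < 2 * 2 ^ n') ∧ Consts w f n n' (oa + N + 4 * M) (w / (2 * f + 1)) M u N σ' ∧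
      σ'.v 2 = r ∧ σ'.v 5 = oa ∧ σ'.v 20 = oa + N ∧ σ'.v 21 = oa + N + M ∧
      σ'.v 22 = oa + N + 2 * M ∧ σ'.v 23 = oa + N + 3 * M ∧ σ'.v 28 = 2 ^ n' ∧ σ'.m = σ.m) := by
  have F : Fits w (2 * f + 2) (2 * f) (2 ^ n) := ⟨rfl, Nat.two_pow_pos n, hn, by omega⟩
  have hbig := four_mul_lt_two_pow F (by omega)
  apply Tr.le
  case h =>
    unfold prepare
    apply Tr.set (x := 2 * f + 1)
    · simp
    · simp [h1]; ring
    apply Tr.set (x := 2 * f + 2)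
    · simp
    · simp
    apply Tr.set (x := 2 * f)
    · simp
    · simp [h1]; ring
    apply Tr.seq
    · refine Tr.frame 14 (Tr.frameMem (countLanes_spec (by omega) (by omega) hn hn' hr hrw ?_ ?_ ?_)
        countLanes_pure) countLanes_keeps
      · simp [h0]
      · simp [h2]
      · simp
    rintro σ1 ⟨⟨⟨a14, a15, n', hnn, a28, hn'r, hmax⟩, am⟩, ak⟩
    have hKK : 2 ^ n' ≤ 2 ^ n := Nat.pow_le_pow_right (by omega) hnn
    have h8 : (2 * f + 2) * (2 ^ n' - 1) + (2 * f + 2) = 2 ^ n' * (2 * f + 2) := by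
      obtain ⟨d, hd⟩ := Nat.exists_eq_succ_of_ne_zero (Nat.two_pow_pos n').ne'
      rw [hd, Nat.succ_eq_add_one, Nat.add_sub_cancel]
      ring
    have h8w : 2 ^ n' * (2 * f + 2) < 2 ^ w := F.lt_pow ((Nat.mul_le_mul_right _ hKK).trans F.le)
    have ak' : σ1.v 0 = w ∧ σ1.v 1 = f ∧ σ1.v 2 = r ∧ σ1.v 3 = u ∧ σ1.v 4 = N ∧ σ1.v 5 = oa ∧
        σ1.v 6 = 2 * f + 2 ∧ σ1.v 7 = 2 * f ∧ σ1.v 11 = 2 * f + 1 := by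
      simp [ak, h0, h1, h2, h3, h4, h5]
    obtain ⟨b0, b1, b2, b3, b4, b5, b6, b7, b11⟩ := ak'
    apply Tr.set (x := 2 ^ n')
    · simp
    · simp [a28]
    apply Tr.set (x := 2 * f + 1)
    · simp
    · simp [b11]
    apply Tr.set (x := 2 ^ (n + 2))
    · simp
    · simp [a14]; ring
    have e1 : (2 * f + 1) * 2 ^ (n + 2) + 2 ^ (n + 2) = 4 * (2 ^ n * (2 * f + 2)) := by ring
    have e2 : (2 * f + 1) * 2 ^ (n + 2 + 1) = 2 * ((2 * f + 1) * 2 ^ (n + 2)) := by ring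
    have e3 : 1 * 2 ^ (n + 2) ≤ f * 2 ^ (n + 2) := Nat.mul_le_mul_right _ (by omega)
    have e4 : (2 * f + 1) * 2 ^ (n + 2) = 2 * (f * 2 ^ (n + 2)) + 2 ^ (n + 2) := by ring
    have e5 := Nat.two_pow_pos n
    have e6 : 2 ^ (n + 2) = 4 * 2 ^ n := by ring
    apply Tr.seq
    · refine Tr.frame 24 (Tr.frameMem (divide_spec (w := w) (A := 2 * f + 1) (k := n + 2) ?_ ?_ ?_
        (by omega) (by omega) (by omega) (by omega)) divide_pure) (by decide)
      · simp [b0]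
      · simp
      · simp
    rintro σ2 ⟨⟨q26, qm⟩, qk⟩
    have q12 : σ2.v 12 = 2 ^ n' := by simp [qk 12]
    have qk' : ∀ i < 24, i ≠ 12 → σ2.v i = σ1.v i := fun i hi hi' => by
      rw [qk i hi]
      simp [show i ≠ 25 by omega, show i ≠ 24 by omega, hi']
    apply Tr.set (x := w / (2 * f + 1))
    · simp
    · simp [q26]
    apply Tr.set (x := 2 ^ n')
    · simp
    · simp [q12]
    apply Tr.seq
    · exact countWords_spec hN hNw (by simp [qk', b4])
    rintro σ3 ⟨c10, ck, cm⟩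
    rw [← hM] at c10
    have ck' : ∀ i < 24, i ≠ 10 → i ≠ 12 → i ≠ 13 → σ3.v i = σ1.v i := fun i hi h h' h'' => by
      rw [ck i h]
      simp [h'', show i ≠ 28 by omega, qk' i hi h']
    have c28 : σ3.v 28 = 2 ^ n' := by simp [ck]
    have c13 : σ3.v 13 = w / (2 * f + 1) := by simp [ck]
    apply Tr.set (x := (2 * f + 2) * (2 ^ n' - 1))
    · simp [c28, Nat.one_le_two_pow]
    · simp [ck', b6, c28]
    apply Tr.set (x := pack (2 * f + 2) (2 ^ n') (fun _ => 1))
    · simp [ck', b6, h8, h8w, Nat.one_le_two_pow]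
    · simp only [eval_and, eval_shl, eval_var, eval_sub, eval_lit, eval_add, St.set_v, if_true,
        Nat.reduceEqDiff, if_false, one_mul, ck' 15 (by omega) (by omega) (by omega) (by omega), a15,
        ck' 6 (by omega) (by omega) (by omega) (by omega), b6, h8]
      exact low_mask hKK fun _ _ => Nat.one_lt_two_pow (by omega)
    apply Tr.set (x := pack (2 * f + 2) (2 ^ n) (fun i => if i < 2 ^ n' then 2 ^ f - 1 else 0))
    · simp [ck', b1, Nat.one_le_two_pow, F.lt_pow (show f ≤ w + 1 by omega)]
    · simp [ck', b1, pack_mul_const, pack_extend hKK]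
    have hsub : pack (2 * f + 2) (2 ^ n) (fun _ => 1) - pack (2 * f + 2) (2 ^ n') (fun _ => 1) =
        pack (2 * f + 2) (2 ^ n) (fun i => if i < 2 ^ n' then 0 else 1) := by
      rw [← pack_extend hKK, pack_sub fun i _ => by split_ifs <;> omega]
      exact pack_congr fun i _ => by split_ifs <;> rfl
    apply Tr.set (x := pack (2 * f + 2) (2 ^ n)
      (fun i => if i < 2 ^ n' then 1 else 2 ^ (2 * f) - 1))
    · simp [ck', a15, b7, Nat.one_le_two_pow, F.lt_q]
      rw [← pack_extend hKK]
      exact pack_mono fun i _ => by split_ifs <;> omega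
    · simp [ck', a15, b7, hsub, pack_mul_const]
      rw [← pack_extend hKK, pack_add]
      exact pack_congr fun i _ => by split_ifs <;> simp
    apply Tr.set (x := 2 ^ n * (2 * f + 1))
    · simp
    · simp [ck', a14, b11]
    apply Tr.set (x := oa + N)
    · simp
    · simp [ck', b4, b5]
    apply Tr.set (x := oa + N + M)
    · simp
    · simp [c10]
    apply Tr.set (x := oa + N + 2 * M)
    · simp
    · simp [c10]; ring
    apply Tr.set (x := oa + N + 3 * M)
    · simp
    · simp [c10]; ring
    apply Tr.set (x := oa + N + 4 * M)
    · simp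
    · simp [c10]; ring
    apply Tr.skip
    refine ⟨n', hnn, hn'r, hmax, ⟨by omega, F, hnn, ?_, ?_, ?_, ?_, ?_, ?_, ?_, ?_, ?_, ?_, ?_, ?_, ?_,
      ?_, ?_, ?_⟩, ?_, ?_, ?_, ?_, ?_, ?_, ?_, ?_⟩
    all_goals simp [ck', b0, b1, b2, b3, b4, b5, b6, b7, b11, c10, a14, a15, c13, c28, cm, qm, am]
  case ht => clear * -; simp; omega

end PackedMap

/-! ## The algorithm for long fields -/

namespace PackedMap

open Finset Stmt
open PackedMap.Expr (var load)

theorem lt_ceil {r s j : ℕ} (hs : 0 < s) : j < (r + s - 1) / s ↔ j * s < r := by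
  rw [← Nat.succ_le_iff, Nat.le_div_iff_mul_le hs, Nat.succ_mul]
  omega

/-- The input: `x` are the fields of the packed sequence, `zg` the fields of the packed function. -/
structure Input (w f r u N oa : ℕ) (x zg : ℕ → ℕ) (σ : St) : Prop where
  f_pos : 1 ≤ f
  w_ge : 2 * f + 1 ≤ w
  r_le : r ≤ 2 ^ f
  u_le : u ≤ 2 ^ f
  N_eq : N = (r + w / (f + 1) - 1) / (w / (f + 1))
  oa_eq : oa = N + (u + w / (2 * f + 1) - 1) / (w / (2 * f + 1))
  v0 : σ.v 0 = w
  v1 : σ.v 1 = f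
  v2 : σ.v 2 = r
  v3 : σ.v 3 = u
  v4 : σ.v 4 = N
  v5 : σ.v 5 = oa
  x_lt : ∀ e, x e < 2 ^ f
  x_zero : ∀ e, r ≤ e → x e = 0
  words : ∀ j < N, σ.m j = pack (f + 1) (w / (f + 1)) (fun i => x (j * (w / (f + 1)) + i))
  fields : FieldsAt f (w / (2 * f + 1)) u N zg σ.m
  mem_dom : ∀ e < r, ∃ t < u, zg t / 2 ^ f = x e

/-- The output: the values of the packed function at the fields `x`, from address `oa` on. -/
def Output (w f r u N oa : ℕ) (x zg : ℕ → ℕ) (σ σ' : St) : Prop :=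
  (∃ y : ℕ → ℕ, (∀ e < r, Val f zg u (x e) (y e)) ∧ ∀ j < N, σ'.m (oa + j) =
    pack (f + 1) (min (w / (f + 1)) (r - j * (w / (f + 1)))) (fun l => y (j * (w / (f + 1)) + l))) ∧
  ∀ a < oa, σ'.m a = σ.m a

theorem Input.s_pos {w f r u N oa : ℕ} {x zg : ℕ → ℕ} {σ : St} (H : Input w f r u N oa x zg σ) :
    0 < w / (f + 1) ∧ 0 < w / (2 * f + 1) := by
  have := H.w_ge
  exact ⟨Nat.div_pos (by omega) (by omega), Nat.div_pos (by omega) (by omega)⟩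

theorem ceil_le {r s : ℕ} (hs : 0 < s) : (r + s - 1) / s ≤ r := by
  by_contra h
  have h1 : r < (r + s - 1) / s := by omega
  rw [lt_ceil hs] at h1
  have : r * 1 ≤ r * s := Nat.mul_le_mul_left _ hs
  omega

/-- Load, sort, join, sort back, and store the output. -/
def longMap : Stmt := prepare ;; loadArrays ;; sortJoinSort ;; storeOutput

theorem layout_ind {s K : ℕ} {x : ℕ → ℕ} {P : ℕ → Prop} (h0 : P 0) (h : ∀ e, P (x e)) (e : ℕ) :
    P (layout s K x e) := by
  unfold layout
  split_ifs
  exacts [h _, h0]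

/-- There are as many array positions as a field can count. -/
theorem positions_le {w f r n' s N M : ℕ} (hf : 8 ≤ f) (hrf : r ≤ 2 ^ f) (hs : s = w / (f + 1))
    (hltr : ∀ j, j < N ↔ j * s < r) (hr : 1 ≤ r) (hn'r : 2 ^ n' ≤ r)
    (hKw : 2 ^ n' * (2 * f + 2) ≤ w + 1) (hM : M ≤ 8 * N) : M * 2 ^ n' ≤ 2 ^ (2 * f) := by
  have hKs : 2 ^ n' ≤ s := by
    rw [hs, Nat.le_div_iff_mul_le (by omega)]
    have h1 : 2 ^ n' * (2 * f + 2) = 2 * (2 ^ n' * (f + 1)) := by ring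
    have h2 : 0 < 2 ^ n' * (f + 1) := Nat.mul_pos (Nat.two_pow_pos n') (by omega)
    omega
  have hNpos : 0 < N := (hltr 0).2 (by omega)
  -- A single word has at most r lanes in use. With several words, all but the last are full of
  -- input fields, and 2^n' ≤ s.
  have h1 : N * 2 ^ n' ≤ 2 * r := by
    rcases Nat.lt_or_ge r s with h | h
    · have h2 : ¬ 1 < N := fun h2 => by
        have := (hltr 1).1 h2
        omega
      rw [show N = 1 by omega]
      omega
    · have h2 := (hltr (N - 1)).1 (by omega)
      have h3 : (N - 1) * s + s = N * s := by
        rw [← Nat.succ_mul]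
        congr 1
        omega
      have h4 : N * 2 ^ n' ≤ N * s := Nat.mul_le_mul_left _ hKs
      omega
  have h2 : M * 2 ^ n' ≤ (8 * N) * 2 ^ n' := Nat.mul_le_mul_right _ hM
  have h3 : (8 * N) * 2 ^ n' = 8 * (N * 2 ^ n') := by ring
  -- The factor 16 is 8 from M ≤ 8N times 2 from the preceding estimate.
  have h4 : 16 * 2 ^ f ≤ 2 ^ (2 * f) := by
    rw [show (16 : ℕ) = 2 ^ 4 by norm_num, ← pow_add]
    exact Nat.pow_le_pow_right (by omega) (by omega)
  omega

/-- The situation after the preparations. -/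
structure Prepared (w f r u N oa n n' s s₂ M : ℕ) (x zg : ℕ → ℕ) (σ : St) : Prop where
  consts : Consts w f n n' (oa + N + 4 * M) s₂ M u N σ
  f_big : 8 ≤ f
  r_pos : 1 ≤ r
  r_le : r ≤ 2 ^ f
  r_lt : r < 2 ^ w
  u_pos : 0 < u
  u_lt : u < 2 ^ w
  size : oa + N + 4 * M + 2 * w < 2 ^ w
  N_pos : 0 < N
  N_le : 4 * N ≤ M
  M_le : M ≤ 8 * N
  n_le : n ≤ w
  hmax : w + 1 < 2 * (2 ^ n * (2 * f + 2))
  s_eq : s = w / (f + 1)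
  s₂_eq : s₂ = w / (2 * f + 1)
  s₂_pos : 0 < s₂
  lt_N : ∀ j, j < N ↔ j * s < r
  lt_oa : ∀ j, j * s₂ < u → N + j < oa
  oa_ge : N ≤ oa
  lanes_le : 2 ^ n' ≤ r
  lanes_max : n' = n ∨ r < 2 * 2 ^ n'
  v2 : σ.v 2 = r
  v5 : σ.v 5 = oa
  v20 : σ.v 20 = oa + N
  v21 : σ.v 21 = oa + N + M
  v22 : σ.v 22 = oa + N + 2 * M
  v23 : σ.v 23 = oa + N + 3 * M
  v28 : σ.v 28 = 2 ^ n'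
  x_lt : ∀ e, x e < 2 ^ f
  x_le : ∀ e, x e ≤ zg (u - 1) / 2 ^ f
  x_zero : ∀ e, r ≤ e → x e = 0
  words : ∀ j < N, σ.m j = pack (f + 1) s (fun i => x (j * s + i))
  fields : FieldsAt f s₂ u N zg σ.m

theorem Prepared.map {w f r u N oa n n' s s₂ M μ : ℕ} {x zg : ℕ → ℕ} {σ : St}
    (H : Prepared w f r u N oa n n' s s₂ M x zg σ) (hM : M = 2 ^ μ) :
    Tr w (loadArrays ;; sortJoinSort ;; storeOutput) σ (160 * M + 60 +
        (4000 * (M * (n' + μ + 1) * (n' + 1)) + 5000 * ((M + u / s₂ + 1) * (n + 1)) + 120 +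
          (110 * N + 50 * n + 300)))
      (fun σ' => (∃ y : ℕ → ℕ, (∀ e < r, Val f zg u (x e) (y e)) ∧ ∀ j < N, σ'.m (oa + j) =
        pack (f + 1) (min s (r - j * s)) (fun l => y (j * s + l))) ∧ ∀ a < oa, σ'.m a = σ.m a) := by
  have C1 := H.consts
  have F := C1.fits
  have hsize := H.size
  have hNM := H.N_le
  have hNpos := H.N_pos
  have hlow : ∀ i < M, ∀ l < 2 ^ n', i * 2 ^ n' + l < M * 2 ^ n' := fun i hi l hl => by
    have : (i + 1) * 2 ^ n' ≤ M * 2 ^ n' := Nat.mul_le_mul_right _ hi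
    rw [Nat.succ_mul] at this
    omega
  have hsf : s * (f + 1) ≤ w := H.s_eq ▸ Nat.div_mul_le_self _ _
  have hs2f : s₂ * (2 * f + 1) ≤ w := H.s₂_eq ▸ Nat.div_mul_le_self _ _
  have hKK : 2 ^ n' ≤ 2 ^ n := Nat.pow_le_pow_right (by omega) C1.n'_le
  have hKw := (Nat.mul_le_mul_right (2 * f + 2) hKK).trans F.le
  have h4M : 4 ∣ M := by
    rw [hM]
    have : 2 ≤ μ := by
      by_contra h
      have : 2 ^ μ < 2 ^ 2 := Nat.pow_lt_pow_right (by omega) (by omega)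
      omega
    exact pow_dvd_pow 2 this
  -- Maximality of n bounds the number of fields in a word of G by four times the number of lanes.
  have hs₂4 : s₂ ≤ 4 * 2 ^ n := by
    by_contra h
    have h1 : (4 * 2 ^ n + 1) * (2 * f + 1) ≤ s₂ * (2 * f + 1) := Nat.mul_le_mul_right _ (by omega)
    have h2 : (4 * 2 ^ n + 1) * (2 * f + 1) =
      2 * (2 ^ n * (2 * f + 2)) + 2 * (2 ^ n * (2 * f)) + 2 * f + 1 := by ring
    have := H.hmax
    omega
  -- Four pieces suffice either because all lanes are in use or because r itself is less than 2 ·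
  -- 2^n'.
  have hcnt : min s r ≤ 4 * 2 ^ n' := by
    rcases H.lanes_max with h | h
    · have h1 : s * (f + 1) < (4 * 2 ^ n') * (f + 1) := by
        have h2 : (4 * 2 ^ n') * (f + 1) = 2 * (2 ^ n * (2 * f + 2)) := by rw [h]; ring
        have := H.hmax
        omega
      exact (min_le_left _ _).trans (lt_of_mul_lt_mul_right h1 (Nat.zero_le _)).le
    · omega
  have hpos := positions_le H.f_big H.r_le H.s_eq H.lt_N H.r_pos H.lanes_le hKw H.M_le
  obtain ⟨φ, -, φval, φeq⟩ := val_fun H.fields.mono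
  apply Tr.seq
  · exact Tr.frame 24 (loadArrays_spec (s := s) (x := x) (S := oa + N) C1 H.x_lt
      (by rw [mul_comm]; exact hsf) (by omega) (by omega) H.words (fun e he => H.x_zero e (by
        by_contra h
        exact absurd ((H.lt_N N).2 (by omega)) (lt_irrefl N)))
      h4M (H.lanes_le.trans H.r_le) H.v20 H.v28) loadArrays_keeps
  rintro σ2 ⟨⟨b1, b2⟩, bk⟩
  have C2 := C1.of_same fun i hi _ _ => bk i (by omega)
  have hn := H.n_le
  apply Tr.seq
  · refine Tr.frame 8 (sortJoinSort_spec (X := layout s (2 ^ n') x) ⟨C2, by omega, by omega, hn,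
      H.s₂_pos, hs₂4, hs2f, H.u_pos, H.u_lt, fun j hj => ?_, (bk 20 (by omega)).trans H.v20,
      (bk 21 (by omega)).trans H.v21, (bk 22 (by omega)).trans H.v22, (bk 23 (by omega)).trans H.v23,
      ⟨H.fields.lt, H.fields.mono, fun j hj => ?_⟩,
      layout_ind (P := (· < _)) (Nat.two_pow_pos f) H.x_lt, layout_ind (P := (· ≤ _)) (Nat.zero_le _) H.x_le, hpos,
      fun i hi => (b1 i hi).1, fun i hi => (b1 i hi).2⟩ hM) sortJoinSort_keeps
    · have := H.lt_oa j hj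
      omega
    · rw [b2 _ (by have := H.lt_oa j hj; omega)]
      exact H.fields.word j hj
  rintro σ3 ⟨⟨c1, c2, c3, ⟨Y, Ylt, Yval, Yarr⟩, c4⟩, ck⟩
  refine Tr.imp (storeOutput_spec (C2.of_same c1) H.hmax (s := s) (r := r) (S := oa + N) (oa := oa)
    (b := σ3.v 21) (Y := Y) (y := fun e => φ (x e)) ⟨H.f_big, by omega, hNM, le_rfl, c2, c3, H.s_eq,
      fun j hj => (H.lt_N j).1 hj, H.r_lt, hcnt, ?_, ?_, rfl, Ylt, Yarr,
      fun j hj q hq p hp t ht h1 h2 => ?_⟩) ?_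
  · rw [ck 2 (by omega), bk 2 (by omega), H.v2]
  · rw [ck 5 (by omega), bk 5 (by omega), H.v5]
  · have h3 := Yval _ (hlow (4 * j + 2 * q + p) (by omega) t ht)
    rw [layout_at x hq hp ht, if_pos h1] at h3
    exact φeq _ _ h3
  · rintro σ4 ⟨d1, d2⟩
    refine ⟨⟨fun e => φ (x e), fun e _ => φval _, d1⟩, fun a ha => ?_⟩
    rw [d2 a fun i _ => by omega, c4 a (by omega), b2 a (by omega)]

/-- Besides joining the phases, this checks that output, four arrays of length M and two mask areas
fit into the 2^w memory cells, so that no address wraps around. -/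
theorem longMap_spec {w f r u N oa n : ℕ} {x zg : ℕ → ℕ} {σ : St} (H : Input w f r u N oa x zg σ)
    (hf : 8 ≤ f) (hr : 1 ≤ r) (hn : 2 ^ n * (2 * f + 2) ≤ w + 1)
    (hmax : w + 1 < 2 * (2 ^ n * (2 * f + 2))) {M μ : ℕ} (hμ : μ = Nat.clog 2 N)
    (hM : M = 2 ^ (μ + 2)) :
    Tr w longMap σ (4000 * (M * (min (Nat.log 2 r) n + (μ + 2) + 1) *
        (min (Nat.log 2 r) n + 1)) + 7000 * ((M + u / (w / (2 * f + 1)) + 1) * (n + 1)))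
      (Output w f r u N oa x zg σ) := by
  obtain ⟨hs, hs2⟩ := H.s_pos
  obtain ⟨s, hseq⟩ : ∃ s, s = w / (f + 1) := ⟨_, rfl⟩
  obtain ⟨s₂, hs2eq⟩ : ∃ s₂, s₂ = w / (2 * f + 1) := ⟨_, rfl⟩
  have hw := H.w_ge
  have hrf := H.r_le
  have huf := H.u_le
  have hNeq := H.N_eq
  have hoa := H.oa_eq
  have hwords := H.words
  have hfields := H.fields
  unfold Output
  rw [← hseq] at hs hNeq hwords ⊢
  rw [← hs2eq] at hs2 hoa hfields ⊢
  have F : Fits w (2 * f + 2) (2 * f) (2 ^ n) := ⟨rfl, Nat.two_pow_pos n, hn, by omega⟩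
  have hw4 := (four_mul_lt_two_pow F (by omega)).1
  have hNr : N ≤ r := hNeq ▸ ceil_le hs
  have hNG : (u + s₂ - 1) / s₂ ≤ u := ceil_le hs2
  have hltr : ∀ j, j < N ↔ j * s < r := fun j => hNeq ▸ lt_ceil hs
  have hNpos : 0 < N := (hltr 0).2 (by omega)
  -- The exponents require f + 6 ≤ w - 3, which w ≥ 2f + 1 yields for f ≥ 8.
  have hpow : 64 * 2 ^ f ≤ 2 ^ (w - 3) := by
    rw [show (64 : ℕ) = 2 ^ 6 by norm_num, ← pow_add]
    exact Nat.pow_le_pow_right (by omega) (by omega)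
  have hpow' : 2 ^ w = 8 * 2 ^ (w - 3) := by
    rw [show w = w - 3 + 3 by omega, pow_add, Nat.add_sub_cancel]
    ring
  have hμN := two_pow_clog_lt hNpos
  have hNμ : N ≤ 2 ^ Nat.clog 2 N := Nat.le_pow_clog (by omega) N
  rw [← hμ] at hμN hNμ
  have hM4 : M = 4 * 2 ^ μ := by rw [hM]; ring
  have hμM := Nat.lt_two_pow_self (n := μ)
  have hnw : n < 2 ^ n := Nat.lt_two_pow_self
  have hnw' : 2 ^ n * 1 ≤ 2 ^ n * (2 * f + 2) := Nat.mul_le_mul_left _ (by omega)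
  have hdom : ∀ e < r, 0 < u ∧ x e ≤ zg (u - 1) / 2 ^ f := by
    intro e he
    obtain ⟨t, ht, h⟩ := H.mem_dom e he
    refine ⟨by omega, h ▸ ?_⟩
    rcases Nat.lt_or_ge t (u - 1) with h1 | h1
    · exact (H.fields.mono t (u - 1) h1 (by omega)).le
    · rw [show t = u - 1 by omega]
  obtain ⟨l, hl⟩ : ∃ l, l = min (Nat.log 2 r) n := ⟨_, rfl⟩
  rw [← hl]
  unfold longMap
  refine Tr.le (Tr.seq (t₂ := 160 * M + 60 + (4000 * (M * (l + (μ + 2) + 1) * (l + 1)) +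
    5000 * ((M + u / s₂ + 1) * (n + 1)) + 120 + (110 * N + 50 * n + 300)))
    (prepare_spec hf hw hr (by omega) hNpos (by omega) hn hmax H.v0 H.v1 H.v2 H.v3 H.v4 H.v5
      (hμ ▸ hM)) ?_) ?_
  · rintro σ1 ⟨n', hnn, hn'r, hn'max, C1, a2, a5, a20, a21, a22, a23, a28, am⟩
    rw [← hs2eq] at C1
    refine Tr.le (Tr.imp (Prepared.map (s := s) (x := x) (zg := zg) ⟨C1, hf, hr, hrf, by omega,
      (hdom 0 (by omega)).1, by omega, by omega, hNpos, by omega, by omega, by omega, hmax, hseq,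
      hs2eq, hs2, hltr, fun j hj => by have := (lt_ceil hs2).2 hj; omega,
      hoa ▸ Nat.le_add_right _ _, hn'r, hn'max,
      a2, a5, a20, a21, a22, a23, a28, H.x_lt, fun e => ?_, H.x_zero, am ▸ hwords, am ▸ hfields⟩ hM)
      fun σ' h => am ▸ h) ?_
    · rcases Nat.lt_or_ge e r with h | h
      · exact (hdom e h).2
      · rw [H.x_zero e h]
        exact Nat.zero_le _
    · have : n' ≤ l := hl ▸ le_min (Nat.le_log_of_pow_le (by omega) hn'r) hnn
      gcongr
  · rw [← hμ]
    have h1 : (M + u / s₂ + 1) * (n + 1) = M + u / s₂ * (n + 1) + n + 1 + M * n := by ring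
    have h2 := Nat.zero_le (u / s₂ * (n + 1))
    have h3 := Nat.zero_le (M * n)
    clear * - hM4 hμM hNμ h1 h2 h3
    generalize M * (l + (μ + 2) + 1) * (l + 1) = A
    generalize u / s₂ * (n + 1) = B at *
    generalize (M + u / s₂ + 1) * (n + 1) = D at *
    generalize M * n = E at *
    omega

end PackedMap

/-! ## The algorithm for short fields -/

namespace PackedMap

open Finset Stmt
open PackedMap.Expr (var load)

/-- From one field to the next: `a` is the position in the word `b`, the variable `k` holds the
length of a field. -/
def advance (a b k : ℕ) : Stmt :=
  .set a (var a + var k) ;;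
  .ite (var 0) (var a + var k) (.set a 0 ;; .set b (var b + 1) ;; .skip) .skip

/-- The test whether another field fits replaces a division: position and word number track
remainder and quotient of the field number. -/
theorem advance_spec {w a b k A c i : ℕ} {σ : St} (hA : 0 < A) (hAw : A ≤ w) (hw : 2 * w < 2 ^ w)
    (h0 : σ.v 0 = w) (hk : σ.v k = A) (ha : σ.v a = A * (i % (w / A))) (hb : σ.v b = c + i / (w / A))
    (hak : k ≠ a) (ha0 : a ≠ 0) (hab : a ≠ b) :
    Tr w (advance a b k) σ 30 (fun σ' => σ'.v a = A * ((i + 1) % (w / A)) ∧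
      σ'.v b = c + (i + 1) / (w / A) ∧ (∀ l, l ≠ a → l ≠ b → σ'.v l = σ.v l) ∧ σ'.m = σ.m) := by
  obtain ⟨s, hs⟩ : ∃ s, s = w / A := ⟨_, rfl⟩
  have hspos : 0 < s := hs ▸ Nat.div_pos hAw hA
  rw [← hs] at ha hb ⊢
  have hsA : s * A ≤ w := hs ▸ Nat.div_mul_le_self _ _
  have hlt := Nat.mod_lt i hspos
  have hdm := Nat.div_add_mod i s
  have e1 : (i % s + 1) * A ≤ s * A := Nat.mul_le_mul_right _ hlt
  have e2 : A * (i % s) + A = (i % s + 1) * A := by ring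
  apply Tr.le
  case h =>
    unfold advance
    apply Tr.set (x := (i % s + 1) * A)
    · simp
    · simp [ha, hk, e2]
    apply Tr.ite
    · simp
    · simp
    · simp [ha0.symm, h0]; omega
    · simp [hak, hk]; omega
    · intro h
      simp [ha0.symm, h0, hak, hk] at h
      have h1 : s = i % s + 1 := by
        by_contra h2
        have : (i % s + 2) * A ≤ s * A := Nat.mul_le_mul_right _ (by omega)
        rw [Nat.succ_mul] at this
        omega
      have h2 : (i + 1) / s = i / s + 1 ∧ (i + 1) % s = 0 :=
        (Nat.div_mod_unique hspos).2 ⟨by rw [Nat.mul_succ]; omega, hspos⟩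
      apply Tr.set (x := 0)
      · simp
      · simp
      apply Tr.set (x := c + (i / s + 1))
      · simp
      · simp [hab.symm, hb]; ring
      apply Tr.skip
      refine ⟨by simp [hab, h2], by simp [h2], fun l h3 h4 => by simp [h3, h4], by simp⟩
    · intro h
      simp [ha0.symm, h0, hak, hk] at h
      have h1 : i % s + 1 < s := by
        have h3 : (i % s + 2) * A ≤ w := by rw [Nat.succ_mul]; omega
        rw [← Nat.le_div_iff_mul_le hA, ← hs] at h3
        omega
      have h2 : (i + 1) / s = i / s ∧ (i + 1) % s = i % s + 1 :=
        (Nat.div_mod_unique hspos).2 ⟨by omega, h1⟩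
      apply Tr.skip
      refine ⟨by simp [h2]; ring, by simp [hab.symm, h2, hb], fun l h3 h4 => by simp [h3], by simp⟩
  case ht => clear * -; simp

theorem pack_field {A s k : ℕ} {a : ℕ → ℕ} (h : k < s) (ha : ∀ i, a i < 2 ^ A) :
    (pack A s a / 2 ^ (A * k)) &&& (2 ^ A - 1) = a k := by
  have := pack_extract (c := 1) h ha
  simpa using this

/-- `9` becomes the value of the packed function at `8`. -/
def lookup : Stmt :=
  .set 9 0 ;; .set 10 0 ;; .set 11 0 ;; .set 12 (var 4) ;;
  .loop (var 10) (var 3) (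
    .set 13 ((load (var 12) >>> var 11) &&& ((1 <<< var 7) - 1)) ;;
    .ite (var 13 >>> var 1) (var 8) .skip
      (.ite (var 8) (var 13 >>> var 1) .skip (.set 9 (var 13 &&& ((1 <<< var 1) - 1)) ;; .skip)) ;;
    advance 11 12 7 ;; .set 10 (var 10 + 1) ;; .skip)

theorem lookup_pure : lookup.pure = true := by decide

/-- Look all fields up, one after the other. -/
def shortMap : Stmt :=
  .set 6 (var 1 + 1) ;; .set 7 (var 1 + var 1 + 1) ;; .set 14 0 ;; .set 15 0 ;; .set 16 0 ;;
  .loop (var 14) (var 2) (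
    .set 8 ((load (var 16) >>> var 15) &&& ((1 <<< var 6) - 1)) ;; lookup ;;
    .ite 0 (var 15) (.set 17 (var 17 + (var 9 <<< var 15)) ;; .skip) (.set 17 (var 9) ;; .skip) ;;
    .store (var 5 + var 16) (var 17) ;; advance 15 16 6 ;; .set 14 (var 14 + 1) ;; .skip)

/-- Linear search. Branching offers only `<`, so equality of keys is established by two comparisons.
-/
theorem lookup_spec {w f u N x s : ℕ} {zg : ℕ → ℕ} {σ : St} (hs : s = w / (2 * f + 1))
    (hw : 2 * f + 1 ≤ w) (hww : 2 * w < 2 ^ w) (hG : FieldsAt f s u N zg σ.m) (hx : x < 2 ^ w)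
    (hu : u < 2 ^ w) (hN : N + u ≤ 2 ^ w) (h0 : σ.v 0 = w) (h1 : σ.v 1 = f) (h3 : σ.v 3 = u)
    (h4 : σ.v 4 = N) (h7 : σ.v 7 = 2 * f + 1) (h8 : σ.v 8 = x) :
    Tr w lookup σ (100 * u + 30) (fun σ' => (∀ l, l < 9 ∨ 13 < l → σ'.v l = σ.v l) ∧
      Val f zg u x (σ'.v 9)) := by
  have hspos : 0 < s := hs ▸ Nat.div_pos hw (by omega)
  have hsA : s * (2 * f + 1) ≤ w := hs ▸ Nat.div_mul_le_self _ _
  have hzA : ∀ t, zg t < 2 ^ (2 * f + 1) := fun t => lt_of_le_pow (hG.lt t) (by omega)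
  have hAw : 2 ^ (2 * f + 1) ≤ 2 ^ w := Nat.pow_le_pow_right (by omega) hw
  apply Tr.le
  case h =>
    unfold lookup
    apply Tr.set (x := 0)
    · simp
    · simp
    apply Tr.set (x := 0)
    · simp
    · simp
    apply Tr.set (x := 0)
    · simp
    · simp
    apply Tr.set (x := N)
    · simp
    · simp [h4]
    refine Tr.imp (Tr.loop_count (fun t σ' => (∀ l, l < 9 ∨ 13 < l → σ'.v l = σ.v l) ∧ σ'.m = σ.m ∧
      σ'.v 10 = t ∧ σ'.v 11 = (2 * f + 1) * (t % s) ∧ σ'.v 12 = N + t / s ∧ Val f zg t x (σ'.v 9))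
      u 90 ?_ ?_ ?_) ?_
    · refine ⟨fun l hl => ?_, by simp, by simp, by simp, by simp, fun t ht => by omega, fun _ => ?_⟩
      · simp [show l ≠ 9 by omega, show l ≠ 10 by omega, show l ≠ 11 by omega, show l ≠ 12 by omega]
      · simp
    · rintro t ht σ' ⟨keep, -, i1, -⟩
      simp only [eval_var, i1, keep 3 (by omega), h3, ok_var, true_and]
      exact ⟨by omega, hu, trivial⟩
    · rintro t ht σ' ⟨keep, hm, i1, i2, i3, i4⟩
      have hts : t / s ≤ t := Nat.div_le_self _ _
      have hdm := Nat.div_add_mod t s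
      have hmod := Nat.mod_lt t hspos
      have hjs : t / s * s < u := by rw [mul_comm]; omega
      have hsh : (2 * f + 1) * (t % s) ≤ w := by
        rw [mul_comm]
        exact (Nat.mul_le_mul_right _ hmod.le).trans hsA
      have hf : (pack (2 * f + 1) s (fun i => if t / s * s + i < u then zg (t / s * s + i) else 0) /
          2 ^ ((2 * f + 1) * (t % s))) &&& (2 ^ (2 * f + 1) - 1) = zg t := by
        rw [pack_field hmod fun i => ?_]
        · have h5 : t / s * s + t % s = t := by rw [mul_comm]; omega
          rw [h5, if_pos ht]
        · split_ifs
          exacts [hzA _, Nat.two_pow_pos _]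
      have hword : pack (2 * f + 1) s (fun i => if t / s * s + i < u then zg (t / s * s + i) else 0) <
          2 ^ w := by
        refine (pack_lt fun i _ => ?_).trans_le
          (Nat.pow_le_pow_right (by omega) (by rw [mul_comm]; exact hsA))
        split_ifs
        exacts [hzA _, Nat.two_pow_pos _]
      have hz := (hzA t).trans_le hAw
      have hz' : zg t / 2 ^ f < 2 ^ w := (Nat.div_le_self _ _).trans_lt hz
      -- Extending the searched range by one field: a match fixes the result, and earlier fields
      -- cannot match as well since their keys are smaller.
      have hval : ∀ y, (zg t / 2 ^ f = x → y = zg t % 2 ^ f) → (zg t / 2 ^ f ≠ x → y = σ'.v 9) →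
          Val f zg (t + 1) x y := by
        intro y h5 h6
        refine ⟨fun t' ht' he => ?_, fun hno => ?_⟩
        · rcases Nat.lt_succ_iff_lt_or_eq.1 ht' with h7 | rfl
          · rw [h6 (he ▸ (hG.mono t' t h7 ht).ne'), i4.1 t' h7 he]
          · exact h5 he
        · rw [h6 (hno t (by omega)), i4.2 fun t' ht' => hno t' (by omega)]
      apply Tr.le
      case h =>
        apply Tr.set (x := zg t)
        · simp [i3, i2, keep 7, h7, hm, hG.word _ hjs, Nat.one_le_two_pow]
          omega
        · simp only [eval_and, eval_shr, eval_load, eval_var, eval_sub, eval_shl, eval_lit, one_mul, i3,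
            i2, keep 7 (by omega), h7, hm, hG.word _ hjs, hf]
        apply Tr.seq (R := fun σ'' => (∀ l, l < 9 ∨ 13 < l → σ''.v l = σ.v l) ∧ σ''.m = σ.m ∧
          σ''.v 10 = t ∧ σ''.v 11 = (2 * f + 1) * (t % s) ∧ σ''.v 12 = N + t / s ∧
          Val f zg (t + 1) x (σ''.v 9))
        · have hk : ∀ l, l < 9 ∨ 13 < l → (σ'.set 13 (zg t)).v l = σ.v l := fun l hl => by
            simp [show l ≠ 13 by omega, keep l hl]
          apply Tr.ite
          · simp [keep, h1, hz]; omega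
          · simp
          · simpa [keep, h1] using hz'
          · simpa [keep, h8] using hx
          · intro h
            simp [keep, h1, h8] at h
            exact Tr.skip ⟨hk, by simp [hm], by simp [i1], by simp [i2], by simp [i3],
              hval _ (fun h5 => by omega) fun _ => by simp⟩
          · intro h
            simp [keep, h1, h8] at h
            apply Tr.ite
            · simp
            · simp [keep, h1, hz]; omega
            · simpa [keep, h8] using hx
            · simpa [keep, h1] using hz'
            · intro h5
              simp [keep, h1, h8] at h5
              exact Tr.skip ⟨hk, by simp [hm], by simp [i1], by simp [i2], by simp [i3],
                hval _ (fun h5 => by omega) fun _ => by simp⟩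
            · intro h5
              simp [keep, h1, h8] at h5
              apply Tr.set (x := zg t % 2 ^ f)
              · simp [keep, h1, Nat.one_le_two_pow]; omega
              · simp [keep, h1, Nat.and_two_pow_sub_one_eq_mod]
              apply Tr.skip
              refine ⟨fun l hl => ?_, by simp [hm], by simp [i1], by simp [i2], by simp [i3],
                hval _ (fun h5 => by simp) fun h6 => by omega⟩
              rw [St.set_v, if_neg (by omega), hk l hl]
        rintro σ2 ⟨k2, m2, a1, a2, a3, a4⟩
        apply Tr.seq
        · exact advance_spec (A := 2 * f + 1) (c := N) (i := t) (by omega) hw hww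
            ((k2 0 (by omega)).trans h0) ((k2 7 (by omega)).trans h7) (hs ▸ a2) (hs ▸ a3) (by omega)
            (by omega) (by omega)
        rintro σ3 ⟨b1, b2, b3, b4⟩
        rw [← hs] at b1 b2
        apply Tr.set (x := t + 1)
        · simp
        · simp [b3 10, a1]
        apply Tr.skip
        refine ⟨fun l hl => ?_, by simp [b4, m2], by simp, by simp [b1], by simp [b2], ?_⟩
        · rw [St.set_v, if_neg (by omega), b3 l (by omega) (by omega), k2 l hl]
        · simpa [b3 9] using a4
      case ht => clear * -; simp
    · rintro σ' ⟨keep, -, -, -, -, h⟩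
      exact ⟨keep, h⟩
  case ht => clear * -; simp; omega

/-- The unfinished output word is stored after every field, so an incomplete last word needs no
separate treatment. The quadratic time matters only for bounded f. -/
theorem shortMap_spec {w f r u N oa : ℕ} {x zg : ℕ → ℕ} {σ : St} (H : Input w f r u N oa x zg σ) :
    Tr w shortMap σ (r * (100 * u + 150) + 50) (Output w f r u N oa x zg σ) := by
  obtain ⟨hs, hs2⟩ := H.s_pos
  obtain ⟨s, hseq⟩ : ∃ s, s = w / (f + 1) := ⟨_, rfl⟩
  have hw := H.w_ge
  have hrf := H.r_le
  have huf := H.u_le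
  have hoa := H.oa_eq
  have hNG : (u + w / (2 * f + 1) - 1) / (w / (2 * f + 1)) ≤ u := ceil_le hs2
  have hoaN : N ≤ oa := hoa ▸ Nat.le_add_right _ _
  have hNeq := H.N_eq
  have hwords := H.words
  unfold Output
  rw [← hseq] at hs hNeq hwords ⊢
  have hNr : N ≤ r := hNeq ▸ ceil_le hs
  have hltr : ∀ j, j < N ↔ j * s < r := fun j => hNeq ▸ lt_ceil hs
  have hsA : s * (f + 1) ≤ w := hseq ▸ Nat.div_mul_le_self _ _
  have hww : 2 * w < 2 ^ w := by
    have h1 := succ_lt_two_pow (w := w - 1) (by have := H.f_pos; omega)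
    have h2 : 2 ^ w = 2 * 2 ^ (w - 1) := by
      rw [← pow_succ']
      congr 1
      omega
    omega
  have hpow : 4 * 2 ^ f ≤ 2 ^ w := by
    rw [show (4 : ℕ) = 2 ^ 2 by norm_num, ← pow_add]
    exact Nat.pow_le_pow_right (by omega) (by have := H.f_pos; omega)
  have hf0 := Nat.two_pow_pos f
  obtain ⟨φ, -, φval, φeq⟩ := val_fun H.fields.mono
  apply Tr.le
  case h =>
    unfold shortMap
    apply Tr.set (x := f + 1)
    · simp
    · simp [H.v1]
    apply Tr.set (x := 2 * f + 1)
    · simp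
    · simp [H.v1]; ring
    apply Tr.set (x := 0)
    · simp
    · simp
    apply Tr.set (x := 0)
    · simp
    · simp
    apply Tr.set (x := 0)
    · simp
    · simp
    refine Tr.imp (Tr.loop_count (fun i σ' => (∀ l < 6, σ'.v l = σ.v l) ∧ σ'.v 6 = f + 1 ∧
      σ'.v 7 = 2 * f + 1 ∧ σ'.v 14 = i ∧ σ'.v 15 = (f + 1) * (i % s) ∧ σ'.v 16 = 0 + i / s ∧
      (0 < i % s → σ'.v 17 = pack (f + 1) (i % s) (fun l => φ (x (i / s * s + l)))) ∧
      (∀ j, j * s < i → σ'.m (oa + j) =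
        pack (f + 1) (min s (i - j * s)) (fun l => φ (x (j * s + l)))) ∧
      ∀ a < oa, σ'.m a = σ.m a) r (100 * u + 140) ?_ ?_ ?_) ?_
    · refine ⟨fun l hl => ?_, by simp, by simp, by simp, by simp, by simp, by simp, by simp, by simp⟩
      simp [show l ≠ 6 by omega, show l ≠ 7 by omega, show l ≠ 14 by omega, show l ≠ 15 by omega,
        show l ≠ 16 by omega]
    · rintro i hi σ' ⟨keep, -, -, i1, -⟩
      simp only [eval_var, i1, keep 2 (by omega), H.v2, ok_var, true_and]
      exact ⟨by omega, by omega, trivial⟩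
    · rintro i hi σ' ⟨keep, k6, k7, i1, i2, i3, i4, i5, i6⟩
      have hdm := Nat.div_add_mod i s
      have hmod := Nat.mod_lt i hs
      have hcomm : i / s * s = s * (i / s) := mul_comm _ _
      have hjN : i / s < N := (hltr _).2 (by omega)
      have hsh : (f + 1) * (i % s) ≤ w := by
        rw [mul_comm]
        exact (Nat.mul_le_mul_right _ hmod.le).trans hsA
      have hxA : ∀ e, x e < 2 ^ (f + 1) := fun e => lt_of_le_pow (H.x_lt e) (by omega)
      have hword : pack (f + 1) s (fun l => x (i / s * s + l)) < 2 ^ w :=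
        (pack_lt fun l _ => hxA _).trans_le
          (Nat.pow_le_pow_right (by omega) (by rw [mul_comm]; exact hsA))
      have hm : σ'.m (i / s) = pack (f + 1) s (fun l => x (i / s * s + l)) := by
        rw [i6 _ (by omega), hwords _ hjN]
      have he : i / s * s + i % s = i := by omega
      apply Tr.le
      case h =>
        apply Tr.set (x := x i)
        · simp [i2, i3, k6, hm, hword, Nat.one_le_two_pow]
          omega
        · simp only [eval_and, eval_shr, eval_load, eval_var, eval_sub, eval_shl, eval_lit, one_mul, i2,
            i3, k6, zero_add, hm, pack_field hmod fun l => hxA _, he]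
        apply Tr.seq
        · refine Tr.frameMem (lookup_spec (w := w) (f := f) (u := u) (N := N) (x := x i) (zg := zg) rfl
            hw hww ⟨H.fields.lt, H.fields.mono, fun j hj => ?_⟩ ?_ ?_ ?_ ?_ ?_ ?_ ?_ ?_ ?_) lookup_pure
          · rw [St.set_m, i6 _ (by have := (lt_ceil hs2).2 hj; omega)]
            exact H.fields.word j hj
          · have := H.x_lt i
            omega
          · omega
          · omega
          · simp [keep, H.v0]
          · simp [keep, H.v1]
          · simp [keep, H.v3]
          · simp [keep, H.v4]
          · simp [k7]
          · simp
        rintro σ1 ⟨⟨a1, a2⟩, a3⟩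
        have a4 : σ1.v 9 = φ (x i) := φeq _ _ a2
        have a1' : ∀ l, l < 8 ∨ 13 < l → σ1.v l = σ'.v l := fun l hl => by
          rw [a1 l (by omega), St.set_v, if_neg (by omega)]
        apply Tr.seq (R := fun σ2 => σ2.m = σ'.m ∧ (∀ l, l < 8 ∨ 13 < l ∧ l < 17 → σ2.v l = σ'.v l) ∧
          σ2.v 17 = pack (f + 1) (i % s + 1) (fun l => φ (x (i / s * s + l))))
        · apply Tr.ite
          · simp
          · simp
          · simp
          · simp [a1', i2]; omega
          · intro h
            simp [a1', i2] at h
            apply Tr.set (x := pack (f + 1) (i % s + 1) (fun l => φ (x (i / s * s + l))))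
            · simp [a1', i2]; omega
            · simp only [eval_add, eval_shl, eval_var, a1' 17 (by omega), a1' 15 (by omega), i2, a4,
                i4 h, pack_succ, he]
            apply Tr.skip
            exact ⟨by simp [a3], fun l hl => by rw [St.set_v, if_neg (by omega), a1' l (by omega)],
              by simp⟩
          · intro h
            simp [a1', i2] at h
            apply Tr.set (x := pack (f + 1) (i % s + 1) (fun l => φ (x (i / s * s + l))))
            · simp
            · rw [h] at he
              simp only [eval_var, a4, h, zero_add, pack_one, he]
            apply Tr.skip
            exact ⟨by simp [a3], fun l hl => by rw [St.set_v, if_neg (by omega), a1' l (by omega)],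
              by simp⟩
        rintro σ2 ⟨b1, b2, b3⟩
        apply Tr.store (y := oa + i / s)
          (x := pack (f + 1) (i % s + 1) (fun l => φ (x (i / s * s + l))))
        · simp
        · simp
        · simp [b2, keep, H.v5, i3]
        · simpa using b3
        · omega
        apply Tr.seq
        · refine advance_spec (A := f + 1) (c := 0) (i := i) (by omega) (by omega) hww ?_ ?_ ?_ ?_
            (by omega) (by omega) (by omega)
          · simp [b2, keep, H.v0]
          · simp [b2, k6]
          · simp [b2, i2, hseq]
          · simp [b2, i3, hseq]
        rintro σ3 ⟨c1, c2, c3, c4⟩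
        rw [← hseq] at c1 c2
        have c3' : ∀ l, l ≠ 15 → l ≠ 16 → σ3.v l = σ2.v l := fun l h1 h2 => by simp [c3 l h1 h2]
        apply Tr.set (x := i + 1)
        · simp
        · simp [c3', b2, i1]
        apply Tr.skip
        refine ⟨fun l hl => ?_, by simp [c3', b2, k6], by simp [c3', b2, k7], by simp, by simp [c1],
          by simp [c2], fun h => ?_, fun j hj => ?_, fun a ha => ?_⟩
        · rw [St.set_v, if_neg (by omega), c3' l (by omega) (by omega), b2 l (by omega), keep l hl]
        · have h1 : (i + 1) / s = i / s ∧ (i + 1) % s = i % s + 1 := by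
            refine (Nat.div_mod_unique hs).2 ⟨by omega, ?_⟩
            by_contra h2
            have h3 : (i + 1) / s = i / s + 1 ∧ (i + 1) % s = 0 :=
              (Nat.div_mod_unique hs).2 ⟨by rw [Nat.mul_succ]; omega, hs⟩
            omega
          rw [h1.1, h1.2]
          simp [c3', b3]
        · simp only [St.set_m, c4, St.write_m, b1]
          have h1 : j ≤ i / s := by
            rw [Nat.le_div_iff_mul_le hs]
            omega
          split_ifs with h2
          · rw [show j = i / s by omega, show min s (i + 1 - i / s * s) = i % s + 1 by omega]
          · have h3 : (j + 1) * s ≤ i / s * s := Nat.mul_le_mul_right _ (by omega)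
            rw [Nat.succ_mul] at h3
            rw [i5 j (by omega), show min s (i - j * s) = min s (i + 1 - j * s) by omega]
        · simp only [St.set_m, c4, St.write_m, b1]
          rw [if_neg (by omega), i6 a ha]
      case ht => clear * -; simp; omega
    · rintro σ' ⟨-, -, -, -, -, -, -, h1, h2⟩
      exact ⟨⟨fun e => φ (x e), fun e _ => φval _, fun j hj => h1 j ((hltr j).1 hj)⟩, h2⟩
  case ht =>
    clear * -
    simp only [cost_var, cost_lit, cost_add]
    have : r * (1 + 1 + 1 + (100 * u + 140)) + 7 * r = r * (100 * u + 150) := by ring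
    omega

end PackedMap

/-! ## Running times -/

namespace PackedMap

open Finset Stmt
open PackedMap.Expr (var load)

/-- Choose the algorithm by the length of the fields. -/
def mapStmt : Stmt := .ite 7 (var 1) (.ite 0 (var 2) longMap .skip) shortMap

/-- The bound on the number of steps, without the constant factor. -/
noncomputable def timeBound (w f r u : ℕ) : ℝ :=
  ((r * f : ℝ) / w + 1) * Real.logb 2 r * Real.logb 2 w +
    (((r + u) * f : ℝ) / w + 1) * Real.logb 2 w

theorem one_le_logb {w : ℕ} (hw : 3 ≤ w) : 1 ≤ Real.logb 2 w := by
  rw [Real.le_logb_iff_rpow_le (by norm_num) (by positivity), Real.rpow_one]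
  exact_mod_cast (by omega : 2 ≤ w)

theorem logb_natCast_nonneg (r : ℕ) : 0 ≤ Real.logb 2 r := by
  rcases Nat.eq_zero_or_pos r with rfl | h
  · simp
  · exact Real.logb_nonneg (by norm_num) (by exact_mod_cast h)

theorem one_le_timeBound {w f r u : ℕ} (hw : 3 ≤ w) : 1 ≤ timeBound w f r u := by
  have h1 := one_le_logb hw
  have h2 := logb_natCast_nonneg r
  have h3 : (0 : ℝ) ≤ (r * f : ℝ) / w := by positivity
  have h4 : (0 : ℝ) ≤ ((r + u) * f : ℝ) / w := by positivity
  unfold timeBound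
  have h5 : 0 ≤ ((r * f : ℝ) / w + 1) * Real.logb 2 r * Real.logb 2 w := by positivity
  nlinarith [mul_nonneg h4 (by linarith : 0 ≤ Real.logb 2 w)]

/-! ### From numbers of words to the quantities of the bound. -/

theorem div_le_fields {w g s r c : ℕ} (hw : 0 < w) (hs : 0 < s) (h : w ≤ c * g * s) :
    (r : ℝ) / s ≤ c * ((r * g : ℝ) / w) := by
  have hw' : (0 : ℝ) < w := by exact_mod_cast hw
  have hs' : (0 : ℝ) < s := by exact_mod_cast hs
  have h' : (w : ℝ) ≤ c * g * s := by exact_mod_cast h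
  rw [← mul_div_assoc, div_le_div_iff₀ hs' hw']
  have := mul_le_mul_of_nonneg_left h' (Nat.cast_nonneg (α := ℝ) r)
  linarith

/-- Rounding down the number of fields per word loses at most a factor 2, because at least one field
fits. -/
theorem fields_bound {w f s k c : ℕ} (hs : s = w / k) (hk : k ≤ c * f) (hkw : k ≤ w) (hk0 : 0 < k) :
    w ≤ (2 * c) * f * s := by
  have h1 : 0 < s := hs ▸ Nat.div_pos hkw hk0
  have h2 : w < (s + 1) * k := by
    rw [hs]
    exact (Nat.div_lt_iff_lt_mul hk0).1 (Nat.lt_succ_self _)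
  have h3 : (s + 1) * k ≤ (2 * s) * (c * f) := Nat.mul_le_mul (by omega) hk
  have h4 : (2 * s) * (c * f) = (2 * c) * f * s := by ring
  omega

/-- If X fills a word then rf/w ≥ 1/4, so each added 1 is at most four times the quotient next to
it. -/
theorem timeBound_le {w f r u s : ℕ} (hf : 1 ≤ f) (hfw : 2 * f + 1 ≤ w) (hs : s = w / (f + 1))
    (hsr : s ≤ r) : timeBound w f r u ≤ 5 * ((r * f : ℝ) / w * Real.logb 2 r * Real.logb 2 w +
      ((r + u) * f : ℝ) / w * Real.logb 2 w) := by
  have hw : (0 : ℝ) < w := by exact_mod_cast (by omega : 0 < w)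
  have h1 := one_le_logb (show 3 ≤ w by omega)
  have h2 := logb_natCast_nonneg r
  have h3 := fields_bound hs (c := 2) (f := f) (by omega) (by omega) (by omega)
  have h4 : (1 : ℝ) / 4 ≤ (r * f : ℝ) / w := by
    rw [le_div_iff₀ hw]
    have h5 : 2 * 2 * f * s ≤ 2 * 2 * f * r := Nat.mul_le_mul_left _ hsr
    have h6 : (w : ℝ) ≤ 2 * 2 * f * r := by exact_mod_cast h3.trans h5
    linarith
  have h5 : (r * f : ℝ) / w ≤ ((r + u) * f : ℝ) / w := by
    gcongr
    linarith [(Nat.cast_nonneg u : (0 : ℝ) ≤ u)]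
  unfold timeBound
  have h6 : ((r * f : ℝ) / w + 1) * Real.logb 2 r * Real.logb 2 w ≤
      (5 * ((r * f : ℝ) / w)) * Real.logb 2 r * Real.logb 2 w := by
    gcongr
    linarith
  have h7 : (((r + u) * f : ℝ) / w + 1) * Real.logb 2 w ≤
      (5 * (((r + u) * f : ℝ) / w)) * Real.logb 2 w := by
    gcongr
    linarith
  linarith

/-- Three facts decide: M is O(rf/w + 1), log M is O(log r + 1) because N ≤ r, and the exponent l of
the lanes in use is bounded by log r as well as by log w. -/
theorem long_time {w f r u s s₂ N n l μ M : ℕ} (hf : 1 ≤ f) (hfw : 2 * f + 1 ≤ w) (hr : 1 ≤ r)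
    (hs : s = w / (f + 1)) (hs₂ : s₂ = w / (2 * f + 1)) (hN : N = (r + s - 1) / s)
    (hn : 2 ^ n ≤ w) (hl : l = min (Nat.log 2 r) n) (hμ : 2 ^ μ < 2 * N) (hM : M = 2 ^ (μ + 2)) :
    ((4000 * (M * (l + (μ + 2) + 1) * (l + 1)) + 7000 * ((M + u / s₂ + 1) * (n + 1)) + 100 : ℕ) : ℝ) ≤
      2000000 * timeBound w f r u := by
  have hw : (0 : ℝ) < w := by exact_mod_cast (by omega : 0 < w)
  have hlw := one_le_logb (show 3 ≤ w by omega)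
  have hL := logb_natCast_nonneg r
  have hs0 : 0 < s := hs ▸ Nat.div_pos (by omega) (by omega)
  have hs20 : 0 < s₂ := hs₂ ▸ Nat.div_pos (by omega) (by omega)
  have h1 := div_le_fields (r := r) (by omega) hs0
    (fields_bound hs (c := 2) (f := f) (by omega) (by omega) (by omega))
  have h2 := div_le_fields (r := u) (by omega) hs20
    (fields_bound hs₂ (c := 3) (f := f) (by omega) (by omega) (by omega))
  have hNr : N ≤ r := hN ▸ ceil_le hs0
  have hNs : (N : ℝ) ≤ r / s + 1 := by
    have h3 : N * s ≤ r + s := by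
      have := Nat.div_mul_le_self (r + s - 1) s
      rw [← hN] at this
      omega
    have hs' : (0 : ℝ) < s := by exact_mod_cast hs0
    rw [← sub_le_iff_le_add, le_div_iff₀ hs', sub_mul]
    have : (N : ℝ) * s ≤ r + s := by exact_mod_cast h3
    linarith
  have hnl : (n : ℝ) ≤ Real.logb 2 w := by
    rw [Real.le_logb_iff_rpow_le (by norm_num) hw, Real.rpow_natCast]
    exact_mod_cast hn
  have hr' : (0 : ℝ) < r := by exact_mod_cast hr
  have hll : (l : ℝ) ≤ Real.logb 2 r := by
    rw [Real.le_logb_iff_rpow_le (by norm_num) hr', Real.rpow_natCast]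
    have : 2 ^ l ≤ r := (Nat.pow_le_pow_right (by omega) (hl ▸ min_le_left _ _)).trans
      (Nat.pow_log_le_self 2 (by omega))
    exact_mod_cast this
  have hln : (l : ℝ) ≤ Real.logb 2 w := by
    have : l ≤ n := hl ▸ min_le_right _ _
    exact (by exact_mod_cast this : (l : ℝ) ≤ n).trans hnl
  have hμL : (μ : ℝ) ≤ Real.logb 2 r + 1 := by
    rw [← sub_le_iff_le_add, Real.le_logb_iff_rpow_le (by norm_num) hr', Real.rpow_sub (by norm_num),
      Real.rpow_one, Real.rpow_natCast, div_le_iff₀ (by norm_num)]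
    have : 2 ^ μ ≤ r * 2 := by omega
    exact_mod_cast this
  have hMN : (M : ℝ) ≤ 8 * N := by
    have : M ≤ 8 * N := by rw [hM, pow_add]; omega
    exact_mod_cast this
  have hus : ((u / s₂ : ℕ) : ℝ) ≤ u / s₂ := Nat.cast_div_le
  have hab : (r * f : ℝ) / w + u * f / w = ((r + u) * f : ℝ) / w := by ring
  have ha0 : (0 : ℝ) ≤ r * f / w := by positivity
  have hb0 : (0 : ℝ) ≤ u * f / w := by positivity
  unfold timeBound
  rw [← hab]
  push_cast at h1 h2 ⊢
  generalize (r * f : ℝ) / w = a at *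
  generalize (u * f : ℝ) / w = b at *
  generalize Real.logb 2 (w : ℝ) = W at *
  generalize Real.logb 2 (r : ℝ) = L at *
  have hl0 : (0 : ℝ) ≤ l := Nat.cast_nonneg l
  have hM' : (M : ℝ) ≤ 32 * a + 8 := by linarith
  have e1 : (M : ℝ) * (l + (μ + 2) + 1) * (l + 1) ≤ (32 * a + 8) * (4 * L * W + 8 * W) := by
    rw [mul_assoc]
    -- The first factor is estimated through log r and the second through log w. Using fewer lanes
    -- when r is small is what makes the first estimate possible.
    have h3 : ((l : ℝ) + (μ + 2) + 1) * (l + 1) ≤ (2 * L + 4) * (2 * W) := by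
      exact mul_le_mul (by linarith) (by linarith) (by positivity) (by positivity)
    have h4 : (2 * L + 4) * (2 * W) = 4 * L * W + 8 * W := by ring
    rw [h4] at h3
    gcongr
  have e2 : ((M : ℝ) + (u / s₂ : ℕ) + 1) * (n + 1) ≤ (32 * a + 6 * b + 9) * (2 * W) := by
    exact mul_le_mul (by linarith) (by linarith) (by positivity) (by positivity)
  have haL : 0 ≤ a * L * W := by positivity
  have hLW : 0 ≤ L * W := by positivity
  have haW : 0 ≤ a * W := by positivity
  have hbW : 0 ≤ b * W := by positivity
  linarith

/-- For f ≤ 7 the quadratic algorithm handles at most 128 fields of X and of G in constantly many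
steps. -/
theorem mapStmt_spec {w f r u N oa : ℕ} {x zg : ℕ → ℕ} {σ : St} (H : Input w f r u N oa x zg σ) :
    ∃ T : ℕ, (T : ℝ) ≤ 2000000 * timeBound w f r u ∧ Tr w mapStmt σ T (Output w f r u N oa x zg σ) := by
  have hf := H.f_pos
  have hw := H.w_ge
  have hfw : f < 2 ^ w := lt_of_le_of_lt (by omega) (Nat.lt_two_pow_self (n := w))
  have h7 : 7 < 2 ^ w := by
    have : 2 ^ 3 ≤ 2 ^ w := Nat.pow_le_pow_right (by omega) (by omega)
    omega
  have hrw : r < 2 ^ w := H.r_le.trans_lt (Nat.pow_lt_pow_right (by omega) (by omega))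
  have hE := one_le_timeBound (w := w) (f := f) (r := r) (u := u) (by omega)
  have hN := H.N_eq
  obtain ⟨hs, hs2⟩ := H.s_pos
  rcases Nat.lt_or_ge 7 f with h | h
  · rcases Nat.eq_zero_or_pos r with hr | hr
    -- An empty X has no output words, so nothing is done; the preparations of the long algorithm
    -- need r ≥ 1.
    · refine ⟨100, by push_cast; linarith, ?_⟩
      have hN0 : N = 0 := by
        have := ceil_le (r := r) hs
        omega
      refine Tr.le (Tr.ite (t₁ := 20) (t₂ := 1) (by simp) (by simp) (by simpa using h7)
        (by simpa [H.v1] using hfw) (fun _ => ?_) fun h' => ?_) (by simp)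
      · refine Tr.le (Tr.ite (t₁ := 1) (t₂ := 1) (by simp) (by simp) (by simp)
          (by simpa [H.v2] using hrw) (fun h' => ?_) fun _ => ?_) (by simp)
        · simp [H.v2, hr] at h'
        · exact Tr.skip ⟨⟨fun _ => 0, fun e he => by omega, fun j hj => by omega⟩, fun _ _ => rfl⟩
      · simp [H.v1] at h'
        omega
    · obtain ⟨n, hn, hmax⟩ := exists_lanes (w := w) (B := 2 * f + 2) (by omega) (by omega)
      have hnw : 2 ^ n ≤ w := by
        have : 2 ^ n * 2 ≤ 2 ^ n * (2 * f + 2) := Nat.mul_le_mul_left _ (by omega)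
        omega
      have hN0 : 0 < N := hN ▸ (lt_ceil hs).2 (by omega)
      refine ⟨_, long_time hf hw hr rfl rfl hN hnw rfl (two_pow_clog_lt hN0) rfl, ?_⟩
      have hin : Tr w (.ite 0 (var 2) longMap .skip) σ _ (Output w f r u N oa x zg σ) :=
        Tr.ite (t₂ := 1) (by simp) (by simp) (by simp) (by simpa [H.v2] using hrw)
          (fun _ => longMap_spec H h hr hn hmax rfl rfl) fun h' => by
            simp [H.v2] at h'
            omega
      refine Tr.le (Tr.ite (t₂ := 1) (by simp) (by simp) (by simpa using h7)
        (by simpa [H.v1] using hfw) (fun _ => hin) fun h' => ?_) ?_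
      · simp [H.v1] at h'
        omega
      · simp
        omega
  · refine ⟨2000000, by push_cast; linarith, ?_⟩
    refine Tr.le (Tr.ite (t₁ := 1) (by simp) (by simp) (by simpa using h7)
      (by simpa [H.v1] using hfw) (fun h' => ?_) fun _ => shortMap_spec H) ?_
    · simp [H.v1] at h'
      omega
    · have h1 : 2 ^ f ≤ 2 ^ 7 := Nat.pow_le_pow_right (by omega) h
      have hr := H.r_le
      have hu := H.u_le
      have h2 : r * (100 * u + 150) ≤ 2 ^ 7 * (100 * 2 ^ 7 + 150) := by
        gcongr <;> omega
      simp
      omega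

end PackedMap

/-! ## Packed sequences as lanes -/

namespace PackedMap

open Finset WordRAM Packed

/-- The field number `i` of a packed sequence, and `0` beyond its end. -/
def field {f : ℕ} (l : List (BitVec f)) (i : ℕ) : ℕ := (l.getD i 0).toNat

theorem field_lt {f : ℕ} (l : List (BitVec f)) (i : ℕ) : field l i < 2 ^ f := BitVec.isLt _

theorem field_of_le {f : ℕ} {l : List (BitVec f)} {i : ℕ} (h : l.length ≤ i) : field l i = 0 := by
  simp [field, List.getElem?_eq_none h]

theorem field_eq {f : ℕ} {l : List (BitVec f)} {i : ℕ} (h : i < l.length) :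
    field l i = l[i].toNat := by
  simp [field, h]

theorem bits_eq_pack {f : ℕ} (l : List (BitVec f)) {K : ℕ} (h : l.length ≤ K) :
    bits l = pack (f + 1) K (field l) := by
  induction l generalizing K with
  | nil => rw [pack_congr (b := fun _ => 0) fun i _ => field_of_le (by simp), pack_const_zero]; rfl
  | cons x l ih =>
    obtain ⟨K, rfl⟩ := Nat.exists_eq_succ_of_ne_zero (by simp at h; omega : K ≠ 0)
    rw [bits, ih (K := K) (by simpa using h), Nat.succ_eq_add_one, add_comm K, pack_append, pack_one,
      mul_one, mul_comm]
    congr 2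
    exact pack_congr fun i _ => by simp [field, add_comm 1 i]

/-- The number of lanes K is free between the actual length of the slice and s, since missing fields
read as 0. Input words use K = s and output words use their exact length. -/
theorem bits_slice {f : ℕ} (l : List (BitVec f)) (n s : ℕ) {K : ℕ} (hK : K ≤ s)
    (h : min s (l.length - n) ≤ K) :
    bits ((l.drop n).take s) = pack (f + 1) K (fun i => field l (n + i)) := by
  rw [bits_eq_pack _ (K := K) (by simpa using h)]
  refine pack_congr fun i hi => ?_
  simp only [field, List.getD_eq_getElem?_getD, List.getElem?_take, List.getElem?_drop]
  rw [if_pos (by omega)]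

theorem word_toNat {w f : ℕ} (l : List (BitVec f)) (j : ℕ) :
    (word w l j).toNat = pack (f + 1) (w / (f + 1)) (fun i => field l (j * (w / (f + 1)) + i)) := by
  rw [word, BitVec.toNat_ofNat, fieldsPerWord, bits_slice l _ _ le_rfl (min_le_left _ _), Nat.mod_eq_of_lt]
  refine (pack_lt fun i _ => lt_of_le_pow (field_lt _ _) (by omega)).trans_le
    (Nat.pow_le_pow_right (by omega) ?_)
  rw [mul_comm]
  exact Nat.div_mul_le_self _ _

/-- Read as a number, the concatenation is z · 2^f + g(z), so quotient and remainder by 2^f recover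
argument and value. -/
theorem field_toSeq {f : ℕ} (G : PackedFunction f) {t : ℕ} (ht : t < G.dom.length) :
    field G.toSeq t / 2 ^ f = G.dom[t].toNat ∧ field G.toSeq t % 2 ^ f = (G.g G.dom[t]).toNat := by
  have h : field G.toSeq t = G.dom[t].toNat * 2 ^ f + (G.g G.dom[t]).toNat := by
    rw [field_eq (by simpa [PackedFunction.toSeq] using ht)]
    simp only [PackedFunction.toSeq, List.getElem_map, BitVec.toNat_append, Nat.shiftLeft_eq]
    rw [mul_comm, ← Nat.two_pow_add_eq_or_of_lt (BitVec.isLt _)]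
  have hf := Nat.two_pow_pos f
  have hg := (G.g G.dom[t]).isLt
  rw [h, mul_comm, Nat.mul_add_div hf, Nat.mul_add_mod, Nat.div_eq_of_lt hg, Nat.mod_eq_of_lt hg]
  simp

theorem length_dom_le {f : ℕ} (G : PackedFunction f) : G.dom.length ≤ 2 ^ f := by
  have h1 : (G.dom.map BitVec.toNat).Nodup := by
    rw [List.Nodup, List.pairwise_map]
    exact G.sorted.imp fun h => (BitVec.lt_def.1 h).ne
  have h2 : G.dom.map BitVec.toNat ⊆ List.range (2 ^ f) := by
    intro a ha
    obtain ⟨b, -, rfl⟩ := List.mem_map.1 ha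
    exact List.mem_range.2 b.isLt
  simpa using (h1.subperm h2).length_le

/-- The abstract state of a machine whose registers `0` to `5` have been moved to the variables `0`
to `5`. -/
def inputState {w : ℕ} (s : State w) (v : ℕ → ℕ) : St :=
  ⟨fun i => if i < 6 then (s.reg i).toNat else v i, fun a => (s.mem (BitVec.ofNat w a)).toNat⟩

theorem input_inputState {w f : ℕ} {X : List (BitVec f)} {G : PackedFunction f} {s : State w}
    (hf : 1 ≤ f) (hfw : 2 * f + 1 ≤ w) (hr : X.length ≤ 2 ^ f) (hdom : ∀ x ∈ X, x ∈ G.dom)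
    (hs : IsInitial s G X) (v : ℕ → ℕ) :
    Input w f X.length G.dom.length (funAddr w X) (outAddr w G X) (field X) (field G.toSeq)
      (inputState s v) := by
  have hu := length_dom_le G
  have hs0 : 0 < w / (f + 1) := Nat.div_pos (by omega) (by omega)
  have hs20 : 0 < w / (2 * f + 1) := Nat.div_pos (by omega) (by omega)
  have e2 : f + f = 2 * f := by ring
  have hN : funAddr w X = (X.length + w / (f + 1) - 1) / (w / (f + 1)) := rfl
  have hnum : numWords w (f + f) G.dom.length =
      (G.dom.length + w / (2 * f + 1) - 1) / (w / (2 * f + 1)) := by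
    rw [numWords, fieldsPerWord, e2]
  have hoa : outAddr w G X = funAddr w X +
      (G.dom.length + w / (2 * f + 1) - 1) / (w / (2 * f + 1)) := by
    rw [outAddr, hnum]
    rfl
  have hNr := hN ▸ ceil_le (r := X.length) hs0
  have hNG := ceil_le (r := G.dom.length) hs20
  have hpow : 2 ^ f * 4 ≤ 2 ^ w := by
    rw [show (4 : ℕ) = 2 ^ 2 by norm_num, ← pow_add]
    exact Nat.pow_le_pow_right (by omega) (by omega)
  have hpf := Nat.two_pow_pos f
  have hww := Nat.lt_two_pow_self (n := w)
  have hlen : G.toSeq.length = G.dom.length := by simp [PackedFunction.toSeq]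
  refine ⟨hf, hfw, hr, hu, hN, hoa, ?_, ?_, ?_, ?_, ?_, ?_, field_lt X, fun e he => field_of_le he,
    fun j hj => ?_, ⟨fun t => e2 ▸ field_lt _ _, fun i j hij hj => ?_, fun j hj => ?_⟩, fun e he => ?_⟩
  · simp [inputState, hs.reg_w, Nat.mod_eq_of_lt hww]
  · simp [inputState, hs.reg_f, Nat.mod_eq_of_lt (show f < 2 ^ w by omega)]
  · simp [inputState, hs.reg_r, Nat.mod_eq_of_lt (show X.length < 2 ^ w by omega)]
  · simp [inputState, hs.reg_u, Nat.mod_eq_of_lt (show G.dom.length < 2 ^ w by omega)]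
  · simp [inputState, hs.reg_G, Nat.mod_eq_of_lt (show funAddr w X < 2 ^ w by omega)]
  · simp [inputState, hs.reg_out, Nat.mod_eq_of_lt (show outAddr w G X < 2 ^ w by omega)]
  · have h := hs.input.1 j hj
    rw [zero_add] at h
    simp only [inputState, h, word_toNat]
  · rw [(field_toSeq G (by omega)).1, (field_toSeq G hj).1]
    exact BitVec.lt_def.1 (List.pairwise_iff_getElem.1 G.sorted i j (by omega) hj hij)
  · have h := hs.input.2 j (by
      rw [hlen, hnum, lt_ceil hs20]
      exact hj)
    simp only [inputState, h, word_toNat]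
    generalize hz : field G.toSeq = zz
    rw [e2]
    refine pack_congr fun i _ => ?_
    rw [← hz]
    split_ifs with h1
    · rfl
    · exact field_of_le (by omega)
  · obtain ⟨t, ht, h⟩ := List.mem_iff_getElem.1 (hdom X[e] (List.getElem_mem he))
    exact ⟨t, ht, by rw [(field_toSeq G ht).1, h, field_eq he]⟩

/-- Move the input to the variables. -/
def prelude : ℕ → Program
  | 0 => .instr (.move 0 0)
  | k + 1 => .seq (prelude k) (.instr (.move (2 * (20 + k) + 1) k))

/-- The variables 0, 1, 2 live in registers 1, 3, 5, which still hold input. The detour through the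
variables 20 to 25 keeps the copying from overwriting it. -/
theorem prelude_runs {w : ℕ} (s : State w) (k : ℕ) (hk : k ≤ 6) : ∃ s', WordRAM.Runs (prelude k) s (k + 1) s' ∧
    s'.mem = s.mem ∧ (∀ i < 41, s'.reg i = s.reg i) ∧
    ∀ i < k, s'.reg (2 * (20 + i) + 1) = s.reg i := by
  induction k with
  | zero => exact ⟨_, .instr _ _, rfl, fun i _ => by simp [Instr.exec], fun i hi => by omega⟩
  | succ k ih =>
    obtain ⟨s', h1, h2, h3, h4⟩ := ih (by omega)
    refine ⟨_, .seq h1 (.instr _ _), h2, fun i hi => ?_, fun i hi => ?_⟩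
    · simp only [Instr.exec, Function.update_apply]
      rw [if_neg (by omega), h3 i hi]
    · simp only [Instr.exec, Function.update_apply]
      split_ifs with h
      · rw [h3 k (by omega), show i = k by omega]
      · exact h4 i (by omega)

/-- Copy the variables `20` to `25` to the variables `0` to `5`, then compute. -/
def mapMain : Stmt :=
  .set 0 (.var 20) ;; .set 1 (.var 21) ;; .set 2 (.var 22) ;; .set 3 (.var 23) ;; .set 4 (.var 24) ;;
  .set 5 (.var 25) ;; mapStmt

/-- The program for the operation `Map`. -/
def mapProgram : Program := .seq (prelude 6) mapMain.comp

theorem mapProgram_runs {w f : ℕ} {X : List (BitVec f)} {G : PackedFunction f} {s : State w}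
    (hf : 1 ≤ f) (hfw : 2 * f + 1 ≤ w) (hr : X.length ≤ 2 ^ f) (hdom : ∀ x ∈ X, x ∈ G.dom)
    (hs : IsInitial s G X) :
    ∃ (t : ℕ) (s' : State w), WordRAM.Runs mapProgram s t s' ∧ InputStored s'.mem G X ∧
      StoredAt s'.mem (outAddr w G X) (Map G X) ∧
      (t : ℝ) ≤ 2000020 * timeBound w f X.length G.dom.length := by
  obtain ⟨s1, r1, m1, g1, v1⟩ := prelude_runs s 6 le_rfl
  -- The arbitrary machine state is read as an abstract state through the numerical values of its
  -- words, so unspecified registers and cells need no assumption.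
  let σ0 : St := ⟨fun i => (s1.reg (2 * i + 1)).toNat, fun a => (s1.mem (BitVec.ofNat w a)).toNat⟩
  have rel : Rel σ0 s1 := ⟨fun i => by simp [σ0], fun a _ => by simp [σ0]⟩
  let σ1 := (((((σ0.set 0 (σ0.v 20)).set 1 (σ0.v 21)).set 2 (σ0.v 22)).set 3 (σ0.v 23)).set 4
    (σ0.v 24)).set 5 (σ0.v 25)
  have hσ : σ1 = inputState s σ0.v := by
    have h20 : ∀ i < 6, σ0.v (20 + i) = (s.reg i).toNat := fun i hi => by simp [σ0, v1 i hi]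
    refine congrArg₂ St.mk (funext fun i => ?_) (by simp [σ0, m1])
    by_cases hi : i < 6
    · rw [if_pos hi, ← h20 i hi]
      interval_cases i <;> simp
    · rw [if_neg hi]
      simp [show i ≠ 0 by omega, show i ≠ 1 by omega, show i ≠ 2 by omega, show i ≠ 3 by omega,
        show i ≠ 4 by omega, show i ≠ 5 by omega]
  have H := input_inputState hf hfw hr hdom hs σ0.v
  rw [← hσ] at H
  obtain ⟨T, hT, T', σ2, hT', big, ⟨y, hy, hout⟩, hlow⟩ := mapStmt_spec H
  have big' : Big w mapMain σ0 (2 + (2 + (2 + (2 + (2 + (2 + T')))))) σ2 :=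
    .seq (.set trivial) <| .seq (.set trivial) <| .seq (.set trivial) <| .seq (.set trivial) <|
      .seq (.set trivial) <| .seq (.set trivial) big
  obtain ⟨s2, r2, rel2⟩ := big'.sound s1 rel
  have hs0 : 0 < w / (f + 1) := Nat.div_pos (by omega) (by omega)
  have hs20 : 0 < w / (2 * f + 1) := Nat.div_pos (by omega) (by omega)
  have hNr := H.N_eq ▸ ceil_le (r := X.length) hs0
  have hNG := ceil_le (r := G.dom.length) hs20
  have hoa := H.oa_eq
  have hu := H.u_le
  have hpow : 2 ^ f * 4 ≤ 2 ^ w := by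
    rw [show (4 : ℕ) = 2 ^ 2 by norm_num, ← pow_add]
    exact Nat.pow_le_pow_right (by omega) (by omega)
  have hpf := Nat.two_pow_pos f
  have hkeep : ∀ a < outAddr w G X, s2.mem (BitVec.ofNat w a) = s.mem (BitVec.ofNat w a) := by
    intro a ha
    rw [rel2.mem a (by omega), hlow a ha, hσ]
    simp [inputState]
  have hlenM : (Map G X).length = X.length := by simp [Map]
  refine ⟨_, s2, .seq r1 r2, ⟨fun j hj => ?_, fun j hj => ?_⟩, fun j hj => ?_, ?_⟩
  · rw [zero_add, hkeep j (hj.trans_le (Nat.le_add_right _ _)), ← hs.input.1 j hj, zero_add]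
  · rw [hkeep _ ?_, hs.input.2 j hj]
    have : G.toSeq.length = G.dom.length := by simp [PackedFunction.toSeq]
    rw [this] at hj
    rw [outAddr, funAddr]
    omega
  · rw [hlenM] at hj
    have hj' : j < funAddr w X := hj
    rw [rel2.mem _ (by omega), hout j hj', word, fieldsPerWord,
      bits_slice _ _ _ (min_le_left _ (X.length - j * (w / (f + 1)))) (by rw [hlenM])]
    congr 1
    refine pack_congr fun i hi => ?_
    have he : j * (w / (f + 1)) + i < X.length := by omega
    obtain ⟨t, ht, h⟩ := List.mem_iff_getElem.1 (hdom _ (List.getElem_mem he))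
    rw [(hy _ he).1 t ht (by rw [(field_toSeq G ht).1, h, field_eq he]), (field_toSeq G ht).2, h,
      field_eq (by rw [hlenM]; exact he)]
    simp [Map]
  -- Moving the input costs 7 steps and copying it to its variables costs 12; since the bound is at
  -- least 1, 20 more in the constant covers both.
  · have h1 := one_le_timeBound (w := w) (f := f) (r := X.length) (u := G.dom.length) (by omega)
    have h2 : (T' : ℝ) ≤ T := by exact_mod_cast hT'
    push_cast
    linarith

end PackedMap

theorem mainTheorem3 :
    ∃ (P : WordRAM.Program) (C : ℝ),
      ∀ (w f r u : ℕ) (X : List (BitVec f)) (G : Packed.PackedFunction f) (s : WordRAM.State w),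
        1 ≤ f → 2 * f + 1 ≤ w →
        X.length = r → G.dom.length = u → r ≤ 2 ^ f →
        (∀ x ∈ X, x ∈ G.dom) →
        Packed.IsInitial s G X →
        ∃ (t : ℕ) (s' : WordRAM.State w),
          WordRAM.Runs P s t s' ∧
          Packed.InputStored s'.mem G X ∧
          Packed.StoredAt s'.mem (Packed.outAddr w G X) (Packed.Map G X) ∧
          (t : ℝ) ≤ C * (((r * f : ℝ) / w + 1) * Real.logb 2 r * Real.logb 2 w
              + (((r + u) * f : ℝ) / w + 1) * Real.logb 2 w) ∧
          (Packed.fieldsPerWord w f ≤ r →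
            (t : ℝ) ≤ C * ((r * f : ℝ) / w * Real.logb 2 r * Real.logb 2 w
              + ((r + u) * f : ℝ) / w * Real.logb 2 w)) := by
  -- The second bound is weaker by the factor 5 of `timeBound_le`, and 5 · 2000020 is below this
  -- constant.
  refine ⟨PackedMap.mapProgram, 20000000, ?_⟩
  intro w f r u X G s hf hfw hX hu hr hdom hs
  subst hX hu
  obtain ⟨t, s', h1, h2, h3, h4⟩ := PackedMap.mapProgram_runs hf hfw hr hdom hs
  have h5 := PackedMap.one_le_timeBound (w := w) (f := f) (r := X.length) (u := G.dom.length)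
    (by omega)
  refine ⟨t, s', h1, h2, h3, ?_, fun hsr => ?_⟩
  · change (t : ℝ) ≤ 20000000 * PackedMap.timeBound w f X.length G.dom.length
    linarith
  · have h6 := PackedMap.timeBound_le (u := G.dom.length) hf hfw rfl hsr
    linarith
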